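/- Conventions. Let $d\ge 0$. Fix $P_0\in C_0^\infty(\mathbb R^d)$ with $P_0(\xi)=1$ for $|\xi|<1$ and $P_0(\xi)=0$ for $|\xi|>2$; put $\phi_0=P_0$, $\phi_k(\xi)=P_0(2^{-k}\xi)-P_0(2^{-k+1}\xi)$ for $k\ge 1$, and $u_k=\phi_k(D)u$ for $u\in\mathscr S'(\mathbb R^d)$, where $D=-i\partial$. For real $r$ let $\|u\|_r=\sup_q 2^{qr}\|u_q\|_{L^\infty}$ and $|u|_r=(\sum_q 2^{2qr}\|u_q\|_{L^2}^2)^{1/2}$; $C^r_*$ and $H^r$ are the spaces of $u\in\mathscr S'(\mathbb R^d)$ for which $\|u\|_r<\infty$, respectively $|u|_r<\infty$. For $X=C^r_*$ or $X=H^r$ write $X_{loc}$ for the space of distributions $v\in\mathscr D'(\mathbb R^d)$ with $\psi v\in X$ for all $\psi\in C_0^\infty(\mathbb R^d)$, with the seminorms $v\mapsto\|\psi v\|_X$. The space $X_{loc}\cap\mathscr S'$ carries these seminorms together with those of the strong topology of $\mathscr S'(\mathbb R^d)$. For a map $\chi:\mathbb R^d\to\mathbb R^d$ and an integer $N\ge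 0$ put $$\chi^\star u=\sum_{k\ge 0}\ \sum_{0\le l\le k+N}\phi_l(D)(u_k\circ\chi).$$ The series is taken in $\mathscr S'(\mathbb R^d)$ when $u\in X$, and in $\mathscr D'(\mathbb R^d)$ when $u\in X_{loc}\cap\mathscr S'$. A diffeomorphism is a $C^1$ bijection of $\mathbb R^d$ with $C^1$ inverse. Theorem. Let $\rho>0$, and let $\chi:\mathbb R^d\to\mathbb R^d$ be a $C^{1+\rho}_{*,loc}$ map with $D\chi\in C^\rho_*$. (1) For every $N\ge0$ and $\sigma>0$ the operator $\chi^\star$ is defined and continuous as a map $C^\sigma_*\to C^\sigma_*$ and as a map $C^\sigma_{*,loc}\cap\mathscr S'\to C^\sigma_{*,loc}$. (2) Suppose that $\chi$ is a diffeomorphism. For every $N\ge0$ and $s>0$ the operator $\chi^\star$ is defined and continuous as a map $H^s_{loc}\cap\mathscr S'\to H^s_{loc}$ and, if $D(\chi^{-1})$ is bounded, as a map $H^s\to H^s$. (3) Let $\tilde\rho>0$, and let $\tilde\chi:\mathbb R^d\to\mathbb R^d$ be a $C^{1+\tilde\rho}_{*,loc}$ map with $D\tilde\chi\in C^{\tilde\rho}_*$.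 Let $\chi^\star$, $\tilde\chi^\star$ and $(\tilde\chi\circ\chi)^\star$ be formed with integers $N,\tilde N,N''\ge 0$ such that $2^N>2\sup|D\chi|$, $2^{\tilde N}>2\sup|D\tilde\chi|$ and $2^{N''}>2\sup|D(\tilde\chi\circ\chi)|$. Then $$\chi^\star\tilde\chi^\star u=(\tilde\chi\circ\chi)^\star u+Ru,$$ where, with $m=\min(\rho,\tilde\rho)$, for all $\sigma>0$ and $s>0$: (a) $R: C^\sigma_*\to C^{\sigma+m}_*$ is defined and continuous; (b) for every $u\in C^\sigma_{*,loc}\cap\mathscr S'$ for which $\tilde\chi^\star u$ is a tempered distribution (so that $\chi^\star\tilde\chi^\star u$ makes sense), $Ru\in C^{\sigma+m}_{*,loc}$, and $Ru$ depends continuously on the pair $(u,\tilde\chi^\star u)$ in the topology of $(C^\sigma_{*,loc}\cap\mathscr S')\times\mathscr S'$, with $\mathscr S'$ carrying its strong topology; (c) if $\chi$ and $\tilde\chi$ are diffeomorphisms, then (b) holds with $C^\sigma_{*,loc}$, $C^{\sigma+m}_{*,loc}$ replaced by $H^s_{loc}$, $H^{s+m}_{loc}$; and if moreover $D(\chi^{-1})$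 and $D(\tilde\chi^{-1})$ are bounded, then $R: H^s\to H^{s+m}$ is defined and continuous. -/

import Mathlib

open Filter Topology MeasureTheory
open scoped ENNReal NNReal SchwartzMap ContDiff Distributions FourierTransform

noncomputable section

namespace Paracomposition

/-- The Euclidean space `ℝ^d`. -/
abbrev Rd (d : ℕ) : Type := EuclideanSpace ℝ (Fin d)

/-- Real test functions `C_0^∞(ℝ^d)`. -/
abbrev Test (d : ℕ) : Type := TestFunction (⊤ : TopologicalSpace.Opens (Rd d)) ℝ ⊤

/-- Distributions `𝓓'(ℝ^d)` with complex values. -/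
abbrev Distr (d : ℕ) : Type := Distribution (⊤ : TopologicalSpace.Opens (Rd d)) ℂ ⊤

/-! ### Littlewood-Paley decomposition -/

/-- A cutoff `P_0 ∈ C_0^∞(ℝ^d)` with `P_0 = 1` for `|ξ| < 1` and `P_0 = 0` for `|ξ| > 2`. -/
structure LPCutoff (d : ℕ) where
  /-- the cutoff function -/
  toFun : Rd d → ℂ
  smooth : ContDiff ℝ ∞ toFun
  eq_one : ∀ ξ, ‖ξ‖ < 1 → toFun ξ = 1
  eq_zero : ∀ ξ, 2 < ‖ξ‖ → toFun ξ = 0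

variable {d : ℕ}

/-- The dyadic symbol: `P_0` for `k = 0`, and `P_0(2^{-k} ξ) - P_0(2^{-(k-1)} ξ)` for `k ≥ 1`. -/
def LPCutoff.symbol (P : LPCutoff d) : ℕ → Rd d → ℂ
  | 0, ξ => P.toFun ξ
  | k + 1, ξ => P.toFun (((2 : ℝ) ^ (k + 1))⁻¹ • ξ) - P.toFun (((2 : ℝ) ^ k)⁻¹ • ξ)

/-- The operator `φ_k(D)`, `D = -i∂`, on tempered distributions: `φ_k(D) u = u_k`.
Mathlib's Fourier transform uses the phase `exp(-2πi x·ξ)`, so that `D` has symbol `2πξ`. -/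
def block (P : LPCutoff d) (k : ℕ) : 𝓢'(Rd d, ℂ) →L[ℂ] 𝓢'(Rd d, ℂ) :=
  TemperedDistribution.fourierMultiplierCLM ℂ (fun ξ => P.symbol k ((2 * Real.pi) • ξ))

/-! ### Zygmund and Sobolev norms -/

/-- The `L^p` norm of a tempered distribution; it is `∞` if the distribution is not in `L^p`. -/
def lpNorm (p : ℝ≥0∞) [Fact (1 ≤ p)] (T : 𝓢'(Rd d, ℂ)) : ℝ≥0∞ :=
  ⨅ (f : Lp ℂ p (volume : Measure (Rd d))) (_ : Lp.toTemperedDistribution f = T), ‖f‖ₑ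

/-- `‖u‖_r = sup_q 2^{qr} ‖u_q‖_∞`; the space `C^r_*(ℝ^d)` consists of the `u` for which
this is finite. -/
def zygNorm (P : LPCutoff d) (r : ℝ) (u : 𝓢'(Rd d, ℂ)) : ℝ≥0∞ :=
  ⨆ q : ℕ, (2 : ℝ≥0∞) ^ ((q : ℝ) * r) * lpNorm ∞ (block P q u)

/-- `|u|_s = (∑_q 2^{2qs} ‖u_q‖_{L^2}^2)^{1/2}`; the space `H^s(ℝ^d)` consists of the `u` for which
this is finite. -/
def sobNorm (P : LPCutoff d) (s : ℝ) (u : 𝓢'(Rd d, ℂ)) : ℝ≥0∞ :=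
  (∑' q : ℕ, (2 : ℝ≥0∞) ^ (2 * (q : ℝ) * s) * lpNorm 2 (block P q u) ^ 2) ^ (1 / 2 : ℝ)

/-! ### Local spaces -/

/-- The product `ψ u` of a test function and a tempered distribution. -/
def cut (ψ : Test d) (u : 𝓢'(Rd d, ℂ)) : 𝓢'(Rd d, ℂ) :=
  TemperedDistribution.smulLeftCLM ℂ (fun x => (ψ x : ℂ)) u

/-- A real test function as a (complex) Schwartz function. -/
def Test.toSchwartz (φ : Test d) : 𝓢(Rd d, ℂ) :=
  HasCompactSupport.toSchwartzMap (f := fun x => (φ x : ℂ))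
    (φ.hasCompactSupport.comp_left (g := fun t : ℝ => (t : ℂ)) Complex.ofReal_zero)
    (Complex.ofRealCLM.contDiff.comp φ.contDiff)

/-- The product of two test functions. -/
def Test.mul (ψ φ : Test d) : Test d where
  toFun x := ψ x * φ x
  contDiff' := ψ.contDiff.mul φ.contDiff
  hasCompactSupport' := φ.hasCompactSupport.mul_left
  tsupport_subset' := fun _ _ => trivial

/-- The distribution `v` is the restriction to test functions of the tempered distribution `w`. -/
def IsRestriction (w : 𝓢'(Rd d, ℂ)) (v : Distr d) : Prop :=
  ∀ φ : Test d, v φ = w φ.toSchwartz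

/-- `w = ψ v`, where `v` is a distribution and the compactly supported distribution `ψ v` is
regarded as a tempered one. -/
def IsCut (ψ : Test d) (v : Distr d) (w : 𝓢'(Rd d, ℂ)) : Prop :=
  ∀ φ : Test d, w φ.toSchwartz = v (Test.mul ψ φ)

/-- The seminorm `v ↦ p (ψ v)` on distributions (there is exactly one `w` with `w = ψ v`). -/
def cutNorm (p : 𝓢'(Rd d, ℂ) → ℝ≥0∞) (ψ : Test d) (v : Distr d) : ℝ≥0∞ :=
  ⨅ (w : 𝓢'(Rd d, ℂ)) (_ : IsCut ψ v w), p w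

/-- The tempered distribution `u` is in the local space of the space with norm `p`. -/
def MemLoc (p : 𝓢'(Rd d, ℂ) → ℝ≥0∞) (u : 𝓢'(Rd d, ℂ)) : Prop :=
  ∀ ψ : Test d, p (cut ψ u) < ⊤

/-- The distribution `v` is in the local space of the space with norm `p`. -/
def MemLocDistr (p : 𝓢'(Rd d, ℂ) → ℝ≥0∞) (v : Distr d) : Prop :=
  ∀ ψ : Test d, cutNorm p ψ v < ⊤

/-- The seminorm `u ↦ sup_{f ∈ B} |u(f)|` on tempered distributions. For `B` running through the
bounded subsets of the Schwartz space these define the strong topology of `𝓢'`. -/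
def dualNorm (B : Set 𝓢(Rd d, ℂ)) (u : 𝓢'(Rd d, ℂ)) : ℝ≥0∞ :=
  ⨆ f ∈ B, ‖u f‖ₑ

/-! ### Paracomposition -/

/-- The tempered distribution `T` is the function `f`. -/
def IsFun (f : Rd d → ℂ) (T : 𝓢'(Rd d, ℂ)) : Prop :=
  ∀ g : 𝓢(Rd d, ℂ), Integrable (fun x => g x * f x) ∧ T g = ∫ x, g x * f x

/-- `g k = u_k ∘ χ` for all `k`, as tempered distributions, where `u_k = φ_k(D) u` is regarded as
a continuous function. -/
def IsBlockComp (P : LPCutoff d) (χ : Rd d → Rd d) (u : 𝓢'(Rd d, ℂ))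
    (g : ℕ → 𝓢'(Rd d, ℂ)) : Prop :=
  ∀ k, ∃ f : Rd d → ℂ, Continuous f ∧ IsFun f (block P k u) ∧ IsFun (f ∘ χ) (g k)

/-- `∑_{0 ≤ l ≤ k + N} φ_l(D) T`. -/
def lowFreq (P : LPCutoff d) (N k : ℕ) (T : 𝓢'(Rd d, ℂ)) : 𝓢'(Rd d, ℂ) :=
  ∑ l ∈ Finset.range (k + N + 1), block P l T

/-- `v = χ^⋆ u = ∑_k ∑_{l ≤ k + N} φ_l(D) (u_k ∘ χ)`, with convergence in `𝓢'(ℝ^d)`. -/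
def IsParacomp (P : LPCutoff d) (N : ℕ) (χ : Rd d → Rd d) (u v : 𝓢'(Rd d, ℂ)) : Prop :=
  ∃ g : ℕ → 𝓢'(Rd d, ℂ), IsBlockComp P χ u g ∧ HasSum (fun k => lowFreq P N k (g k)) v

/-- `v = χ^⋆ u = ∑_k ∑_{l ≤ k + N} φ_l(D) (u_k ∘ χ)`, with convergence in `𝓓'(ℝ^d)`. -/
def IsParacompDistr (P : LPCutoff d) (N : ℕ) (χ : Rd d → Rd d) (u : 𝓢'(Rd d, ℂ))
    (v : Distr d) : Prop :=
  ∃ g : ℕ → 𝓢'(Rd d, ℂ), IsBlockComp P χ u g ∧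
    ∀ φ : Test d, HasSum (fun k => lowFreq P N k (g k) φ.toSchwartz) (v φ)

/-! ### The maps `χ` -/

/-- `χ` is a `C^{1+ρ}_{*,loc}` map with `Dχ ∈ C^ρ_*` (for `ρ > 0` such a map is `C^1`). -/
structure IsZygmundMap (P : LPCutoff d) (ρ : ℝ) (χ : Rd d → Rd d) : Prop where
  contDiff : ContDiff ℝ 1 χ
  memLoc : ∀ i, ∃ T : 𝓢'(Rd d, ℂ), IsFun (fun x => ((χ x i : ℝ) : ℂ)) T ∧
    MemLoc (zygNorm P (1 + ρ)) T
  deriv : ∀ i j, ∃ T : 𝓢'(Rd d, ℂ),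
    IsFun (fun x => ((fderiv ℝ χ x (EuclideanSpace.single j 1) i : ℝ) : ℂ)) T ∧
      zygNorm P ρ T < ⊤

/-- `2^N > 2 sup |Dχ|`. -/
def LargeFor (χ : Rd d → Rd d) (N : ℕ) : Prop :=
  ∃ M : ℝ, (∀ x, ‖fderiv ℝ χ x‖ ≤ M) ∧ 2 * M < 2 ^ N

/-- `χ` is a diffeomorphism of class `C^1` with inverse `κ`. -/
structure IsDiffeo (χ κ : Rd d → Rd d) : Prop where
  contDiff : ContDiff ℝ 1 χ
  contDiff_inv : ContDiff ℝ 1 κ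
  left_inv : Function.LeftInverse κ χ
  right_inv : Function.RightInverse κ χ

/-- `Dκ` is bounded. -/
def BoundedDeriv (κ : Rd d → Rd d) : Prop :=
  ∃ M : ℝ, ∀ x, ‖fderiv ℝ κ x‖ ≤ M

/-! ### Continuity and remainders -/

/-- `χ^⋆` is defined on the space with norm `p`, and is continuous from it into itself. (By
construction `χ^⋆` is linear, so that continuity is boundedness.) -/
def ContinuousOnSpace (P : LPCutoff d) (N : ℕ) (χ : Rd d → Rd d)
    (p : 𝓢'(Rd d, ℂ) → ℝ≥0∞) : Prop :=
  ∃ C : ℝ≥0, ∀ u, p u < ⊤ → ∃ v, IsParacomp P N χ u v ∧ p v ≤ C * p u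

/-- `χ^⋆` is defined on the local space of the space with norm `p`, takes values in the
local space, and is continuous. The tempered distributions in the local space carry the seminorms
`p (ψ u)` and those of the strong topology of `𝓢'`, the values carry the seminorms `p (ψ v)`. -/
def ContinuousOnLocalSpace (P : LPCutoff d) (N : ℕ) (χ : Rd d → Rd d)
    (p : 𝓢'(Rd d, ℂ) → ℝ≥0∞) : Prop :=
  (∀ u, MemLoc p u → ∃ v, IsParacompDistr P N χ u v ∧ MemLocDistr p v) ∧
  ∀ ψ : Test d, ∃ (ψ' : Test d) (B : Set 𝓢(Rd d, ℂ)) (C : ℝ≥0), Bornology.IsVonNBounded ℂ B ∧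
    ∀ u v, MemLoc p u → IsParacompDistr P N χ u v →
      cutNorm p ψ v ≤ C * (p (cut ψ' u) + dualNorm B u)

/-- `R u = χ^⋆ χ'^⋆ u - (χ' ∘ χ)^⋆ u` is defined on the space with norm `p`, and
is continuous from it into the space with norm `q`. The operators `χ^⋆`, `χ'^⋆`, `(χ' ∘ χ)^⋆` are
formed with `N`, `N'`, `N''`. -/
def RemainderOnSpace (P : LPCutoff d) (N N' N'' : ℕ) (χ χ' : Rd d → Rd d)
    (p q : 𝓢'(Rd d, ℂ) → ℝ≥0∞) : Prop :=
  ∃ C : ℝ≥0, ∀ u, p u < ⊤ → ∃ w v z, IsParacomp P N' χ' u w ∧ IsParacomp P N χ w v ∧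
    IsParacomp P N'' (χ' ∘ χ) u z ∧ q (v - z) ≤ C * p u

/-- `R u = χ^⋆ χ'^⋆ u - (χ' ∘ χ)^⋆ u` is defined for all `u` in the local space of the space with
norm `p` such that `w = χ'^⋆ u` is tempered, takes values in the local space of the space with
norm `q`, and is continuous (with respect to the seminorms of `u` as above, and to the strong
topology of `𝓢'` for `w`). -/
def RemainderOnLocalSpace (P : LPCutoff d) (N N' N'' : ℕ) (χ χ' : Rd d → Rd d)
    (p q : 𝓢'(Rd d, ℂ) → ℝ≥0∞) : Prop :=
  (∀ u w w₀, MemLoc p u → IsParacompDistr P N' χ' u w₀ → IsRestriction w w₀ →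
    ∃ v z, IsParacompDistr P N χ w v ∧ IsParacompDistr P N'' (χ' ∘ χ) u z ∧
      MemLocDistr q (v - z)) ∧
  ∀ ψ : Test d, ∃ (ψ' : Test d) (B : Set 𝓢(Rd d, ℂ)) (C : ℝ≥0), Bornology.IsVonNBounded ℂ B ∧
    ∀ u w w₀ v z, MemLoc p u → IsParacompDistr P N' χ' u w₀ → IsRestriction w w₀ →
      IsParacompDistr P N χ w v → IsParacompDistr P N'' (χ' ∘ χ) u z →
      cutNorm q ψ (v - z) ≤ C * (p (cut ψ' u) + dualNorm B u + dualNorm B w)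

end Paracomposition

end

open Filter Topology MeasureTheory
open scoped ENNReal NNReal SchwartzMap ContDiff Distributions FourierTransform

noncomputable section

namespace Paracomposition

variable {d : ℕ}

open SchwartzMap LineDeriv

/-! Write S_n for the cutoff to frequencies of size at most about 2^n, so that the terms of the
series are S_{k+N}(u_k ∘ χ). The k-th term has its spectrum in a ball of radius comparable to 2^k.
Hence its dyadic block of index q is negligible for q much larger than k, and positive smoothness of
u makes the sum over k ≥ q converge. Schur's test for the resulting kernel gives boundedness
(`exists_nrm_paracomp_le`).

The composition formula rests on one cancellation estimate, `exists_cv_ker_comp_le`. If h has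
frequencies at most of size 2^k and 2^N > 2 sup|A|, where A is the derivative of χ, then φ_l(D)(h ∘
χ) is of size 2^{k-l-lρ} for l > k + N, up to averages of h. To see this, reproduce h by a rescaled
Schwartz kernel κ, so that h(χ(x+z)) = ∫ κ(y - χ(x+z)) h(y) dy. At scale 2^{-l} the map is χ(x) +
A(x)z + Q(z) with a small polynomial Q, up to an error 2^{-l(1+ρ)} (the predicate `App`). Expand κ
about y - χ(x) - A(x)z in powers of Q(z). Each term is a polynomial in z times a derivative of κ at
y - χ(x) - A(x)z. As a function of z it has its spectrum in the image under the adjoint of A(x) of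
the spectrum of κ. That image misses the support of φ_l, so the kernel of φ_l(D) annihilates all
these terms (`integral_ker_mul_taylor_eq_zero`), and only the Taylor remainder survives. The
polynomials come from Taylor expansion of the blocks of Dχ with q ≤ l, followed by integration along
segments (`exists_poly_approx`, `exists_poly_approx_primitive`). The property `App` is stable under
composition (`App.comp`), so the estimate also applies to χ' ∘ χ.

For the remainder, fix the block f = u_j and put w = S_{j+N'}(f ∘ χ'). Its contribution to the
double paracomposition is Σ_k S_{k+N}(w_k ∘ χ), to be compared with S_{j+N''}(f ∘ χ' ∘ χ). Terms
with k well above j are negligible by the spectrum of w. In the finitely many others, raise every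
cutoff to a common S_L with L = j + const. What is added consists of high blocks of compositions,
small by the cancellation estimate for χ and for χ' ∘ χ. What is left is S_L applied to (f ∘ χ' -
S_{j+K} w) ∘ χ, small by the same estimate for χ'. Each error gains the factor 2^{-jm}, up to almost
orthogonality in frequency (`exists_lpNorm_remainder_le`), and summation over j gains m derivatives
(`exists_nrm_remainder_le`).

Zygmund and Sobolev spaces are treated together through `Kind`. The map enters the Lebesgue norms
only through `Pull`, which is trivial for suprema and is a Jacobian bound for L². Global and local
statements are treated together through `Loc`, a cutoff η that is either 1 or a Schwartz function
vanishing outside a ball. The norms `nu` combine a norm on a ball with a rapidly decreasing multiple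
of the global supremum, which absorbs the tails of the kernels. For local spaces, u is split as ψ'u
+ (1 - ψ')u. The second part is away from the image of the support of ψ, so it contributes a regular
function, controlled by a seminorm of the strong topology of 𝓢' (`exists_nrm_far_le`). -/

/-! ### Powers of two -/

/-- The power `2 ^ a` in `[0, ∞]`. -/
def tw (a : ℝ) : ℝ≥0∞ := (2 : ℝ≥0∞) ^ a

lemma tw_add (a b : ℝ) : tw (a + b) = tw a * tw b :=
  ENNReal.rpow_add _ _ (by norm_num) (by norm_num)

lemma tw_ne_top (a : ℝ) : tw a ≠ ⊤ := by simp [tw, ENNReal.rpow_eq_top_iff]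

lemma tw_ne_zero (a : ℝ) : tw a ≠ 0 := by
  simp [tw, ENNReal.rpow_eq_zero_iff]

lemma tw_zero : tw 0 = 1 := by simp [tw]

lemma tw_le {a b : ℝ} (h : a ≤ b) : tw a ≤ tw b :=
  ENNReal.rpow_le_rpow_of_exponent_le (by norm_num) h

lemma tw_le_one {a : ℝ} (h : a ≤ 0) : tw a ≤ 1 := tw_zero ▸ tw_le h

lemma one_le_tw {a : ℝ} (h : 0 ≤ a) : 1 ≤ tw a := tw_zero ▸ tw_le h

lemma tw_eq_ofReal (a : ℝ) : tw a = ENNReal.ofReal ((2 : ℝ) ^ a) := by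
  rw [tw, ← ENNReal.ofReal_rpow_of_pos (by norm_num)]; norm_num

lemma tw_mul_tw_neg (a : ℝ) : tw a * tw (-a) = 1 := by
  rw [← tw_add]; simp [tw_zero]

lemma tw_rpow (a b : ℝ) : tw a ^ b = tw (a * b) := by
  rw [tw, tw, ENNReal.rpow_mul]

lemma tw_coe (a : ℝ) : ((tw a).toNNReal : ℝ≥0∞) = tw a := ENNReal.coe_toNNReal (tw_ne_top a)

lemma tw_neg_mul_nat (δ : ℝ) (n : ℕ) : tw (-(δ * n)) = tw (-δ) ^ n := by
  rw [← ENNReal.rpow_natCast, tw_rpow]; congr 1; ring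

lemma tsum_tw_ne_top {δ : ℝ} (hδ : 0 < δ) : ∑' n : ℕ, tw (-(δ * n)) ≠ ⊤ := by
  simp_rw [tw_neg_mul_nat]
  rw [ENNReal.tsum_geometric]
  apply ENNReal.inv_ne_top.2
  have : tw (-δ) < 1 := by
    rw [← tw_zero]
    exact ENNReal.rpow_lt_rpow_of_exponent_lt (by norm_num) (by norm_num) (by linarith)
  exact (tsub_pos_of_lt this).ne'

/-- The injection l ↦ q - l into ℤ gives a bound independent of q; the sum over ℤ is at most twice a
geometric series. -/
lemma tsum_tw_abs {δ : ℝ} (hδ : 0 < δ) : ∃ C : ℝ≥0, ∀ q : ℕ,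
    ∑' l : ℕ, tw (-(δ * |(q : ℝ) - l|)) ≤ C := by
  have h := tsum_tw_ne_top hδ
  refine ⟨(2 * ∑' n : ℕ, tw (-(δ * n))).toNNReal, fun q ↦ ?_⟩
  rw [ENNReal.coe_toNNReal (ENNReal.mul_ne_top (by norm_num) h), two_mul]
  have hz : ∑' l : ℕ, tw (-(δ * |(q : ℝ) - l|)) ≤ ∑' n : ℤ, tw (-(δ * |(n : ℝ)|)) := by
    have := ENNReal.tsum_comp_le_tsum_of_injective (f := fun l : ℕ ↦ (q : ℤ) - l)
      (fun a b hab ↦ by simpa using hab) (fun n : ℤ ↦ tw (-(δ * |(n : ℝ)|)))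
    simpa using this
  refine hz.trans ?_
  set F : ℤ → ℝ≥0∞ := fun n ↦ tw (-(δ * n.natAbs)) with hF
  have : ∀ n : ℤ, tw (-(δ * |(n : ℝ)|)) ≤ Set.indicator (Set.range fun m : ℕ ↦ (m : ℤ)) F n +
      Set.indicator (Set.range fun m : ℕ ↦ -(m : ℤ)) F n := by
    intro n
    have e : |(n : ℝ)| = (n.natAbs : ℝ) := by simp [Nat.cast_natAbs]
    rw [e]
    rcases le_total 0 n with hn | hn
    · rw [Set.indicator_of_mem (show n ∈ Set.range (fun m : ℕ ↦ (m : ℤ)) from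
        ⟨n.natAbs, by simp [hn]⟩)]
      exact le_self_add
    · rw [Set.indicator_of_mem (show n ∈ Set.range (fun m : ℕ ↦ -(m : ℤ)) from
        ⟨n.natAbs, by simp [abs_of_nonpos hn]⟩)]
      exact le_add_self
  refine (ENNReal.tsum_le_tsum this).trans ?_
  rw [ENNReal.tsum_add, ← tsum_subtype, ← tsum_subtype,
    tsum_range (g := fun m : ℕ ↦ (m : ℤ)) F (fun a b h ↦ by simpa using h),
    tsum_range (g := fun m : ℕ ↦ -(m : ℤ)) F (fun a b h ↦ by simpa using h)]
  simp [hF]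

/-! ### Sequence norms and function norms -/

/-- The two scales of spaces: `zyg` for the Zygmund spaces (`p = ∞`), `sob` for the Sobolev
spaces (`p = 2`). -/
inductive Kind
  | zyg
  | sob

/-- The Lebesgue exponent. -/
def Kind.p : Kind → ℝ≥0∞
  | .zyg => ⊤
  | .sob => 2

instance (kd : Kind) : Fact (1 ≤ kd.p) := ⟨by cases kd <;> simp [Kind.p]⟩

/-- The norm of a sequence: supremum or `ℓ²`. -/
def sq : Kind → (ℕ → ℝ≥0∞) → ℝ≥0∞
  | .zyg, a => ⨆ q, a q
  | .sob, a => (∑' q, a q ^ 2) ^ (1 / 2 : ℝ)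

/-- The norm of a function on a set: supremum or `L²`. -/
def fn : Kind → Set (Rd d) → (Rd d → ℝ≥0∞) → ℝ≥0∞
  | .zyg, K, f => ⨆ x ∈ K, f x
  | .sob, K, f => (∫⁻ x in K, f x ^ 2) ^ (1 / 2 : ℝ)

lemma rpow_half_sq (a : ℝ≥0∞) : (a ^ (1 / 2 : ℝ)) ^ 2 = a := by
  rw [← ENNReal.rpow_natCast, ← ENNReal.rpow_mul]; norm_num

lemma sq_rpow_half (a : ℝ≥0∞) : (a ^ 2) ^ (1 / 2 : ℝ) = a := by
  rw [← ENNReal.rpow_natCast, ← ENNReal.rpow_mul]; norm_num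

lemma rpow_half_le_iff {a b : ℝ≥0∞} : a ^ (1 / 2 : ℝ) ≤ b ↔ a ≤ b ^ 2 := by
  constructor
  · intro h
    rw [← rpow_half_sq a]; gcongr
  · intro h
    rw [← sq_rpow_half b]; gcongr

lemma sq_lintegral_le {α : Type*} [MeasurableSpace α] (μ : Measure α) {f : α → ℝ≥0∞}
    (hf : AEMeasurable f μ) : (∫⁻ x, f x ∂μ) ^ 2 ≤ μ Set.univ * ∫⁻ x, f x ^ 2 ∂μ := by
  have h := ENNReal.lintegral_mul_le_Lp_mul_Lq μ (p := 2) (q := 2)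
    ((Real.holderConjugate_iff).2 ⟨by norm_num, by norm_num⟩) (f := fun _ ↦ 1) (g := f)
    aemeasurable_const hf
  simp only [Pi.mul_apply, one_mul, lintegral_const, ENNReal.rpow_two, one_pow] at h
  calc (∫⁻ x, f x ∂μ) ^ 2 ≤ (μ Set.univ ^ (1 / 2 : ℝ) * (∫⁻ x, f x ^ 2 ∂μ) ^ (1 / 2 : ℝ)) ^ 2 := by
        gcongr
    _ = _ := by rw [mul_pow, rpow_half_sq, rpow_half_sq]

/-- Cauchy–Schwarz for the measure with density w. This is the half of Schur's test used both for
sequences and for averaging operators. -/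
lemma sq_lintegral_mul_le {α : Type*} [MeasurableSpace α] (μ : Measure α) {w f : α → ℝ≥0∞}
    (hw : Measurable w) (hf : Measurable f) :
    (∫⁻ x, w x * f x ∂μ) ^ 2 ≤ (∫⁻ x, w x ∂μ) * ∫⁻ x, w x * f x ^ 2 ∂μ := by
  have h := sq_lintegral_le (μ.withDensity w) hf.aemeasurable
  rw [lintegral_withDensity_eq_lintegral_mul _ hw hf, withDensity_apply _ MeasurableSet.univ,
    lintegral_withDensity_eq_lintegral_mul _ hw (hf.pow_const 2)] at h
  simpa using h

lemma sq_mono {kd : Kind} {a b : ℕ → ℝ≥0∞} (h : ∀ q, a q ≤ b q) : sq kd a ≤ sq kd b := by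
  cases kd
  · exact iSup_mono h
  · simp only [sq]
    gcongr with q
    exact h q

lemma sq_const_mul (kd : Kind) (c : ℝ≥0∞) (a : ℕ → ℝ≥0∞) :
    sq kd (fun q ↦ c * a q) = c * sq kd a := by
  cases kd
  · exact (ENNReal.mul_iSup ..).symm
  · simp only [sq, mul_pow]
    rw [ENNReal.tsum_mul_left, ENNReal.mul_rpow_of_nonneg _ _ (by norm_num), sq_rpow_half]

lemma le_sq (kd : Kind) (a : ℕ → ℝ≥0∞) (q : ℕ) : a q ≤ sq kd a := by
  cases kd
  · exact le_iSup a q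
  · simp only [sq]
    rw [← sq_rpow_half (a q)]
    gcongr
    exact ENNReal.le_tsum (f := fun q ↦ a q ^ 2) q

/-- Schur's test for the two sequence norms. -/
lemma sq_schur (kd : Kind) {A : ℕ → ℕ → ℝ≥0∞} {C₁ C₂ : ℝ≥0∞} (h₁ : ∀ q, ∑' l, A q l ≤ C₁)
    (h₂ : ∀ l, ∑' q, A q l ≤ C₂) (a : ℕ → ℝ≥0∞) :
    sq kd (fun q ↦ ∑' l, A q l * a l) ≤ (C₁ + C₂) * sq kd a := by
  cases kd
  · refine iSup_le fun q ↦ ?_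
    calc ∑' l, A q l * a l ≤ ∑' l, A q l * (⨆ l, a l) := by gcongr with l; exact le_iSup a l
      _ = (∑' l, A q l) * ⨆ l, a l := ENNReal.tsum_mul_right
      _ ≤ _ := by gcongr; exacts [(h₁ q).trans le_self_add, le_rfl]
  · simp only [sq]
    rw [rpow_half_le_iff, mul_pow, rpow_half_sq]
    -- Weighted Cauchy–Schwarz in each row uses the row sums; summing over q afterwards uses the
    -- column sums.
    have key : ∀ q, (∑' l, A q l * a l) ^ 2 ≤ C₁ * ∑' l, A q l * a l ^ 2 := by
      intro q
      have := sq_lintegral_mul_le Measure.count (w := A q) (f := a) (measurable_of_countable _)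
        (measurable_of_countable _)
      simp only [lintegral_count] at this
      exact this.trans (by gcongr; exact h₁ q)
    calc ∑' q, (∑' l, A q l * a l) ^ 2 ≤ ∑' q, C₁ * ∑' l, A q l * a l ^ 2 :=
          ENNReal.tsum_le_tsum key
      _ = C₁ * ∑' l, ∑' q, A q l * a l ^ 2 := by rw [ENNReal.tsum_mul_left, ENNReal.tsum_comm]
      _ = C₁ * ∑' l, (∑' q, A q l) * a l ^ 2 := by simp_rw [ENNReal.tsum_mul_right]
      _ ≤ C₁ * ∑' l, C₂ * a l ^ 2 := by gcongr with l; exact h₂ l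
      _ = C₁ * C₂ * ∑' l, a l ^ 2 := by rw [ENNReal.tsum_mul_left, mul_assoc]
      _ ≤ (C₁ + C₂) ^ 2 * ∑' l, a l ^ 2 := by
          gcongr; rw [_root_.sq]; gcongr <;> simp

lemma sq_add (kd : Kind) (a b : ℕ → ℝ≥0∞) :
    sq kd (fun q ↦ a q + b q) ≤ sq kd a + sq kd b := by
  cases kd
  · exact iSup_le fun q ↦ add_le_add (le_iSup a q) (le_iSup b q)
  · have := ENNReal.lintegral_Lp_add_le (μ := Measure.count) (p := 2) (f := a) (g := b)
      (measurable_of_countable _).aemeasurable (measurable_of_countable _).aemeasurable (by norm_num)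
    simpa [lintegral_count, sq] using this

/-- Schur's test for an exponentially decaying kernel. -/
lemma exists_sq_exp_le (kd : Kind) {δ : ℝ} (hδ : 0 < δ) : ∃ C : ℝ≥0, ∀ a : ℕ → ℝ≥0∞,
    sq kd (fun q ↦ ∑' l : ℕ, tw (-(δ * |(q : ℝ) - l|)) * a l) ≤ C * sq kd a := by
  obtain ⟨C, hC⟩ := tsum_tw_abs hδ
  refine ⟨C + C, fun a ↦ ?_⟩
  push_cast
  exact sq_schur kd hC (fun l ↦ by simp_rw [abs_sub_comm _ (l : ℝ)]; exact hC l) a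

variable {K : Set (Rd d)} {f g : Rd d → ℝ≥0∞} {kd : Kind}

lemma fn_mono (h : ∀ x ∈ K, f x ≤ g x) (hK : MeasurableSet K) : fn kd K f ≤ fn kd K g := by
  cases kd
  · exact iSup₂_mono h
  · simp only [fn]
    gcongr 1
    exact setLIntegral_mono' hK fun x hx ↦ by gcongr; exact h x hx

lemma fn_mono' (h : ∀ x, f x ≤ g x) : fn kd K f ≤ fn kd K g := by
  cases kd
  · exact iSup₂_mono fun x _ ↦ h x
  · simp only [fn]
    gcongr with x
    exact h x

lemma fn_mono_set {K' : Set (Rd d)} (h : K ⊆ K') : fn kd K f ≤ fn kd K' f := by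
  cases kd
  · exact biSup_mono h
  · simp only [fn]
    gcongr 1
    exact lintegral_mono_set h

lemma fn_const_mul (c : ℝ≥0∞) (hf : Measurable f) :
    fn kd K (fun x ↦ c * f x) = c * fn kd K f := by
  cases kd
  · simp only [fn, ENNReal.mul_iSup]
  · simp only [fn, mul_pow]
    rw [lintegral_const_mul _ (hf.pow_const 2), ENNReal.mul_rpow_of_nonneg _ _ (by norm_num),
      sq_rpow_half]

lemma fn_add (hf : Measurable f) (hg : Measurable g) :
    fn kd K (fun x ↦ f x + g x) ≤ fn kd K f + fn kd K g := by
  cases kd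
  · exact iSup₂_le fun x hx ↦ add_le_add (le_iSup₂ (f := fun x (_ : x ∈ K) ↦ f x) x hx)
      (le_iSup₂ (f := fun x (_ : x ∈ K) ↦ g x) x hx)
  · have := ENNReal.lintegral_Lp_add_le (μ := volume.restrict K) (p := 2) (f := f) (g := g)
      hf.aemeasurable hg.aemeasurable (by norm_num)
    simpa [fn] using this

lemma fn_sum {ι : Type*} (s : Finset ι) {F : ι → Rd d → ℝ≥0∞} (hF : ∀ i, Measurable (F i)) :
    fn kd K (fun x ↦ ∑ i ∈ s, F i x) ≤ ∑ i ∈ s, fn kd K (F i) := by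
  classical
  induction s using Finset.induction_on with
  | empty => cases kd <;> simp [fn]
  | insert i s hi ih =>
    simp only [Finset.sum_insert hi]
    exact (fn_add (hF i) (Finset.measurable_sum _ fun j _ ↦ hF j)).trans (by gcongr)

lemma fn_tsum {F : ℕ → Rd d → ℝ≥0∞} (hF : ∀ i, Measurable (F i)) :
    fn kd K (fun x ↦ ∑' i, F i x) ≤ ∑' i, fn kd K (F i) := by
  have hs : ∀ x, ∑' i, F i x = ⨆ n, ∑ i ∈ Finset.range n, F i x := fun x ↦
    ENNReal.tsum_eq_iSup_nat
  have hle : ∀ n, fn kd K (fun x ↦ ∑ i ∈ Finset.range n, F i x) ≤ ∑' i, fn kd K (F i) := fun n ↦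
    (fn_sum _ hF).trans (ENNReal.sum_le_tsum _)
  simp_rw [hs]
  cases kd
  · refine iSup₂_le fun x hx ↦ iSup_le fun n ↦ le_trans ?_ (hle n)
    exact le_iSup₂ (f := fun x (_ : x ∈ K) ↦ ∑ i ∈ Finset.range n, F i x) x hx
  · simp only [fn] at hle ⊢
    rw [rpow_half_le_iff]
    have hmono : ∀ x, Monotone fun n ↦ ∑ i ∈ Finset.range n, F i x := fun x m n hmn ↦
      Finset.sum_le_sum_of_subset (Finset.range_mono hmn)
    have : ∀ x, (⨆ n, ∑ i ∈ Finset.range n, F i x) ^ 2 = ⨆ n, (∑ i ∈ Finset.range n, F i x) ^ 2 := by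
      intro x
      exact Monotone.map_iSup_of_continuousAt (f := fun a : ℝ≥0∞ ↦ a ^ 2)
        (ENNReal.continuous_pow 2).continuousAt (pow_left_mono 2) (by simp)
    simp_rw [this]
    rw [lintegral_iSup (fun n ↦ (Finset.measurable_sum _ fun j _ ↦ hF j).pow_const 2)
      (fun m n hmn x ↦ by
        have := hmono x hmn
        dsimp only at this ⊢; gcongr)]
    exact iSup_le fun n ↦ rpow_half_le_iff.1 (hle n)

/-! ### Averaging operators -/

/-- The weight `2^{kd} (1 + 2^k |z|)^{-M}`. -/
def jap (M k : ℕ) (z : Rd d) : ℝ := 2 ^ (k * d) / (1 + 2 ^ k * ‖z‖) ^ M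

/-- Averaging with the weight `jap M k`. -/
def J (M k : ℕ) (f : Rd d → ℝ≥0∞) (x : Rd d) : ℝ≥0∞ :=
  ∫⁻ y, ENNReal.ofReal (jap M k (y - x)) * f y

lemma jap_nonneg (M k : ℕ) (z : Rd d) : 0 ≤ jap M k z := by unfold jap; positivity

lemma jap_pos (M k : ℕ) (z : Rd d) : 0 < jap M k z := by unfold jap; positivity

lemma continuous_jap (M k : ℕ) : Continuous (jap M k : Rd d → ℝ) := by
  unfold jap
  exact continuous_const.div (by fun_prop) fun z ↦ by positivity

lemma jap_anti {M M' : ℕ} (h : M ≤ M') (k : ℕ) (z : Rd d) : jap M' k z ≤ jap M k z := by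
  unfold jap
  gcongr
  nlinarith [norm_nonneg z, pow_pos (two_pos : (0 : ℝ) < 2) k]

lemma jap_neg (M k : ℕ) (z : Rd d) : jap M k (-z) = jap M k z := by simp [jap]

lemma jap_le (M k : ℕ) (z : Rd d) : jap M k z ≤ 2 ^ (k * d) := by
  unfold jap
  apply div_le_self (by positivity)
  apply one_le_pow₀
  nlinarith [norm_nonneg z, pow_pos (two_pos : (0 : ℝ) < 2) k]

lemma measurable_jap (M k : ℕ) (x : Rd d) :
    Measurable fun y ↦ ENNReal.ofReal (jap M k (y - x)) :=
  ((continuous_jap M k).comp (continuous_id.sub continuous_const)).measurable.ennreal_ofReal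

lemma jap_eq_scale (M k : ℕ) (z : Rd d) : jap M k z = 2 ^ (k * d) * jap M 0 ((2 : ℝ) ^ k • z) := by
  simp [jap, norm_smul]; ring

-- The factor 2^{kd} makes the weights L¹-invariant under dyadic dilation, so the bound does not
-- depend on k; the exponent d + 1 is enough for integrability at infinity.
variable (d) in
lemma exists_lintegral_jap : ∃ C : ℝ≥0, ∀ M k : ℕ, d + 1 ≤ M → ∀ x : Rd d,
    ∫⁻ y, ENNReal.ofReal (jap M k (y - x)) ≤ C := by
  have h0 : Integrable (jap (d + 1) 0 : Rd d → ℝ) := by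
    have := integrable_one_add_norm (E := Rd d) (μ := volume) (r := d + 1) (by simp)
    refine this.congr (.of_forall fun x ↦ ?_)
    simp only [jap, zero_mul, pow_zero, one_mul, one_div]
    rw [Real.rpow_neg (by positivity)]
    norm_cast
  refine ⟨(∫⁻ y : Rd d, ENNReal.ofReal (jap (d + 1) 0 y)).toNNReal, fun M k hM x ↦ ?_⟩
  rw [ENNReal.coe_toNNReal h0.lintegral_lt_top.ne]
  rw [lintegral_sub_right_eq_self (fun y ↦ ENNReal.ofReal (jap M k y)) x]
  calc ∫⁻ y : Rd d, ENNReal.ofReal (jap M k y)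
      ≤ ∫⁻ y : Rd d, ENNReal.ofReal (jap (d + 1) k y) := by
        gcongr with y; exact jap_anti hM k y
    _ ≤ ∫⁻ y : Rd d, ENNReal.ofReal (jap (d + 1) 0 y) := by
        have hk : Integrable (jap (d + 1) k : Rd d → ℝ) := by
          simp_rw [funext fun z : Rd d ↦ jap_eq_scale (d + 1) k z]
          exact (h0.comp_smul (by positivity)).const_mul _
        rw [← ofReal_integral_eq_lintegral_ofReal hk (.of_forall fun z ↦ jap_nonneg _ _ _),
          ← ofReal_integral_eq_lintegral_ofReal h0 (.of_forall fun z ↦ jap_nonneg _ _ _)]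
        apply ENNReal.ofReal_le_ofReal
        simp_rw [funext fun z : Rd d ↦ jap_eq_scale (d + 1) k z]
        rw [integral_const_mul, Measure.integral_comp_smul]
        simp only [finrank_euclideanSpace, Fintype.card_fin, smul_eq_mul]
        rw [abs_of_nonneg (by positivity), ← pow_mul, ← mul_assoc, mul_inv_cancel₀ (by positivity),
          one_mul]

lemma measurable_J (M k : ℕ) (hf : Measurable f) : Measurable (J M k f) := by
  unfold J
  refine Measurable.lintegral_prod_right' (f := fun p : Rd d × Rd d ↦
    ENNReal.ofReal (jap M k (p.2 - p.1)) * f p.2) ?_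
  exact (((continuous_jap M k).comp (continuous_snd.sub continuous_fst)).measurable.ennreal_ofReal).mul
    (hf.comp measurable_snd)

lemma J_anti {M M' : ℕ} (h : M ≤ M') (k : ℕ) (f : Rd d → ℝ≥0∞) (x : Rd d) :
    J M' k f x ≤ J M k f x := by
  unfold J; gcongr; exact jap_anti h _ _

variable (d) in
lemma exists_J_le_iSup : ∃ C : ℝ≥0, ∀ M k : ℕ, d + 1 ≤ M → ∀ (f : Rd d → ℝ≥0∞) (x : Rd d),
    J M k f x ≤ C * ⨆ y, f y := by
  obtain ⟨C, hC⟩ := exists_lintegral_jap d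
  refine ⟨C, fun M k hM f x ↦ ?_⟩
  unfold J
  calc ∫⁻ y, ENNReal.ofReal (jap M k (y - x)) * f y
      ≤ ∫⁻ y, ENNReal.ofReal (jap M k (y - x)) * ⨆ y, f y := by gcongr with y; exact le_iSup f y
    _ = (∫⁻ y, ENNReal.ofReal (jap M k (y - x))) * ⨆ y, f y :=
        lintegral_mul_const _ (measurable_jap M k x)
    _ ≤ _ := by gcongr; exact hC M k hM x

variable (d) in
/-- The averaging operators are uniformly bounded on `L^p`. -/
lemma exists_fn_J_le (kd : Kind) : ∃ C : ℝ≥0, ∀ M k : ℕ, d + 1 ≤ M → ∀ f : Rd d → ℝ≥0∞,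
    Measurable f → fn kd Set.univ (J M k f) ≤ C * fn kd Set.univ f := by
  cases kd
  · obtain ⟨C, hC⟩ := exists_J_le_iSup d
    refine ⟨C, fun M k hM f _ ↦ ?_⟩
    simp only [fn, Set.mem_univ, iSup_pos]
    exact iSup_le fun x ↦ hC M k hM f x
  · obtain ⟨C, hC⟩ := exists_lintegral_jap d
    refine ⟨C, fun M k hM f hf ↦ ?_⟩
    simp only [fn]
    rw [rpow_half_le_iff, mul_pow, rpow_half_sq]
    simp only [Measure.restrict_univ]
    have hm : Measurable fun p : Rd d × Rd d ↦ ENNReal.ofReal (jap M k (p.2 - p.1)) * f p.2 ^ 2 :=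
      (((continuous_jap M k).comp
        (continuous_snd.sub continuous_fst)).measurable.ennreal_ofReal).mul
        ((hf.comp measurable_snd).pow_const 2)
    calc ∫⁻ x, J M k f x ^ 2
        ≤ ∫⁻ x, C * ∫⁻ y, ENNReal.ofReal (jap M k (y - x)) * f y ^ 2 := by
          gcongr with x
          refine (sq_lintegral_mul_le volume (measurable_jap M k x) hf).trans ?_
          gcongr
          exact hC M k hM x
      _ = C * ∫⁻ y, ∫⁻ x, ENNReal.ofReal (jap M k (y - x)) * f y ^ 2 := by
          rw [lintegral_const_mul _ (Measurable.lintegral_prod_right' hm),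
            lintegral_lintegral_swap hm.aemeasurable]
      _ ≤ C * ∫⁻ y, C * f y ^ 2 := by
          gcongr with y
          simp_rw [← neg_sub _ y, jap_neg]
          rw [lintegral_mul_const _ (measurable_jap M k y)]
          gcongr
          exact hC M k hM y
      _ = _ := by rw [lintegral_const_mul _ (hf.pow_const 2)]; ring

-- Bernstein's inequality for averages. For p = 2 Cauchy–Schwarz loses only 2^{kd/2}; the cruder
-- loss 2^{kd} is harmless and lets both scales share one statement.
variable (d) in
lemma exists_J_le_fn (kd : Kind) : ∃ C : ℝ≥0, ∀ M k : ℕ, d + 1 ≤ M → ∀ f : Rd d → ℝ≥0∞,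
    Measurable f → ∀ x, J M k f x ≤ C * tw (k * d) * fn kd Set.univ f := by
  cases kd
  · obtain ⟨C, hC⟩ := exists_J_le_iSup d
    refine ⟨C, fun M k hM f _ x ↦ (hC M k hM f x).trans ?_⟩
    simp only [fn, Set.mem_univ, iSup_pos]
    gcongr
    exact le_mul_of_one_le_right' (one_le_tw (by positivity))
  · obtain ⟨C, hC⟩ := exists_lintegral_jap d
    refine ⟨C + 1, fun M k hM f hf x ↦ ?_⟩
    simp only [fn, Measure.restrict_univ]
    have e : tw (k * d) = ENNReal.ofReal (2 ^ (k * d)) := by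
      rw [tw_eq_ofReal]; norm_cast
    have h1 : J M k f x ^ 2 ≤ (C + 1 : ℝ≥0) * tw (k * d) * (∫⁻ y, f y ^ 2) := by
      refine (sq_lintegral_mul_le volume (measurable_jap M k x) hf).trans ?_
      rw [mul_assoc]
      refine mul_le_mul' ((hC M k hM x).trans (by push_cast; exact le_self_add)) ?_
      rw [← lintegral_const_mul _ (hf.pow_const 2)]
      gcongr with y
      rw [e]
      exact ENNReal.ofReal_le_ofReal (jap_le _ _ _)
    have h2 : J M k f x ^ 2 ≤ ((C + 1 : ℝ≥0) * tw (k * d) * (∫⁻ y, f y ^ 2) ^ (1 / 2 : ℝ)) ^ 2 := by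
      refine h1.trans ?_
      rw [mul_pow, rpow_half_sq]
      gcongr
      rw [_root_.sq]
      refine le_mul_of_one_le_right' ?_
      exact one_le_mul (by simp) (one_le_tw (by positivity))
    have := ENNReal.rpow_le_rpow h2 (z := 1 / 2) (by norm_num)
    rwa [sq_rpow_half, sq_rpow_half] at this

/-! ### Translates, convolution and Fourier multipliers -/

/-- The Fourier multiplier with a Schwartz symbol. -/
def Op (m : 𝓢(Rd d, ℂ)) : 𝓢'(Rd d, ℂ) →L[ℂ] 𝓢'(Rd d, ℂ) :=
  TemperedDistribution.fourierMultiplierCLM ℂ m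

/-- The transpose of `Op m` on Schwartz functions. -/
def Cop (m : 𝓢(Rd d, ℂ)) (u : 𝓢(Rd d, ℂ)) : 𝓢(Rd d, ℂ) :=
  𝓕 (SchwartzMap.smulLeftCLM ℂ m (𝓕⁻ u))

/-- The translate `K(· - x)`. -/
def tr (x : Rd d) (K : 𝓢(Rd d, ℂ)) : 𝓢(Rd d, ℂ) := compSubConstCLM ℂ x K

/-- The function `x ↦ T (K(· - x))`. -/
def ev (K : 𝓢(Rd d, ℂ)) (T : 𝓢'(Rd d, ℂ)) (x : Rd d) : ℂ := T (tr x K)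

@[simp] lemma tr_apply (x y : Rd d) (K : 𝓢(Rd d, ℂ)) : tr x K y = K (y - x) := rfl

lemma Op_apply (m : 𝓢(Rd d, ℂ)) (T : 𝓢'(Rd d, ℂ)) (u : 𝓢(Rd d, ℂ)) : Op m T u = T (Cop m u) := rfl

lemma hasTemperateGrowth_exp_ofReal_mul_I :
    (fun t : ℝ ↦ Complex.exp (↑t * Complex.I)).HasTemperateGrowth := by
  have hd : ∀ t : ℝ, HasDerivAt (fun t : ℝ ↦ Complex.exp (↑t * Complex.I))
      (Complex.exp (↑t * Complex.I) * Complex.I) t := fun t ↦ by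
    simpa using ((Complex.ofRealCLM.hasDerivAt (x := t)).mul_const Complex.I).cexp
  have hi : ∀ n : ℕ, iteratedDeriv n (fun t : ℝ ↦ Complex.exp (↑t * Complex.I)) =
      fun t : ℝ ↦ Complex.exp (↑t * Complex.I) * Complex.I ^ n := by
    intro n
    induction n with
    | zero => simp
    | succ n ih =>
      rw [iteratedDeriv_succ, ih]
      ext t
      rw [((hd t).mul_const (Complex.I ^ n)).deriv]; ring
  refine ⟨(Complex.ofRealCLM.contDiff.mul contDiff_const).cexp, fun n ↦ ⟨0, 1, fun t ↦ ?_⟩⟩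
  rw [norm_iteratedFDeriv_eq_norm_iteratedDeriv, hi]
  simp [Complex.norm_exp_ofReal_mul_I]

/-- The multiplication formula for the inverse Fourier transform, applied to u and to m times the
character ξ ↦ exp(-2πi⟨ξ, y⟩): modulation of m becomes translation of its transform. -/
lemma Cop_apply (m u : 𝓢(Rd d, ℂ)) (y : Rd d) : Cop m u y = ∫ x, u x * (𝓕 m) (y - x) := by
  have hexp : (fun ξ : Rd d ↦ (Complex.exp (↑(-2 * Real.pi * inner ℝ ξ y) * Complex.I))).HasTemperateGrowth :=
    hasTemperateGrowth_exp_ofReal_mul_I.comp (f := fun ξ : Rd d ↦ -2 * Real.pi * inner ℝ ξ y)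
      (by fun_prop)
  set e : 𝓢(Rd d, ℂ) := SchwartzMap.smulLeftCLM ℂ
    (fun ξ : Rd d ↦ (Complex.exp (↑(-2 * Real.pi * inner ℝ ξ y) * Complex.I))) m with he
  have h1 : ∀ x, 𝓕⁻ e x = (𝓕 m) (y - x) := by
    intro x
    rw [fourierInv_coe, fourier_coe, Real.fourierInv_eq', Real.fourier_eq']
    congr 1 with ξ
    rw [he, SchwartzMap.smulLeftCLM_apply_apply hexp, smul_smul, ← Complex.exp_add]
    congr 2
    rw [inner_sub_right]; push_cast; ring
  simp_rw [← h1]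
  have := SchwartzMap.integral_fourierInv_mul_eq u e
  rw [← this, Cop, fourier_coe, Real.fourier_eq']
  congr 1 with ξ
  rw [he, SchwartzMap.smulLeftCLM_apply_apply hexp, SchwartzMap.smulLeftCLM_apply_apply (by fun_prop)]
  simp only [smul_eq_mul]; ring

lemma iteratedFDeriv_tr (x y : Rd d) (K : 𝓢(Rd d, ℂ)) (n : ℕ) :
    iteratedFDeriv ℝ n (tr x K) y = iteratedFDeriv ℝ n K (y - x) := by
  have : (tr x K : Rd d → ℂ) = fun z ↦ K (z - x) := rfl
  rw [this, iteratedFDeriv_comp_sub]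

lemma lineDeriv_tr (x v : Rd d) (K : 𝓢(Rd d, ℂ)) : ∂_{v} (tr x K) = tr x (∂_{v} K) := by
  ext y
  simp only [tr_apply, SchwartzMap.lineDerivOp_apply_eq_fderiv]
  have : (tr x K : Rd d → ℂ) = fun z ↦ K (z - x) := rfl
  rw [this, fderiv_comp_sub]

/-- A derivative of the convolution is again a transposed multiplier, with the differentiated
kernel. Iterating this moves derivatives under the integral sign without any domination argument. -/
lemma lineDeriv_Cop (m u : 𝓢(Rd d, ℂ)) (v : Rd d) : ∃ m', 𝓕 m' = ∂_{v} (𝓕 m) ∧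
    ∂_{v} (Cop m u) = Cop m' u := by
  refine ⟨-(2 * Real.pi * Complex.I) • smulLeftCLM ℂ (inner ℝ · v) m, ?_, ?_⟩
  · rw [lineDerivOp_fourier_eq]
  · rw [Cop, Cop, lineDerivOp_fourier_eq]
    congr 1
    ext ξ
    have hg : (inner ℝ · v : Rd d → ℝ).HasTemperateGrowth := by fun_prop
    rw [smul_apply, smulLeftCLM_apply_apply hg, smulLeftCLM_apply_apply (by fun_prop),
      smulLeftCLM_apply_apply (by fun_prop), smul_apply, smulLeftCLM_apply_apply hg]
    simp only [smul_eq_mul, Complex.real_smul]; ring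

lemma iteratedFDeriv_Cop (n : ℕ) (m u : 𝓢(Rd d, ℂ)) (y : Rd d) (v : Fin n → Rd d) :
    iteratedFDeriv ℝ n (Cop m u) y v = ∫ x, u x * iteratedFDeriv ℝ n (tr x (𝓕 m)) y v := by
  simp_rw [← iteratedLineDerivOp_eq_iteratedFDeriv]
  induction n generalizing m with
  | zero => simp [Cop_apply]
  | succ n ih =>
    obtain ⟨m', h1, h2⟩ := lineDeriv_Cop m u (v (Fin.last n))
    rw [iteratedLineDerivOp_succ_right, h2, ih]
    congr 1 with x
    rw [iteratedLineDerivOp_succ_right, lineDeriv_tr, h1]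

lemma seminorm_tr_le (k n : ℕ) (K : 𝓢(Rd d, ℂ)) : ∃ C : ℝ, 0 ≤ C ∧ ∀ x : Rd d,
    SchwartzMap.seminorm ℂ k n (tr x K) ≤ C * (1 + ‖x‖) ^ k := by
  set C := (2 : ℝ) ^ k * (((Finset.Iic (k, n)).sup fun m ↦ SchwartzMap.seminorm ℂ m.1 m.2) K)
  have hC : 0 ≤ C := by positivity
  refine ⟨C, hC, fun x ↦ ?_⟩
  refine seminorm_le_bound ℂ k n _ (by positivity) fun y ↦ ?_
  rw [iteratedFDeriv_tr]
  have h1 := SchwartzMap.one_add_le_sup_seminorm_apply (𝕜 := ℂ) (m := (k, n)) (k := k) (n := n)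
    le_rfl le_rfl K (y - x)
  have h2 : ‖y‖ ≤ (1 + ‖y - x‖) * (1 + ‖x‖) := by
    have : ‖y‖ ≤ ‖y - x‖ + ‖x‖ := by simpa using norm_add_le (y - x) x
    nlinarith [norm_nonneg (y - x), norm_nonneg x]
  calc ‖y‖ ^ k * ‖iteratedFDeriv ℝ n K (y - x)‖
      ≤ ((1 + ‖y - x‖) * (1 + ‖x‖)) ^ k * ‖iteratedFDeriv ℝ n K (y - x)‖ := by gcongr
    _ = (1 + ‖y - x‖) ^ k * ‖iteratedFDeriv ℝ n K (y - x)‖ * (1 + ‖x‖) ^ k := by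
        rw [mul_pow]; ring
    _ ≤ _ := by gcongr

/-- Mean value inequality for the n-th derivative on a unit ball. The weight ‖y‖^k is absorbed by
the decay of the next derivative, because 1 + ‖y‖ ≤ (2 + ‖x₀‖)(1 + ‖w‖) on that ball. -/
lemma continuous_tr (K : 𝓢(Rd d, ℂ)) : Continuous fun x ↦ tr x K := by
  rw [continuous_iff_continuousAt]
  intro x₀
  rw [ContinuousAt, (schwartz_withSeminorms ℂ (Rd d) ℂ).tendsto_nhds]
  rintro ⟨k, n⟩ ε hε
  simp only [schwartzSeminormFamily_apply]
  set C := (2 : ℝ) ^ k * (((Finset.Iic (k, n + 1)).sup fun m ↦ SchwartzMap.seminorm ℂ m.1 m.2) K)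
  have hC : 0 ≤ C := by positivity
  set D := C * (2 + ‖x₀‖) ^ k
  have hD : 0 ≤ D := by positivity
  have key : ∀ x, ‖x - x₀‖ ≤ 1 → SchwartzMap.seminorm ℂ k n (tr x K - tr x₀ K) ≤ D * ‖x - x₀‖ := by
    intro x hx
    refine seminorm_le_bound ℂ k n _ (by positivity) fun y ↦ ?_
    have e : iteratedFDeriv ℝ n (tr x K - tr x₀ K : 𝓢(Rd d, ℂ)) y =
        iteratedFDeriv ℝ n K (y - x) - iteratedFDeriv ℝ n K (y - x₀) := by
      have : ((tr x K - tr x₀ K : 𝓢(Rd d, ℂ)) : Rd d → ℂ) = (tr x K : Rd d → ℂ) - (tr x₀ K) := rfl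
      rw [this, iteratedFDeriv_sub_apply ((tr x K).smooth n).contDiffAt
        ((tr x₀ K).smooth n).contDiffAt, iteratedFDeriv_tr, iteratedFDeriv_tr]
    rw [e]
    have hb : ∀ w ∈ Metric.closedBall (y - x₀) 1,
        ‖fderiv ℝ (iteratedFDeriv ℝ n K) w‖ ≤ C / (1 + ‖w‖) ^ k := by
      intro w hw
      rw [norm_fderiv_iteratedFDeriv, le_div_iff₀ (by positivity), mul_comm]
      exact SchwartzMap.one_add_le_sup_seminorm_apply (𝕜 := ℂ) (m := (k, n + 1)) (k := k)
        (n := n + 1) le_rfl le_rfl K w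
    have hb' : ∀ w ∈ Metric.closedBall (y - x₀) 1,
        ‖fderiv ℝ (iteratedFDeriv ℝ n K) w‖ ≤ D / (1 + ‖y‖) ^ k := by
      intro w hw
      refine (hb w hw).trans ?_
      rw [div_le_div_iff₀ (by positivity) (by positivity)]
      have h2 : 1 + ‖y‖ ≤ (2 + ‖x₀‖) * (1 + ‖w‖) := by
        have h3 : ‖y - x₀ - w‖ ≤ 1 := by
          rw [← dist_eq_norm, dist_comm]; exact hw
        have : ‖y‖ ≤ ‖y - x₀ - w‖ + ‖x₀‖ + ‖w‖ := by
          calc ‖y‖ = ‖(y - x₀ - w) + x₀ + w‖ := by congr 1; abel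
            _ ≤ _ := (norm_add_le _ _).trans (by gcongr; exact norm_add_le _ _)
        nlinarith [norm_nonneg w, norm_nonneg x₀]
      calc C * (1 + ‖y‖) ^ k ≤ C * ((2 + ‖x₀‖) * (1 + ‖w‖)) ^ k := by gcongr
        _ = _ := by rw [mul_pow]; ring
    have hdiff : ∀ w ∈ Metric.closedBall (y - x₀) 1, DifferentiableAt ℝ (iteratedFDeriv ℝ n K) w :=
      fun w _ ↦ ((K.smooth ⊤).differentiable_iteratedFDeriv
        (mod_cast ENat.natCast_lt_top n)).differentiableAt
    have := Convex.norm_image_sub_le_of_norm_fderiv_le hdiff hb' (convex_closedBall _ _)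
      (Metric.mem_closedBall_self zero_le_one) (y := y - x)
      (by rw [Metric.mem_closedBall, dist_eq_norm]; rw [← norm_neg]; simpa using hx)
    calc ‖y‖ ^ k * ‖iteratedFDeriv ℝ n K (y - x) - iteratedFDeriv ℝ n K (y - x₀)‖
        ≤ (1 + ‖y‖) ^ k * (D / (1 + ‖y‖) ^ k * ‖y - x - (y - x₀)‖) := by
          gcongr; linarith
      _ = D * ‖x - x₀‖ := by
          rw [show y - x - (y - x₀) = -(x - x₀) by abel, norm_neg]
          field_simp
  have : Tendsto (fun x ↦ D * ‖x - x₀‖) (𝓝 x₀) (𝓝 0) := by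
    have : Continuous fun x ↦ D * ‖x - x₀‖ := by fun_prop
    simpa using this.tendsto x₀
  filter_upwards [this.eventually (gt_mem_nhds hε), Metric.closedBall_mem_nhds x₀ one_pos] with x h1 h2
  exact (key x (by rwa [Metric.mem_closedBall, dist_eq_norm] at h2)).trans_lt h1

lemma continuous_ev (K : 𝓢(Rd d, ℂ)) (T : 𝓢'(Rd d, ℂ)) : Continuous (ev K T) :=
  (ContinuousLinearMap.continuous T).comp (continuous_tr K)

lemma integrable_schwartz_smul {E : Type*} [NormedAddCommGroup E] [NormedSpace ℂ E]
    (u : 𝓢(Rd d, ℂ)) {G : Rd d → E} (hG : AEStronglyMeasurable G) {C : ℝ} {k : ℕ}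
    (hb : ∀ x, ‖G x‖ ≤ C * (1 + ‖x‖) ^ k) : Integrable fun x ↦ u x • G x := by
  have h1 : Integrable (fun x ↦ C * 2 ^ k * (‖x‖ ^ 0 * ‖u x‖ + ‖x‖ ^ k * ‖u x‖)) :=
    ((u.integrable_pow_mul volume 0).add (u.integrable_pow_mul volume k)).const_mul _
  refine h1.mono' (u.continuous.aestronglyMeasurable.smul hG) (.of_forall fun x ↦ ?_)
  have hC : 0 ≤ C := by
    have := (norm_nonneg _).trans (hb 0)
    simpa using this
  rw [norm_smul]
  have h2 : (1 + ‖x‖) ^ k ≤ 2 ^ k * (1 + ‖x‖ ^ k) := by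
    rcases le_total ‖x‖ 1 with h | h
    · calc (1 + ‖x‖) ^ k ≤ 2 ^ k := by gcongr; linarith
        _ ≤ _ := le_mul_of_one_le_right (by positivity) (by simp)
    · calc (1 + ‖x‖) ^ k ≤ (2 * ‖x‖) ^ k := by gcongr; linarith
        _ = 2 ^ k * ‖x‖ ^ k := mul_pow ..
        _ ≤ _ := by gcongr; linarith
  calc ‖u x‖ * ‖G x‖ ≤ ‖u x‖ * (C * (2 ^ k * (1 + ‖x‖ ^ k))) := by
        gcongr; exact (hb x).trans (by gcongr)
    _ = _ := by ring

/-! ### Tempered distributions under a vector-valued integral -/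

/-- The coordinate of the embedding of the Schwartz space in a product of spaces of bounded
continuous functions. -/
def bcfSeminorm (k n : ℕ) (f : 𝓢(Rd d, ℂ)) :
    BoundedContinuousFunction (Rd d) (Rd d [×n]→L[ℝ] ℂ) :=
  BoundedContinuousFunction.ofNormedAddCommGroup
    (fun x ↦ ‖x‖ ^ k • iteratedFDeriv ℝ n f x)
    ((by fun_prop : Continuous fun x : Rd d ↦ ‖x‖ ^ k).smul
      ((f.smooth n).continuous_iteratedFDeriv le_rfl))
    (SchwartzMap.seminorm ℂ k n f) fun x ↦ by
      rw [norm_smul, norm_pow, norm_norm]; exact le_seminorm ℂ k n f x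

lemma norm_bcfSeminorm (k n : ℕ) (f : 𝓢(Rd d, ℂ)) :
    ‖bcfSeminorm k n f‖ = SchwartzMap.seminorm ℂ k n f := by
  apply le_antisymm
  · exact BoundedContinuousFunction.norm_ofNormedAddCommGroup_le _ (by positivity) _
  · refine seminorm_le_bound ℂ k n f (norm_nonneg (bcfSeminorm k n f)) fun x ↦ ?_
    have := (bcfSeminorm k n f).norm_coe_le_norm x
    simpa [bcfSeminorm, norm_smul] using this

variable (d) in
/-- A product of spaces of bounded continuous functions. -/
def BcfProd (s : Finset (ℕ × ℕ)) : Type :=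
  (p : s) → BoundedContinuousFunction (Rd d) (Rd d [×p.1.2]→L[ℝ] ℂ)

instance (s : Finset (ℕ × ℕ)) : NormedAddCommGroup (BcfProd d s) :=
  inferInstanceAs (NormedAddCommGroup
    ((p : s) → BoundedContinuousFunction (Rd d) (Rd d [×p.1.2]→L[ℝ] ℂ)))

instance (s : Finset (ℕ × ℕ)) : NormedSpace ℂ (BcfProd d s) :=
  inferInstanceAs (NormedSpace ℂ
    ((p : s) → BoundedContinuousFunction (Rd d) (Rd d [×p.1.2]→L[ℝ] ℂ)))

instance (s : Finset (ℕ × ℕ)) : CompleteSpace (BcfProd d s) :=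
  inferInstanceAs (CompleteSpace
    ((p : s) → BoundedContinuousFunction (Rd d) (Rd d [×p.1.2]→L[ℝ] ℂ)))

/-- Evaluation of a coordinate. -/
def BcfProd.eval {s : Finset (ℕ × ℕ)} (p : s) (y : Rd d) (v : Fin p.1.2 → Rd d) :
    BcfProd d s →L[ℂ] ℂ :=
  LinearMap.mkContinuous (𝕜 := ℂ) (𝕜₂ := ℂ)
    { toFun := fun F ↦ (F p) y v
      map_add' := fun F G ↦ rfl
      map_smul' := fun c F ↦ rfl } (∏ i, ‖v i‖) fun F ↦ by
    have h1 : ‖F p‖ ≤ ‖F‖ := norm_le_pi_norm (ι := s) (G := fun p : s ↦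
      BoundedContinuousFunction (Rd d) (Rd d [×p.1.2]→L[ℝ] ℂ)) F p
    have h2 := (F p).norm_coe_le_norm y
    calc ‖(F p) y v‖ ≤ ‖(F p) y‖ * ∏ i, ‖v i‖ := ContinuousMultilinearMap.le_opNorm _ _
      _ ≤ ‖F‖ * ∏ i, ‖v i‖ := by gcongr; exact h2.trans h1
      _ = _ := mul_comm _ _

lemma BcfProd.ext_eval {s : Finset (ℕ × ℕ)} {F G : BcfProd d s}
    (h : ∀ p y v, BcfProd.eval p y v F = BcfProd.eval p y v G) : F = G := by
  funext p
  ext y v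
  exact h p y v

/-- The embedding of the Schwartz space in a product of spaces of bounded continuous functions. -/
def bcfEmbed (s : Finset (ℕ × ℕ)) : 𝓢(Rd d, ℂ) →ₗ[ℂ] BcfProd d s where
  toFun f p := bcfSeminorm p.1.1 p.1.2 f
  map_add' f g := by
    funext p
    change _ = bcfSeminorm p.1.1 p.1.2 f + bcfSeminorm p.1.1 p.1.2 g
    ext x v
    have : ((f + g : 𝓢(Rd d, ℂ)) : Rd d → ℂ) = (f : Rd d → ℂ) + g := rfl
    simp [bcfSeminorm, this, iteratedFDeriv_add_apply (f.smooth _).contDiffAt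
      (g.smooth _).contDiffAt]
  map_smul' c f := by
    funext p
    change _ = c • bcfSeminorm p.1.1 p.1.2 f
    ext x v
    have : ((c • f : 𝓢(Rd d, ℂ)) : Rd d → ℂ) = c • (f : Rd d → ℂ) := rfl
    simp [bcfSeminorm, this, iteratedFDeriv_const_smul_apply (f.smooth _).contDiffAt]
    ring

lemma norm_bcfEmbed_le (s : Finset (ℕ × ℕ)) (f : 𝓢(Rd d, ℂ)) :
    ‖bcfEmbed s f‖ ≤ s.sup (schwartzSeminormFamily ℂ (Rd d) ℂ) f := by
  refine (pi_norm_le_iff_of_nonneg (apply_nonneg _ _)).2 fun p ↦ ?_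
  change ‖bcfSeminorm p.1.1 p.1.2 f‖ ≤ _
  rw [norm_bcfSeminorm]
  exact Seminorm.le_finset_sup_apply (p := schwartzSeminormFamily ℂ (Rd d) ℂ) p.2

lemma sup_seminorm_le_norm_bcfEmbed (s : Finset (ℕ × ℕ)) (f : 𝓢(Rd d, ℂ)) :
    s.sup (schwartzSeminormFamily ℂ (Rd d) ℂ) f ≤ ‖bcfEmbed s f‖ := by
  refine Seminorm.finset_sup_apply_le (norm_nonneg _) fun p hp ↦ ?_
  have := norm_le_pi_norm (ι := s) (G := fun p : s ↦
      BoundedContinuousFunction (Rd d) (Rd d [×p.1.2]→L[ℝ] ℂ)) (bcfEmbed s f) ⟨p, hp⟩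
  refine le_trans (le_of_eq ?_) this
  exact (norm_bcfSeminorm p.1 p.2 f).symm

lemma exists_seminorm_bound (T : 𝓢'(Rd d, ℂ)) : ∃ (s : Finset (ℕ × ℕ)) (C : ℝ≥0), ∀ f,
    ‖T f‖ ≤ C * s.sup (schwartzSeminormFamily ℂ (Rd d) ℂ) f := by
  have hT : Continuous T := ContinuousLinearMap.continuous T
  obtain ⟨s, C, -, h⟩ := Seminorm.bound_of_continuous (schwartz_withSeminorms ℂ (Rd d) ℂ)
    ((normSeminorm ℂ ℂ).comp (T : 𝓢(Rd d, ℂ) →ₗ[ℂ] ℂ)) (continuous_norm.comp hT)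
  exact ⟨s, C, fun f ↦ h f⟩

lemma ev_growth (K : 𝓢(Rd d, ℂ)) (T : 𝓢'(Rd d, ℂ)) :
    ∃ (C : ℝ) (n : ℕ), 0 ≤ C ∧ ∀ x, ‖ev K T x‖ ≤ C * (1 + ‖x‖) ^ n := by
  obtain ⟨s, C, h⟩ := exists_seminorm_bound T
  choose D hD0 hD using fun p : ℕ × ℕ ↦ seminorm_tr_le p.1 p.2 K
  refine ⟨C * ∑ p ∈ s, D p, s.sup fun p ↦ p.1, by have := Finset.sum_nonneg fun p (_ : p ∈ s) ↦ hD0 p; positivity,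
    fun x ↦ (h _).trans ?_⟩
  rw [mul_assoc]
  gcongr
  refine Seminorm.finset_sup_apply_le
    (by have := Finset.sum_nonneg fun p (_ : p ∈ s) ↦ hD0 p; positivity) fun p hp ↦ (hD p x).trans ?_
  gcongr
  · exact Finset.sum_nonneg fun p _ ↦ hD0 p
  · exact Finset.single_le_sum (f := D) (fun p _ ↦ hD0 p) hp
  · simp
  · exact Finset.le_sup (f := fun p : ℕ × ℕ ↦ p.1) hp

/-- A Fourier multiplier with Schwartz symbol `m` maps a tempered distribution to the function
obtained by testing it with the translates of `𝓕 m`. -/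
theorem isFun_Op (m : 𝓢(Rd d, ℂ)) (T : 𝓢'(Rd d, ℂ)) : IsFun (ev (𝓕 m) T) (Op m T) := by
  intro u
  set K := 𝓕 m with hK
  obtain ⟨s, C, h⟩ := exists_seminorm_bound T
  -- T is controlled by finitely many seminorms, hence depends only on the image under `bcfEmbed s`.
  -- It descends to a bounded functional on the range, whichever preimages `g` are chosen.
  choose g hg' using fun y : LinearMap.range (bcfEmbed (d := d) s) ↦ y.2
  have hbd : ∀ f, ‖T f‖ ≤ C * ‖bcfEmbed s f‖ := fun f ↦ (h f).trans (by
    gcongr; exact sup_seminorm_le_norm_bcfEmbed s f)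
  have hTg : ∀ (y : LinearMap.range (bcfEmbed (d := d) s)) f, bcfEmbed s f = y → T (g y) = T f := fun y f hf ↦ by
    have h2 := hbd (g y - f)
    rw [map_sub, map_sub, hg', hf, sub_self, norm_zero, mul_zero] at h2
    exact sub_eq_zero.1 (norm_le_zero_iff.1 h2)
  let φ : (LinearMap.range (bcfEmbed (d := d) s)) →L[ℂ] ℂ :=
    LinearMap.mkContinuous
      { toFun := fun y ↦ T (g y)
        map_add' := fun y z ↦ by
          rw [← map_add]; exact hTg _ _ (by rw [map_add, hg', hg']; rfl)
        map_smul' := fun c y ↦ by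
          rw [RingHom.id_apply, ← map_smul]; exact hTg _ _ (by rw [map_smul, hg']; rfl) } C
      fun y ↦ by
      refine (hbd (g y)).trans ?_
      rw [hg']; rfl
  -- Hahn–Banach extends the functional to the whole Banach space, where Bochner integrals exist and
  -- commute with Φ.
  obtain ⟨Φ, hΦ, -⟩ := exists_extension_norm_eq _ φ
  have hΦT : ∀ f, Φ (bcfEmbed s f) = T f := by
    intro f
    have h1 := hΦ ⟨bcfEmbed s f, LinearMap.mem_range_self _ f⟩
    rw [h1]
    exact hTg _ _ rfl
  have hcont : Continuous fun x ↦ bcfEmbed s (tr x K) := by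
    have : Continuous (bcfEmbed (d := d) s) :=
      Seminorm.cont_withSeminorms_normedSpace _ (schwartz_withSeminorms ℂ (Rd d) ℂ) _
        ⟨s, 1, fun f ↦ by simpa using norm_bcfEmbed_le s f⟩
    exact this.comp (continuous_tr K)
  choose D hD0 hD using fun p : ℕ × ℕ ↦ seminorm_tr_le p.1 p.2 K
  have hint : Integrable fun x ↦ u x • bcfEmbed s (tr x K) := by
    refine integrable_schwartz_smul u hcont.aestronglyMeasurable (C := ∑ p ∈ s, D p)
      (k := s.sup fun p ↦ p.1) fun x ↦ (norm_bcfEmbed_le s _).trans ?_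
    have h0 := Finset.sum_nonneg fun p (_ : p ∈ s) ↦ hD0 p
    refine Seminorm.finset_sup_apply_le (by positivity) fun p hp ↦ (hD p x).trans ?_
    gcongr
    · exact Finset.single_le_sum (f := D) (fun p _ ↦ hD0 p) hp
    · simp
    · exact Finset.le_sup (f := fun p : ℕ × ℕ ↦ p.1) hp
  -- Point evaluations of the coordinates separate elements of the product, so the identity of
  -- Banach space valued integrals reduces to scalar ones.
  have heq : bcfEmbed s (Cop m u) = ∫ x, u x • bcfEmbed s (tr x K) := by
    refine BcfProd.ext_eval fun p y v ↦ ?_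
    rw [← ContinuousLinearMap.integral_comp_comm _ hint]
    have h3 : ∀ f, BcfProd.eval p y v (bcfEmbed s f) =
      ‖y‖ ^ p.1.1 • iteratedFDeriv ℝ p.1.2 f y v := fun f ↦ rfl
    simp_rw [map_smul, h3]
    rw [iteratedFDeriv_Cop, ← integral_smul]
    congr 1 with x
    simp only [Complex.real_smul, smul_eq_mul]; ring
  constructor
  · obtain ⟨C, n, hC, hb⟩ := ev_growth K T
    exact integrable_schwartz_smul u (continuous_ev K T).aestronglyMeasurable hb
  · rw [Op_apply, ← hΦT, heq, ← Φ.integral_comp_comm hint]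
    congr 1 with x
    rw [map_smul, hΦT]; rfl

/-! ### Tempered distributions which are functions -/

/-- Continuous functions of polynomial growth. -/
structure PG (f : Rd d → ℂ) : Prop where
  cont : Continuous f
  growth : ∃ (C : ℝ) (n : ℕ), 0 ≤ C ∧ ∀ x, ‖f x‖ ≤ C * (1 + ‖x‖) ^ n

lemma PG.of_bounded {f : Rd d → ℂ} (hf : Continuous f) {C : ℝ} (h : ∀ x, ‖f x‖ ≤ C) : PG f :=
  ⟨hf, C, 0, (norm_nonneg _).trans (h 0), fun x ↦ by simpa using h x⟩

lemma PG.integrable {f : Rd d → ℂ} (hf : PG f) (u : 𝓢(Rd d, ℂ)) :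
    Integrable fun x ↦ u x * f x := by
  obtain ⟨C, n, -, h⟩ := hf.growth
  exact integrable_schwartz_smul u hf.cont.aestronglyMeasurable h

lemma PG_ev (K : 𝓢(Rd d, ℂ)) (T : 𝓢'(Rd d, ℂ)) : PG (ev K T) := ⟨continuous_ev K T, ev_growth K T⟩

lemma PG.mul {f g : Rd d → ℂ} (hf : PG f) (hg : PG g) : PG fun x ↦ f x * g x := by
  obtain ⟨C, n, hC, h⟩ := hf.growth
  obtain ⟨D, m, hD, h'⟩ := hg.growth
  refine ⟨hf.cont.mul hg.cont, C * D, n + m, by positivity, fun x ↦ ?_⟩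
  rw [norm_mul, pow_add]
  calc ‖f x‖ * ‖g x‖ ≤ (C * (1 + ‖x‖) ^ n) * (D * (1 + ‖x‖) ^ m) := by
        gcongr; exacts [h x, h' x]
    _ = _ := by ring

lemma PG.comp {f : Rd d → ℂ} (hf : PG f) {χ : Rd d → Rd d} (hχ : Continuous χ) {M : ℝ}
    (hM : ∀ x, ‖χ x‖ ≤ M * (1 + ‖x‖)) : PG (f ∘ χ) := by
  obtain ⟨C, n, hC, h⟩ := hf.growth
  have hM0 : 0 ≤ M := by simpa using (norm_nonneg _).trans (hM 0)
  refine ⟨hf.cont.comp hχ, C * (1 + M) ^ n, n, by positivity, fun x ↦ (h _).trans ?_⟩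
  rw [mul_assoc, ← mul_pow]
  gcongr
  have := hM x
  nlinarith [norm_nonneg x]

lemma PG.exists_isFun {f : Rd d → ℂ} (hf : PG f) : ∃ T, IsFun f T := by
  obtain ⟨C, n, hC, h⟩ := hf.growth
  have h0 : Integrable (fun x : Rd d ↦ (1 + ‖x‖) ^ (-((d : ℝ) + 1))) :=
    integrable_one_add_norm (by simp)
  let A : 𝓢(Rd d, ℂ) →L[ℂ] ℂ := SchwartzMap.mkCLMtoNormedSpace (σ := RingHom.id ℂ)
    (fun g ↦ ∫ x, g x * f x)
    (fun g g' ↦ by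
      simp only [add_apply, add_mul]
      exact integral_add (hf.integrable g) (hf.integrable g'))
    (fun a g ↦ by
      simp only [smul_apply, smul_eq_mul, mul_assoc, RingHom.id_apply]
      exact integral_const_mul _ _)
    ⟨Finset.Iic (n + d + 1, 0), 2 ^ (n + d + 1) * C * ∫ x : Rd d, (1 + ‖x‖) ^ (-((d : ℝ) + 1)),
      by
        have : 0 ≤ ∫ x : Rd d, (1 + ‖x‖) ^ (-((d : ℝ) + 1)) :=
          integral_nonneg fun x ↦ by positivity
        positivity, fun g ↦ by
      have hb : ∀ x, ‖g x * f x‖ ≤ (2 ^ (n + d + 1) * C *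
          ((Finset.Iic (n + d + 1, 0)).sup (schwartzSeminormFamily ℂ (Rd d) ℂ)) g) *
          (1 + ‖x‖) ^ (-((d : ℝ) + 1)) := by
        intro x
        have h1 := SchwartzMap.one_add_le_sup_seminorm_apply (𝕜 := ℂ) (m := (n + d + 1, 0))
          (k := n + d + 1) (n := 0) le_rfl le_rfl g x
        rw [norm_iteratedFDeriv_zero] at h1
        rw [Real.rpow_neg (by positivity), ← div_eq_mul_inv, le_div_iff₀ (by positivity), norm_mul]
        norm_cast
        calc ‖g x‖ * ‖f x‖ * (1 + ‖x‖) ^ (d + 1)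
            ≤ ‖g x‖ * (C * (1 + ‖x‖) ^ n) * (1 + ‖x‖) ^ (d + 1) := by gcongr; exact h x
          _ = C * ((1 + ‖x‖) ^ (n + d + 1) * ‖g x‖) := by ring
          _ ≤ C * (2 ^ (n + d + 1) *
              ((Finset.Iic (n + d + 1, 0)).sup (schwartzSeminormFamily ℂ (Rd d) ℂ)) g) := by
            exact mul_le_mul_of_nonneg_left h1 hC
          _ = _ := by push_cast; ring
      calc ‖∫ x, g x * f x‖ ≤ ∫ x, _ := norm_integral_le_of_norm_le (h0.const_mul _) (.of_forall hb)
        _ = _ := by rw [integral_const_mul]; ring⟩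
  exact ⟨ContinuousLinearMap.toPointwiseConvergenceCLM _ _ _ _ A, fun g ↦ ⟨hf.integrable g, rfl⟩⟩

open Classical in
/-- The tempered distribution given by a function. -/
def dst (f : Rd d → ℂ) : 𝓢'(Rd d, ℂ) := if h : ∃ T, IsFun f T then h.choose else 0

lemma IsFun.ext {f : Rd d → ℂ} {T T' : 𝓢'(Rd d, ℂ)} (h : IsFun f T) (h' : IsFun f T') : T = T' := by
  ext g; rw [(h g).2, (h' g).2]

lemma IsFun.dst_eq {f : Rd d → ℂ} {T : 𝓢'(Rd d, ℂ)} (h : IsFun f T) : dst f = T := by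
  have h' : ∃ T, IsFun f T := ⟨T, h⟩
  rw [dst, dif_pos h']
  exact h'.choose_spec.ext h

lemma PG.isFun {f : Rd d → ℂ} (hf : PG f) : IsFun f (dst f) := by
  obtain ⟨T, hT⟩ := hf.exists_isFun
  rw [hT.dst_eq]; exact hT

lemma ae_eq_of_schwartz {f g : Rd d → ℂ} (hf : LocallyIntegrable f) (hg : LocallyIntegrable g)
    (h : ∀ u : 𝓢(Rd d, ℂ), ∫ x, u x * f x = ∫ x, u x * g x) : f =ᵐ[volume] g := by
  refine ae_eq_of_integral_contDiff_smul_eq hf hg fun u hu hc ↦ ?_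
  have hc₁ : HasCompactSupport (Complex.ofRealCLM ∘ u) := hc.comp_left rfl
  have hu₂ : ContDiff ℝ ∞ (Complex.ofRealCLM ∘ u) := Complex.ofRealCLM.contDiff.comp hu
  simpa using h (hc₁.toSchwartzMap hu₂)

lemma IsFun.unique {f g : Rd d → ℂ} {T : 𝓢'(Rd d, ℂ)} (hf : IsFun f T) (hg : IsFun g T)
    (hfc : Continuous f) (hgc : Continuous g) : f = g :=
  (Continuous.ae_eq_iff_eq volume hfc hgc).1 (ae_eq_of_schwartz hfc.locallyIntegrable
    hgc.locallyIntegrable fun u ↦ by rw [← (hf u).2, (hg u).2])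

lemma IsFun.add {f g : Rd d → ℂ} {T S : 𝓢'(Rd d, ℂ)} (hf : IsFun f T) (hg : IsFun g S) :
    IsFun (fun x ↦ f x + g x) (T + S) := by
  intro u
  simp only [mul_add]
  refine ⟨(hf u).1.add (hg u).1, ?_⟩
  rw [integral_add (hf u).1 (hg u).1, ← (hf u).2, ← (hg u).2]; rfl

lemma IsFun.const_mul {f : Rd d → ℂ} {T : 𝓢'(Rd d, ℂ)} (hf : IsFun f T) (c : ℂ) :
    IsFun (fun x ↦ c * f x) (c • T) := by
  intro u
  simp only [mul_left_comm _ c]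
  refine ⟨(hf u).1.const_mul c, ?_⟩
  rw [integral_const_mul, ← (hf u).2]; rfl

lemma IsFun.sub {f g : Rd d → ℂ} {T S : 𝓢'(Rd d, ℂ)} (hf : IsFun f T) (hg : IsFun g S) :
    IsFun (fun x ↦ f x - g x) (T - S) := by
  have := hf.add (hg.const_mul (-1))
  rw [show (-1 : ℂ) • S = -S from neg_one_smul ℂ S, ← sub_eq_add_neg] at this
  simpa [sub_eq_add_neg] using this

lemma isFun_zero : IsFun (fun _ : Rd d ↦ (0 : ℂ)) 0 := fun u ↦ by simp

lemma IsFun.sum {ι : Type*} {s : Finset ι} {f : ι → Rd d → ℂ} {T : ι → 𝓢'(Rd d, ℂ)}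
    (h : ∀ i ∈ s, IsFun (f i) (T i)) : IsFun (fun x ↦ ∑ i ∈ s, f i x) (∑ i ∈ s, T i) := by
  classical
  induction s using Finset.induction_on with
  | empty => simpa using isFun_zero
  | insert i s hi ih =>
    simp only [Finset.sum_insert hi]
    exact (h i (Finset.mem_insert_self _ _)).add (ih fun j hj ↦ h j (Finset.mem_insert_of_mem hj))

lemma IsFun.smulLeft {f : Rd d → ℂ} {T : 𝓢'(Rd d, ℂ)} (hf : IsFun f T) {g : Rd d → ℂ}
    (hg : g.HasTemperateGrowth) :
    IsFun (fun x ↦ g x * f x) (TemperedDistribution.smulLeftCLM ℂ g T) := by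
  intro u
  have := hf (SchwartzMap.smulLeftCLM ℂ g u)
  simp only [SchwartzMap.smulLeftCLM_apply_apply hg, smul_eq_mul] at this
  rw [TemperedDistribution.smulLeftCLM_apply_apply]
  simpa [mul_assoc, mul_left_comm, mul_comm] using this

/-- The function `x ↦ ∫ K(y - x) f(y) dy`. -/
def cv (K f : Rd d → ℂ) (x : Rd d) : ℂ := ∫ y, K (y - x) * f y

lemma IsFun.ev_eq {f : Rd d → ℂ} {T : 𝓢'(Rd d, ℂ)} (hf : IsFun f T) (K : 𝓢(Rd d, ℂ)) :
    ev K T = cv K f := by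
  ext x; exact (hf (tr x K)).2

lemma IsFun.integrable_tr {f : Rd d → ℂ} {T : 𝓢'(Rd d, ℂ)} (hf : IsFun f T) (K : 𝓢(Rd d, ℂ))
    (x : Rd d) : Integrable fun y ↦ K (y - x) * f y := (hf (tr x K)).1

lemma IsFun.isFun_Op {f : Rd d → ℂ} {T : 𝓢'(Rd d, ℂ)} (hf : IsFun f T) (m : 𝓢(Rd d, ℂ)) :
    IsFun (cv (𝓕 m : 𝓢(Rd d, ℂ)) f) (Op m T) := by
  rw [← hf.ev_eq]; exact Paracomposition.isFun_Op m T

lemma Op_Op (m m' : 𝓢(Rd d, ℂ)) (T : 𝓢'(Rd d, ℂ)) :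
    Op m' (Op m T) = TemperedDistribution.fourierMultiplierCLM ℂ (fun ξ ↦ m ξ * m' ξ) T :=
  TemperedDistribution.fourierMultiplierCLM_fourierMultiplierCLM_apply m.hasTemperateGrowth
    m'.hasTemperateGrowth T

lemma Op_Op_eq {m m' : 𝓢(Rd d, ℂ)} (h : ∀ ξ, m ξ * m' ξ = m ξ) (T : 𝓢'(Rd d, ℂ)) :
    Op m' (Op m T) = Op m T := by
  rw [Op_Op]; simp_rw [h]; rfl

lemma Op_add (m m' : 𝓢(Rd d, ℂ)) (T : 𝓢'(Rd d, ℂ)) : Op (m + m') T = Op m T + Op m' T := by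
  ext g
  change T _ = T _ + T _
  rw [← map_add]
  congr 1
  change Cop (m + m') g = Cop m g + Cop m' g
  rw [Cop, Cop, Cop, ← FourierTransform.fourier_add]
  congr 1
  ext ξ
  rw [SchwartzMap.smulLeftCLM_apply_apply (m + m').hasTemperateGrowth, add_apply, add_apply,
    SchwartzMap.smulLeftCLM_apply_apply m.hasTemperateGrowth,
    SchwartzMap.smulLeftCLM_apply_apply m'.hasTemperateGrowth, add_smul]

/-- Reproduction of band-limited functions. -/
lemma cv_ev_eq {m m' : 𝓢(Rd d, ℂ)} (h : ∀ ξ, m ξ * m' ξ = m ξ) (T : 𝓢'(Rd d, ℂ)) :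
    cv (𝓕 m' : 𝓢(Rd d, ℂ)) (ev (𝓕 m) T) = ev (𝓕 m) T := by
  have h1 := (isFun_Op m T).isFun_Op m'
  rw [Op_Op_eq h] at h1
  refine h1.unique (isFun_Op m T) ?_ (continuous_ev _ _)
  rw [← (isFun_Op m T).ev_eq]; exact continuous_ev _ _

/-! ### Lebesgue norms of distributions -/

/-- L^p embeds injectively in the tempered distributions, so the infimum runs over a single element.
-/
lemma lpNorm_coe {p : ℝ≥0∞} [Fact (1 ≤ p)] (F : Lp ℂ p (volume : Measure (Rd d))) :
    lpNorm p (Lp.toTemperedDistribution F) = ‖F‖ₑ := by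
  refine le_antisymm (iInf₂_le (κ := fun G ↦ Lp.toTemperedDistribution G = Lp.toTemperedDistribution F) F rfl) (le_iInf₂ fun G hG ↦ ?_)
  have hk := Lp.ker_toTemperedDistributionCLM_eq_bot (F := ℂ) (μ := (volume : Measure (Rd d))) (p := p)
  have : F = G := by
    have h1 : F - G ∈ (Lp.toTemperedDistributionCLM ℂ (volume : Measure (Rd d)) p).ker := by
      rw [LinearMap.mem_ker, map_sub]
      exact sub_eq_zero.2 hG.symm
    rw [hk] at h1
    exact sub_eq_zero.1 h1
  rw [this]

lemma exists_of_lpNorm_lt_top {p : ℝ≥0∞} [Fact (1 ≤ p)] {T : 𝓢'(Rd d, ℂ)} (h : lpNorm p T < ⊤) :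
    ∃ F : Lp ℂ p (volume : Measure (Rd d)), Lp.toTemperedDistribution F = T ∧ ‖F‖ₑ = lpNorm p T := by
  simp only [lpNorm, iInf_lt_iff] at h
  obtain ⟨F, rfl, -⟩ := h
  exact ⟨F, rfl, (lpNorm_coe F).symm⟩

/-- For continuous functions the supremum is the essential supremum, as a nonempty open set has
positive measure. -/
lemma fn_univ_eq_eLpNorm (kd : Kind) {f : Rd d → ℂ} (hf : Continuous f) :
    fn kd Set.univ (fun x ↦ ‖f x‖ₑ) = eLpNorm f kd.p volume := by
  cases kd
  · simp only [fn, Set.mem_univ, iSup_pos, Kind.p, eLpNorm_exponent_top, eLpNormEssSup]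
    refine le_antisymm (iSup_le fun x ↦ ?_) (essSup_le_of_ae_le _ (.of_forall fun x ↦
      le_iSup (fun x ↦ ‖f x‖ₑ) x))
    by_contra! hx
    have ho : IsOpen {y | essSup (fun x ↦ ‖f x‖ₑ) volume < ‖f y‖ₑ} :=
      isOpen_lt continuous_const hf.enorm
    have h0 := ae_le_essSup (f := fun x ↦ ‖f x‖ₑ) (μ := (volume : Measure (Rd d)))
    have h1 : volume {y | essSup (fun x ↦ ‖f x‖ₑ) volume < ‖f y‖ₑ} = 0 := by
      simpa [ae_iff] using h0
    have := (ho.measure_eq_zero_iff volume).1 h1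
    exact (Set.ext_iff.1 this x).1 hx
  · simp [fn, Kind.p, eLpNorm_eq_lintegral_rpow_enorm_toReal]

lemma lpNorm_le_fn (kd : Kind) {f : Rd d → ℂ} (hf : Continuous f) {T : 𝓢'(Rd d, ℂ)}
    (h : IsFun f T) : lpNorm kd.p T ≤ fn kd Set.univ fun x ↦ ‖f x‖ₑ := by
  rw [fn_univ_eq_eLpNorm kd hf]
  by_cases ht : eLpNorm f kd.p volume = ⊤
  · rw [ht]; exact le_top
  have hm : MemLp f kd.p volume := ⟨hf.aestronglyMeasurable, lt_top_iff_ne_top.2 ht⟩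
  have : Lp.toTemperedDistribution hm.toLp = T := by
    ext g
    rw [Lp.toTemperedDistribution_apply, (h g).2]
    refine integral_congr_ae ?_
    filter_upwards [hm.coeFn_toLp] with x hx
    rw [hx]; rfl
  rw [← this, lpNorm_coe, Lp.enorm_toLp]

lemma fn_le_lpNorm (kd : Kind) {f : Rd d → ℂ} (hf : Continuous f) {T : 𝓢'(Rd d, ℂ)}
    (h : IsFun f T) : fn kd Set.univ (fun x ↦ ‖f x‖ₑ) ≤ lpNorm kd.p T := by
  refine le_iInf₂ fun F hF ↦ ?_
  have : f =ᵐ[volume] F := by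
    refine ae_eq_of_schwartz hf.locallyIntegrable ((Lp.memLp F).locallyIntegrable (Fact.out)) fun u ↦ ?_
    rw [← (h u).2, ← hF, Lp.toTemperedDistribution_apply]; rfl
  rw [fn_univ_eq_eLpNorm kd hf, eLpNorm_congr_ae this, Lp.enorm_def]

/-- The topology carried by the type of tempered distributions is that of pointwise convergence, so
sums may be tested on each Schwartz function. -/
lemma hasSum_iff {ι : Type*} {X : ι → 𝓢'(Rd d, ℂ)} {S : 𝓢'(Rd d, ℂ)} :
    HasSum X S ↔ ∀ g, HasSum (fun i ↦ X i g) (S g) := by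
  have h := PointwiseConvergenceCLM.tendsto_iff_forall_tendsto (p := atTop)
    (a := fun s : Finset ι ↦ ∑ i ∈ s, X i) (a₀ := S)
  refine h.trans (forall_congr' fun g ↦ ?_)
  have : ∀ s : Finset ι, (∑ i ∈ s, X i) g = ∑ i ∈ s, X i g := fun s ↦ by simp
  simp only [this]; rfl

/-- Absolute convergence in the Banach space L^p, transported by the continuous embedding into the
tempered distributions. -/
lemma exists_hasSum_of_lpNorm {ι : Type*} {p : ℝ≥0∞} [Fact (1 ≤ p)] {X : ι → 𝓢'(Rd d, ℂ)}
    (h : ∑' i, lpNorm p (X i) ≠ ⊤) : ∃ S, HasSum X S ∧ lpNorm p S ≤ ∑' i, lpNorm p (X i) := by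
  have hi : ∀ i, lpNorm p (X i) < ⊤ := fun i ↦
    lt_top_iff_ne_top.2 (ENNReal.ne_top_of_tsum_ne_top h i)
  choose F hF hF' using fun i ↦ exists_of_lpNorm_lt_top (hi i)
  simp_rw [← hF'] at h ⊢
  have hs : Summable F := by
    refine Summable.of_nnnorm ?_
    exact ENNReal.tsum_coe_ne_top_iff_summable.1 h
  refine ⟨Lp.toTemperedDistribution (∑' i, F i), ?_, ?_⟩
  · have := (Lp.toTemperedDistributionCLM ℂ (volume : Measure (Rd d)) p).hasSum hs.hasSum
    simpa [hF] using this
  · rw [lpNorm_coe]; exact enorm_tsum_le_tsum_enorm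

lemma lpNorm_le_tsum {ι : Type*} {p : ℝ≥0∞} [Fact (1 ≤ p)] {X : ι → 𝓢'(Rd d, ℂ)} {S : 𝓢'(Rd d, ℂ)}
    (h : HasSum X S) : lpNorm p S ≤ ∑' i, lpNorm p (X i) := by
  by_cases ht : ∑' i, lpNorm p (X i) = ⊤
  · rw [ht]; exact le_top
  obtain ⟨S', h1, h2⟩ := exists_hasSum_of_lpNorm ht
  have : S = S' := by
    ext g; exact (hasSum_iff.1 h g).unique (hasSum_iff.1 h1 g)
  rwa [this]

/-! ### Dilations and the symbols of the Littlewood-Paley decomposition -/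

/-- The dilation `ξ ↦ 2^{-k} ξ` of `ℝ^d`. -/
def dilEquiv (k : ℕ) : Rd d ≃L[ℝ] Rd d :=
  ContinuousLinearEquiv.smulLeft (Units.mk0 ((2 : ℝ) ^ k)⁻¹ (by positivity))

/-- The dilated symbol `m(2^{-k} ξ)`. -/
def dil (k : ℕ) (m : 𝓢(Rd d, ℂ)) : 𝓢(Rd d, ℂ) := compCLMOfContinuousLinearEquiv ℂ (dilEquiv k) m

@[simp] lemma dil_apply (k : ℕ) (m : 𝓢(Rd d, ℂ)) (ξ : Rd d) : dil k m ξ = m (((2 : ℝ) ^ k)⁻¹ • ξ) :=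
  rfl

/-- The rescaled kernel `2^{kd} g(2^k z)`. -/
def ks (k : ℕ) (g : Rd d → ℂ) (z : Rd d) : ℂ := 2 ^ (k * d) * g ((2 : ℝ) ^ k • z)

lemma fourier_dil (k : ℕ) (m : 𝓢(Rd d, ℂ)) : (𝓕 (dil k m) : 𝓢(Rd d, ℂ)) = ks k (𝓕 m : 𝓢(Rd d, ℂ)) := by
  ext z
  rw [ks, fourier_coe, fourier_coe, Real.fourier_eq', Real.fourier_eq']
  have h := Measure.integral_comp_inv_smul (μ := (volume : Measure (Rd d)))
    (fun η : Rd d ↦ Complex.exp (↑(-2 * Real.pi * inner ℝ η ((2 : ℝ) ^ k • z)) * Complex.I) • m η)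
    ((2 : ℝ) ^ k)
  have h2 : |((2 : ℝ) ^ k) ^ Module.finrank ℝ (Rd d)| = 2 ^ (k * d) := by
    rw [finrank_euclideanSpace_fin, abs_of_nonneg (by positivity), pow_mul]
  rw [h2] at h
  rw [show (2 : ℂ) ^ (k * d) = ((2 ^ (k * d) : ℝ) : ℂ) by push_cast; rfl, ← Complex.real_smul, ← h]
  congr 1 with ξ
  rw [dil_apply, inner_smul_left, inner_smul_right]
  congr 4
  simp

lemma exists_decay (g : 𝓢(Rd d, ℂ)) (M : ℕ) : ∃ C : ℝ, 0 ≤ C ∧ ∀ z, ‖g z‖ ≤ C / (1 + ‖z‖) ^ M := by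
  refine ⟨2 ^ M * ((Finset.Iic (M, 0)).sup fun m ↦ SchwartzMap.seminorm ℂ m.1 m.2) g,
    by positivity, fun z ↦ ?_⟩
  rw [le_div_iff₀ (by positivity), mul_comm]
  simpa using SchwartzMap.one_add_le_sup_seminorm_apply (𝕜 := ℂ) (m := (M, 0))
      (k := M) (n := 0) le_rfl le_rfl g z

lemma exists_ks_le (g : 𝓢(Rd d, ℂ)) (M : ℕ) : ∃ C : ℝ, 0 ≤ C ∧ ∀ k z, ‖ks k g z‖ ≤ C * jap M k z := by
  obtain ⟨C, hC, h⟩ := exists_decay g M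
  refine ⟨C, hC, fun k z ↦ ?_⟩
  rw [ks, norm_mul, norm_pow, Complex.norm_two, jap]
  have := h ((2 : ℝ) ^ k • z)
  rw [norm_smul, norm_pow, Real.norm_two] at this
  calc _ ≤ (2 : ℝ) ^ (k * d) * (C / (1 + 2 ^ k * ‖z‖) ^ M) := by gcongr
    _ = _ := by ring

lemma enorm_cv_le {K f : Rd d → ℂ} {C : ℝ} {M k : ℕ}
    (h : ∀ z, ‖K z‖ ≤ C * jap M k z) (x : Rd d) :
    ‖cv K f x‖ₑ ≤ ENNReal.ofReal C * J M k (fun y ↦ ‖f y‖ₑ) x := by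
  rw [cv, J, ← lintegral_const_mul' _ _ ENNReal.ofReal_ne_top]
  refine (enorm_integral_le_lintegral_enorm _).trans (lintegral_mono fun y ↦ ?_)
  simp only [enorm_mul, ← mul_assoc]
  have hC : 0 ≤ C := by
    have := (norm_nonneg _).trans (h 0)
    exact nonneg_of_mul_nonneg_left this (jap_pos M k 0)
  gcongr
  rw [← ENNReal.ofReal_mul hC, ← ofReal_norm]
  exact ENNReal.ofReal_le_ofReal (h _)

namespace LPCutoff
variable (P : LPCutoff d)

/-- The symbol `P_0(2πξ)`. -/
def base : 𝓢(Rd d, ℂ) :=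
  HasCompactSupport.toSchwartzMap (f := fun ξ ↦ P.toFun ((2 * Real.pi) • ξ))
    (by
      refine HasCompactSupport.of_support_subset_isCompact (isCompact_closedBall (0 : Rd d) 1) ?_
      intro ξ hξ
      rw [Function.mem_support] at hξ
      rw [mem_closedBall_zero_iff]
      by_contra! h
      refine hξ (P.eq_zero _ ?_)
      rw [norm_smul, Real.norm_of_nonneg (by positivity)]
      nlinarith [Real.pi_gt_three])
    (P.smooth.comp (contDiff_const_smul _))

lemma base_apply (ξ : Rd d) : P.base ξ = P.toFun ((2 * Real.pi) • ξ) := rfl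

/-- The symbol of the low frequency cutoff. -/
def low (k : ℕ) : 𝓢(Rd d, ℂ) := dil k P.base

/-- The symbol of the dyadic block. -/
def blk : ℕ → 𝓢(Rd d, ℂ)
  | 0 => P.low 0
  | k + 1 => P.low (k + 1) - P.low k

lemma low_eq_zero {k : ℕ} {ξ : Rd d} (h : 2 ^ k / Real.pi < ‖ξ‖) : P.low k ξ = 0 := by
  rw [low, dil_apply, base_apply]
  apply P.eq_zero
  rw [norm_smul, norm_smul, norm_inv, norm_pow, Real.norm_two,
    Real.norm_of_nonneg (by positivity)]
  rw [div_lt_iff₀ Real.pi_pos] at h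
  rw [show 2 * Real.pi * (((2 : ℝ) ^ k)⁻¹ * ‖ξ‖) = 2 * ((‖ξ‖ * Real.pi) / 2 ^ k) by ring]
  have : 1 < (‖ξ‖ * Real.pi) / 2 ^ k := by rwa [one_lt_div (by positivity)]
  linarith

lemma low_eq_one {k : ℕ} {ξ : Rd d} (h : ‖ξ‖ < 2 ^ k / (2 * Real.pi)) : P.low k ξ = 1 := by
  rw [low, dil_apply, base_apply]
  apply P.eq_one
  rw [norm_smul, norm_smul, norm_inv, norm_pow, Real.norm_two,
    Real.norm_of_nonneg (by positivity)]
  rw [lt_div_iff₀ (by positivity)] at h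
  rw [show 2 * Real.pi * (((2 : ℝ) ^ k)⁻¹ * ‖ξ‖) = (‖ξ‖ * (2 * Real.pi)) / 2 ^ k by ring]
  rwa [div_lt_one (by positivity)]

lemma blk_eq_zero_of_lt {k : ℕ} {ξ : Rd d} (h : ‖ξ‖ < 2 ^ k / (2 * Real.pi)) :
    P.blk (k + 1) ξ = 0 := by
  have h1 := P.low_eq_one h
  have h2 : P.low (k + 1) ξ = 1 := P.low_eq_one (h.trans (by gcongr <;> simp))
  rw [blk, sub_apply, h1, h2, sub_self]

lemma blk_eq_zero_of_gt {k : ℕ} {ξ : Rd d} (h : 2 ^ k / Real.pi < ‖ξ‖) : P.blk k ξ = 0 := by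
  cases k with
  | zero => exact P.low_eq_zero h
  | succ k =>
    have h1 := P.low_eq_zero h
    have h2 : P.low k ξ = 0 := P.low_eq_zero (lt_of_le_of_lt (by gcongr <;> simp) h)
    rw [blk, sub_apply, h1, h2, sub_self]

lemma symbol_eq (k : ℕ) (ξ : Rd d) : P.symbol k ((2 * Real.pi) • ξ) = P.blk k ξ := by
  cases k with
  | zero => simp [symbol, blk, low, base_apply]
  | succ k => simp [symbol, blk, low, base_apply, smul_comm (2 * Real.pi)]

lemma block_eq (k : ℕ) : block P k = Op (P.blk k) := by
  rw [block, Op]; congr 1 with ξ; exact P.symbol_eq k ξ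

lemma sum_block (n : ℕ) (T : 𝓢'(Rd d, ℂ)) :
    ∑ l ∈ Finset.range (n + 1), block P l T = Op (P.low n) T := by
  induction n with
  | zero => simp [block_eq, blk]
  | succ n ih =>
    rw [Finset.sum_range_succ, ih, block_eq, ← Op_add, blk]
    congr 2; abel

lemma lowFreq_eq (N k : ℕ) (T : 𝓢'(Rd d, ℂ)) : lowFreq P N k T = Op (P.low (k + N)) T :=
  P.sum_block _ T

/-- The kernel of the dyadic block. -/
def ker (k : ℕ) : 𝓢(Rd d, ℂ) := 𝓕 (P.blk k)

/-- The kernel of the low frequency cutoff. -/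
def lowKer (k : ℕ) : 𝓢(Rd d, ℂ) := 𝓕 (P.low k)

lemma lowKer_eq (k : ℕ) : (P.lowKer k : Rd d → ℂ) = ks k (𝓕 P.base : 𝓢(Rd d, ℂ)) := fourier_dil k _

lemma exists_lowKer_le (M : ℕ) : ∃ C : ℝ, 0 ≤ C ∧ ∀ k z, ‖P.lowKer k z‖ ≤ C * jap M k z := by
  simp_rw [lowKer_eq]; exact exists_ks_le _ M

lemma ker_succ (k : ℕ) : P.ker (k + 1) = P.lowKer (k + 1) - P.lowKer k := by
  simp only [ker, lowKer, blk, sub_eq_add_neg, FourierTransform.fourier_add,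
    FourierTransform.fourier_neg]

lemma jap_le_succ (M k : ℕ) (z : Rd d) : jap M k z ≤ 2 ^ M * jap M (k + 1) z := by
  unfold jap
  rw [mul_div_assoc', div_le_div_iff₀ (by positivity) (by positivity)]
  have h1 : (1 + 2 ^ (k + 1) * ‖z‖) ^ M ≤ 2 ^ M * (1 + 2 ^ k * ‖z‖) ^ M := by
    rw [← mul_pow]; gcongr; rw [pow_succ]; linarith
  have h2 : (2 : ℝ) ^ (k * d) ≤ 2 ^ ((k + 1) * d) := by gcongr <;> simp
  calc (2 : ℝ) ^ (k * d) * (1 + 2 ^ (k + 1) * ‖z‖) ^ M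
      ≤ 2 ^ ((k + 1) * d) * (2 ^ M * (1 + 2 ^ k * ‖z‖) ^ M) := by gcongr
    _ = _ := by ring

lemma exists_ker_le (M : ℕ) : ∃ C : ℝ, 0 ≤ C ∧ ∀ k z, ‖P.ker k z‖ ≤ C * jap M k z := by
  obtain ⟨C, hC, h⟩ := P.exists_lowKer_le M
  refine ⟨C + C * 2 ^ M, by positivity, fun k z ↦ ?_⟩
  cases k with
  | zero =>
    refine (h 0 z).trans ?_
    have := jap_nonneg M 0 z
    gcongr
    have : 0 ≤ C * 2 ^ M := by positivity
    linarith
  | succ k =>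
    rw [ker_succ, sub_apply, add_mul]
    refine (norm_sub_le _ _).trans (add_le_add (h _ _) ((h _ _).trans ?_))
    rw [mul_assoc]
    gcongr
    exact jap_le_succ M k z

end LPCutoff

variable (d) in
/-- A bump function which is one on the support of `P.low 0`. -/
def fatBump (δ : ℝ) (hδ : 0 < δ) : ContDiffBump (0 : Rd d) :=
  ⟨1 / Real.pi, 1 / Real.pi + δ, by positivity, by linarith⟩

/-- A cutoff which is one on the support of `P.low 0`. -/
def fat (δ : ℝ) (hδ : 0 < δ) : 𝓢(Rd d, ℂ) :=
  HasCompactSupport.toSchwartzMap (f := fun ξ ↦ (fatBump d δ hδ ξ : ℂ))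
    ((fatBump d δ hδ).hasCompactSupport.comp_left (g := fun t : ℝ ↦ (t : ℂ)) Complex.ofReal_zero)
    (Complex.ofRealCLM.contDiff.comp (fatBump d δ hδ).contDiff)

lemma fat_apply {δ : ℝ} (hδ : 0 < δ) (ξ : Rd d) : fat δ hδ ξ = (fatBump d δ hδ ξ : ℂ) := rfl

lemma fat_eq_one {δ : ℝ} (hδ : 0 < δ) {ξ : Rd d} (h : ‖ξ‖ ≤ 1 / Real.pi) : fat δ hδ ξ = 1 := by
  rw [fat_apply, ContDiffBump.one_of_mem_closedBall _ (by simpa [fatBump] using h)]; simp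

lemma fat_eq_zero {δ : ℝ} (hδ : 0 < δ) {ξ : Rd d} (h : 1 / Real.pi + δ ≤ ‖ξ‖) : fat δ hδ ξ = 0 := by
  rw [fat_apply, ContDiffBump.zero_of_le_dist _ (by simpa [fatBump] using h)]; simp

lemma dil_fat_eq_one {δ : ℝ} (hδ : 0 < δ) {k : ℕ} {ξ : Rd d} (h : ‖ξ‖ ≤ 2 ^ k / Real.pi) :
    dil k (fat δ hδ) ξ = 1 := by
  rw [dil_apply]
  apply fat_eq_one hδ
  rw [norm_smul, norm_inv, norm_pow, Real.norm_two, inv_mul_le_iff₀ (by positivity)]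
  rwa [mul_one_div]

lemma dil_fat_eq_zero {δ : ℝ} (hδ : 0 < δ) {k : ℕ} {ξ : Rd d} (h : 2 ^ k * (1 / Real.pi + δ) ≤ ‖ξ‖) :
    dil k (fat δ hδ) ξ = 0 := by
  rw [dil_apply]
  apply fat_eq_zero hδ
  rw [norm_smul, norm_inv, norm_pow, Real.norm_two, le_inv_mul_iff₀ (by positivity)]
  exact h

lemma LPCutoff.low_mul_fat (P : LPCutoff d) {δ : ℝ} (hδ : 0 < δ) (k : ℕ) (ξ : Rd d) :
    P.low k ξ * dil k (fat δ hδ) ξ = P.low k ξ := by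
  rcases le_or_gt ‖ξ‖ (2 ^ k / Real.pi) with h | h
  · rw [dil_fat_eq_one hδ h, mul_one]
  · rw [P.low_eq_zero h, zero_mul]

lemma LPCutoff.blk_mul_fat (P : LPCutoff d) {δ : ℝ} (hδ : 0 < δ) (k : ℕ) (ξ : Rd d) :
    P.blk k ξ * dil k (fat δ hδ) ξ = P.blk k ξ := by
  rcases le_or_gt ‖ξ‖ (2 ^ k / Real.pi) with h | h
  · rw [dil_fat_eq_one hδ h, mul_one]
  · rw [P.blk_eq_zero_of_gt h, zero_mul]

/-- The function `h` is continuous and reproduced by the kernel of the fat cutoff at level `k`. -/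
structure Band (k : ℕ) (h : Rd d → ℂ) : Prop where
  pg : PG h
  eq : ∀ (δ : ℝ) (hδ : 0 < δ) (x : Rd d),
    Integrable (fun y ↦ ks k (𝓕 (fat δ hδ) : 𝓢(Rd d, ℂ)) (y - x) * h y) ∧
      h x = ∫ y, ks k (𝓕 (fat δ hδ) : 𝓢(Rd d, ℂ)) (y - x) * h y

lemma Band.of_mul {m : 𝓢(Rd d, ℂ)} {k : ℕ}
    (hm : ∀ (δ : ℝ) (hδ : 0 < δ) ξ, m ξ * dil k (fat δ hδ) ξ = m ξ) (T : 𝓢'(Rd d, ℂ)) :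
    Band k (ev (𝓕 m) T) := by
  refine ⟨PG_ev _ _, fun δ hδ x ↦ ?_⟩
  rw [← fourier_dil]
  exact ⟨(isFun_Op m T).integrable_tr _ x, (congrFun (cv_ev_eq (hm δ hδ) T) x).symm⟩

lemma LPCutoff.band_ker (P : LPCutoff d) (k : ℕ) (T : 𝓢'(Rd d, ℂ)) : Band k (ev (P.ker k) T) :=
  .of_mul (fun _ hδ ξ ↦ P.blk_mul_fat hδ k ξ) T

lemma LPCutoff.band_lowKer (P : LPCutoff d) (k : ℕ) (T : 𝓢'(Rd d, ℂ)) :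
    Band k (ev (P.lowKer k) T) :=
  .of_mul (fun _ hδ ξ ↦ P.low_mul_fat hδ k ξ) T

lemma Band.exists_enorm_le (M : ℕ) : ∃ C : ℝ≥0, ∀ (k : ℕ) (h : Rd d → ℂ), Band k h → ∀ x,
    ‖h x‖ₑ ≤ C * J M k (fun y ↦ ‖h y‖ₑ) x := by
  obtain ⟨C, hC, hb⟩ := exists_ks_le (𝓕 (fat (d := d) 1 one_pos) : 𝓢(Rd d, ℂ)) M
  refine ⟨C.toNNReal, fun k h hh x ↦ ?_⟩
  rw [(hh.eq 1 one_pos x).2]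
  exact enorm_cv_le (hb k) x

/-! ### Taylor expansion of Schwartz functions -/

/-- The unit vectors. -/
def e (i : Fin d) : Rd d := EuclideanSpace.single i 1

/-- Iterated partial derivatives. -/
def pd {n : ℕ} (I : Fin n → Fin d) (g : 𝓢(Rd d, ℂ)) : 𝓢(Rd d, ℂ) := ∂^{fun j ↦ e (I j)} g

/-- Monomials. -/
def mono {n : ℕ} (I : Fin n → Fin d) (x : Rd d) : ℝ := ∏ j, x (I j)

lemma sum_coord (x : Rd d) : x = ∑ i, x i • e i := by
  have := (EuclideanSpace.basisFun (Fin d) ℝ).sum_repr x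
  simpa [e] using this.symm

lemma iteratedFDeriv_eq_sum (n : ℕ) (g : 𝓢(Rd d, ℂ)) (w x : Rd d) :
    iteratedFDeriv ℝ n g w (fun _ ↦ x) = ∑ I : Fin n → Fin d, (mono I x : ℂ) * pd I g w := by
  conv_lhs => rw [show (fun _ : Fin n ↦ x) = fun _ ↦ ∑ i, x i • e i from funext fun _ ↦ sum_coord x]
  rw [ContinuousMultilinearMap.map_sum]
  congr 1 with I
  rw [ContinuousMultilinearMap.map_smul_univ, pd, iteratedLineDerivOp_eq_iteratedFDeriv,
    Complex.real_smul, mono]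

/-- The Taylor polynomial of `g` of order `< N` at `w`. -/
def taylor (N : ℕ) (g : 𝓢(Rd d, ℂ)) (w x : Rd d) : ℂ :=
  ∑ n ∈ Finset.range N, ((n.factorial : ℝ)⁻¹ : ℂ) * ∑ I : Fin n → Fin d, (mono I x : ℂ) * pd I g w

/-- The remainder of Taylor's formula for Schwartz functions. -/
lemma norm_sub_taylor_le (g : 𝓢(Rd d, ℂ)) (N M : ℕ) (w x : Rd d) :
    ‖g (w + x) - taylor (N + 1) g w x‖ ≤
      2 ^ M * ((Finset.Iic (M, N + 1)).sup (schwartzSeminormFamily ℂ (Rd d) ℂ)) g *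
        ‖x‖ ^ (N + 1) * (1 + ‖x‖) ^ M / (1 + ‖w‖) ^ M := by
  set C := (2 : ℝ) ^ M * ((Finset.Iic (M, N + 1)).sup (schwartzSeminormFamily ℂ (Rd d) ℂ)) g
  have hC : 0 ≤ C := by positivity
  have h1 := map_add_eq_sum_add_integral_iteratedFDeriv (f := g) (x := w) (y := x) (n := N)
    fun t _ ↦ (g.smooth (N + 1)).contDiffAt
  have h2 : ∑ k ∈ Finset.range (N + 1), (k.factorial : ℝ)⁻¹ • (iteratedFDeriv ℝ k g w (fun _ ↦ x)) =
      taylor (N + 1) g w x := by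
    refine Finset.sum_congr rfl fun n _ ↦ ?_
    rw [iteratedFDeriv_eq_sum, Complex.real_smul]; push_cast; rfl
  rw [h1, h2, add_sub_cancel_left, norm_smul]
  have h3 : ∀ t ∈ Set.uIoc (0 : ℝ) 1,
      ‖(1 - t) ^ N • iteratedFDeriv ℝ (N + 1) g (w + t • x) (fun _ ↦ x)‖ ≤
        C * ‖x‖ ^ (N + 1) * (1 + ‖x‖) ^ M / (1 + ‖w‖) ^ M := by
    intro t ht
    rw [Set.uIoc_of_le zero_le_one] at ht
    rw [norm_smul, norm_pow, Real.norm_of_nonneg (by linarith [ht.2])]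
    have h4 := SchwartzMap.one_add_le_sup_seminorm_apply (𝕜 := ℂ) (m := (M, N + 1))
      (k := M) (n := N + 1) le_rfl le_rfl g (w + t • x)
    have h5 := ContinuousMultilinearMap.le_opNorm (iteratedFDeriv ℝ (N + 1) g (w + t • x)) (fun _ ↦ x)
    rw [Finset.prod_const, Finset.card_univ, Fintype.card_fin] at h5
    -- Transfers the decay of the derivative from the intermediate point w + t x back to w, at the
    -- price of a power of 1 + ‖x‖.
    have h6 : 1 + ‖w‖ ≤ (1 + ‖w + t • x‖) * (1 + ‖x‖) := by
      have : ‖w‖ ≤ ‖w + t • x‖ + ‖t • x‖ := by simpa using norm_sub_le (w + t • x) (t • x)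
      have h7 : ‖t • x‖ ≤ ‖x‖ := by
        rw [norm_smul, Real.norm_of_nonneg ht.1.le]
        exact mul_le_of_le_one_left (norm_nonneg _) ht.2
      nlinarith [norm_nonneg (w + t • x), norm_nonneg x]
    have h8 : (1 - t) ^ N ≤ 1 := pow_le_one₀ (by linarith [ht.2]) (by linarith [ht.1])
    rw [le_div_iff₀ (by positivity)]
    set Dn := ‖iteratedFDeriv ℝ (N + 1) g (w + t • x)‖
    calc (1 - t) ^ N * ‖iteratedFDeriv ℝ (N + 1) g (w + t • x) (fun _ ↦ x)‖ * (1 + ‖w‖) ^ M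
        ≤ 1 * (Dn * ‖x‖ ^ (N + 1)) * ((1 + ‖w + t • x‖) * (1 + ‖x‖)) ^ M := by gcongr
      _ = ((1 + ‖w + t • x‖) ^ M * Dn) * ‖x‖ ^ (N + 1) * (1 + ‖x‖) ^ M := by rw [mul_pow]; ring
      _ ≤ C * ‖x‖ ^ (N + 1) * (1 + ‖x‖) ^ M := by gcongr; exact h4
  have h4 := intervalIntegral.norm_integral_le_of_norm_le_const h3
  have h5 : ‖((N.factorial : ℝ)⁻¹)‖ ≤ 1 := by
    rw [norm_inv, Real.norm_natCast]
    exact inv_le_one_of_one_le₀ (by exact_mod_cast Nat.one_le_iff_ne_zero.2 N.factorial_ne_zero)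
  simp only [sub_zero, abs_one, mul_one] at h4
  exact (mul_le_mul h5 h4 (norm_nonneg _) zero_le_one).trans_eq (one_mul _)

lemma exists_taylor_le (g : 𝓢(Rd d, ℂ)) (N M : ℕ) : ∃ C : ℝ, 0 ≤ C ∧ ∀ w x : Rd d,
    ‖g (w + x) - taylor (N + 1) g w x‖ ≤ C * ‖x‖ ^ (N + 1) * (1 + ‖x‖) ^ M / (1 + ‖w‖) ^ M :=
  ⟨_, by positivity, norm_sub_taylor_le g N M⟩

/-! ### Vanishing moments -/

/-- Polynomial functions. -/
inductive IsPoly : (Rd d → ℝ) → Prop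
  | const (c : ℝ) : IsPoly fun _ ↦ c
  | coord (i : Fin d) : IsPoly fun x ↦ x i
  | add {p q : Rd d → ℝ} : IsPoly p → IsPoly q → IsPoly fun x ↦ p x + q x
  | mul {p q : Rd d → ℝ} : IsPoly p → IsPoly q → IsPoly fun x ↦ p x * q x

lemma IsPoly.sum {ι : Type*} (s : Finset ι) {p : ι → Rd d → ℝ} (h : ∀ i, IsPoly (p i)) :
    IsPoly fun x ↦ ∑ i ∈ s, p i x := by
  classical
  induction s using Finset.induction_on with
  | empty => simpa using IsPoly.const 0
  | insert i s hi ih => simpa only [Finset.sum_insert hi] using (h i).add ih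

lemma IsPoly.prod {ι : Type*} (s : Finset ι) {p : ι → Rd d → ℝ} (h : ∀ i, IsPoly (p i)) :
    IsPoly fun x ↦ ∏ i ∈ s, p i x := by
  classical
  induction s using Finset.induction_on with
  | empty => simpa using IsPoly.const 1
  | insert i s hi ih => simpa only [Finset.prod_insert hi] using (h i).mul ih

lemma IsPoly.comp {p : Rd d → ℝ} (hp : IsPoly p) {Q : Rd d → Rd d}
    (hQ : ∀ i, IsPoly fun x ↦ Q x i) : IsPoly fun x ↦ p (Q x) := by
  induction hp with
  | const c => exact .const c
  | coord i => exact hQ i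
  | add _ _ h1 h2 => exact h1.add h2
  | mul _ _ h1 h2 => exact h1.mul h2

lemma IsPoly.continuous {p : Rd d → ℝ} (hp : IsPoly p) : Continuous p := by
  induction hp with
  | const c => fun_prop
  | coord i => fun_prop
  | add _ _ h1 h2 => exact h1.add h2
  | mul _ _ h1 h2 => exact h1.mul h2

/-- Multiplication by a coordinate differentiates the inverse Fourier transform, which stays zero on
an open ball where it vanished. Polynomial factors therefore do not destroy the spectral gap of a
kernel; this is how vanishing moments are expressed. -/
lemma IsPoly.exists_mul {p : Rd d → ℝ} (hp : IsPoly p) {r : ℝ} (K : 𝓢(Rd d, ℂ))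
    (hK : ∀ ξ, ‖ξ‖ < r → (𝓕⁻ K : 𝓢(Rd d, ℂ)) ξ = 0) : ∃ K' : 𝓢(Rd d, ℂ),
      (∀ z, K' z = p z * K z) ∧ ∀ ξ, ‖ξ‖ < r → (𝓕⁻ K' : 𝓢(Rd d, ℂ)) ξ = 0 := by
  induction hp generalizing K with
  | const c =>
    refine ⟨(c : ℂ) • K, fun z ↦ by simp, fun ξ hξ ↦ ?_⟩
    rw [FourierTransform.fourierInv_smul, smul_apply, hK ξ hξ, smul_zero]
  | coord i =>
    have hg : (inner ℝ · (e i) : Rd d → ℝ).HasTemperateGrowth := by fun_prop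
    refine ⟨smulLeftCLM ℂ (inner ℝ · (e i)) K, fun z ↦ ?_, fun ξ hξ ↦ ?_⟩
    · rw [smulLeftCLM_apply_apply hg]
      simp [e, EuclideanSpace.inner_single_right]
    · have h1 := lineDerivOp_fourierInv_eq K (e i)
      have h2 : (∂_{e i} (𝓕⁻ K : 𝓢(Rd d, ℂ)) : 𝓢(Rd d, ℂ)) ξ = 0 := by
        rw [lineDerivOp_apply_eq_fderiv]
        have : (𝓕⁻ K : 𝓢(Rd d, ℂ)) =ᶠ[𝓝 ξ] fun _ ↦ (0 : ℂ) := by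
          filter_upwards [(isOpen_lt continuous_norm continuous_const).mem_nhds hξ] with y hy
          exact hK y hy
        rw [this.fderiv_eq]; simp
      rw [h1, FourierTransform.fourierInv_smul, smul_apply, smul_eq_mul] at h2
      refine (mul_eq_zero.1 h2).resolve_left ?_
      simp [Real.pi_ne_zero]
  | add _ _ h1 h2 =>
    obtain ⟨K₁, h11, h12⟩ := h1 K hK
    obtain ⟨K₂, h21, h22⟩ := h2 K hK
    refine ⟨K₁ + K₂, fun z ↦ by rw [add_apply, h11, h21]; push_cast; ring, fun ξ hξ ↦ ?_⟩
    rw [FourierTransform.fourierInv_add, add_apply, h12 ξ hξ, h22 ξ hξ, add_zero]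
  | mul _ _ h1 h2 =>
    obtain ⟨K₁, h11, h12⟩ := h1 K hK
    obtain ⟨K₂, h21, h22⟩ := h2 K₁ h12
    exact ⟨K₂, fun z ↦ by rw [h21, h11]; push_cast; ring, h22⟩

/-- Differentiating the kernel multiplies its symbol by a monomial, so zeros of the symbol persist.
-/
lemma exists_pd_fourier {n : ℕ} (I : Fin n → Fin d) (γ : 𝓢(Rd d, ℂ)) : ∃ γ' : 𝓢(Rd d, ℂ),
    pd I (𝓕 γ) = 𝓕 γ' ∧ ∀ ξ, γ ξ = 0 → γ' ξ = 0 := by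
  induction n generalizing γ with
  | zero => exact ⟨γ, by simp [pd], fun _ h ↦ h⟩
  | succ n ih =>
    have hg : (inner ℝ · (e (I (Fin.last n))) : Rd d → ℝ).HasTemperateGrowth := by fun_prop
    obtain ⟨γ', h1, h2⟩ := ih (Fin.init I)
      (-(2 * Real.pi * Complex.I) • smulLeftCLM ℂ (inner ℝ · (e (I (Fin.last n)))) γ)
    refine ⟨γ', ?_, fun ξ hξ ↦ h2 ξ ?_⟩
    · rw [← h1, pd, iteratedLineDerivOp_succ_right, lineDerivOp_fourier_eq]; rfl
    · rw [smul_apply, smulLeftCLM_apply_apply hg, hξ, smul_zero, smul_zero]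

/-- If the spectrum of `K` avoids the ball of radius `r` and the spectrum of `g` is in the ball of
radius `r'`, then `K` is orthogonal to `p(z) g(y - A z)` for all polynomials `p`, provided that
`‖A‖ r' < r`. -/
lemma integral_ker_mul_poly_eq_zero {m γ : 𝓢(Rd d, ℂ)} {A : Rd d →L[ℝ] Rd d} {r r' : ℝ}
    (hm : ∀ ξ, ‖ξ‖ < r → m ξ = 0) (hγ : ∀ ξ, r' < ‖ξ‖ → γ ξ = 0) (hr : ‖A‖ * r' < r)
    {p : Rd d → ℝ} (hp : IsPoly p) {n : ℕ} (I : Fin n → Fin d) (y : Rd d) :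
    ∫ z, (𝓕 m : 𝓢(Rd d, ℂ)) z * (p z * pd I (𝓕 γ) (y - A z)) = 0 := by
  obtain ⟨γ', h1, h2⟩ := exists_pd_fourier I γ
  obtain ⟨K, h3, h4⟩ := hp.exists_mul (𝓕 m : 𝓢(Rd d, ℂ)) (r := r) (by
    rw [FourierTransform.fourierInv_fourier_eq]; exact hm)
  rw [h1]
  have e1 : ∀ z, (𝓕 m : 𝓢(Rd d, ℂ)) z * (p z * (𝓕 γ' : 𝓢(Rd d, ℂ)) (y - A z)) =
      ∫ ξ, K z * (Complex.exp (↑(-2 * Real.pi * inner ℝ ξ (y - A z)) * Complex.I) * γ' ξ) := by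
    intro z
    rw [integral_const_mul, h3, fourier_coe γ', Real.fourier_eq']
    simp only [smul_eq_mul]; ring
  simp_rw [e1]
  rw [integral_integral_swap]
  · apply integral_eq_zero_of_ae
    refine .of_forall fun ξ ↦ ?_
    simp only [Pi.zero_apply]
    rcases le_or_gt ‖ξ‖ r' with h | h
    · have h5 : ‖A.adjoint ξ‖ < r := by
        refine lt_of_le_of_lt (A.adjoint.le_opNorm ξ) (lt_of_le_of_lt ?_ hr)
        rw [LinearIsometryEquiv.norm_map]; gcongr
      have h6 := h4 _ h5
      rw [fourierInv_coe, Real.fourierInv_eq'] at h6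
      rw [← mul_zero (Complex.exp (↑(-2 * Real.pi * inner ℝ ξ y) * Complex.I) * γ' ξ), ← h6,
        ← integral_const_mul]
      congr 1 with z
      rw [inner_sub_right, show (-2 * Real.pi * (inner ℝ ξ y - inner ℝ ξ (A z))) =
        -2 * Real.pi * inner ℝ ξ y + 2 * Real.pi * inner ℝ z (A.adjoint ξ) by
          rw [A.adjoint_inner_right, real_inner_comm (A z)]; ring]
      rw [Complex.ofReal_add, add_mul, Complex.exp_add, smul_eq_mul]; ring
    · rw [h2 ξ (hγ ξ h)]; simp
  · have h5 : Integrable (fun q : Rd d × Rd d ↦ K q.1 * γ' q.2) (volume.prod volume) :=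
      K.integrable.mul_prod γ'.integrable
    have h6 : Continuous fun q : Rd d × Rd d ↦
        Complex.exp (↑(-2 * Real.pi * inner ℝ q.2 (y - A q.1)) * Complex.I) := by fun_prop
    have := h5.bdd_mul (c := 1) h6.aestronglyMeasurable
      (.of_forall fun q ↦ by rw [Complex.norm_exp_ofReal_mul_I])
    refine this.congr (.of_forall fun q ↦ ?_)
    simp only [Function.uncurry]; ring

/-! ### Approximation of maps by polynomials and the main cancellation estimate -/

/-- Polynomial approximation of order `1 + ρ` of the map `χ` with derivative `A`, at all dyadic
scales. -/
def App (ρ : ℝ) (χ : Rd d → Rd d) (A : Rd d → Rd d →L[ℝ] Rd d) : Prop :=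
  ∃ (ε C : ℝ) (L : ℕ), 0 < ε ∧ 0 ≤ C ∧ ∀ (l : ℕ) (x : Rd d), ∃ Q : Rd d → Rd d,
    (∀ i, IsPoly fun z ↦ Q z i) ∧
    (∀ z, ‖Q z‖ ≤ C * (2 : ℝ) ^ (-(l : ℝ) * (1 + ε)) * (1 + 2 ^ l * ‖z‖) ^ L) ∧
    ∀ z, ‖χ (x + z) - χ x - A x z - Q z‖ ≤
      C * (2 : ℝ) ^ (-(l : ℝ) * (1 + ρ)) * (1 + 2 ^ l * ‖z‖) ^ L

lemma taylor_one (g : 𝓢(Rd d, ℂ)) (w x : Rd d) : taylor 1 g w x = g w := by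
  simp [taylor, mono, pd]

lemma continuous_mono {n : ℕ} (I : Fin n → Fin d) : Continuous (mono I) := by
  unfold mono; fun_prop

lemma continuous_taylor {X : Type*} [TopologicalSpace X] (N : ℕ) (g : 𝓢(Rd d, ℂ))
    {u v : X → Rd d} (hu : Continuous u) (hv : Continuous v) :
    Continuous fun p ↦ taylor N g (u p) (v p) := by
  unfold taylor
  refine continuous_finsetSum _ fun n _ ↦ continuous_const.mul
    (continuous_finsetSum _ fun I _ ↦ ?_)
  exact (Complex.continuous_ofReal.comp ((continuous_mono I).comp hv)).mul
    ((pd I g).continuous.comp hu)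

lemma one_add_norm_add_le (v e : Rd d) : 1 + ‖v + e‖ ≤ (1 + ‖v‖) * (1 + ‖e‖) := by
  nlinarith [norm_add_le v e, norm_nonneg v, norm_nonneg e]

/-- Here q stands for the rescaled polynomial part of the map and e for its rescaled error. Removing
e costs a first-order Taylor remainder, already of the required size. Expanding in q to order N with
Nε ≥ ρ leaves N + 1 factors of size 2^{k-l-lε}, whose product is at most 2^{k-l-lρ} since k ≤ l. The
decay is kept at the true argument w + q + e, which is y - χ(x+z) after scaling, so that an average
centred at χ(x+z) results. -/
lemma exists_perturbed_taylor_le (g : 𝓢(Rd d, ℂ)) {ρ ε C₀ : ℝ} (hρ : 0 ≤ ρ) (hε : 0 < ε)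
    (hC₀ : 0 ≤ C₀) (L M : ℕ) : ∃ (N L' : ℕ) (C : ℝ), 0 ≤ C ∧ ∀ (k l : ℕ), k ≤ l →
      ∀ (w q e : Rd d) (s : ℝ), 1 ≤ s → ‖q‖ ≤ C₀ * (2 : ℝ) ^ ((k : ℝ) - l - l * ε) * s ^ L →
      ‖e‖ ≤ C₀ * (2 : ℝ) ^ ((k : ℝ) - l - l * ρ) * s ^ L →
      ‖g (w + q + e) - taylor (N + 1) g w q‖ ≤
        C * (2 : ℝ) ^ ((k : ℝ) - l - l * ρ) * s ^ L' / (1 + ‖w + q + e‖) ^ M := by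
  obtain ⟨N, hN⟩ := exists_nat_ge (ρ / ε)
  rw [div_le_iff₀ hε] at hN
  obtain ⟨C₁, hC₁, h₁⟩ := exists_taylor_le g 0 M
  obtain ⟨C₂, hC₂, h₂⟩ := exists_taylor_le g N M
  refine ⟨N, L * (N + 1 + 3 * M), C₁ * C₀ * (1 + C₀) ^ M +
    C₂ * C₀ ^ (N + 1) * (1 + C₀) ^ (3 * M), by positivity, ?_⟩
  intro k l hkl w q e s hs hq he
  have hkl' : (k : ℝ) ≤ l := by exact_mod_cast hkl
  set v := w + q + e with hv
  set β := (2 : ℝ) ^ ((k : ℝ) - l - l * ρ) with hβ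
  have hβ0 : 0 < β := by positivity
  have hl : (0 : ℝ) ≤ l := by positivity
  have hβ1 : β ≤ 1 := Real.rpow_le_one_of_one_le_of_nonpos (by norm_num) (by nlinarith)
  have hα1 : (2 : ℝ) ^ ((k : ℝ) - l - l * ε) ≤ 1 :=
    Real.rpow_le_one_of_one_le_of_nonpos (by norm_num) (by nlinarith)
  have hsL : 1 ≤ s ^ L := one_le_pow₀ hs
  have hs0 : 0 < s := by linarith
  have he1 : 1 + ‖e‖ ≤ (1 + C₀) * s ^ L := by
    have : ‖e‖ ≤ C₀ * 1 * s ^ L := he.trans (by gcongr)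
    linarith
  have hq1 : 1 + ‖q‖ ≤ (1 + C₀) * s ^ L := by
    have : ‖q‖ ≤ C₀ * 1 * s ^ L := hq.trans (by gcongr)
    linarith
  have hqN : ‖q‖ ^ (N + 1) ≤ C₀ ^ (N + 1) * β * s ^ (L * (N + 1)) := by
    calc ‖q‖ ^ (N + 1) ≤ (C₀ * (2 : ℝ) ^ ((k : ℝ) - l - l * ε) * s ^ L) ^ (N + 1) := by gcongr
      _ = C₀ ^ (N + 1) * ((2 : ℝ) ^ ((k : ℝ) - l - l * ε)) ^ (N + 1) * s ^ (L * (N + 1)) := by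
        rw [mul_pow, mul_pow, ← pow_mul]
      _ ≤ _ := by
        gcongr
        rw [← Real.rpow_natCast, ← Real.rpow_mul (by norm_num), hβ]
        apply Real.rpow_le_rpow_of_exponent_le (by norm_num)
        push_cast
        have h1 : (N : ℝ) * (k - l) ≤ 0 := mul_nonpos_of_nonneg_of_nonpos (by positivity) (by linarith)
        have h2 : (l : ℝ) * ρ ≤ l * (N * ε) := by gcongr
        nlinarith
  have hv1 : 0 < 1 + ‖v‖ := by positivity
  have t1 : ‖g (v + -e) - taylor 1 g v (-e)‖ * (1 + ‖v‖) ^ M ≤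
      C₁ * C₀ * (1 + C₀) ^ M * β * s ^ (L * (N + 1 + 3 * M)) := by
    have := h₁ v (-e)
    rw [zero_add, pow_one, norm_neg, le_div_iff₀ (by positivity)] at this
    calc _ ≤ C₁ * ‖e‖ * (1 + ‖e‖) ^ M := this
      _ ≤ C₁ * (C₀ * β * s ^ L) * ((1 + C₀) * s ^ L) ^ M := by gcongr
      _ = C₁ * C₀ * (1 + C₀) ^ M * β * s ^ (L * (1 + M)) := by
        rw [mul_pow, ← pow_mul, mul_add, pow_add, mul_one]; ring
      _ ≤ _ := by gcongr <;> omega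
  have t2 : ‖g (w + q) - taylor (N + 1) g w q‖ * (1 + ‖v‖) ^ M ≤
      C₂ * C₀ ^ (N + 1) * (1 + C₀) ^ (3 * M) * β * s ^ (L * (N + 1 + 3 * M)) := by
    have := h₂ w q
    rw [le_div_iff₀ (by positivity)] at this
    have hvw : 1 + ‖v‖ ≤ (1 + ‖w‖) * ((1 + C₀) * s ^ L) ^ 2 := by
      calc 1 + ‖v‖ ≤ (1 + ‖w + q‖) * (1 + ‖e‖) := one_add_norm_add_le _ _
        _ ≤ ((1 + ‖w‖) * (1 + ‖q‖)) * (1 + ‖e‖) := by gcongr; exact one_add_norm_add_le _ _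
        _ ≤ ((1 + ‖w‖) * ((1 + C₀) * s ^ L)) * ((1 + C₀) * s ^ L) := by gcongr
        _ = _ := by ring
    set X := ‖g (w + q) - taylor (N + 1) g w q‖
    calc X * (1 + ‖v‖) ^ M ≤ X * ((1 + ‖w‖) * ((1 + C₀) * s ^ L) ^ 2) ^ M := by gcongr
      _ = X * (1 + ‖w‖) ^ M * ((1 + C₀) * s ^ L) ^ (2 * M) := by rw [mul_pow, ← pow_mul]; ring
      _ ≤ C₂ * ‖q‖ ^ (N + 1) * (1 + ‖q‖) ^ M * ((1 + C₀) * s ^ L) ^ (2 * M) := by gcongr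
      _ ≤ C₂ * (C₀ ^ (N + 1) * β * s ^ (L * (N + 1))) * ((1 + C₀) * s ^ L) ^ M *
          ((1 + C₀) * s ^ L) ^ (2 * M) := by gcongr
      _ = _ := by
        rw [mul_assoc _ (((1 + C₀) * s ^ L) ^ M), ← pow_add, show M + 2 * M = 3 * M by ring,
          mul_pow, ← pow_mul, mul_add L (N + 1), pow_add]; ring
  rw [le_div_iff₀ (by positivity)]
  have e1 : v + -e = w + q := by rw [hv]; abel
  rw [taylor_one, e1] at t1
  have e2 : g v - taylor (N + 1) g w q =
      (g (w + q) - taylor (N + 1) g w q) - (g (w + q) - g v) := by ring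
  calc ‖g v - taylor (N + 1) g w q‖ * (1 + ‖v‖) ^ M
      ≤ (‖g (w + q) - taylor (N + 1) g w q‖ + ‖g (w + q) - g v‖) * (1 + ‖v‖) ^ M := by
        rw [e2]; gcongr; exact norm_sub_le _ _
    _ ≤ _ := by linarith

lemma integrable_ker_mul_poly (K g : 𝓢(Rd d, ℂ)) {p : Rd d → ℝ} (hp : IsPoly p)
    (A : Rd d →L[ℝ] Rd d) (y : Rd d) : Integrable fun z ↦ K z * (p z * g (y - A z)) := by
  obtain ⟨K', hK', -⟩ := hp.exists_mul (r := 0) K fun ξ hξ ↦ absurd hξ (norm_nonneg ξ).not_gt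
  obtain ⟨C, -, hC⟩ := exists_decay g 0
  have := (K'.integrable (μ := volume)).bdd_mul (f := fun z ↦ g (y - A z)) (c := C)
    (g.continuous.comp (by fun_prop)).aestronglyMeasurable
    (.of_forall fun z ↦ by simpa using hC (y - A z))
  refine this.congr (.of_forall fun z ↦ ?_)
  simp only [hK']; ring

lemma IsPoly.mono {Q : Rd d → Rd d} (hQ : ∀ i, IsPoly fun z ↦ Q z i) {n : ℕ} (I : Fin n → Fin d) :
    IsPoly fun z ↦ Paracomposition.mono I (Q z) :=
  IsPoly.prod _ fun j ↦ hQ (I j)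

lemma integral_ker_mul_taylor_eq_zero {m γ : 𝓢(Rd d, ℂ)} {A : Rd d →L[ℝ] Rd d} {r r' : ℝ}
    (hm : ∀ ξ, ‖ξ‖ < r → m ξ = 0) (hγ : ∀ ξ, r' < ‖ξ‖ → γ ξ = 0) (hr : ‖A‖ * r' < r)
    {Q : Rd d → Rd d} (hQ : ∀ i, IsPoly fun z ↦ Q z i) (N : ℕ) (y : Rd d) :
    ∫ z, (𝓕 m : 𝓢(Rd d, ℂ)) z * taylor N (𝓕 γ) (y - A z) (Q z) = 0 := by
  have e1 : ∀ z, (𝓕 m : 𝓢(Rd d, ℂ)) z * taylor N (𝓕 γ) (y - A z) (Q z) =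
      ∑ n ∈ Finset.range N, ∑ I : Fin n → Fin d, ((n.factorial : ℝ)⁻¹ : ℂ) *
        ((𝓕 m : 𝓢(Rd d, ℂ)) z * (mono I (Q z) * pd I (𝓕 γ) (y - A z))) := by
    intro z
    rw [taylor, Finset.mul_sum]
    refine Finset.sum_congr rfl fun n _ ↦ ?_
    rw [Finset.mul_sum, Finset.mul_sum]
    refine Finset.sum_congr rfl fun I _ ↦ ?_
    ring
  simp_rw [e1]
  have hi : ∀ (n : ℕ) (I : Fin n → Fin d), Integrable fun z ↦ ((n.factorial : ℝ)⁻¹ : ℂ) *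
        ((𝓕 m : 𝓢(Rd d, ℂ)) z * (mono I (Q z) * pd I (𝓕 γ) (y - A z))) := fun n I ↦
    (integrable_ker_mul_poly _ _ (IsPoly.mono hQ I) A y).const_mul _
  rw [integral_finsetSum _ fun n _ ↦ integrable_finsetSum _ fun I _ ↦ hi n I]
  refine Finset.sum_eq_zero fun n _ ↦ ?_
  rw [integral_finsetSum _ fun I _ ↦ hi n I]
  refine Finset.sum_eq_zero fun I _ ↦ ?_
  rw [integral_const_mul, integral_ker_mul_poly_eq_zero hm hγ hr (IsPoly.mono hQ I) I y, mul_zero]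

lemma J_eq_translate (M k : ℕ) (f : Rd d → ℝ≥0∞) (x : Rd d) :
    J M k f x = ∫⁻ z, ENNReal.ofReal (jap M k z) * f (x + z) := by
  rw [J, ← lintegral_add_left_eq_self _ x]
  simp

lemma jap_mul_pow_le {M L l : ℕ} (z : Rd d) :
    jap (M + L) l z * (1 + 2 ^ l * ‖z‖) ^ L = jap M l z := by
  unfold jap
  rw [pow_add]
  field_simp

/-- Estimate of an integral in which a kernel may be replaced by its difference to a function
annihilated by `K`. -/
lemma enorm_integral_le_of_annihilated {K : 𝓢(Rd d, ℂ)} {h : Rd d → ℂ} {Φ : Rd d → Rd d} {H : ℝ}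
    {κ : Rd d → ℂ} {T : Rd d → Rd d → ℂ} {a b : Rd d → ℝ} {D D' : ℝ} {M k l : ℕ} (hM : d + 1 ≤ M)
    (hh : Continuous h) (hH : ∀ y, ‖h y‖ ≤ H) (hΦ : Continuous Φ)
    (hT : Continuous fun p : Rd d × Rd d ↦ T p.1 p.2)
    (hκ : ∀ x, Integrable (fun y ↦ κ (y - x) * h y) ∧ h x = ∫ y, κ (y - x) * h y)
    (ha : ∀ z, 0 ≤ a z) (hb : ∀ z, 0 ≤ b z) (hD : 0 ≤ D) (hD' : 0 ≤ D')
    (hTa : ∀ z y, ‖κ (y - Φ z) - T z y‖ ≤ a z * jap M k (y - Φ z))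
    (hTb : ∀ z y, ‖T z y‖ ≤ b z * jap M k (y - Φ z))
    (hKa : ∀ z, ‖K z‖ * a z ≤ D * jap M l z) (hKb : ∀ z, ‖K z‖ * b z ≤ D' * jap M l z)
    (h0 : ∀ y, ∫ z, K z * T z y = 0) :
    ‖∫ z, K z * h (Φ z)‖ₑ ≤ ENNReal.ofReal D *
      ∫⁻ z, ENNReal.ofReal (jap M l z) * J M k (fun y ↦ ‖h y‖ₑ) (Φ z) := by
  have hH0 : 0 ≤ H := (norm_nonneg _).trans (hH 0)
  obtain ⟨C₄, hC₄⟩ := exists_lintegral_jap d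
  have hbound : ∀ z, ∫⁻ y, ‖T z y * h y‖ₑ ≤ ENNReal.ofReal (b z * H) * C₄ := by
    intro z
    have hbz := hb z
    calc ∫⁻ y, ‖T z y * h y‖ₑ ≤ ∫⁻ y, ENNReal.ofReal (b z * H) *
          ENNReal.ofReal (jap M k (y - Φ z)) := by
          refine lintegral_mono fun y ↦ ?_
          simp only
          rw [← ENNReal.ofReal_mul (by positivity), ← ofReal_norm]
          apply ENNReal.ofReal_le_ofReal
          rw [norm_mul]
          calc ‖T z y‖ * ‖h y‖ ≤ (b z * jap M k (y - Φ z)) * H :=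
                mul_le_mul (hTb z y) (hH y) (norm_nonneg _)
                  (mul_nonneg hbz (jap_nonneg _ _ _))
            _ = _ := by ring
      _ = _ := lintegral_const_mul' _ _ ENNReal.ofReal_ne_top
      _ ≤ _ := by gcongr; exact hC₄ _ _ hM _
  have hTy : ∀ z, Integrable fun y ↦ T z y * h y := by
    intro z
    have hm : Continuous fun y ↦ T z y * h y :=
      (hT.comp (by fun_prop : Continuous fun y ↦ (z, y))).mul hh
    exact ⟨hm.aestronglyMeasurable, (hbound z).trans_lt
      (ENNReal.mul_lt_top ENNReal.ofReal_lt_top ENNReal.coe_lt_top)⟩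
  -- The bounds `b`, `D'` and `H` only ensure absolute convergence, needed for Fubini; they do not
  -- enter the final estimate.
  have hintp : Integrable (fun p : Rd d × Rd d ↦ K p.1 * (T p.1 p.2 * h p.2))
      (volume.prod volume) := by
    have hm : Continuous fun p : Rd d × Rd d ↦ K p.1 * (T p.1 p.2 * h p.2) :=
      (K.continuous.comp continuous_fst).mul (hT.mul (hh.comp continuous_snd))
    refine ⟨hm.aestronglyMeasurable, ?_⟩
    rw [hasFiniteIntegral_iff_enorm, lintegral_prod _ hm.enorm.measurable.aemeasurable]
    have hb' : ∀ z, ∫⁻ y, ‖K z * (T z y * h y)‖ₑ ≤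
        ENNReal.ofReal (D' * H) * C₄ * ENNReal.ofReal (jap M l z) := by
      intro z
      simp only [enorm_mul (K z)]
      rw [lintegral_const_mul' _ _ enorm_ne_top]
      calc ‖K z‖ₑ * ∫⁻ y, ‖T z y * h y‖ₑ ≤ ‖K z‖ₑ * (ENNReal.ofReal (b z * H) * C₄) := by
            gcongr; exact hbound z
        _ = ENNReal.ofReal (‖K z‖ * b z * H) * C₄ := by
            rw [← ofReal_norm, ← mul_assoc, ← ENNReal.ofReal_mul (norm_nonneg _), mul_assoc]
        _ ≤ ENNReal.ofReal (D' * jap M l z * H) * C₄ := by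
            gcongr ENNReal.ofReal (?_ * _) * _; exact hKb z
        _ = _ := by
            rw [mul_right_comm, ENNReal.ofReal_mul (by positivity)]; ring
    refine (lintegral_mono hb').trans_lt ?_
    rw [lintegral_const_mul' _ _ (ENNReal.mul_ne_top ENNReal.ofReal_ne_top ENNReal.coe_ne_top)]
    refine ENNReal.mul_lt_top (ENNReal.mul_lt_top ENNReal.ofReal_lt_top ENNReal.coe_lt_top) ?_
    have := hC₄ M l hM 0
    simp only [sub_zero] at this
    exact this.trans_lt ENNReal.coe_lt_top
  have hF1 : Integrable fun z ↦ K z * h (Φ z) := by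
    have := (K.integrable (μ := volume)).bdd_mul (f := fun z ↦ h (Φ z)) (c := H)
      (hh.comp hΦ).aestronglyMeasurable (.of_forall fun z ↦ hH _)
    exact this.congr (.of_forall fun z ↦ mul_comm _ _)
  have hzero : ∫ z, ∫ y, K z * (T z y * h y) = 0 := by
    rw [integral_integral_swap hintp]
    apply integral_eq_zero_of_ae
    refine .of_forall fun y ↦ ?_
    simp only [← mul_assoc, Pi.zero_apply]
    rw [integral_mul_const, h0, zero_mul]
  -- Reproduce h(Φ z) by κ and subtract the vanishing integral, so that only the difference κ - T
  -- remains.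
  have hcv : ∫ z, K z * h (Φ z) = ∫ z, ∫ y, K z * ((κ (y - Φ z) - T z y) * h y) := by
    rw [← sub_zero (∫ z, K z * h (Φ z)), ← hzero, ← integral_sub hF1 hintp.integral_prod_left]
    congr 1 with z
    obtain ⟨h2, h3⟩ := hκ (Φ z)
    simp only
    rw [integral_const_mul, integral_const_mul, ← mul_sub, h3, ← integral_sub h2 (hTy z)]
    congr 2 with y
    ring
  rw [hcv]
  calc ‖∫ z, ∫ y, K z * ((κ (y - Φ z) - T z y) * h y)‖ₑ
      ≤ ∫⁻ z, ∫⁻ y, ‖K z * ((κ (y - Φ z) - T z y) * h y)‖ₑ :=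
        (enorm_integral_le_lintegral_enorm _).trans
          (lintegral_mono fun z ↦ enorm_integral_le_lintegral_enorm _)
    _ ≤ ∫⁻ z, ENNReal.ofReal D * (ENNReal.ofReal (jap M l z) * J M k (fun y ↦ ‖h y‖ₑ) (Φ z)) := by
        refine lintegral_mono fun z ↦ ?_
        simp only [J]
        rw [← lintegral_const_mul' _ _ ENNReal.ofReal_ne_top,
          ← lintegral_const_mul' _ _ ENNReal.ofReal_ne_top]
        refine lintegral_mono fun y ↦ ?_
        simp only
        rw [← mul_assoc, ← mul_assoc, ← mul_assoc, enorm_mul, enorm_mul]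
        refine mul_le_mul_left ?_ _
        have hj := jap_nonneg M k (y - Φ z)
        have hj' := jap_nonneg M l z
        rw [← ENNReal.ofReal_mul hD, ← ENNReal.ofReal_mul (by positivity), ← ofReal_norm,
          ← ofReal_norm, ← ENNReal.ofReal_mul (norm_nonneg _)]
        apply ENNReal.ofReal_le_ofReal
        calc ‖K z‖ * ‖κ (y - Φ z) - T z y‖ ≤ ‖K z‖ * (a z * jap M k (y - Φ z)) := by
              gcongr; exact hTa z y
          _ = (‖K z‖ * a z) * jap M k (y - Φ z) := by ring
          _ ≤ _ := mul_le_mul_of_nonneg_right (hKa z) hj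
    _ = _ := lintegral_const_mul' _ _ ENNReal.ofReal_ne_top

lemma continuous_scaled_taylor (N : ℕ) (g : 𝓢(Rd d, ℂ)) (b : ℂ) (a : ℝ) (c : Rd d)
    (A : Rd d →L[ℝ] Rd d) {Q : Rd d → Rd d} (hQ : Continuous Q) :
    Continuous fun p : Rd d × Rd d ↦ b * taylor N g (a • (p.2 - c) - A p.1) (-(a • Q p.1)) := by
  refine continuous_const.mul (continuous_taylor N g ?_ ?_) <;> fun_prop

/-- The high frequencies of the composition of a low frequency function with a map are small. -/
theorem exists_cv_ker_comp_le (P : LPCutoff d) {ρ : ℝ} (hρ : 0 < ρ) {χ : Rd d → Rd d}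
    {A : Rd d → Rd d →L[ℝ] Rd d} (hχ : Continuous χ) (hA : App ρ χ A) {B : ℝ}
    (hB : ∀ x, ‖A x‖ ≤ B) {N : ℕ} (hN : 2 * B < 2 ^ N) (M : ℕ) :
    ∃ C : ℝ≥0, ∀ k l : ℕ, k + N + 1 ≤ l → ∀ h : Rd d → ℂ, Band k h → (∃ H, ∀ x, ‖h x‖ ≤ H) → ∀ x,
      ‖cv (P.ker l) (h ∘ χ) x‖ₑ ≤ C * tw ((k : ℝ) - l - l * ρ) *
        J M l (fun y ↦ J M k (fun y ↦ ‖h y‖ₑ) (χ y)) x := by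
  have hB0 : 0 ≤ B := (norm_nonneg _).trans (hB 0)
  -- The reproducing cutoff at scale k lives in the ball of radius 2^k(1/π + δ). This δ gives B(1/π
  -- + δ) < 2^N/(2π), so the adjoint of A(x) maps that ball into the ball of radius 2^{k+N}/(2π). As
  -- l - 1 ≥ k + N, the symbol φ_l vanishes there. The strict inequality 2B < 2^N is what makes δ
  -- positive; the denominator uses B + 1 so that B = 0 is allowed.
  set δ := (2 ^ N - 2 * B) / (4 * Real.pi * (B + 1)) with hδ_def
  have hpi := Real.pi_pos
  have hδ : 0 < δ := by
    have : 0 < 2 ^ N - 2 * B := by linarith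
    positivity
  have hδB : B * (1 / Real.pi + δ) < 2 ^ N / (2 * Real.pi) := by
    rw [lt_div_iff₀ (by positivity)]
    have h1 : B * (1 / Real.pi + δ) * (2 * Real.pi) = 2 * B + (B / (B + 1)) * ((2 ^ N - 2 * B) / 2) := by
      rw [hδ_def]; field_simp; ring
    rw [h1]
    have h2 : B / (B + 1) ≤ 1 := by rw [div_le_one (by positivity)]; linarith
    nlinarith
  set γ : 𝓢(Rd d, ℂ) := fat δ hδ with hγ
  obtain ⟨ε, C₀, L, hε, hC₀, happ⟩ := hA
  obtain ⟨Nt, L', C₁, hC₁, htay⟩ := exists_perturbed_taylor_le (𝓕 γ) hρ.le hε hC₀ L (M + d + 1)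
  obtain ⟨C₂, hC₂, hker⟩ := P.exists_ker_le (M + d + 1 + L')
  obtain ⟨C₃, hC₃, hks⟩ := exists_ks_le (𝓕 γ : 𝓢(Rd d, ℂ)) (M + d + 1)
  refine ⟨(C₂ * C₁).toNNReal, fun k l hkl h hh ⟨H, hH⟩ x ↦ ?_⟩
  have hH0 : 0 ≤ H := (norm_nonneg _).trans (hH 0)
  obtain ⟨Q, hQ, hQ1, hQ2⟩ := happ l x
  set c := χ x with hc
  set s : Rd d → ℝ := fun z ↦ 1 + 2 ^ l * ‖z‖ with hs
  have hs1 : ∀ z, 1 ≤ s z := fun z ↦ by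
    have : 0 ≤ 2 ^ l * ‖z‖ := by positivity
    simp only [hs]; linarith
  have hs0 : ∀ z, 0 ≤ s z := fun z ↦ zero_le_one.trans (hs1 z)
  set β : ℝ := (2 : ℝ) ^ ((k : ℝ) - l - l * ρ) with hβ
  have hβ0 : 0 < β := by positivity
  have hkl' : k ≤ l := by omega
  have hβ1 : β ≤ 1 := by
    have h1 : (k : ℝ) ≤ l := by exact_mod_cast hkl'
    have h2 : (0 : ℝ) ≤ l * ρ := by positivity
    exact Real.rpow_le_one_of_one_le_of_nonpos (by norm_num) (by linarith)
  set κ := ks k (𝓕 γ : 𝓢(Rd d, ℂ)) with hκ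
  -- The Taylor polynomial of the rescaled kernel at y - χ(x) - A(x)z in the direction -Q(z); the
  -- error of the approximation of χ is left to the perturbation.
  set Tf : Rd d → Rd d → ℂ := fun z y ↦ 2 ^ (k * d) *
    taylor (Nt + 1) (𝓕 γ) ((2 : ℝ) ^ k • (y - c) - ((2 : ℝ) ^ k • A x) z) (-((2 : ℝ) ^ k • Q z))
    with hTf
  have hpow : ∀ a : ℝ, (2 : ℝ) ^ k * (2 : ℝ) ^ (-(l : ℝ) * (1 + a)) =
      (2 : ℝ) ^ ((k : ℝ) - l - l * a) := fun a ↦ by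
    rw [← Real.rpow_natCast, ← Real.rpow_add (by norm_num)]; congr 1; ring
  have hT : ∀ z y, ‖κ (y - χ (x + z)) - Tf z y‖ ≤
      C₁ * β * s z ^ L' * jap (M + d + 1) k (y - χ (x + z)) := by
    intro z y
    have h1 := htay k l hkl' ((2 : ℝ) ^ k • (y - c) - ((2 : ℝ) ^ k • A x) z) (-((2 : ℝ) ^ k • Q z))
      (-((2 : ℝ) ^ k • (χ (x + z) - c - A x z - Q z))) (s z) (hs1 z)
      (by
        rw [norm_neg, norm_smul, norm_pow, Real.norm_two, ← hpow]
        calc (2 : ℝ) ^ k * ‖Q z‖ ≤ 2 ^ k * (C₀ * (2 : ℝ) ^ (-(l : ℝ) * (1 + ε)) * s z ^ L) := by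
              gcongr; exact hQ1 z
          _ = _ := by ring)
      (by
        rw [norm_neg, norm_smul, norm_pow, Real.norm_two, ← hpow]
        calc (2 : ℝ) ^ k * ‖χ (x + z) - c - A x z - Q z‖
            ≤ 2 ^ k * (C₀ * (2 : ℝ) ^ (-(l : ℝ) * (1 + ρ)) * s z ^ L) := by
              gcongr; exact hQ2 z
          _ = _ := by ring)
    have h2 : (2 : ℝ) ^ k • (y - c) - ((2 : ℝ) ^ k • A x) z + -((2 : ℝ) ^ k • Q z) +
        -((2 : ℝ) ^ k • (χ (x + z) - c - A x z - Q z)) = (2 : ℝ) ^ k • (y - χ (x + z)) := by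
      rw [smul_apply]; module
    rw [h2, norm_smul, norm_pow, Real.norm_two] at h1
    simp only [hκ, hTf, ks, ← mul_sub, norm_mul, norm_pow, Complex.norm_two, jap]
    refine (mul_le_mul_of_nonneg_left h1 (by positivity)).trans_eq ?_
    ring
  set K := P.ker l with hK
  -- The kernel was given L' surplus powers of decay, which pay for the polynomial growth of the
  -- Taylor remainder in 2^l‖z‖.
  have hKs : ∀ z, ‖K z‖ * s z ^ L' ≤ C₂ * jap (M + d + 1) l z := fun z ↦ by
    rw [← jap_mul_pow_le (L := L'), ← mul_assoc]
    exact mul_le_mul_of_nonneg_right (hker l z) (pow_nonneg (hs0 z) _)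
  have hQc : Continuous Q := by
    rw [show Q = fun z ↦ WithLp.toLp 2 (fun i ↦ Q z i) from rfl]
    exact (PiLp.continuous_toLp 2 _).comp (continuous_pi fun i ↦ (hQ i).continuous)
  have hcontT : Continuous fun p : Rd d × Rd d ↦ Tf p.1 p.2 :=
    continuous_scaled_taylor _ _ _ _ _ _ hQc
  have hTb : ∀ z y, ‖Tf z y‖ ≤ (C₁ + C₃) * s z ^ L' * jap (M + d + 1) k (y - χ (x + z)) := by
    intro z y
    have h1 := hT z y
    have h2 := hks k (y - χ (x + z))
    have h3 : ‖Tf z y‖ ≤ ‖κ (y - χ (x + z))‖ + ‖κ (y - χ (x + z)) - Tf z y‖ := by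
      simpa using norm_sub_le (κ (y - χ (x + z))) (κ (y - χ (x + z)) - Tf z y)
    have h4 : 1 ≤ s z ^ L' := one_le_pow₀ (hs1 z)
    have h5 := jap_nonneg (M + d + 1) k (y - χ (x + z))
    have h6 : C₁ * β * s z ^ L' * jap (M + d + 1) k (y - χ (x + z)) ≤
      C₁ * 1 * s z ^ L' * jap (M + d + 1) k (y - χ (x + z)) := by gcongr
    have h7 : C₃ * jap (M + d + 1) k (y - χ (x + z)) ≤
      C₃ * s z ^ L' * jap (M + d + 1) k (y - χ (x + z)) := by
      gcongr; exact le_mul_of_one_le_right hC₃ h4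
    linarith
  have hzero : ∀ y, ∫ z, K z * Tf z y = 0 := by
    intro y
    have h1 := integral_ker_mul_taylor_eq_zero (m := P.blk l) (γ := γ) (A := (2 : ℝ) ^ k • A x)
      (r := 2 ^ (l - 1) / (2 * Real.pi)) (r' := 1 / Real.pi + δ) (Q := fun z ↦ -((2 : ℝ) ^ k • Q z))
      (fun ξ hξ ↦ by
        obtain ⟨l', rfl⟩ : ∃ l', l = l' + 1 := ⟨l - 1, by omega⟩
        exact P.blk_eq_zero_of_lt (by simpa using hξ))
      (fun ξ hξ ↦ fat_eq_zero hδ hξ.le)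
      (by
        rw [norm_smul, norm_pow, Real.norm_two]
        calc (2 : ℝ) ^ k * ‖A x‖ * (1 / Real.pi + δ) ≤ 2 ^ k * B * (1 / Real.pi + δ) := by
              gcongr; exact hB x
          _ = 2 ^ k * (B * (1 / Real.pi + δ)) := by ring
          _ < 2 ^ k * (2 ^ N / (2 * Real.pi)) := by gcongr
          _ = 2 ^ (k + N) / (2 * Real.pi) := by rw [pow_add]; ring
          _ ≤ _ := by gcongr <;> first | omega | norm_num)
      (fun i ↦ by
        have := (IsPoly.const (-(2 : ℝ) ^ k)).mul (hQ i)
        simpa using this) (Nt + 1) ((2 : ℝ) ^ k • (y - c))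
    have h2 : ∀ z, K z * Tf z y = 2 ^ (k * d) * ((𝓕 (P.blk l) : 𝓢(Rd d, ℂ)) z *
        taylor (Nt + 1) (𝓕 γ) ((2 : ℝ) ^ k • (y - c) - ((2 : ℝ) ^ k • A x) z)
          (-((2 : ℝ) ^ k • Q z))) := by
      intro z; simp only [hTf, hK, LPCutoff.ker]; ring
    simp only [h2]
    rw [integral_const_mul, h1, mul_zero]
  have h1 : cv K (h ∘ χ) x = ∫ z, K z * h (χ (x + z)) := by
    rw [cv, ← integral_add_left_eq_self _ x]; simp
  rw [h1]
  have hC13 : 0 ≤ C₁ + C₃ := by positivity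
  refine (enorm_integral_le_of_annihilated (κ := κ) (T := Tf) (Φ := fun z ↦ χ (x + z))
    (a := fun z ↦ C₁ * β * s z ^ L') (b := fun z ↦ (C₁ + C₃) * s z ^ L') (D := C₂ * C₁ * β)
    (D' := C₂ * (C₁ + C₃)) (M := M + d + 1) (k := k) (l := l) (by omega) hh.pg.cont hH
    (by fun_prop) hcontT (hh.eq δ hδ) (fun z ↦ ?_) (fun z ↦ ?_) (by positivity) (by positivity)
    hT hTb (fun z ↦ ?_) (fun z ↦ ?_) hzero).trans ?_
  · exact mul_nonneg (by positivity) (pow_nonneg (hs0 z) _)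
  · exact mul_nonneg hC13 (pow_nonneg (hs0 z) _)
  · calc ‖K z‖ * (C₁ * β * s z ^ L') = C₁ * β * (‖K z‖ * s z ^ L') := by ring
      _ ≤ C₁ * β * (C₂ * jap (M + d + 1) l z) :=
        mul_le_mul_of_nonneg_left (hKs z) (by positivity)
      _ = _ := by ring
  · calc ‖K z‖ * ((C₁ + C₃) * s z ^ L') = (C₁ + C₃) * (‖K z‖ * s z ^ L') := by ring
      _ ≤ (C₁ + C₃) * (C₂ * jap (M + d + 1) l z) := mul_le_mul_of_nonneg_left (hKs z) hC13
      _ = _ := by ring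
  · rw [ENNReal.ofReal_mul (by positivity), tw_eq_ofReal, J_eq_translate M l]
    refine mul_le_mul_right (lintegral_mono fun z ↦ ?_) _
    exact mul_le_mul (ENNReal.ofReal_le_ofReal (jap_anti (by omega) _ _))
      (J_anti (by omega) _ _ _) zero_le zero_le

/-! ### Low frequency approximation of distributions -/

/-- The cutoff equals 1 near the origin, so P_0 - 1 and its derivatives are bounded and vanish
there, hence are O(‖ξ‖). After dilation this bound produces a factor 2^{-l}. -/
lemma LPCutoff.exists_iteratedFDeriv_one_sub_le (P : LPCutoff d) (i : ℕ) : ∃ C : ℝ, 0 ≤ C ∧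
    ∀ ξ : Rd d, ‖iteratedFDeriv ℝ i (fun η ↦ P.base η - 1) ξ‖ ≤ C * ‖ξ‖ := by
  have hsm : ContDiff ℝ i (P.base : Rd d → ℂ) := P.base.smooth i
  obtain ⟨C, hC⟩ := P.base.decay 0 i
  refine ⟨(C + 1) * (2 * Real.pi), by have := hC.1; positivity, fun ξ ↦ ?_⟩
  rcases lt_or_ge ‖ξ‖ (1 / (2 * Real.pi)) with h | h
  · have : (fun η ↦ P.base η - 1) =ᶠ[𝓝 ξ] fun _ ↦ (0 : ℂ) := by
      filter_upwards [(isOpen_lt continuous_norm continuous_const).mem_nhds h] with η hη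
      have := P.low_eq_one (k := 0) (ξ := η) (by simpa using hη)
      rw [low, dil_apply] at this
      simp only [pow_zero, inv_one, one_smul] at this
      rw [this, sub_self]
    rw [(this.iteratedFDeriv ℝ i).eq_of_nhds, iteratedFDeriv_fun_zero]
    have := hC.1
    simp; positivity
  · have h1 : ‖iteratedFDeriv ℝ i (fun η ↦ P.base η - 1) ξ‖ ≤ C + 1 := by
      rw [fun_iteratedFDeriv_sub_apply hsm.contDiffAt contDiffAt_const]
      refine (norm_sub_le _ _).trans (add_le_add (by simpa using hC.2 ξ) ?_)
      cases i with
      | zero => simp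
      | succ i => rw [iteratedFDeriv_const_of_ne (by simp)]; simp
    rw [div_le_iff₀ (by positivity)] at h
    have := hC.1
    calc _ ≤ C + 1 := h1
      _ ≤ (C + 1) * (‖ξ‖ * (2 * Real.pi)) := le_mul_of_one_le_right (by positivity) h
      _ = _ := by ring

/-- One extra power of ‖ξ‖, available for a Schwartz function, is exchanged for the factor 2^{-l},
in every seminorm. -/
lemma LPCutoff.tendsto_low_smul (P : LPCutoff d) (γ : 𝓢(Rd d, ℂ)) :
    Tendsto (fun l ↦ SchwartzMap.smulLeftCLM ℂ (P.low l) γ) atTop (𝓝 γ) := by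
  rw [(schwartz_withSeminorms ℂ (Rd d) ℂ).tendsto_nhds]
  rintro ⟨k, n⟩ ε hε
  simp only [schwartzSeminormFamily_apply]
  choose C hC0 hC using P.exists_iteratedFDeriv_one_sub_le
  set D := ∑ i ∈ Finset.range (n + 1), (n.choose i : ℝ) * C i * SchwartzMap.seminorm ℂ (k + 1) (n - i) γ
  have hD : 0 ≤ D := Finset.sum_nonneg fun i _ ↦ by have := hC0 i; positivity
  have key : ∀ l, SchwartzMap.seminorm ℂ k n (SchwartzMap.smulLeftCLM ℂ (P.low l) γ - γ) ≤
      D * ((2 : ℝ)⁻¹) ^ l := by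
    intro l
    refine seminorm_le_bound ℂ k n _ (by positivity) fun ξ ↦ ?_
    have e1 : ((SchwartzMap.smulLeftCLM ℂ (P.low l) γ - γ : 𝓢(Rd d, ℂ)) : Rd d → ℂ) =
        fun η ↦ (fun η ↦ P.base η - 1) (((2 : ℝ) ^ l)⁻¹ • η) * γ η := by
      ext η
      rw [sub_apply, SchwartzMap.smulLeftCLM_apply_apply (P.low l).hasTemperateGrowth, smul_eq_mul,
        low, dil_apply, sub_mul, one_mul]
    have hsm : ContDiff ℝ ∞ (fun η : Rd d ↦ P.base η - 1) := (P.base.smooth _).sub contDiff_const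
    rw [e1]
    have h1 := norm_iteratedFDeriv_mul_le (𝕜 := ℝ) (n := n) (N := ∞)
      (hsm.comp (contDiff_const_smul (((2 : ℝ) ^ l)⁻¹))) (γ.smooth _) ξ
      (by exact_mod_cast le_top)
    refine (mul_le_mul_of_nonneg_left h1 (by positivity)).trans ?_
    calc _ = ∑ i ∈ Finset.range (n + 1), ‖ξ‖ ^ k * ((n.choose i : ℝ) *
          ‖iteratedFDeriv ℝ i ((fun η ↦ P.base η - 1) ∘ fun η ↦ ((2 : ℝ) ^ l)⁻¹ • η) ξ‖ *
            ‖iteratedFDeriv ℝ (n - i) γ ξ‖) := by rw [Finset.mul_sum]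
      _ ≤ ∑ i ∈ Finset.range (n + 1), (n.choose i : ℝ) * C i *
          SchwartzMap.seminorm ℂ (k + 1) (n - i) γ * ((2 : ℝ)⁻¹) ^ l := by
        refine Finset.sum_le_sum fun i _ ↦ ?_
        have h2 : ‖iteratedFDeriv ℝ i ((fun η ↦ P.base η - 1) ∘ fun η ↦ ((2 : ℝ) ^ l)⁻¹ • η) ξ‖ ≤
            C i * (((2 : ℝ)⁻¹) ^ l * ‖ξ‖) := by
          have := congrFun (iteratedFDeriv_comp_const_smul (𝕜 := ℝ) (i := i)
            (f := fun η : Rd d ↦ P.base η - 1) ((2 : ℝ) ^ l)⁻¹ (hsm.of_le (by exact_mod_cast le_top))) ξ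
          have h3 : iteratedFDeriv ℝ i ((fun η ↦ P.base η - 1) ∘ fun η ↦ ((2 : ℝ) ^ l)⁻¹ • η) ξ =
            (((2 : ℝ) ^ l)⁻¹) ^ i • iteratedFDeriv ℝ i (fun η ↦ P.base η - 1) (((2 : ℝ) ^ l)⁻¹ • ξ) := this
          rw [h3, norm_smul, norm_pow, norm_inv, norm_pow, Real.norm_two]
          have h4 := hC i (((2 : ℝ) ^ l)⁻¹ • ξ)
          rw [norm_smul, norm_inv, norm_pow, Real.norm_two, ← inv_pow, inv_pow] at h4
          have h5 : (((2 : ℝ) ^ l)⁻¹) ^ i ≤ 1 := pow_le_one₀ (by positivity)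
            (inv_le_one_of_one_le₀ (one_le_pow₀ (by norm_num)))
          calc _ ≤ 1 * _ := mul_le_mul h5 h4 (norm_nonneg _) zero_le_one
            _ = _ := by rw [one_mul, inv_pow]
        have h3 := le_seminorm ℂ (k + 1) (n - i) γ ξ
        have := hC0 i
        calc _ ≤ ‖ξ‖ ^ k * ((n.choose i : ℝ) * (C i * (((2 : ℝ)⁻¹) ^ l * ‖ξ‖)) *
            ‖iteratedFDeriv ℝ (n - i) γ ξ‖) := by gcongr
          _ = (n.choose i : ℝ) * C i * (‖ξ‖ ^ (k + 1) * ‖iteratedFDeriv ℝ (n - i) γ ξ‖) *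
              ((2 : ℝ)⁻¹) ^ l := by ring
          _ ≤ _ := by gcongr
      _ = _ := by rw [Finset.sum_mul]
  have h0 : Tendsto (fun l : ℕ ↦ D * ((2 : ℝ)⁻¹) ^ l) atTop (𝓝 0) := by
    simpa using (tendsto_pow_atTop_nhds_zero_of_lt_one (by norm_num : (0 : ℝ) ≤ 2⁻¹)
      (by norm_num)).const_mul D
  filter_upwards [h0.eventually (gt_mem_nhds hε)] with l hl
  exact (key l).trans_lt hl

lemma LPCutoff.tendsto_Op_low (P : LPCutoff d) (T : 𝓢'(Rd d, ℂ)) (g : 𝓢(Rd d, ℂ)) :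
    Tendsto (fun l ↦ Op (P.low l) T g) atTop (𝓝 (T g)) := by
  have h1 : Tendsto (fun l ↦ Cop (P.low l) g) atTop (𝓝 g) := by
    have := ((FourierTransform.fourierCLM ℂ 𝓢(Rd d, ℂ)).continuous.tendsto _).comp
      (P.tendsto_low_smul (𝓕⁻ g))
    have h2 : FourierTransform.fourierCLM ℂ 𝓢(Rd d, ℂ) (𝓕⁻ g) = g := by
      rw [FourierTransform.fourierCLM_apply]; exact FourierTransform.fourier_fourierInv_eq g
    rw [h2] at this
    exact this
  exact ((ContinuousLinearMap.continuous T).tendsto g).comp h1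

/-- Pointwise convergence of the Littlewood-Paley decomposition. -/
lemma LPCutoff.hasSum_ev_ker (P : LPCutoff d) {f : Rd d → ℂ} {T : 𝓢'(Rd d, ℂ)} (hf : IsFun f T)
    (hc : Continuous f) {b : ℕ → ℝ} (hb : Summable b) (h : ∀ q x, ‖ev (P.ker q) T x‖ ≤ b q)
    (x : Rd d) : HasSum (fun q ↦ ev (P.ker q) T x) (f x) := by
  have hs : ∀ x, Summable fun q ↦ ev (P.ker q) T x := fun x ↦ .of_norm_bounded hb fun q ↦ h q x
  have hsc : Continuous fun x ↦ ∑' q, ev (P.ker q) T x :=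
    continuous_tsum (fun q ↦ continuous_ev _ _) hb fun q x ↦ h q x
  have hsb : ∀ x, ‖∑' q, ev (P.ker q) T x‖ ≤ ∑' q, b q := fun x ↦
    tsum_of_norm_bounded hb.hasSum fun q ↦ h q x
  have hpg : PG fun x ↦ ∑' q, ev (P.ker q) T x := .of_bounded hsc hsb
  have h1 : IsFun (fun x ↦ ∑' q, ev (P.ker q) T x) T := by
    intro g
    refine ⟨hpg.integrable g, tendsto_nhds_unique (P.tendsto_Op_low T g) ?_⟩
    have h2 : ∀ n, Op (P.low n) T g =
        ∫ x, g x * ∑ q ∈ Finset.range (n + 1), ev (P.ker q) T x := by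
      intro n
      rw [← P.sum_block]
      have := IsFun.sum (s := Finset.range (n + 1)) (f := fun q ↦ ev (P.ker q) T)
        (T := fun q ↦ block P q T) fun q _ ↦ by
          rw [P.block_eq]; exact isFun_Op _ T
      exact (this g).2
    simp_rw [h2]
    refine tendsto_integral_of_dominated_convergence (fun x ↦ ‖g x‖ * ∑' q, b q) (fun n ↦ ?_)
      (g.integrable.norm.mul_const _) (fun n ↦ .of_forall fun x ↦ ?_) (.of_forall fun x ↦ ?_)
    · exact (g.continuous.mul (continuous_finsetSum _ fun q _ ↦
        continuous_ev _ _)).aestronglyMeasurable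
    · rw [norm_mul]
      gcongr
      refine (norm_sum_le _ _).trans ((Finset.sum_le_sum fun q _ ↦ h q x).trans ?_)
      exact hb.sum_le_tsum _ fun q _ ↦ (norm_nonneg _).trans (h q x)
    · exact (((hs x).hasSum.tendsto_sum_nat).comp (tendsto_add_atTop_nat 1)).const_mul (g x)
  rw [hf.unique h1 hc hsc]
  exact (hs x).hasSum

lemma exists_ev_ker_le_of_zygNorm (P : LPCutoff d) {ρ : ℝ} {T : 𝓢'(Rd d, ℂ)}
    (h : zygNorm P ρ T < ⊤) : ∃ C : ℝ, 0 ≤ C ∧ ∀ q x,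
      ‖ev (P.ker q) T x‖ ≤ C * (2 : ℝ) ^ (-(q : ℝ) * ρ) := by
  refine ⟨(zygNorm P ρ T).toReal, by positivity, fun q x ↦ ?_⟩
  have h1 : tw (q * ρ) * ‖ev (P.ker q) T x‖ₑ ≤ zygNorm P ρ T := by
    refine le_trans ?_ (le_iSup (fun q : ℕ ↦ (2 : ℝ≥0∞) ^ ((q : ℝ) * ρ) * lpNorm ⊤ (block P q T)) q)
    refine mul_le_mul' le_rfl ?_
    refine le_trans ?_ (fn_le_lpNorm .zyg (continuous_ev (P.ker q) T) (T := block P q T) (by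
      rw [P.block_eq]; exact isFun_Op _ T))
    exact le_iSup₂ (f := fun x (_ : x ∈ Set.univ) ↦ ‖ev (P.ker q) T x‖ₑ) x (Set.mem_univ x)
  have h2 : ‖ev (P.ker q) T x‖ₑ ≤ zygNorm P ρ T * tw (-(q * ρ)) := by
    calc ‖ev (P.ker q) T x‖ₑ = (tw (q * ρ) * ‖ev (P.ker q) T x‖ₑ) * tw (-(q * ρ)) := by
          rw [mul_right_comm, tw_mul_tw_neg, one_mul]
      _ ≤ _ := by gcongr
  have h3 := ENNReal.toReal_mono (ENNReal.mul_ne_top h.ne (tw_ne_top _)) h2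
  rw [ENNReal.toReal_mul, tw_eq_ofReal, ENNReal.toReal_ofReal (by positivity), toReal_enorm] at h3
  rwa [neg_mul]

/-! ### Polynomial approximation of maps with Zygmund derivative -/

lemma mono_smul {n : ℕ} (I : Fin n → Fin d) (c : ℝ) (z : Rd d) :
    mono I (c • z) = c ^ n * mono I z := by
  simp [mono, Finset.prod_mul_distrib]

lemma abs_coord_le (z : Rd d) (i : Fin d) : |z i| ≤ ‖z‖ := by
  simpa using PiLp.norm_apply_le z i

lemma abs_mono_le {n : ℕ} (I : Fin n → Fin d) (z : Rd d) : |mono I z| ≤ ‖z‖ ^ n := by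
  rw [mono, Finset.abs_prod]
  calc ∏ j, |z (I j)| ≤ ∏ _j : Fin n, ‖z‖ :=
        Finset.prod_le_prod (fun _ _ ↦ abs_nonneg _) fun j _ ↦ abs_coord_le z _
    _ = _ := by simp

lemma norm_le_sum_coord (z : Rd d) : ‖z‖ ≤ ∑ i, |z i| := by
  conv_lhs => rw [sum_coord z]
  refine (norm_sum_le _ _).trans (Finset.sum_le_sum fun i _ ↦ ?_)
  rw [norm_smul]; simp [e]

lemma exists_sum_rpow_le {δ : ℝ} (hδ : 0 < δ) : ∃ C : ℝ, 0 ≤ C ∧ ∀ l : ℕ,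
    ∑ q ∈ Finset.range (l + 1), (2 : ℝ) ^ ((q : ℝ) * δ) ≤ C * (2 : ℝ) ^ ((l : ℝ) * δ) := by
  set r := (2 : ℝ) ^ (-δ) with hr
  have hr1 : r < 1 := Real.rpow_lt_one_of_one_lt_of_neg (by norm_num) (by linarith)
  have h1 : 0 < 1 - r := by linarith
  have hC : (1 - r)⁻¹ * r + 1 = (1 - r)⁻¹ := by field_simp; ring
  refine ⟨(1 - r)⁻¹, by positivity, fun l ↦ ?_⟩
  induction l with
  | zero =>
    have : 0 < r := by positivity
    simpa using (one_le_inv₀ h1).2 (by linarith)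
  | succ l ih =>
    rw [Finset.sum_range_succ]
    have h2 : (2 : ℝ) ^ ((l : ℝ) * δ) = r * (2 : ℝ) ^ (((l + 1 : ℕ) : ℝ) * δ) := by
      rw [hr, ← Real.rpow_add (by norm_num)]; congr 1; push_cast; ring
    calc _ ≤ (1 - r)⁻¹ * (r * (2 : ℝ) ^ (((l + 1 : ℕ) : ℝ) * δ)) + (2 : ℝ) ^ (((l + 1 : ℕ) : ℝ) * δ) := by
          rw [← h2]; gcongr
      _ = ((1 - r)⁻¹ * r + 1) * (2 : ℝ) ^ (((l + 1 : ℕ) : ℝ) * δ) := by ring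
      _ = _ := by rw [hC]

lemma summable_rpow_neg {ρ : ℝ} (hρ : 0 < ρ) : Summable fun q : ℕ ↦ (2 : ℝ) ^ (-(q : ℝ) * ρ) := by
  have h : ∀ q : ℕ, (2 : ℝ) ^ (-(q : ℝ) * ρ) = ((2 : ℝ) ^ (-ρ)) ^ q := fun q ↦ by
    rw [← Real.rpow_natCast, ← Real.rpow_mul (by norm_num)]; congr 1; ring
  simp_rw [h]
  exact summable_geometric_of_lt_one (by positivity)
    (Real.rpow_lt_one_of_one_lt_of_neg (by norm_num) (by linarith))

lemma exists_norm_cv_ks_le (g : 𝓢(Rd d, ℂ)) : ∃ C : ℝ, 0 ≤ C ∧ ∀ (k : ℕ) (f : Rd d → ℂ) (H : ℝ),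
    (∀ x, ‖f x‖ ≤ H) → ∀ x, ‖cv (ks k g) f x‖ ≤ C * H := by
  obtain ⟨C, hC, hb⟩ := exists_ks_le g (d + 1)
  obtain ⟨C', hC'⟩ := exists_J_le_iSup d
  refine ⟨C * C', by positivity, fun k f H hf x ↦ ?_⟩
  have hH : 0 ≤ H := (norm_nonneg _).trans (hf 0)
  have h1 : ‖cv (ks k g) f x‖ₑ ≤ ENNReal.ofReal C * (C' * ENNReal.ofReal H) := by
    refine (enorm_cv_le (hb k) x).trans ?_
    gcongr
    refine (hC' _ _ le_rfl _ _).trans ?_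
    gcongr
    exact iSup_le fun y ↦ by rw [← ofReal_norm]; exact ENNReal.ofReal_le_ofReal (hf y)
  rw [← ofReal_norm, ← ENNReal.ofReal_coe_nnreal, ← ENNReal.ofReal_mul (by positivity),
    ← ENNReal.ofReal_mul hC, ENNReal.ofReal_le_ofReal_iff (by positivity)] at h1
  linarith

/-- Taylor expansion of a band-limited function. -/
lemma exists_band_taylor_le (N : ℕ) : ∃ C : ℝ, 0 ≤ C ∧ ∀ (q : ℕ) (f : Rd d → ℂ) (H : ℝ),
    Band q f → (∀ x, ‖f x‖ ≤ H) → ∀ x z,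
    ‖f (x + z) - ∑ n ∈ Finset.range (N + 1), ∑ I : Fin n → Fin d, (mono I z : ℂ) *
      (((n.factorial : ℝ)⁻¹ : ℂ) * (-2 ^ q) ^ n * cv (ks q (pd I (𝓕 (fat 1 one_pos)))) f x)‖ ≤
      C * H * (2 ^ q * ‖z‖) ^ (N + 1) * (1 + 2 ^ q * ‖z‖) ^ (d + 1) := by
  set g : 𝓢(Rd d, ℂ) := 𝓕 (fat (d := d) 1 one_pos) with hg
  obtain ⟨C₁, hC₁, ht⟩ := exists_taylor_le g N (d + 1)
  obtain ⟨C₂, hC₂⟩ := exists_lintegral_jap d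
  refine ⟨C₁ * C₂, by positivity, fun q f H hf hH x z ↦ ?_⟩
  have hH0 : 0 ≤ H := (norm_nonneg _).trans (hH 0)
  obtain ⟨h1, h2⟩ := hf.eq 1 one_pos (x + z)
  rw [← hg] at h1 h2
  have hi : ∀ (n : ℕ) (I : Fin n → Fin d), Integrable fun y ↦ ks q (pd I g) (y - x) * f y := by
    intro n I
    obtain ⟨γ', h3, -⟩ := exists_pd_fourier I (fat (d := d) 1 one_pos)
    rw [hg, h3, ← fourier_dil]
    exact hf.pg.isFun.integrable_tr _ x
  set c : ℕ → ℂ := fun n ↦ ((n.factorial : ℝ)⁻¹ : ℂ) * (-2 ^ q) ^ n with hc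
  have e1 : ∑ n ∈ Finset.range (N + 1), ∑ I : Fin n → Fin d, (mono I z : ℂ) *
      (c n * cv (ks q (pd I g)) f x) = ∫ y, ∑ n ∈ Finset.range (N + 1), ∑ I : Fin n → Fin d,
      (mono I z : ℂ) * (c n * (ks q (pd I g) (y - x) * f y)) := by
    rw [integral_finsetSum _ fun n _ ↦ integrable_finsetSum _ fun I _ ↦
      ((hi n I).const_mul _).const_mul _]
    refine Finset.sum_congr rfl fun n _ ↦ ?_
    rw [integral_finsetSum _ fun I _ ↦ ((hi n I).const_mul _).const_mul _]
    refine Finset.sum_congr rfl fun I _ ↦ ?_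
    rw [integral_const_mul, integral_const_mul]; rfl
  have hint2 : Integrable fun y ↦ ∑ n ∈ Finset.range (N + 1), ∑ I : Fin n → Fin d,
      (mono I z : ℂ) * (c n * (ks q (pd I g) (y - x) * f y)) :=
    integrable_finsetSum _ fun n _ ↦ integrable_finsetSum _ fun I _ ↦
      ((hi n I).const_mul _).const_mul _
  rw [e1, h2, ← integral_sub h1 hint2]
  -- The expansion is made in the reproducing kernel, not in f; the coefficients are then
  -- convolutions of f with rescaled derivatives of the kernel, bounded by sup|f|.
  have e2 : ∀ y, ks q g (y - (x + z)) * f y - ∑ n ∈ Finset.range (N + 1), ∑ I : Fin n → Fin d,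
      (mono I z : ℂ) * (c n * (ks q (pd I g) (y - x) * f y)) = 2 ^ (q * d) *
      (g ((2 : ℝ) ^ q • (y - x) + -((2 : ℝ) ^ q • z)) -
        taylor (N + 1) g ((2 : ℝ) ^ q • (y - x)) (-((2 : ℝ) ^ q • z))) * f y := by
    intro y
    have e3 : (2 : ℝ) ^ q • (y - (x + z)) = (2 : ℝ) ^ q • (y - x) + -((2 : ℝ) ^ q • z) := by module
    rw [ks, e3, mul_sub, sub_mul]
    congr 1
    rw [taylor, Finset.mul_sum, Finset.sum_mul]
    refine Finset.sum_congr rfl fun n _ ↦ ?_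
    rw [Finset.mul_sum, Finset.mul_sum, Finset.sum_mul]
    refine Finset.sum_congr rfl fun I _ ↦ ?_
    rw [← neg_smul, mono_smul]
    simp only [hc, ks]
    push_cast
    ring
  set s := C₁ * (2 ^ q * ‖z‖) ^ (N + 1) * (1 + 2 ^ q * ‖z‖) ^ (d + 1) with hs
  have hs0 : 0 ≤ s := by positivity
  have hb : ∀ y, ‖ks q g (y - (x + z)) * f y - ∑ n ∈ Finset.range (N + 1), ∑ I : Fin n → Fin d,
      (mono I z : ℂ) * (c n * (ks q (pd I g) (y - x) * f y))‖ₑ ≤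
      ENNReal.ofReal (s * H) * ENNReal.ofReal (jap (d + 1) q (y - x)) := by
    intro y
    rw [e2, ← ENNReal.ofReal_mul (by positivity), ← ofReal_norm]
    apply ENNReal.ofReal_le_ofReal
    have h3 := ht ((2 : ℝ) ^ q • (y - x)) (-((2 : ℝ) ^ q • z))
    rw [norm_neg, norm_smul, norm_smul, norm_pow, Real.norm_two] at h3
    rw [norm_mul, norm_mul, norm_pow, Complex.norm_two, jap]
    calc _ ≤ (2 : ℝ) ^ (q * d) * (s / (1 + 2 ^ q * ‖y - x‖) ^ (d + 1)) * H := by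
          gcongr
          exact hH y
      _ = _ := by ring
  have h4 : ‖∫ y, (ks q g (y - (x + z)) * f y - ∑ n ∈ Finset.range (N + 1), ∑ I : Fin n → Fin d,
      (mono I z : ℂ) * (c n * (ks q (pd I g) (y - x) * f y)))‖ₑ ≤ ENNReal.ofReal (s * H) * C₂ := by
    refine (enorm_integral_le_lintegral_enorm _).trans ((lintegral_mono hb).trans ?_)
    rw [lintegral_const_mul' _ _ ENNReal.ofReal_ne_top]
    gcongr
    exact hC₂ _ _ le_rfl _
  rw [← ofReal_norm, ← ENNReal.ofReal_coe_nnreal, ← ENNReal.ofReal_mul (by positivity),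
    ENNReal.ofReal_le_ofReal_iff (by positivity)] at h4
  refine h4.trans_eq ?_
  rw [hs]; ring

lemma tsum_tail_rpow_le {ρ : ℝ} (hρ : 0 < ρ) {a : ℕ → ℂ} {s : ℂ} (hs : HasSum a s) {H : ℝ}
    (h : ∀ q, ‖a q‖ ≤ H * (2 : ℝ) ^ (-(q : ℝ) * ρ)) (l : ℕ) :
    ‖s - ∑ q ∈ Finset.range (l + 1), a q‖ ≤
      H * (∑' q : ℕ, (2 : ℝ) ^ (-(q : ℝ) * ρ)) * (2 : ℝ) ^ (-(l : ℝ) * ρ) := by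
  have hH : 0 ≤ H := by simpa using (norm_nonneg _).trans (h 0)
  have h1 := (hasSum_nat_add_iff' (l + 1)).2 hs
  have h2 : ∀ q : ℕ, ‖a (q + (l + 1))‖ ≤
      H * (2 : ℝ) ^ (-(l : ℝ) * ρ) * (2 : ℝ) ^ (-(q : ℝ) * ρ) := fun q ↦ by
    refine (h _).trans ?_
    rw [mul_assoc, ← Real.rpow_add (by norm_num)]
    gcongr
    · norm_num
    · push_cast; nlinarith
  have h3 := ((summable_rpow_neg hρ).mul_left (H * (2 : ℝ) ^ (-(l : ℝ) * ρ))).hasSum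
  rw [tsum_mul_left] at h3
  refine (h1.norm_le_of_bounded h3 h2).trans_eq (by ring)

/-- Polynomial approximation of Zygmund functions. -/
lemma exists_poly_approx (P : LPCutoff d) {ρ : ℝ} (hρ : 0 < ρ) {f : Rd d → ℂ} {T : 𝓢'(Rd d, ℂ)}
    (hf : IsFun f T) (hc : Continuous f) (hT : zygNorm P ρ T < ⊤) :
    ∃ N₀ : ℕ, ∀ N, N₀ ≤ N → ∃ C : ℝ, 0 ≤ C ∧
      ∀ (l : ℕ) (x : Rd d), ∃ c : (n : ℕ) → (Fin n → Fin d) → ℂ,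
      (∀ z, ‖f (x + z) - ∑ n ∈ Finset.range (N + 1), ∑ I : Fin n → Fin d, (mono I z : ℂ) * c n I‖ ≤
        C * (2 : ℝ) ^ (-(l : ℝ) * ρ) * (1 + 2 ^ l * ‖z‖) ^ (N + d + 2)) ∧
      (∀ I, ‖c 0 I - f x‖ ≤ C * (2 : ℝ) ^ (-(l : ℝ) * min ρ (1 / 2))) ∧
      (∀ n ∈ Finset.range N, ∀ I, ‖c (n + 1) I‖ ≤
        C * (2 : ℝ) ^ (-(l : ℝ) * min ρ (1 / 2)) * (2 ^ l) ^ (n + 1)) := by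
  obtain ⟨H, hH, ha⟩ := exists_ev_ker_le_of_zygNorm P hT
  -- The Taylor order must exceed ρ: the remainders of the blocks q ≤ l then grow geometrically in
  -- q, and their sum is controlled by q = l.
  obtain ⟨N₀, hN₀⟩ := exists_nat_gt ρ
  refine ⟨N₀, fun N hNN ↦ ?_⟩
  have hN : ρ < N := hN₀.trans_le (by exact_mod_cast hNN)
  -- Being less than 1, ε keeps n + 1 - ε positive, so that the sums defining the nonconstant
  -- coefficients are also controlled by q = l; the value 1/2 has no other meaning.
  set ε := min ρ (1 / 2) with hε
  have hε0 : 0 < ε := by positivity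
  have hερ : ε ≤ ρ := min_le_left _ _
  have hε2 : ε ≤ 1 / 2 := min_le_right _ _
  set g : 𝓢(Rd d, ℂ) := 𝓕 (fat (d := d) 1 one_pos) with hg
  set a : ℕ → Rd d → ℂ := fun q ↦ ev (P.ker q) T with ha_def
  obtain ⟨C₁, hC₁, ht⟩ := exists_band_taylor_le (d := d) N
  have hsum := fun x ↦ P.hasSum_ev_ker hf hc ((summable_rpow_neg hρ).mul_left H) ha x
  have htail := fun x l ↦ tsum_tail_rpow_le hρ (hsum x) (fun q ↦ ha q x) l
  set S := ∑' q : ℕ, (2 : ℝ) ^ (-(q : ℝ) * ρ) with hS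
  have hS0 : 0 ≤ S := tsum_nonneg fun q ↦ by positivity
  obtain ⟨C₂, hC₂, hs2⟩ := exists_sum_rpow_le (δ := N + 1 - ρ) (by linarith)
  choose C₃ hC₃ hs3 using fun n : ℕ ↦ exists_sum_rpow_le (δ := n + 1 - ε)
    (by have : (0 : ℝ) ≤ n := n.cast_nonneg
        linarith)
  choose C₄ hC₄ hs4 using fun (n : ℕ) (I : Fin n → Fin d) ↦ exists_norm_cv_ks_le (pd I g)
  set C₅ := ∑ n ∈ Finset.range N, ∑ I : Fin (n + 1) → Fin d, C₃ n * C₄ (n + 1) I with hC₅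
  have hC₅0 : 0 ≤ C₅ := Finset.sum_nonneg fun n _ ↦ Finset.sum_nonneg fun I _ ↦
    mul_nonneg (hC₃ n) (hC₄ _ I)
  -- The polynomial is the Taylor polynomial at x of the sum of the blocks q ≤ l, that is, of f seen
  -- at scale 2^{-l}. The three parts of the constant come from the blocks q > l, from the Taylor
  -- remainders and from the coefficients.
  refine ⟨H * S + C₁ * H * C₂ + C₅ * H, by positivity, fun l x ↦ ⟨fun n I ↦
    ∑ q ∈ Finset.range (l + 1), ((n.factorial : ℝ)⁻¹ : ℂ) * (-2 ^ q) ^ n * cv (ks q (pd I g)) (a q) x,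
    fun z ↦ ?_, fun I ↦ ?_, fun n hn I ↦ ?_⟩⟩
  · have e1 : ∑ n ∈ Finset.range (N + 1), ∑ I : Fin n → Fin d, (mono I z : ℂ) *
        ∑ q ∈ Finset.range (l + 1), ((n.factorial : ℝ)⁻¹ : ℂ) * (-2 ^ q) ^ n *
          cv (ks q (pd I g)) (a q) x = ∑ q ∈ Finset.range (l + 1), ∑ n ∈ Finset.range (N + 1),
        ∑ I : Fin n → Fin d, (mono I z : ℂ) * (((n.factorial : ℝ)⁻¹ : ℂ) * (-2 ^ q) ^ n *
          cv (ks q (pd I g)) (a q) x) := by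
      simp_rw [Finset.mul_sum]
      rw [Finset.sum_comm' (s := Finset.range (l + 1)) (t := fun _ ↦ Finset.range (N + 1))
        (t' := Finset.range (N + 1)) (s' := fun _ ↦ Finset.range (l + 1)) (by tauto)]
      exact Finset.sum_congr rfl fun n _ ↦ Finset.sum_comm
    rw [e1]
    set s := 1 + 2 ^ l * ‖z‖ with hs
    have hs1 : 1 ≤ s := by rw [hs]; have : 0 ≤ 2 ^ l * ‖z‖ := by positivity
                           linarith
    have h1 : ∀ q ∈ Finset.range (l + 1), ‖a q (x + z) - ∑ n ∈ Finset.range (N + 1),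
        ∑ I : Fin n → Fin d, (mono I z : ℂ) * (((n.factorial : ℝ)⁻¹ : ℂ) * (-2 ^ q) ^ n *
          cv (ks q (pd I g)) (a q) x)‖ ≤ C₁ * H * (2 : ℝ) ^ (-(l : ℝ) * (N + 1)) *
            s ^ (N + d + 2) * (2 : ℝ) ^ ((q : ℝ) * (N + 1 - ρ)) := by
      intro q hq
      have hql : q ≤ l := Nat.lt_succ_iff.1 (Finset.mem_range.1 hq)
      refine (ht q (a q) _ (P.band_ker q T) (ha q) x z).trans ?_
      have h2 : (2 : ℝ) ^ q * ‖z‖ ≤ s := by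
        have : (2 : ℝ) ^ q * ‖z‖ ≤ 2 ^ l * ‖z‖ := by gcongr; norm_num
        linarith
      have h2' : 1 + (2 : ℝ) ^ q * ‖z‖ ≤ s := by
        have : (2 : ℝ) ^ q * ‖z‖ ≤ 2 ^ l * ‖z‖ := by gcongr; norm_num
        linarith
      have h3 : (2 : ℝ) ^ q * ‖z‖ ≤ (2 : ℝ) ^ ((q : ℝ) - l) * s := by
        rw [Real.rpow_sub (by norm_num), Real.rpow_natCast, Real.rpow_natCast, div_mul_eq_mul_div,
          mul_div_assoc]
        gcongr
        rw [le_div_iff₀ (by positivity)]; linarith [mul_comm ‖z‖ (2 ^ l)]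
      calc _ ≤ C₁ * (H * (2 : ℝ) ^ (-(q : ℝ) * ρ)) * ((2 : ℝ) ^ ((q : ℝ) - l) * s) ^ (N + 1) *
            s ^ (d + 1) := by gcongr
        _ = C₁ * H * s ^ (N + d + 2) * ((2 : ℝ) ^ (-(q : ℝ) * ρ) *
            (2 : ℝ) ^ (((q : ℝ) - l) * (N + 1 : ℕ))) := by
          rw [Real.rpow_mul_natCast (by norm_num)]; ring
        _ = C₁ * H * s ^ (N + d + 2) * ((2 : ℝ) ^ (-(l : ℝ) * (N + 1)) *
            (2 : ℝ) ^ ((q : ℝ) * (N + 1 - ρ))) := by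
          rw [← Real.rpow_add (by norm_num), ← Real.rpow_add (by norm_num)]
          congr 2; push_cast; ring
        _ = _ := by ring
    have h2 : ‖∑ q ∈ Finset.range (l + 1), a q (x + z) - ∑ q ∈ Finset.range (l + 1),
        ∑ n ∈ Finset.range (N + 1), ∑ I : Fin n → Fin d, (mono I z : ℂ) *
        (((n.factorial : ℝ)⁻¹ : ℂ) * (-2 ^ q) ^ n * cv (ks q (pd I g)) (a q) x)‖ ≤
        C₁ * H * C₂ * (2 : ℝ) ^ (-(l : ℝ) * ρ) * s ^ (N + d + 2) := by
      rw [← Finset.sum_sub_distrib]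
      refine (norm_sum_le_of_le _ h1).trans ?_
      rw [← Finset.mul_sum]
      calc _ ≤ C₁ * H * (2 : ℝ) ^ (-(l : ℝ) * (N + 1)) * s ^ (N + d + 2) *
            (C₂ * (2 : ℝ) ^ ((l : ℝ) * (N + 1 - ρ))) := by gcongr; exact hs2 l
        _ = C₁ * H * C₂ * ((2 : ℝ) ^ (-(l : ℝ) * (N + 1)) * (2 : ℝ) ^ ((l : ℝ) * (N + 1 - ρ))) *
            s ^ (N + d + 2) := by ring
        _ = _ := by rw [← Real.rpow_add (by norm_num)]; congr 3; ring
    have h3 : H * S * (2 : ℝ) ^ (-(l : ℝ) * ρ) ≤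
        H * S * (2 : ℝ) ^ (-(l : ℝ) * ρ) * s ^ (N + d + 2) :=
      le_mul_of_one_le_right (by positivity) (one_le_pow₀ hs1)
    have h4 : 0 ≤ C₅ * H * (2 : ℝ) ^ (-(l : ℝ) * ρ) * s ^ (N + d + 2) := by positivity
    have := norm_sub_le_norm_sub_add_norm_sub (f (x + z))
      (∑ q ∈ Finset.range (l + 1), a q (x + z)) (∑ q ∈ Finset.range (l + 1),
        ∑ n ∈ Finset.range (N + 1), ∑ I : Fin n → Fin d, (mono I z : ℂ) *
        (((n.factorial : ℝ)⁻¹ : ℂ) * (-2 ^ q) ^ n * cv (ks q (pd I g)) (a q) x))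
    have := htail (x + z) l
    have h6 := norm_sub_rev (f (x + z)) (∑ q ∈ Finset.range (l + 1), a q (x + z))
    rw [add_mul, add_mul, add_mul, add_mul]
    linarith
  · have e1 : ∑ q ∈ Finset.range (l + 1), (((0 : ℕ).factorial : ℝ)⁻¹ : ℂ) * (-2 ^ q) ^ 0 *
        cv (ks q (pd I g)) (a q) x = ∑ q ∈ Finset.range (l + 1), a q x := by
      refine Finset.sum_congr rfl fun q _ ↦ ?_
      have : pd I g = g := by simp [pd]
      rw [this, show a q x = _ from ((P.band_ker q T).eq 1 one_pos x).2]
      simp only [Nat.factorial_zero, Nat.cast_one, Complex.ofReal_one, inv_one, pow_zero, one_mul]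
      rfl
    change ‖∑ q ∈ Finset.range (l + 1), (((0 : ℕ).factorial : ℝ)⁻¹ : ℂ) * (-2 ^ q) ^ 0 *
        cv (ks q (pd I g)) (a q) x - f x‖ ≤ _
    rw [e1, norm_sub_rev]
    calc _ ≤ H * S * (2 : ℝ) ^ (-(l : ℝ) * ρ) := htail x l
      _ ≤ H * S * (2 : ℝ) ^ (-(l : ℝ) * ε) := by
        refine mul_le_mul_of_nonneg_left (Real.rpow_le_rpow_of_exponent_le (by norm_num) ?_)
          (by positivity)
        have : (0 : ℝ) ≤ l := l.cast_nonneg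
        nlinarith
      _ ≤ _ := by
        gcongr
        have : 0 ≤ C₁ * H * C₂ := by positivity
        have : 0 ≤ C₅ * H := by positivity
        linarith
  · have hfac : ‖(((n + 1).factorial : ℝ)⁻¹ : ℂ)‖ ≤ 1 := by
      rw [norm_inv]
      refine inv_le_one_of_one_le₀ ?_
      rw [Complex.norm_real, Real.norm_natCast]
      exact_mod_cast Nat.factorial_pos (n + 1)
    have h1 : ∀ q ∈ Finset.range (l + 1), ‖(((n + 1).factorial : ℝ)⁻¹ : ℂ) * (-2 ^ q) ^ (n + 1) *
        cv (ks q (pd I g)) (a q) x‖ ≤ C₄ (n + 1) I * H * (2 : ℝ) ^ ((q : ℝ) * (n + 1 - ε)) := by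
      intro q _
      rw [norm_mul, norm_mul]
      calc _ ≤ 1 * ((2 : ℝ) ^ q) ^ (n + 1) * (C₄ (n + 1) I * (H * (2 : ℝ) ^ (-(q : ℝ) * ρ))) := by
            refine mul_le_mul (mul_le_mul hfac ?_ (norm_nonneg _) zero_le_one)
              (hs4 _ I q (a q) _ (ha q) x) (norm_nonneg _) (by positivity)
            simp
        _ = C₄ (n + 1) I * H * ((2 : ℝ) ^ ((q : ℝ) * (n + 1 : ℕ)) * (2 : ℝ) ^ (-(q : ℝ) * ρ)) := by
            rw [Real.rpow_mul_natCast (by norm_num), Real.rpow_natCast]; ring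
        _ = C₄ (n + 1) I * H * ((2 : ℝ) ^ ((q : ℝ) * (n + 1 - ρ))) := by
            rw [← Real.rpow_add (by norm_num)]; congr 2; push_cast; ring
        _ ≤ _ := by
            have := hC₄ _ I
            gcongr
            norm_num
    refine (norm_sum_le_of_le _ h1).trans ?_
    rw [← Finset.mul_sum]
    have h5 : C₃ n * C₄ (n + 1) I ≤ C₅ :=
      (Finset.single_le_sum (f := fun I ↦ C₃ n * C₄ (n + 1) I) (fun I _ ↦
        mul_nonneg (hC₃ n) (hC₄ _ I)) (Finset.mem_univ I)).trans
      (Finset.single_le_sum (f := fun n ↦ ∑ I : Fin (n + 1) → Fin d, C₃ n * C₄ (n + 1) I)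
        (fun n _ ↦ Finset.sum_nonneg fun I _ ↦ mul_nonneg (hC₃ n) (hC₄ _ I)) hn)
    have := hC₄ _ I
    calc _ ≤ C₄ (n + 1) I * H * (C₃ n * (2 : ℝ) ^ ((l : ℝ) * (n + 1 - ε))) := by
          gcongr; exact hs3 n l
      _ = C₃ n * C₄ (n + 1) I * H * ((2 : ℝ) ^ (-(l : ℝ) * ε) * (2 : ℝ) ^ ((l : ℝ) * (n + 1 : ℕ))) := by
          rw [← Real.rpow_add (by norm_num),
            show -(l : ℝ) * ε + l * (n + 1 : ℕ) = (l : ℝ) * (n + 1 - ε) by push_cast; ring]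
          ring
      _ ≤ C₅ * H * ((2 : ℝ) ^ (-(l : ℝ) * ε) * (2 : ℝ) ^ ((l : ℝ) * (n + 1 : ℕ))) := by gcongr
      _ ≤ (H * S + C₁ * H * C₂ + C₅ * H) *
          ((2 : ℝ) ^ (-(l : ℝ) * ε) * (2 : ℝ) ^ ((l : ℝ) * (n + 1 : ℕ))) := by
          gcongr
          have : 0 ≤ C₁ * H * C₂ := by positivity
          have : 0 ≤ H * S := by positivity
          linarith
      _ = _ := by rw [Real.rpow_mul_natCast (by norm_num), Real.rpow_natCast]; ring

/-! ### Approximation of Zygmund maps -/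

lemma exists_bound_of_zygNorm (P : LPCutoff d) {ρ : ℝ} (hρ : 0 < ρ) {f : Rd d → ℂ} {T : 𝓢'(Rd d, ℂ)}
    (hf : IsFun f T) (hc : Continuous f) (hT : zygNorm P ρ T < ⊤) : ∃ B : ℝ, ∀ x, ‖f x‖ ≤ B := by
  obtain ⟨H, hH, ha⟩ := exists_ev_ker_le_of_zygNorm P hT
  have hs := (summable_rpow_neg hρ).mul_left H
  exact ⟨_, fun x ↦ (P.hasSum_ev_ker hf hc hs ha x).norm_le_of_bounded hs.hasSum fun q ↦ ha q x⟩

/-- The polynomial approximations of the partial derivatives are integrated along the segment from x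
to x + z; integrating t^n produces the denominators n + 1. The exact derivative at x is taken out
separately. This leaves in Q the constant terms, which are only close to the gradient, and the
higher terms, all of size 2^{-l(1+ε)} at distance 2^{-l}. The extra factor ‖z‖ accounts for the gain
of one order. -/
lemma exists_poly_approx_primitive (P : LPCutoff d) {ρ : ℝ} (hρ : 0 < ρ) {F : Rd d → ℝ}
    (hF : ContDiff ℝ 1 F) (h : ∀ j, ∃ T : 𝓢'(Rd d, ℂ),
      IsFun (fun x ↦ ((fderiv ℝ F x (e j) : ℝ) : ℂ)) T ∧ zygNorm P ρ T < ⊤) :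
    ∃ L₀ : ℕ, ∀ L, L₀ ≤ L → ∃ C : ℝ, 0 ≤ C ∧ ∀ (l : ℕ) (x : Rd d), ∃ Q : Rd d → ℝ, IsPoly Q ∧
      (∀ z, |Q z| ≤ C * (2 : ℝ) ^ (-(l : ℝ) * (1 + min ρ (1 / 2))) * (1 + 2 ^ l * ‖z‖) ^ L) ∧
      ∀ z, |F (x + z) - F x - fderiv ℝ F x z - Q z| ≤
        C * (2 : ℝ) ^ (-(l : ℝ) * (1 + ρ)) * (1 + 2 ^ l * ‖z‖) ^ L := by
  set ε := min ρ (1 / 2)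
  choose T hT hT' using h
  have hcont : ∀ j, Continuous fun x ↦ fderiv ℝ F x (e j) := fun j ↦
    (hF.continuous_fderiv (by norm_num)).clm_apply continuous_const
  choose N₀ hN₀ using fun j ↦ exists_poly_approx P hρ (hT j)
    (Complex.continuous_ofReal.comp (hcont j)) (hT' j)
  set N := ∑ j, N₀ j
  choose C hC hc using fun j ↦ hN₀ j N (Finset.single_le_sum (fun _ _ ↦ Nat.zero_le _) (Finset.mem_univ j))
  set D : ℝ := ∑ n ∈ Finset.range N, (d : ℝ) ^ (n + 1) with hD
  have hD0 : 0 ≤ D := by positivity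
  set C' := ∑ j, C j with hC'
  have hC'0 : 0 ≤ C' := Finset.sum_nonneg fun j _ ↦ hC j
  refine ⟨N + d + 3, fun L hL ↦ ⟨C' * (1 + D), by positivity, fun l x ↦ ?_⟩⟩
  choose c h1 h2 h3 using fun j ↦ hc j l x
  set p : Fin d → Rd d → ℝ := fun j z ↦ ∑ n ∈ Finset.range (N + 1), ∑ I : Fin n → Fin d,
    mono I z * ((c j n I).re / (n + 1)) with hp
  set r : Fin d → Rd d → ℝ := fun j z ↦ ∑ n ∈ Finset.range (N + 1), ∑ I : Fin n → Fin d,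
    mono I z * (c j n I).re with hr
  have hs : ∀ z : Rd d, 1 ≤ 1 + 2 ^ l * ‖z‖ := fun z ↦ le_add_of_nonneg_right (by positivity)
  have hzs : ∀ z : Rd d, ‖z‖ ≤ (2 : ℝ) ^ (-(l : ℝ)) * (1 + 2 ^ l * ‖z‖) := fun z ↦ by
    have : (2 : ℝ) ^ (-(l : ℝ)) * 2 ^ l = 1 := by
      rw [← Real.rpow_natCast, ← Real.rpow_add (by norm_num)]; simp
    rw [mul_add, ← mul_assoc, this, one_mul]
    exact le_add_of_nonneg_left (by positivity)
  refine ⟨fun z ↦ ∑ j, z j * (p j z - fderiv ℝ F x (e j)), ?_, fun z ↦ ?_, fun z ↦ ?_⟩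
  · refine IsPoly.sum _ fun j ↦ (IsPoly.coord j).mul ?_
    simp_rw [sub_eq_add_neg]
    refine IsPoly.add (IsPoly.sum _ fun n ↦ IsPoly.sum _ fun I ↦ ?_) (IsPoly.const _)
    exact (IsPoly.prod _ fun k ↦ IsPoly.coord _).mul (IsPoly.const _)
  · have h4 : ∀ j, |p j z - fderiv ℝ F x (e j)| ≤
        C j * (2 : ℝ) ^ (-(l : ℝ) * ε) * (1 + D) * (1 + 2 ^ l * ‖z‖) ^ N := by
      intro j
      have e1 : p j z = (c j 0 default).re + ∑ n ∈ Finset.range N, ∑ I : Fin (n + 1) → Fin d,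
          mono I z * ((c j (n + 1) I).re / (n + 1 + 1)) := by
        simp only [hp]
        rw [Finset.sum_range_succ', add_comm]
        congr 1
        · simp [mono]
        · push_cast; rfl
      rw [e1, add_sub_right_comm, add_comm]
      have h5 : |(c j 0 default).re - fderiv ℝ F x (e j)| ≤ C j * (2 : ℝ) ^ (-(l : ℝ) * ε) := by
        refine le_trans ?_ (h2 j default)
        refine le_trans (le_of_eq ?_) (Complex.abs_re_le_norm _)
        simp
      have h6 : ∀ n ∈ Finset.range N, |∑ I : Fin (n + 1) → Fin d,
          mono I z * ((c j (n + 1) I).re / (n + 1 + 1))| ≤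
          C j * (2 : ℝ) ^ (-(l : ℝ) * ε) * (1 + 2 ^ l * ‖z‖) ^ N * (d : ℝ) ^ (n + 1) := by
        intro n hn
        refine (Finset.abs_sum_le_sum_abs _ _).trans ?_
        have h7 : ∀ I ∈ Finset.univ (α := Fin (n + 1) → Fin d),
            |mono I z * ((c j (n + 1) I).re / (n + 1 + 1))| ≤
            C j * (2 : ℝ) ^ (-(l : ℝ) * ε) * (1 + 2 ^ l * ‖z‖) ^ N := by
          intro I _
          rw [abs_mul, abs_div]
          have h8 : |(c j (n + 1) I).re| / |(n + 1 + 1 : ℝ)| ≤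
              C j * (2 : ℝ) ^ (-(l : ℝ) * ε) * (2 ^ l) ^ (n + 1) := by
            refine (div_le_self (abs_nonneg _) ?_).trans
              ((Complex.abs_re_le_norm _).trans (h3 j n hn I))
            rw [abs_of_nonneg (by positivity)]
            have : (0 : ℝ) ≤ n := n.cast_nonneg
            linarith
          have hCj := hC j
          calc _ ≤ ‖z‖ ^ (n + 1) * (C j * (2 : ℝ) ^ (-(l : ℝ) * ε) * (2 ^ l) ^ (n + 1)) :=
                mul_le_mul (abs_mono_le I z) h8 (by positivity) (by positivity)
            _ = C j * (2 : ℝ) ^ (-(l : ℝ) * ε) * (2 ^ l * ‖z‖) ^ (n + 1) := by ring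
            _ ≤ C j * (2 : ℝ) ^ (-(l : ℝ) * ε) * (1 + 2 ^ l * ‖z‖) ^ (n + 1) := by
              gcongr; linarith
            _ ≤ _ := by
              have := Finset.mem_range.1 hn
              gcongr
              · exact hs z
              · omega
        refine (Finset.sum_le_sum h7).trans (le_of_eq ?_)
        simp; ring
      have h9 := (Finset.abs_sum_le_sum_abs _ _).trans (Finset.sum_le_sum h6)
      rw [← Finset.mul_sum, ← hD] at h9
      have h10 : C j * (2 : ℝ) ^ (-(l : ℝ) * ε) ≤
          C j * (2 : ℝ) ^ (-(l : ℝ) * ε) * (1 + 2 ^ l * ‖z‖) ^ N :=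
        le_mul_of_one_le_right (mul_nonneg (hC j) (by positivity)) (one_le_pow₀ (hs z))
      have := abs_add_le (∑ n ∈ Finset.range N, ∑ I : Fin (n + 1) → Fin d,
          mono I z * ((c j (n + 1) I).re / (n + 1 + 1))) ((c j 0 default).re - fderiv ℝ F x (e j))
      linarith
    calc _ ≤ ∑ j, |z j * (p j z - fderiv ℝ F x (e j))| := Finset.abs_sum_le_sum_abs _ _
      _ ≤ ∑ j, C j * ((2 : ℝ) ^ (-(l : ℝ)) * (1 + 2 ^ l * ‖z‖) *
          ((2 : ℝ) ^ (-(l : ℝ) * ε) * (1 + D) * (1 + 2 ^ l * ‖z‖) ^ N)) := by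
        refine Finset.sum_le_sum fun j _ ↦ ?_
        rw [abs_mul]
        calc _ ≤ ((2 : ℝ) ^ (-(l : ℝ)) * (1 + 2 ^ l * ‖z‖)) *
              (C j * (2 : ℝ) ^ (-(l : ℝ) * ε) * (1 + D) * (1 + 2 ^ l * ‖z‖) ^ N) :=
            mul_le_mul ((abs_coord_le z j).trans (hzs z)) (h4 j) (abs_nonneg _) (by positivity)
          _ = _ := by ring
      _ = C' * (1 + D) * ((2 : ℝ) ^ (-(l : ℝ)) * (2 : ℝ) ^ (-(l : ℝ) * ε)) *
          (1 + 2 ^ l * ‖z‖) ^ (N + 1) := by rw [← Finset.sum_mul]; ring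
      _ ≤ _ := by
        rw [← Real.rpow_add (by norm_num), show -(l : ℝ) + -l * ε = -l * (1 + ε) by ring]
        gcongr
        · exact hs z
        · omega
  · set M := C' * (2 : ℝ) ^ (-(l : ℝ) * (1 + ρ)) * (1 + 2 ^ l * ‖z‖) ^ (N + d + 3) with hM
    -- G vanishes at 0 and is the error at 1. Its derivative only involves the errors of the
    -- approximations r of the gradient along z, since t p_j(tz) has derivative r_j(tz); the r_j
    -- need not form a gradient field.
    set G : ℝ → ℝ := fun t ↦ F (x + t • z) - F x - t * fderiv ℝ F x z -
      ∑ j, (t * z j) * (p j (t • z) - fderiv ℝ F x (e j)) with hG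
    have hlin : ∀ y, fderiv ℝ F y z = ∑ j, z j * fderiv ℝ F y (e j) := fun y ↦ by
      conv_lhs => rw [sum_coord z, map_sum]
      simp
    have hder : ∀ t : ℝ, HasDerivAt G (∑ j, z j * (fderiv ℝ F (x + t • z) (e j) - r j (t • z))) t := by
      intro t
      have d1 : HasDerivAt (fun t : ℝ ↦ F (x + t • z)) (fderiv ℝ F (x + t • z) z) t := by
        have := ((hF.differentiable (by norm_num)) (x + t • z)).hasFDerivAt.comp_hasDerivAt t
          (((hasDerivAt_id t).smul_const z).const_add x)
        exact this.congr_deriv (by simp)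
      have d2 : ∀ j, HasDerivAt (fun t : ℝ ↦ (t * z j) * (p j (t • z) - fderiv ℝ F x (e j)))
          (z j * (r j (t • z) - fderiv ℝ F x (e j))) t := by
        intro j
        have e2 : (fun t : ℝ ↦ (t * z j) * (p j (t • z) - fderiv ℝ F x (e j))) = fun t ↦
            ∑ n ∈ Finset.range (N + 1), ∑ I : Fin n → Fin d,
              t ^ (n + 1) * (z j * mono I z * ((c j n I).re / (n + 1))) -
                t * (z j * fderiv ℝ F x (e j)) := by
          funext t
          rw [mul_sub, hp]
          simp only [mono_smul, Finset.mul_sum]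
          congr 1
          · exact Finset.sum_congr rfl fun n _ ↦ Finset.sum_congr rfl fun I _ ↦ by ring
          · ring
        rw [e2, show z j * (r j (t • z) - fderiv ℝ F x (e j)) = ∑ n ∈ Finset.range (N + 1),
          ∑ I : Fin n → Fin d, ((n + 1 : ℕ) * t ^ n) * (z j * mono I z * ((c j n I).re / (n + 1))) -
          1 * (z j * fderiv ℝ F x (e j)) by
            rw [mul_sub, hr]
            simp only [mono_smul, Finset.mul_sum, one_mul]
            congr 1
            refine Finset.sum_congr rfl fun n _ ↦ Finset.sum_congr rfl fun I _ ↦ ?_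
            have : (n : ℝ) + 1 ≠ 0 := by positivity
            push_cast; field_simp]
        refine HasDerivAt.fun_sub (HasDerivAt.fun_sum fun n _ ↦ HasDerivAt.fun_sum fun I _ ↦ ?_)
          ((hasDerivAt_id t).mul_const _)
        exact (by simpa using hasDerivAt_pow (n + 1) t :
          HasDerivAt (fun t : ℝ ↦ t ^ (n + 1)) ((n + 1 : ℕ) * t ^ n) t).mul_const _
      have := ((d1.sub_const (F x)).sub ((hasDerivAt_id t).mul_const (fderiv ℝ F x z))).sub
        (HasDerivAt.fun_sum (u := Finset.univ) fun j _ ↦ d2 j)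
      refine this.congr_deriv ?_
      rw [hlin, hlin, one_mul, ← Finset.sum_sub_distrib, ← Finset.sum_sub_distrib]
      exact Finset.sum_congr rfl fun j _ ↦ by ring
    have hbd : ∀ t ∈ Set.Ico (0 : ℝ) 1, ‖∑ j, z j * (fderiv ℝ F (x + t • z) (e j) - r j (t • z))‖ ≤ M := by
      intro t ht
      have hj : ∀ j ∈ Finset.univ, ‖z j * (fderiv ℝ F (x + t • z) (e j) - r j (t • z))‖ ≤
          C j * ((2 : ℝ) ^ (-(l : ℝ)) * (1 + 2 ^ l * ‖z‖) *
            ((2 : ℝ) ^ (-(l : ℝ) * ρ) * (1 + 2 ^ l * ‖z‖) ^ (N + d + 2))) := by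
        intro j _
        have h5 : |fderiv ℝ F (x + t • z) (e j) - r j (t • z)| ≤
            C j * (2 : ℝ) ^ (-(l : ℝ) * ρ) * (1 + 2 ^ l * ‖z‖) ^ (N + d + 2) := by
          calc _ ≤ C j * (2 : ℝ) ^ (-(l : ℝ) * ρ) * (1 + 2 ^ l * ‖t • z‖) ^ (N + d + 2) := by
                refine le_trans (le_trans (le_of_eq ?_) (Complex.abs_re_le_norm _)) (h1 j (t • z))
                simp [hr, Complex.re_sum]
            _ ≤ _ := by
                have := hC j
                gcongr
                rw [norm_smul, Real.norm_of_nonneg ht.1]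
                exact mul_le_of_le_one_left (norm_nonneg _) ht.2.le
        rw [norm_mul]
        calc _ ≤ ((2 : ℝ) ^ (-(l : ℝ)) * (1 + 2 ^ l * ‖z‖)) *
              (C j * (2 : ℝ) ^ (-(l : ℝ) * ρ) * (1 + 2 ^ l * ‖z‖) ^ (N + d + 2)) :=
            mul_le_mul ((abs_coord_le z j).trans (hzs z)) h5 (abs_nonneg _) (by positivity)
          _ = _ := by ring
      refine (norm_sum_le_of_le _ hj).trans (le_of_eq ?_)
      rw [← Finset.sum_mul, hM, show -(l : ℝ) * (1 + ρ) = -(l : ℝ) + -l * ρ by ring,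
        Real.rpow_add (by norm_num)]
      ring
    have := norm_image_sub_le_of_norm_deriv_le_segment' (f := G) (a := 0) (b := 1) (C := M)
      (fun t _ ↦ (hder t).hasDerivWithinAt) hbd 1 (by simp)
    have e3 : G 1 - G 0 = F (x + z) - F x - fderiv ℝ F x z -
        ∑ j, z j * (p j z - fderiv ℝ F x (e j)) := by simp [hG]
    rw [e3, sub_zero, mul_one, Real.norm_eq_abs] at this
    refine this.trans ?_
    calc M ≤ C' * (1 + D) * (2 : ℝ) ^ (-(l : ℝ) * (1 + ρ)) * (1 + 2 ^ l * ‖z‖) ^ (N + d + 3) := by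
          rw [hM]; gcongr; nlinarith
      _ ≤ _ := by
          gcongr
          exact hs z

section Map

variable {P : LPCutoff d} {ρ : ℝ} {χ : Rd d → Rd d}

lemma fderiv_coord (h : ContDiff ℝ 1 χ) (i : Fin d) (x v : Rd d) :
    fderiv ℝ (fun x ↦ χ x i) x v = fderiv ℝ χ x v i := by
  have h1 := (EuclideanSpace.proj (𝕜 := ℝ) i).hasFDerivAt.comp x
    ((h.differentiable (by norm_num)) x).hasFDerivAt
  have h2 : fderiv ℝ (fun x ↦ χ x i) x = _ := h1.fderiv
  rw [h2]; rfl

lemma contDiff_coord (h : ContDiff ℝ 1 χ) (i : Fin d) : ContDiff ℝ 1 fun x ↦ χ x i :=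
  (EuclideanSpace.proj (𝕜 := ℝ) i).contDiff.comp h

theorem IsZygmundMap.app (hρ : 0 < ρ) (h : IsZygmundMap P ρ χ) : App ρ χ (fderiv ℝ χ) := by
  have h0 : ∀ i, _ := fun i ↦ exists_poly_approx_primitive P hρ (contDiff_coord h.contDiff i) fun j ↦ by
    simp_rw [fderiv_coord h.contDiff]
    exact h.deriv i j
  choose L₀ hL₀ using h0
  choose C hC hc using fun i ↦ hL₀ i (∑ j, L₀ j)
    (Finset.single_le_sum (fun _ _ ↦ Nat.zero_le _) (Finset.mem_univ i))
  refine ⟨min ρ (1 / 2), ∑ i, C i, ∑ j, L₀ j, by positivity, Finset.sum_nonneg fun i _ ↦ hC i,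
    fun l x ↦ ?_⟩
  choose Q h1 h2 h3 using fun i ↦ hc i l x
  refine ⟨fun z ↦ WithLp.toLp 2 fun i ↦ Q i z, h1, fun z ↦ ?_, fun z ↦ ?_⟩
  · refine (norm_le_sum_coord _).trans ((Finset.sum_le_sum fun i _ ↦ h2 i z).trans (le_of_eq ?_))
    rw [Finset.sum_mul, Finset.sum_mul]
  · rw [Finset.sum_mul, Finset.sum_mul]
    refine (norm_le_sum_coord _).trans (Finset.sum_le_sum fun i _ ↦ ?_)
    simpa [fderiv_coord h.contDiff] using h3 i z

/-- Polynomial approximations compose, since χ' is Lipschitz and polynomials are closed under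
substitution. Thus χ' ∘ χ is handled without estimating its derivative in a Zygmund space. -/
lemma App.comp {ρ' : ℝ} {χ' : Rd d → Rd d} {A A' : Rd d → Rd d →L[ℝ] Rd d} (h : App ρ χ A)
    (h' : App ρ' χ' A') {B B' : ℝ} (hB : ∀ x, ‖A x‖ ≤ B) (hB' : ∀ x, ‖A' x‖ ≤ B')
    (hL : ∀ x y, ‖χ' x - χ' y‖ ≤ B' * ‖x - y‖) :
    App (min ρ ρ') (χ' ∘ χ) fun x ↦ (A' (χ x)).comp (A x) := by
  obtain ⟨ε, C, L, hε, hC, H⟩ := h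
  obtain ⟨ε', C', L', hε', hC', H'⟩ := h'
  have hB0 : 0 ≤ B := (norm_nonneg _).trans (hB 0)
  have hB'0 : 0 ≤ B' := (norm_nonneg _).trans (hB' 0)
  refine ⟨min ε ε', B' * C + C' * (1 + B + C) ^ L', L + (L + 1) * L', by positivity, by positivity,
    fun l x ↦ ?_⟩
  obtain ⟨Q, h1, h2, h3⟩ := H l x
  obtain ⟨Q', h1', h2', h3'⟩ := H' l (χ x)
  have hpw : ∀ a b : ℝ, a ≤ b → (2 : ℝ) ^ (-(l : ℝ) * b) ≤ (2 : ℝ) ^ (-(l : ℝ) * a) := fun a b hab ↦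
    Real.rpow_le_rpow_of_exponent_le (by norm_num) (by nlinarith [(l.cast_nonneg : (0 : ℝ) ≤ l)])
  have hs : ∀ z : Rd d, 1 ≤ 1 + 2 ^ l * ‖z‖ := fun z ↦ le_add_of_nonneg_right (by positivity)
  have hlin : ∀ (T : Rd d →L[ℝ] Rd d) v i, T v i = ∑ j, v j * T (e j) i := fun T v i ↦ by
    conv_lhs => rw [sum_coord v, map_sum]
    simp
  have hw : ∀ z, 1 + 2 ^ l * ‖A x z + Q z‖ ≤ (1 + B + C) * (1 + 2 ^ l * ‖z‖) ^ (L + 1) := by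
    intro z
    set s := 1 + 2 ^ l * ‖z‖ with hs'
    have e1 : (2 : ℝ) ^ l * (2 : ℝ) ^ (-(l : ℝ) * (1 + ε)) ≤ 1 := by
      rw [← Real.rpow_natCast, ← Real.rpow_add (by norm_num)]
      exact Real.rpow_le_one_of_one_le_of_nonpos (by norm_num)
        (by nlinarith [(l.cast_nonneg : (0 : ℝ) ≤ l)])
    have e2 : ‖A x z + Q z‖ ≤ B * ‖z‖ + C * (2 : ℝ) ^ (-(l : ℝ) * (1 + ε)) * s ^ L :=
      (norm_add_le _ _).trans (add_le_add ((A x).le_of_opNorm_le (hB x) z) (h2 z))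
    have e3 : s ^ L ≤ s ^ (L + 1) := pow_le_pow_right₀ (hs z) (by omega)
    have e4 : s ≤ s ^ (L + 1) := le_self_pow₀ (hs z) (by omega)
    have e5 : 1 ≤ s := hs z
    calc _ ≤ 1 + 2 ^ l * (B * ‖z‖ + C * (2 : ℝ) ^ (-(l : ℝ) * (1 + ε)) * s ^ L) := by gcongr
      _ = 1 + B * (s - 1) + C * (2 ^ l * (2 : ℝ) ^ (-(l : ℝ) * (1 + ε))) * s ^ L := by
        rw [hs']; ring
      _ ≤ s ^ (L + 1) + B * s ^ (L + 1) + C * 1 * s ^ (L + 1) := by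
        gcongr <;> linarith
      _ = _ := by ring
  -- Inserting χ(x+z) - χ(x) ≈ A(x)z + Q(z) into the expansion of χ' at χ(x) gives, besides the
  -- composed linear part, the image of Q under A'(χ x) and the composed polynomial Q'. Both are
  -- small of order 1 + min(ε, ε'), and the powers of 1 + 2^l‖z‖ add up to L + (L + 1)L'.
  refine ⟨fun z ↦ A' (χ x) (Q z) + Q' (A x z + Q z), fun i ↦ ?_, fun z ↦ ?_, fun z ↦ ?_⟩
  · refine IsPoly.add (p := fun z ↦ A' (χ x) (Q z) i) (q := fun z ↦ Q' (A x z + Q z) i) ?_ ?_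
    · rw [show (fun z ↦ A' (χ x) (Q z) i) = _ from funext fun z ↦ hlin (A' (χ x)) (Q z) i]
      exact IsPoly.sum _ fun j ↦ (h1 j).mul (.const _)
    · refine (h1' i).comp (Q := fun z ↦ A x z + Q z) fun i ↦ ?_
      refine IsPoly.add (p := fun z ↦ A x z i) ?_ (h1 i)
      rw [show (fun z ↦ A x z i) = _ from funext fun z ↦ hlin (A x) z i]
      exact IsPoly.sum _ fun j ↦ (IsPoly.coord j).mul (.const _)
  · have e1 : ‖A' (χ x) (Q z)‖ ≤ B' * (C * (2 : ℝ) ^ (-(l : ℝ) * (1 + min ε ε')) *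
        (1 + 2 ^ l * ‖z‖) ^ (L + (L + 1) * L')) := by
      refine ((A' (χ x)).le_of_opNorm_le (hB' _) _).trans (mul_le_mul_of_nonneg_left ?_ hB'0)
      refine (h2 z).trans ?_
      gcongr ?_ * ?_ * ?_
      · exact hpw _ _ (by simp)
      · exact pow_le_pow_right₀ (hs z) (by omega)
    have e2 : ‖Q' (A x z + Q z)‖ ≤ C' * (2 : ℝ) ^ (-(l : ℝ) * (1 + min ε ε')) *
        ((1 + B + C) ^ L' * (1 + 2 ^ l * ‖z‖) ^ (L + (L + 1) * L')) := by
      refine (h2' _).trans ?_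
      gcongr ?_ * ?_ * ?_
      · exact hpw _ _ (by simp)
      · refine (pow_le_pow_left₀ (by positivity) (hw z) L').trans ?_
        rw [mul_pow, ← pow_mul]
        gcongr ?_ * ?_
        exact pow_le_pow_right₀ (hs z) (by omega)
    refine (norm_add_le _ _).trans ((add_le_add e1 e2).trans_eq (by ring))
  · have e1 : ‖χ' (χ (x + z)) - χ' (χ x + (A x z + Q z))‖ ≤
        B' * (C * (2 : ℝ) ^ (-(l : ℝ) * (1 + min ρ ρ')) *
          (1 + 2 ^ l * ‖z‖) ^ (L + (L + 1) * L')) := by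
      refine (hL _ _).trans (mul_le_mul_of_nonneg_left ?_ hB'0)
      rw [show χ (x + z) - (χ x + (A x z + Q z)) = χ (x + z) - χ x - A x z - Q z by abel]
      refine (h3 z).trans ?_
      gcongr ?_ * ?_ * ?_
      · exact hpw _ _ (by simp)
      · exact pow_le_pow_right₀ (hs z) (by omega)
    have e2 : ‖χ' (χ x + (A x z + Q z)) - χ' (χ x) - A' (χ x) (A x z + Q z) - Q' (A x z + Q z)‖ ≤
        C' * (2 : ℝ) ^ (-(l : ℝ) * (1 + min ρ ρ')) *
        ((1 + B + C) ^ L' * (1 + 2 ^ l * ‖z‖) ^ (L + (L + 1) * L')) := by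
      refine (h3' _).trans ?_
      gcongr ?_ * ?_ * ?_
      · exact hpw _ _ (by simp)
      · refine (pow_le_pow_left₀ (by positivity) (hw z) L').trans ?_
        rw [mul_pow, ← pow_mul]
        gcongr ?_ * ?_
        exact pow_le_pow_right₀ (hs z) (by omega)
    rw [show (χ' ∘ χ) (x + z) - (χ' ∘ χ) x - (A' (χ x)).comp (A x) z -
      (A' (χ x) (Q z) + Q' (A x z + Q z)) = (χ' (χ (x + z)) - χ' (χ x + (A x z + Q z))) +
      (χ' (χ x + (A x z + Q z)) - χ' (χ x) - A' (χ x) (A x z + Q z) - Q' (A x z + Q z)) by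
        simp only [Function.comp_apply, ContinuousLinearMap.comp_apply, map_add]; abel]
    refine (norm_add_le _ _).trans ((add_le_add e1 e2).trans_eq (by ring))


lemma IsZygmundMap.exists_fderiv_le (hρ : 0 < ρ) (h : IsZygmundMap P ρ χ) :
    ∃ B : ℝ, ∀ x, ‖fderiv ℝ χ x‖ ≤ B := by
  choose T hT hT' using h.deriv
  have hcont : ∀ i j, Continuous fun x ↦ fderiv ℝ χ x (e j) i := fun i j ↦
    (EuclideanSpace.proj (𝕜 := ℝ) i).continuous.comp
      ((h.contDiff.continuous_fderiv (by norm_num)).clm_apply continuous_const)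
  choose B hB using fun i j ↦ exists_bound_of_zygNorm P hρ (hT i j)
    (Complex.continuous_ofReal.comp (hcont i j)) (hT' i j)
  have hB0 : ∀ i j, 0 ≤ B i j := fun i j ↦ (norm_nonneg _).trans (hB i j 0)
  refine ⟨∑ i, ∑ j, B i j, fun x ↦ ContinuousLinearMap.opNorm_le_bound _
    (Finset.sum_nonneg fun i _ ↦ Finset.sum_nonneg fun j _ ↦ hB0 i j) fun v ↦ ?_⟩
  refine (norm_le_sum_coord _).trans ?_
  rw [Finset.sum_mul]
  refine Finset.sum_le_sum fun i _ ↦ ?_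
  have e1 : fderiv ℝ χ x v i = ∑ j, v j * fderiv ℝ χ x (e j) i := by
    conv_lhs => rw [sum_coord v, map_sum]
    simp
  rw [e1, Finset.sum_mul]
  refine (Finset.abs_sum_le_sum_abs _ _).trans (Finset.sum_le_sum fun j _ ↦ ?_)
  rw [abs_mul, mul_comm]
  have := hB i j x
  rw [Complex.norm_real] at this
  exact mul_le_mul this (abs_coord_le v j) (abs_nonneg _) (hB0 i j)

lemma norm_sub_le_of_fderiv_le {B : ℝ} (h : ContDiff ℝ 1 χ) (hB : ∀ x, ‖fderiv ℝ χ x‖ ≤ B) (x y : Rd d) :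
    ‖χ x - χ y‖ ≤ B * ‖x - y‖ :=
  convex_univ.norm_image_sub_le_of_norm_fderiv_le
    (fun x _ ↦ (h.differentiable (by norm_num)) x) (fun x _ ↦ hB x) (Set.mem_univ y) (Set.mem_univ x)

end Map

/-! ### Localized norms -/

lemma PG.schwartz (g : 𝓢(Rd d, ℂ)) : PG g := by
  obtain ⟨C, -, h⟩ := exists_decay g 0
  exact .of_bounded g.continuous (C := C) (by simpa using h)

/-- The closed ball of radius `R`; the whole space if `R = ∞`. -/
def bal (d : ℕ) (R : ℝ≥0∞) : Set (Rd d) := {x | ‖x‖ₑ ≤ R}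

lemma measurableSet_bal (R : ℝ≥0∞) : MeasurableSet (bal d R) :=
  measurableSet_le measurable_enorm measurable_const

lemma bal_top : bal d ⊤ = Set.univ := by simp [bal]

lemma bal_mono {R R' : ℝ≥0∞} (h : R ≤ R') : bal d R ⊆ bal d R' := fun _ hx ↦ le_trans hx h

/-- The norm on a ball of a function of frequency `2^n`, with a rapidly decreasing tail. -/
def nu (kd : Kind) (M : ℕ) (R : ℝ≥0∞) (n : ℕ) (f : Rd d → ℝ≥0∞) : ℝ≥0∞ :=
  fn kd (bal d R) f + tw (-(n * M)) * ⨆ x, f x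

section nu

variable {kd : Kind} {M n : ℕ} {R : ℝ≥0∞} {f g : Rd d → ℝ≥0∞}

lemma nu_mono (h : ∀ x, f x ≤ g x) : nu kd M R n f ≤ nu kd M R n g :=
  add_le_add (fn_mono' h) (mul_le_mul' le_rfl (iSup_mono h))

lemma nu_anti {n' : ℕ} (h : n ≤ n') : nu kd M R n' f ≤ nu kd M R n f :=
  add_le_add le_rfl (mul_le_mul' (tw_le (neg_le_neg
    (mul_le_mul_of_nonneg_right (Nat.cast_le.2 h) M.cast_nonneg))) le_rfl)

lemma nu_const_mul (c : ℝ≥0∞) (hf : Measurable f) :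
    nu kd M R n (fun x ↦ c * f x) = c * nu kd M R n f := by
  rw [nu, nu, fn_const_mul c hf, ← ENNReal.mul_iSup]; ring

lemma nu_add (hf : Measurable f) (hg : Measurable g) :
    nu kd M R n (fun x ↦ f x + g x) ≤ nu kd M R n f + nu kd M R n g := by
  refine (add_le_add (fn_add hf hg) (mul_le_mul' le_rfl
    (iSup_le fun x ↦ add_le_add (le_iSup f x) (le_iSup g x)))).trans (le_of_eq ?_)
  rw [nu, nu]; ring

lemma nu_tsum {F : ℕ → Rd d → ℝ≥0∞} (hF : ∀ i, Measurable (F i)) :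
    nu kd M R n (fun x ↦ ∑' i, F i x) ≤ ∑' i, nu kd M R n (F i) := by
  refine (add_le_add (fn_tsum hF) (mul_le_mul' le_rfl
    (iSup_le fun x ↦ ENNReal.tsum_le_tsum fun i ↦ le_iSup (F i) x))).trans (le_of_eq ?_)
  rw [← ENNReal.tsum_mul_left, ← ENNReal.tsum_add]; rfl

end nu

lemma fn_le_iSup_of_ne_top (kd : Kind) {R : ℝ≥0∞} (hR : R ≠ ⊤) : ∃ C : ℝ≥0, ∀ f : Rd d → ℝ≥0∞,
    fn kd (bal d R) f ≤ C * ⨆ x, f x := by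
  cases kd
  · refine ⟨1, fun f ↦ ?_⟩
    rw [ENNReal.coe_one, one_mul]
    exact iSup₂_le fun x _ ↦ le_iSup f x
  · have hV : volume (bal d R) ≠ ⊤ := by
      have : bal d R = Metric.closedBall (0 : Rd d) R.toReal := by
        ext x
        rw [bal, Set.mem_ofPred_eq, mem_closedBall_zero_iff, ← ofReal_norm,
          ENNReal.ofReal_le_iff_le_toReal hR]
      rw [this]; exact measure_closedBall_lt_top.ne
    refine ⟨(volume (bal d R) ^ (1 / 2 : ℝ)).toNNReal, fun f ↦ ?_⟩
    rw [ENNReal.coe_toNNReal (by finiteness)]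
    simp only [fn]
    rw [rpow_half_le_iff, mul_pow, rpow_half_sq]
    calc ∫⁻ x in bal d R, f x ^ 2 ≤ ∫⁻ _ in bal d R, (⨆ x, f x) ^ 2 := by
          gcongr with x; exact le_iSup f x
      _ = _ := by rw [lintegral_const, Measure.restrict_apply MeasurableSet.univ, Set.univ_inter,
                    mul_comm]

lemma fn_indicator (kd : Kind) {K : Set (Rd d)} (hK : MeasurableSet K) (f : Rd d → ℝ≥0∞) :
    fn kd Set.univ (K.indicator f) = fn kd K f := by
  cases kd
  · simp only [fn, Set.mem_univ, iSup_pos]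
    refine le_antisymm (iSup_le fun x ↦ ?_) (iSup₂_le fun x hx ↦ ?_)
    · by_cases hx : x ∈ K
      · rw [Set.indicator_of_mem hx]; exact le_iSup₂ (f := fun x (_ : x ∈ K) ↦ f x) x hx
      · rw [Set.indicator_of_notMem hx]; exact zero_le
    · exact (Set.indicator_of_mem hx f).symm.le.trans (le_iSup (K.indicator f) x)
  · simp only [fn, Measure.restrict_univ]
    rw [← lintegral_indicator hK]
    congr 2; funext x
    by_cases hx : x ∈ K <;> simp [hx]

lemma exists_fn_weight_le (kd : Kind) : ∃ C : ℝ≥0,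
    fn kd Set.univ (fun x : Rd d ↦ ENNReal.ofReal (jap (d + 1) 0 x)) ≤ C := by
  have h1 : ∀ x : Rd d, ENNReal.ofReal (jap (d + 1) 0 x) ≤ 1 := fun x ↦
    ENNReal.ofReal_le_one.2 (by simpa using jap_le (d + 1) 0 x)
  cases kd
  · exact ⟨1, by simpa [fn] using h1⟩
  · obtain ⟨C, hC⟩ := exists_lintegral_jap d
    refine ⟨(C ^ (1 / 2 : ℝ)), ?_⟩
    simp only [fn, Measure.restrict_univ]
    rw [ENNReal.coe_rpow_of_nonneg _ (by norm_num)]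
    gcongr
    calc _ ≤ ∫⁻ x : Rd d, ENNReal.ofReal (jap (d + 1) 0 (x - 0)) := by
          gcongr with x
          rw [sub_zero, pow_two]
          exact mul_le_of_le_one_left zero_le (h1 x)
      _ ≤ _ := hC (d + 1) 0 le_rfl 0

lemma jap_le_of_one_le {M m l : ℕ} {z : Rd d} (hz : 1 ≤ ‖z‖) :
    jap (M + m) l z ≤ (2 : ℝ) ^ (-(l * m : ℝ)) * jap M l z := by
  have h1 : ((2 : ℝ) ^ l) ^ m ≤ (1 + 2 ^ l * ‖z‖) ^ m := by
    gcongr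
    nlinarith [show (0 : ℝ) < 2 ^ l by positivity]
  rw [Real.rpow_neg (by norm_num), Real.rpow_mul (by norm_num), Real.rpow_natCast, Real.rpow_natCast,
    inv_mul_eq_div, le_div_iff₀ (by positivity), jap, jap, pow_add, div_mul_eq_mul_div]
  rw [div_le_div_iff₀ (by positivity) (by positivity)]
  have : (0 : ℝ) ≤ 2 ^ (l * d) * (1 + 2 ^ l * ‖z‖) ^ M := by positivity
  nlinarith

/-- Averaging operators act on localized norms. -/
lemma exists_nu_J_le (kd : Kind) (M : ℕ) (R : ℝ≥0∞) : ∃ C : ℝ≥0, ∀ M' n l : ℕ, M + d + 1 ≤ M' →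
    n ≤ l → ∀ f : Rd d → ℝ≥0∞, Measurable f → nu kd M R n (J M' l f) ≤ C * nu kd M (R + 1) n f := by
  obtain ⟨C₁, hC₁⟩ := exists_fn_J_le d kd
  obtain ⟨C₂, hC₂⟩ := exists_J_le_iSup d
  have hsup : ∀ M' n : ℕ, M + d + 1 ≤ M' → ∀ f : Rd d → ℝ≥0∞,
      ⨆ x, J M' n f x ≤ C₂ * ⨆ x, f x := fun M' n hM' f ↦ iSup_le (hC₂ M' n (by omega) f)
  rcases eq_or_ne R ⊤ with rfl | hR
  · refine ⟨C₁ + C₂, fun M' n l hM' hnl f hf ↦ ?_⟩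
    have h1 := hC₁ M' l (by omega) f hf
    have h2 := hsup M' l hM' f
    simp only [nu, top_add, bal_top, ENNReal.coe_add]
    calc _ ≤ C₁ * fn kd Set.univ f + tw (-(n * M)) * (C₂ * ⨆ x, f x) := by gcongr
      _ ≤ C₁ * fn kd Set.univ f + tw (-(n * M)) * (C₂ * ⨆ x, f x) +
          (C₂ * fn kd Set.univ f + C₁ * (tw (-(n * M)) * ⨆ x, f x)) := le_self_add
      _ = _ := by ring
  · obtain ⟨C₃, hC₃⟩ := fn_le_iSup_of_ne_top (d := d) kd hR
    refine ⟨C₁ + C₂ + C₃ * C₂, fun M' n l hM' hnl f hf ↦ ?_⟩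
    set g := (bal d (R + 1)).indicator f with hg
    have hgm : Measurable g := hf.indicator (measurableSet_bal _)
    -- A point y outside the ball of radius R + 1 has distance at least 1 from x. There M surplus
    -- powers of decay are worth 2^{-lM} ≤ 2^{-nM}, the weight of the global supremum in `nu`.
    have h1 : ∀ x ∈ bal d R, J M' l f x ≤ J M' l g x + tw (-(n * M)) * J (M' - M) l f x := by
      intro x hx
      rw [J, J, J, ← lintegral_const_mul' _ _ (tw_ne_top _)]
      refine le_trans (lintegral_mono fun y ↦ ?_) (lintegral_add_left
        ((measurable_jap M' l x).mul hgm) _).le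
      change _ ≤ ENNReal.ofReal (jap M' l (y - x)) * g y + _
      by_cases hy : y ∈ bal d (R + 1)
      · rw [hg, Set.indicator_of_mem hy]; exact le_self_add
      · rw [hg, Set.indicator_of_notMem hy, mul_zero, zero_add, ← mul_assoc]
        gcongr
        refine le_trans ?_ (mul_le_mul' (tw_le (a := -(l * M)) (neg_le_neg
          (mul_le_mul_of_nonneg_right (Nat.cast_le.2 hnl) M.cast_nonneg))) le_rfl)
        rw [tw_eq_ofReal, ← ENNReal.ofReal_mul (by positivity)]
        apply ENNReal.ofReal_le_ofReal
        have h2 : M' = (M' - M) + M := by omega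
        conv_lhs => rw [h2]
        refine jap_le_of_one_le ?_
        by_contra! h3
        apply hy
        calc ‖y‖ₑ ≤ ‖x‖ₑ + ‖y - x‖ₑ := by simpa using enorm_add_le x (y - x)
          _ ≤ R + 1 := by
            refine add_le_add hx ?_
            rw [← ofReal_norm]
            exact ENNReal.ofReal_le_one.2 h3.le
    have h4 : fn kd (bal d R) (J M' l f) ≤
        C₁ * fn kd (bal d (R + 1)) f + tw (-(n * M)) * (C₃ * (C₂ * ⨆ x, f x)) := by
      refine (fn_mono h1 (measurableSet_bal R)).trans ((fn_add (measurable_J _ _ hgm)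
        ((measurable_J _ _ hf).const_mul _)).trans ?_)
      rw [fn_const_mul _ (measurable_J _ _ hf)]
      refine add_le_add ?_ (mul_le_mul' le_rfl ((hC₃ _).trans (mul_le_mul' le_rfl
        (iSup_le (hC₂ _ l (by omega) f)))))
      refine (fn_mono_set (Set.subset_univ _)).trans ((hC₁ M' l (by omega) g hgm).trans_eq ?_)
      rw [hg, fn_indicator _ (measurableSet_bal _)]
    have h2 := hsup M' l hM' f
    simp only [nu, ENNReal.coe_add, ENNReal.coe_mul]
    calc _ ≤ C₁ * fn kd (bal d (R + 1)) f + tw (-(n * M)) * (C₃ * (C₂ * ⨆ x, f x)) +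
          tw (-(n * M)) * (C₂ * ⨆ x, f x) := by gcongr
      _ ≤ C₁ * fn kd (bal d (R + 1)) f + tw (-(n * M)) * (C₃ * (C₂ * ⨆ x, f x)) +
          tw (-(n * M)) * (C₂ * ⨆ x, f x) + ((C₂ + C₃ * C₂) * fn kd (bal d (R + 1)) f +
          C₁ * (tw (-(n * M)) * ⨆ x, f x)) := le_self_add
      _ = _ := by ring

/-- The Bernstein loss 2^{kd} in the supremum is compensated by its weight 2^{-nM}, because k ≤ n
and d ≤ M. -/
lemma exists_nu_J_le_fn (kd : Kind) {M : ℕ} (hM : d ≤ M) : ∃ C : ℝ≥0, ∀ M' k n : ℕ, d + 1 ≤ M' →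
    k ≤ n → ∀ (R : ℝ≥0∞) (f : Rd d → ℝ≥0∞), Measurable f →
      nu kd M R n (J M' k f) ≤ C * fn kd Set.univ f := by
  obtain ⟨C₁, hC₁⟩ := exists_fn_J_le d kd
  obtain ⟨C₂, hC₂⟩ := exists_J_le_fn d kd
  refine ⟨C₁ + C₂, fun M' k n hM' hkn R f hf ↦ ?_⟩
  rw [nu, ENNReal.coe_add, add_mul]
  refine add_le_add ((fn_mono_set (Set.subset_univ _)).trans (hC₁ M' k hM' f hf)) ?_
  calc _ ≤ tw (-(n * M)) * (C₂ * tw (k * d) * fn kd Set.univ f) := by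
        gcongr; exact iSup_le (hC₂ M' k hM' f hf)
    _ = (tw (-(n * M)) * tw (k * d)) * (C₂ * fn kd Set.univ f) := by ring
    _ ≤ 1 * (C₂ * fn kd Set.univ f) := by
        gcongr
        rw [← tw_add]
        refine tw_le_one ?_
        have : (k : ℝ) * d ≤ n * M := by gcongr
        linarith
    _ = _ := one_mul _

/-! ### Vanishing and decay of high frequency blocks of localized functions -/

/-- F is reproduced by the fat cutoff with δ = 1/π, whose symbol is supported in the ball of radius
2^n · 2/π; the product of the two symbols is zero. -/
lemma cv_eq_zero_of_band {n : ℕ} {F : Rd d → ℂ} (hF : Band n F) (K : 𝓢(Rd d, ℂ)) {r : ℝ}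
    (hr : 2 ^ n * (2 / Real.pi) ≤ r) (hK : ∀ ξ, ‖ξ‖ < r → (𝓕⁻ K : 𝓢(Rd d, ℂ)) ξ = 0) (x : Rd d) :
    cv K F x = 0 := by
  have hpi : (0 : ℝ) < 1 / Real.pi := by positivity
  set γ : 𝓢(Rd d, ℂ) := dil n (fat (d := d) (1 / Real.pi) hpi) with hγ
  have h1 : Op γ (dst F) = dst F := by
    refine (hF.pg.isFun.isFun_Op γ).ext ?_
    have : cv (𝓕 γ : 𝓢(Rd d, ℂ)) F = F := by
      funext x
      rw [hγ, fourier_dil]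
      exact ((hF.eq _ hpi x).2).symm
    rw [this]; exact hF.pg.isFun
  set m : 𝓢(Rd d, ℂ) := 𝓕⁻ K with hm
  have hKm : 𝓕 m = K := by simp [hm]
  have h2 : Op m (dst F) = 0 := by
    rw [← h1, Op_Op]
    have : (fun ξ ↦ γ ξ * m ξ) = fun _ ↦ 0 := by
      funext ξ
      rcases lt_or_ge ‖ξ‖ r with h | h
      · rw [hK ξ h, mul_zero]
      · rw [hγ, dil_fat_eq_zero hpi (le_trans (by
          rw [show (1 / Real.pi + 1 / Real.pi : ℝ) = 2 / Real.pi by ring]; exact hr) h), zero_mul]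
    rw [this]
    ext u
    simp
  have h3 := isFun_Op m (dst F)
  rw [h2, hKm] at h3
  rw [← hF.pg.isFun.ev_eq]
  exact congrFun (h3.unique isFun_zero (continuous_ev _ _) continuous_const) x

/-- The gap 3 is exact bookkeeping: φ_q vanishes for ‖ξ‖ < 2^{q-1}/(2π), which is at least 2^n · 2/π
as soon as q - 1 ≥ n + 2. -/
lemma LPCutoff.ker_vanish (P : LPCutoff d) {n q : ℕ} (h : n + 3 ≤ q) (ξ : Rd d)
    (hξ : ‖ξ‖ < 2 ^ n * (2 / Real.pi)) : (𝓕⁻ (P.ker q) : 𝓢(Rd d, ℂ)) ξ = 0 := by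
  obtain ⟨q, rfl⟩ : ∃ k, q = k + 1 := ⟨q - 1, by omega⟩
  rw [LPCutoff.ker, FourierTransform.fourierInv_fourier_eq]
  refine P.blk_eq_zero_of_lt (hξ.trans_le ?_)
  have : (2 : ℝ) ^ (n + 2) ≤ 2 ^ q := pow_le_pow_right₀ (by norm_num) (by omega)
  rw [mul_div_assoc', div_le_div_iff₀ Real.pi_pos (by positivity)]
  rw [pow_add] at this
  nlinarith [Real.pi_pos]

/-- High frequency blocks of the product of a Schwartz function and a function of low frequency. -/
lemma exists_cv_ker_mul_le (P : LPCutoff d) (M : ℕ) : ∃ (C : ℝ≥0) (s : Finset (ℕ × ℕ)),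
    ∀ (g : 𝓢(Rd d, ℂ)) (n q : ℕ) (F : Rd d → ℂ), Band n F → n + 3 ≤ q → ∀ x,
      ‖cv (P.ker q) (fun y ↦ g y * F y) x‖ₑ ≤
        C * ENNReal.ofReal (s.sup (schwartzSeminormFamily ℂ (Rd d) ℂ) g) * tw (-(q * M)) *
          ENNReal.ofReal (jap (d + 1) 0 x) * ⨆ y, ‖F y‖ₑ := by
  obtain ⟨C₁, hC₁, hK⟩ := P.exists_ker_le ((d + 1) + (M + 1 + (d + 1)))
  obtain ⟨C₂, hC₂⟩ := exists_lintegral_jap d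
  refine ⟨(C₁ * 2 ^ (d + 1)).toNNReal * C₂, Finset.Iic (d + 1, M + 1), fun g n q F hF hq x ↦ ?_⟩
  set S := (Finset.Iic (d + 1, M + 1)).sup (schwartzSeminormFamily ℂ (Rd d) ℂ) g with hS
  have hS0 : 0 ≤ S := apply_nonneg _ _
  have hint : ∀ K : 𝓢(Rd d, ℂ), Integrable fun z ↦ K z * F (x + z) := fun K ↦ by
    have := (hF.pg.isFun.integrable_tr K x).comp_add_left x
    simpa using this
  have hcv : ∀ (K : Rd d → ℂ) (f : Rd d → ℂ), cv K f x = ∫ z, K z * f (x + z) := fun K f ↦ by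
    rw [cv, ← integral_add_left_eq_self _ x]; simp
  -- Moments of the kernel against F vanish, since a monomial factor preserves the spectral gap.
  -- Hence the Taylor polynomial of g at x contributes nothing, and the remainder brings ‖z‖^{M+1},
  -- worth 2^{-qM} by the decay of the kernel.
  have hmono : ∀ (m : ℕ) (I : Fin m → Fin d), Integrable (fun z ↦ P.ker q z * (mono I z * F (x + z))) ∧
      ∫ z, P.ker q z * (mono I z * F (x + z)) = 0 := by
    intro m I
    obtain ⟨K', h1, h2⟩ := (IsPoly.prod Finset.univ fun j ↦ IsPoly.coord (I j) :
      IsPoly fun z : Rd d ↦ ∏ j, z (I j)).exists_mul (P.ker q) (P.ker_vanish hq)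
    have e1 : (fun z ↦ P.ker q z * (mono I z * F (x + z))) = fun z ↦ K' z * F (x + z) := by
      funext z; rw [h1, mono]; ring
    rw [e1]
    exact ⟨hint K', by rw [← hcv, cv_eq_zero_of_band hF K' le_rfl h2]⟩
  have e2 : ∀ z, P.ker q z * (taylor (M + 1) g x z * F (x + z)) =
      ∑ m ∈ Finset.range (M + 1), ∑ I : Fin m → Fin d, ((m.factorial : ℝ)⁻¹ : ℂ) * pd I g x *
        (P.ker q z * (mono I z * F (x + z))) := by
    intro z
    rw [taylor, Finset.sum_mul, Finset.mul_sum]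
    refine Finset.sum_congr rfl fun m _ ↦ ?_
    rw [Finset.mul_sum, Finset.sum_mul, Finset.mul_sum]
    exact Finset.sum_congr rfl fun I _ ↦ by ring
  have hti : Integrable fun z ↦ P.ker q z * (taylor (M + 1) g x z * F (x + z)) := by
    simp_rw [e2]
    exact integrable_finsetSum _ fun m _ ↦ integrable_finsetSum _ fun I _ ↦ (hmono m I).1.const_mul _
  have ht0 : ∫ z, P.ker q z * (taylor (M + 1) g x z * F (x + z)) = 0 := by
    simp_rw [e2]
    rw [integral_finsetSum _ fun m _ ↦ integrable_finsetSum _ fun I _ ↦ (hmono m I).1.const_mul _]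
    refine Finset.sum_eq_zero fun m _ ↦ ?_
    rw [integral_finsetSum _ fun I _ ↦ (hmono m I).1.const_mul _]
    refine Finset.sum_eq_zero fun I _ ↦ ?_
    rw [integral_const_mul, (hmono m I).2, mul_zero]
  have hgi : Integrable fun z ↦ P.ker q z * (g (x + z) * F (x + z)) := by
    have hpg : PG fun y ↦ g y * F y := (PG.schwartz g).mul hF.pg
    have := (hpg.isFun.integrable_tr (P.ker q) x).comp_add_left x
    simpa using this
  have e3 : cv (P.ker q) (fun y ↦ g y * F y) x =
      ∫ z, P.ker q z * ((g (x + z) - taylor (M + 1) g x z) * F (x + z)) := by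
    rw [hcv, ← sub_zero (∫ z, _), ← ht0, ← integral_sub hgi hti]
    congr 1; funext z; ring
  rw [e3]
  have hb : ∀ z, ‖P.ker q z * ((g (x + z) - taylor (M + 1) g x z) * F (x + z))‖ₑ ≤
      ENNReal.ofReal (C₁ * 2 ^ (d + 1) * S * (2 : ℝ) ^ (-(q * M : ℝ)) * jap (d + 1) 0 x) *
        (⨆ y, ‖F y‖ₑ) * ENNReal.ofReal (jap (d + 1) q (z - 0)) := by
    intro z
    rw [← mul_assoc, enorm_mul, mul_right_comm, ← ENNReal.ofReal_mul (by
      have := jap_nonneg (d + 1) 0 x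
      positivity)]
    refine mul_le_mul' ?_ (le_iSup (fun y ↦ ‖F y‖ₑ) (x + z))
    rw [← ofReal_norm, norm_mul]
    apply ENNReal.ofReal_le_ofReal
    have h1 := norm_sub_taylor_le g M (d + 1) x z
    rw [← hS] at h1
    set s := 1 + 2 ^ q * ‖z‖ with hs
    have h2 : ‖z‖ ^ (M + 1) ≤ (2 : ℝ) ^ (-(q * M : ℝ)) * s ^ (M + 1) := by
      rw [Real.rpow_neg (by norm_num), Real.rpow_mul (by norm_num), Real.rpow_natCast,
        Real.rpow_natCast, inv_mul_eq_div, le_div_iff₀ (by positivity)]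
      calc ‖z‖ ^ (M + 1) * (2 ^ q) ^ M ≤ ‖z‖ ^ (M + 1) * (2 ^ q) ^ (M + 1) := by
            gcongr
            · exact one_le_pow₀ (by norm_num)
            · omega
        _ = (2 ^ q * ‖z‖) ^ (M + 1) := by rw [mul_pow]; ring
        _ ≤ _ := by gcongr; linarith
    have h3 : 1 + ‖z‖ ≤ s := by
      have : 1 * ‖z‖ ≤ 2 ^ q * ‖z‖ := by gcongr; exact one_le_pow₀ (by norm_num)
      linarith
    have h4 : jap (d + 1) 0 x = 1 / (1 + ‖x‖) ^ (d + 1) := by simp [jap]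
    rw [sub_zero, h4]
    calc _ ≤ (C₁ * jap ((d + 1) + (M + 1 + (d + 1))) q z) * (2 ^ (d + 1) * S *
          ((2 : ℝ) ^ (-(q * M : ℝ)) * s ^ (M + 1)) * s ^ (d + 1) / (1 + ‖x‖) ^ (d + 1)) := by
          refine mul_le_mul (hK q z) (h1.trans ?_) (norm_nonneg _)
            (mul_nonneg hC₁ (jap_nonneg _ _ _))
          gcongr
      _ = C₁ * 2 ^ (d + 1) * S * (2 : ℝ) ^ (-(q * M : ℝ)) * (1 / (1 + ‖x‖) ^ (d + 1)) *
          (jap ((d + 1) + (M + 1 + (d + 1))) q z * s ^ (M + 1 + (d + 1))) := by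
          rw [pow_add s (M + 1)]; ring
      _ = _ := by rw [hs, jap_mul_pow_le]
  refine (enorm_integral_le_lintegral_enorm _).trans ((lintegral_mono hb).trans ?_)
  rw [lintegral_const_mul _ (measurable_jap _ _ _)]
  calc _ ≤ ENNReal.ofReal (C₁ * 2 ^ (d + 1) * S * (2 : ℝ) ^ (-(q * M : ℝ)) * jap (d + 1) 0 x) *
        (⨆ y, ‖F y‖ₑ) * C₂ := by gcongr; exact hC₂ _ _ le_rfl 0
    _ = _ := by
      rw [ENNReal.ofReal_mul (by positivity), ENNReal.ofReal_mul (by positivity),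
        ENNReal.ofReal_mul (by positivity), tw_eq_ofReal, ENNReal.coe_mul]
      rw [ENNReal.ofReal]
      ring

/-- `η` is a Schwartz cutoff supported in the ball of radius `R`, or `η = 1` and `R = ∞`. -/
def Loc (η : Rd d → ℂ) (R : ℝ≥0∞) : Prop :=
  (η = fun _ ↦ 1) ∧ R = ⊤ ∨ R ≠ ⊤ ∧ (∃ ψ : 𝓢(Rd d, ℂ), η = ψ) ∧ ∀ x ∉ bal d R, η x = 0

lemma Loc.hasTemperateGrowth {η : Rd d → ℂ} {R : ℝ≥0∞} (h : Loc η R) : η.HasTemperateGrowth := by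
  rcases h with ⟨rfl, -⟩ | ⟨-, ⟨ψ, rfl⟩, -⟩
  · fun_prop
  · exact ψ.hasTemperateGrowth

lemma Loc.exists_bound {η : Rd d → ℂ} {R : ℝ≥0∞} (h : Loc η R) : ∃ B : ℝ≥0, ∀ x, ‖η x‖ₑ ≤ B := by
  rcases h with ⟨rfl, -⟩ | ⟨-, ⟨ψ, rfl⟩, -⟩
  · exact ⟨1, fun x ↦ by simp⟩
  · obtain ⟨C, hC, hb⟩ := exists_decay ψ 0
    refine ⟨C.toNNReal, fun x ↦ ?_⟩
    rw [← ofReal_norm]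
    exact ENNReal.ofReal_le_ofReal (by simpa using hb x)

lemma Loc.enorm_eq_zero {η : Rd d → ℂ} {R : ℝ≥0∞} (h : Loc η R) {x : Rd d} (hx : x ∉ bal d R) :
    η x = 0 := by
  rcases h with ⟨-, rfl⟩ | ⟨-, -, h⟩
  · simp [bal] at hx
  · exact h x hx

lemma Loc.pg {η F : Rd d → ℂ} {R : ℝ≥0∞} (h : Loc η R) (hF : PG F) : PG fun x ↦ η x * F x := by
  rcases h with ⟨rfl, -⟩ | ⟨-, ⟨ψ, rfl⟩, -⟩
  · simpa using hF
  · exact (PG.schwartz ψ).mul hF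

/-- High frequency blocks of a localized function of frequency `2^n`. -/
lemma Loc.exists_fn_cv_ker_le_iSup (P : LPCutoff d) (kd : Kind) {η : Rd d → ℂ} {R : ℝ≥0∞}
    (h : Loc η R) (M : ℕ) : ∃ C : ℝ≥0, ∀ (n q : ℕ) (F : Rd d → ℂ), Band n F → n + 3 ≤ q →
      fn kd Set.univ (fun x ↦ ‖cv (P.ker q) (fun y ↦ η y * F y) x‖ₑ) ≤
        C * tw (-(q * M)) * ⨆ y, ‖F y‖ₑ := by
  rcases h with ⟨rfl, -⟩ | ⟨-, ⟨ψ, rfl⟩, -⟩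
  · refine ⟨0, fun n q F hF hq ↦ ?_⟩
    simp only [one_mul]
    simp_rw [cv_eq_zero_of_band hF _ le_rfl (P.ker_vanish hq)]
    cases kd <;> simp [fn]
  · obtain ⟨C, s, hC⟩ := exists_cv_ker_mul_le P M
    obtain ⟨C₃, hC₃⟩ := exists_fn_weight_le (d := d) kd
    refine ⟨C * (s.sup (schwartzSeminormFamily ℂ (Rd d) ℂ) ψ).toNNReal * C₃, fun n q F hF hq ↦ ?_⟩
    have hw : Measurable fun x : Rd d ↦ ENNReal.ofReal (jap (d + 1) 0 x) :=
      (continuous_jap _ _).measurable.ennreal_ofReal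
    calc _ ≤ fn kd Set.univ (fun x ↦ (C * ENNReal.ofReal (s.sup (schwartzSeminormFamily ℂ (Rd d) ℂ) ψ) *
          tw (-(q * M)) * ⨆ y, ‖F y‖ₑ) * ENNReal.ofReal (jap (d + 1) 0 x)) := by
          refine fn_mono' fun x ↦ (hC ψ n q F hF hq x).trans_eq (by ring)
      _ ≤ _ := by
          rw [fn_const_mul _ hw]
          refine (mul_le_mul' le_rfl hC₃).trans_eq ?_
          rw [ENNReal.ofReal]; push_cast; ring

/-- Frequency blocks of a localized function of frequency `2^n`. -/
lemma Loc.exists_fn_cv_ker_le (P : LPCutoff d) (kd : Kind) {η : Rd d → ℂ} {R : ℝ≥0∞} (h : Loc η R)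
    (M : ℕ) : ∃ C : ℝ≥0, ∀ (n q : ℕ) (F : Rd d → ℂ), Band n F →
      fn kd Set.univ (fun x ↦ ‖cv (P.ker q) (fun y ↦ η y * F y) x‖ₑ) ≤
        C * tw (min 0 (-((q - n) * M))) * nu kd M R n (fun x ↦ ‖F x‖ₑ) := by
  obtain ⟨B, hB⟩ := h.exists_bound
  obtain ⟨C₁, hC₁, hK⟩ := P.exists_ker_le (d + 1)
  obtain ⟨C₂, hC₂⟩ := exists_fn_J_le d kd
  have weak : ∀ (n q : ℕ) (F : Rd d → ℂ), Band n F →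
      fn kd Set.univ (fun x ↦ ‖cv (P.ker q) (fun y ↦ η y * F y) x‖ₑ) ≤
        C₁.toNNReal * C₂ * B * fn kd (bal d R) (fun x ↦ ‖F x‖ₑ) := by
    intro n q F hF
    have hm : Measurable fun x ↦ ‖F x‖ₑ := hF.pg.cont.measurable.enorm
    have hm2 : Measurable fun x ↦ ‖η x * F x‖ₑ := (h.pg hF.pg).cont.measurable.enorm
    calc _ ≤ fn kd Set.univ (fun x ↦ ENNReal.ofReal C₁ * J (d + 1) q (fun y ↦ ‖η y * F y‖ₑ) x) :=
          fn_mono' fun x ↦ enorm_cv_le (hK q) x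
      _ ≤ ENNReal.ofReal C₁ * (C₂ * fn kd Set.univ (fun y ↦ ‖η y * F y‖ₑ)) := by
          rw [fn_const_mul _ (measurable_J _ _ hm2)]
          gcongr
          exact hC₂ _ _ le_rfl _ hm2
      _ ≤ ENNReal.ofReal C₁ * (C₂ * (B * fn kd (bal d R) (fun x ↦ ‖F x‖ₑ))) := by
          gcongr
          rw [← fn_indicator _ (measurableSet_bal R), ← fn_const_mul _
            (hm.indicator (measurableSet_bal R))]
          refine fn_mono' fun x ↦ ?_
          by_cases hx : x ∈ bal d R
          · rw [Set.indicator_of_mem hx, enorm_mul]; gcongr; exact hB x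
          · rw [h.enorm_eq_zero hx, zero_mul, enorm_zero]; exact zero_le
      _ = _ := by rw [ENNReal.ofReal]; ring
  obtain ⟨C, hC⟩ := h.exists_fn_cv_ker_le_iSup P kd M
  -- For q < n + 3 there is no spectral gap and the bound without decay is used; `tw (3 * M)` makes
  -- the stated decay factor at least 1 there.
  refine ⟨C₁.toNNReal * C₂ * B * (tw (3 * M)).toNNReal + C, fun n q F hF ↦ ?_⟩
  rw [nu, mul_add, ENNReal.coe_add, add_mul]
  rcases lt_or_ge q (n + 3) with hq | hq
  · refine (weak n q F hF).trans (le_trans ?_ le_self_add)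
    rw [add_mul]
    refine le_trans ?_ le_self_add
    refine mul_le_mul' ?_ le_rfl
    push_cast
    rw [tw_coe, mul_assoc _ (tw _) (tw _), ← tw_add]
    refine le_mul_of_one_le_right zero_le (one_le_tw ?_)
    have h1 : (q : ℝ) ≤ n + 2 := by exact_mod_cast Nat.lt_succ_iff.1 hq
    have h2 : (0 : ℝ) ≤ M := M.cast_nonneg
    rcases min_choice (0 : ℝ) (-((q - n) * M)) with h3 | h3 <;> rw [h3] <;> nlinarith
  · refine (hC n q F hF hq).trans (le_trans ?_ le_add_self)
    rw [add_mul]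
    refine le_trans (le_of_eq ?_) le_add_self
    have h1 : (n : ℝ) + 3 ≤ q := by exact_mod_cast hq
    have h2 : (0 : ℝ) ≤ M := M.cast_nonneg
    rw [min_eq_right (by nlinarith), show -((q : ℝ) * M) = -((q - n) * M) + -(n * M) by ring, tw_add]
    ring

/-! ### Blocks of localized compositions -/

/-- Multiplication of tempered distributions by a function of temperate growth. -/
abbrev mulT (η : Rd d → ℂ) : 𝓢'(Rd d, ℂ) →L[ℂ] 𝓢'(Rd d, ℂ) :=
  TemperedDistribution.smulLeftCLM ℂ η

lemma Loc.isFun_mulT {η F : Rd d → ℂ} {R : ℝ≥0∞} (h : Loc η R) {T : 𝓢'(Rd d, ℂ)} (hF : IsFun F T) :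
    IsFun (fun x ↦ η x * F x) (mulT η T) :=
  hF.smulLeft h.hasTemperateGrowth

lemma isFun_block (P : LPCutoff d) {f : Rd d → ℂ} {T : 𝓢'(Rd d, ℂ)} (hf : IsFun f T) (q : ℕ) :
    IsFun (cv (P.ker q) f) (block P q T) := by
  rw [P.block_eq]; exact hf.isFun_Op _

lemma isFun_block_ev (P : LPCutoff d) (T : 𝓢'(Rd d, ℂ)) (q : ℕ) :
    IsFun (ev (P.ker q) T) (block P q T) := by
  rw [P.block_eq]; exact isFun_Op _ _

lemma IsFun.continuous_cv {f : Rd d → ℂ} {T : 𝓢'(Rd d, ℂ)} (hf : IsFun f T) (K : 𝓢(Rd d, ℂ)) :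
    Continuous (cv K f) := by
  rw [← hf.ev_eq]; exact continuous_ev _ _

lemma Loc.exists_lpNorm_block_le (P : LPCutoff d) (kd : Kind) {η : Rd d → ℂ} {R : ℝ≥0∞} (h : Loc η R)
    (M : ℕ) : ∃ C : ℝ≥0, ∀ (n q : ℕ) (F : Rd d → ℂ), Band n F →
      lpNorm kd.p (block P q (mulT η (dst F))) ≤
        C * tw (min 0 (-((q - n) * M))) * nu kd M R n (fun x ↦ ‖F x‖ₑ) := by
  obtain ⟨C, hC⟩ := h.exists_fn_cv_ker_le P kd M
  refine ⟨C, fun n q F hF ↦ le_trans ?_ (hC n q F hF)⟩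
  have h1 := h.isFun_mulT hF.pg.isFun
  exact lpNorm_le_fn kd (h1.continuous_cv _) (isFun_block P h1 q)

lemma Loc.exists_lpNorm_le (kd : Kind) {η : Rd d → ℂ} {R : ℝ≥0∞} (h : Loc η R)
    (M : ℕ) : ∃ C : ℝ≥0, ∀ (n : ℕ) (F : Rd d → ℂ), PG F →
      lpNorm kd.p (mulT η (dst F)) ≤ C * nu kd M R n (fun x ↦ ‖F x‖ₑ) := by
  obtain ⟨B, hB⟩ := h.exists_bound
  refine ⟨B, fun n F hF ↦ ?_⟩
  refine (lpNorm_le_fn kd (h.pg hF).cont (h.isFun_mulT hF.isFun)).trans ?_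
  have hm : Measurable fun x ↦ ‖F x‖ₑ := hF.cont.measurable.enorm
  refine le_trans ?_ (mul_le_mul' le_rfl le_self_add)
  rw [← fn_indicator _ (measurableSet_bal R), ← fn_const_mul _ (hm.indicator (measurableSet_bal R))]
  refine fn_mono' fun x ↦ ?_
  by_cases hx : x ∈ bal d R
  · rw [Set.indicator_of_mem hx, enorm_mul]; gcongr; exact hB x
  · rw [h.enorm_eq_zero hx, zero_mul, enorm_zero]; exact zero_le

/-- Composition with `χ` is bounded from the ball of radius `R'` to the ball of radius `R`. -/
def Pull (kd : Kind) (χ : Rd d → Rd d) (R R' : ℝ≥0∞) : Prop :=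
  ∃ C : ℝ≥0, ∀ f : Rd d → ℝ≥0∞, Measurable f → fn kd (bal d R) (f ∘ χ) ≤ C * fn kd (bal d R') f

lemma Pull.exists_nu_le {kd : Kind} {χ : Rd d → Rd d} {R R' : ℝ≥0∞} (h : Pull kd χ R R') :
    ∃ C : ℝ≥0, ∀ (M n : ℕ) (f : Rd d → ℝ≥0∞), Measurable f →
      nu kd M R n (f ∘ χ) ≤ C * nu kd M R' n f := by
  obtain ⟨C, hC⟩ := h
  refine ⟨C + 1, fun M n f hf ↦ ?_⟩
  rw [nu, nu, mul_add]
  refine add_le_add ((hC f hf).trans (mul_le_mul' (by simp) le_rfl)) ?_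
  refine le_trans (mul_le_mul' le_rfl (iSup_le fun x ↦ le_iSup f (χ x))) ?_
  exact le_mul_of_one_le_left zero_le (by simp)

/-- Continuous maps of linear growth. -/
structure LinGrowth (χ : Rd d → Rd d) : Prop where
  cont : Continuous χ
  growth : ∃ M : ℝ, ∀ x, ‖χ x‖ ≤ M * (1 + ‖x‖)

lemma LinGrowth.pg {χ : Rd d → Rd d} (h : LinGrowth χ) {f : Rd d → ℂ} (hf : PG f) : PG (f ∘ χ) := by
  obtain ⟨M, hM⟩ := h.growth
  exact hf.comp h.cont hM

lemma LinGrowth.comp {χ χ' : Rd d → Rd d} (h' : LinGrowth χ') (h : LinGrowth χ) :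
    LinGrowth (χ' ∘ χ) := by
  obtain ⟨M, hM⟩ := h.growth
  obtain ⟨M', hM'⟩ := h'.growth
  have h0 : 0 ≤ M' := by simpa using (norm_nonneg _).trans (hM' 0)
  refine ⟨h'.cont.comp h.cont, M' * (1 + M), fun x ↦ (hM' _).trans ?_⟩
  rw [mul_assoc]
  gcongr
  nlinarith [hM x, norm_nonneg x]

section

variable {χ : Rd d → Rd d} {kd : Kind} {R R' : ℝ≥0∞} {M : ℕ}

lemma exists_nu_low_le (P : LPCutoff d) (hχ : LinGrowth χ) (h : Pull kd χ (R + 1) R') (M : ℕ) :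
    ∃ C : ℝ≥0, ∀ (n : ℕ) (f : Rd d → ℂ), PG f →
      nu kd M R n (fun x ↦ ‖cv (P.lowKer n) (f ∘ χ) x‖ₑ) ≤ C * nu kd M R' n (fun x ↦ ‖f x‖ₑ) := by
  obtain ⟨C₁, hC₁, hK⟩ := P.exists_lowKer_le (M + d + 1)
  obtain ⟨C₂, hC₂⟩ := exists_nu_J_le (d := d) kd M R
  obtain ⟨C₃, hC₃⟩ := h.exists_nu_le
  refine ⟨C₁.toNNReal * (C₂ * C₃), fun n f hf ↦ ?_⟩
  have hm : Measurable fun x ↦ ‖f x‖ₑ := hf.cont.measurable.enorm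
  have hm2 : Measurable fun x ↦ ‖(f ∘ χ) x‖ₑ := (hχ.pg hf).cont.measurable.enorm
  refine (nu_mono fun x ↦ enorm_cv_le (hK n) x).trans ?_
  rw [nu_const_mul _ (measurable_J _ _ hm2)]
  push_cast
  rw [mul_assoc, mul_assoc]
  refine mul_le_mul' le_rfl ((hC₂ _ n n le_rfl le_rfl _ hm2).trans ?_)
  exact mul_le_mul' le_rfl (hC₃ M n _ hm)

/-- The cancellation estimate bounds the block by two nested averages. The outer one, at scale l,
enlarges the ball by 1. Composition with χ then passes to the whole space, where Bernstein's
inequality controls the inner average at scale k. -/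
lemma exists_nu_ker_le (P : LPCutoff d) (hχ : LinGrowth χ) (h : Pull kd χ (R + 1) ⊤) {ρ : ℝ}
    (hρ : 0 < ρ) {A : Rd d → Rd d →L[ℝ] Rd d} (hA : App ρ χ A) {B : ℝ} (hB : ∀ x, ‖A x‖ ≤ B) {N : ℕ}
    (hN : 2 * B < 2 ^ N) (hM : d ≤ M) :
    ∃ C : ℝ≥0, ∀ k n l : ℕ, k + N + 1 ≤ l → k ≤ n → n ≤ l → ∀ f : Rd d → ℂ, Band k f →
      (∃ H, ∀ x, ‖f x‖ ≤ H) → nu kd M R n (fun x ↦ ‖cv (P.ker l) (f ∘ χ) x‖ₑ) ≤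
        C * tw ((k : ℝ) - l - l * ρ) * fn kd Set.univ (fun x ↦ ‖f x‖ₑ) := by
  obtain ⟨C₁, hC₁⟩ := exists_cv_ker_comp_le P hρ hχ.cont hA hB hN (M + d + 1)
  obtain ⟨C₂, hC₂⟩ := exists_nu_J_le (d := d) kd M R
  obtain ⟨C₃, hC₃⟩ := h.exists_nu_le
  obtain ⟨C₄, hC₄⟩ := exists_nu_J_le_fn (d := d) kd hM
  refine ⟨C₁ * (C₂ * (C₃ * C₄)), fun k n l hkl hkn hnl f hf hfb ↦ ?_⟩
  have hm : Measurable fun x ↦ ‖f x‖ₑ := hf.pg.cont.measurable.enorm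
  have hm1 := measurable_J (M + d + 1) k hm
  have hm2 : Measurable fun y ↦ J (M + d + 1) k (fun y ↦ ‖f y‖ₑ) (χ y) :=
    hm1.comp hχ.cont.measurable
  refine (nu_mono fun x ↦ hC₁ k l hkl f hf hfb x).trans ?_
  rw [nu_const_mul _ (measurable_J _ _ hm2)]
  calc _ ≤ C₁ * tw ((k : ℝ) - l - l * ρ) * (C₂ * (C₃ * (C₄ * fn kd Set.univ fun x ↦ ‖f x‖ₑ))) := by
        refine mul_le_mul' le_rfl ((hC₂ _ n l le_rfl hnl _ hm2).trans (mul_le_mul' le_rfl ?_))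
        refine (hC₃ M n _ hm1).trans (mul_le_mul' le_rfl ?_)
        exact hC₄ _ k n (by omega) hkn ⊤ _ hm
    _ = _ := by push_cast; ring

lemma Band.exists_nu_le (kd : Kind) (hM : d ≤ M) : ∃ C : ℝ≥0, ∀ (k n : ℕ) (f : Rd d → ℂ), Band k f →
    k ≤ n → ∀ R, nu kd M R n (fun x ↦ ‖f x‖ₑ) ≤ C * fn kd Set.univ (fun x ↦ ‖f x‖ₑ) := by
  obtain ⟨C₁, hC₁⟩ := Band.exists_enorm_le (d := d) (d + 1)
  obtain ⟨C₂, hC₂⟩ := exists_nu_J_le_fn (d := d) kd hM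
  refine ⟨C₁ * C₂, fun k n f hf hkn R ↦ ?_⟩
  have hm : Measurable fun x ↦ ‖f x‖ₑ := hf.pg.cont.measurable.enorm
  refine (nu_mono fun x ↦ hC₁ k f hf x).trans ?_
  rw [nu_const_mul _ (measurable_J _ _ hm), ENNReal.coe_mul, mul_assoc]
  exact mul_le_mul' le_rfl (hC₂ _ k n le_rfl hkn R _ hm)

lemma Band.exists_iSup_le (kd : Kind) : ∃ C : ℝ≥0, ∀ (k : ℕ) (f : Rd d → ℂ), Band k f →
    ⨆ x, ‖f x‖ₑ ≤ C * tw (k * d) * fn kd Set.univ (fun x ↦ ‖f x‖ₑ) := by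
  obtain ⟨C₁, hC₁⟩ := Band.exists_enorm_le (d := d) (d + 1)
  obtain ⟨C₂, hC₂⟩ := exists_J_le_fn d kd
  refine ⟨C₁ * C₂, fun k f hf ↦ iSup_le fun x ↦ (hC₁ k f hf x).trans ?_⟩
  have hm : Measurable fun x ↦ ‖f x‖ₑ := hf.pg.cont.measurable.enorm
  rw [ENNReal.coe_mul, mul_assoc, mul_assoc]
  exact mul_le_mul' le_rfl ((hC₂ _ k le_rfl _ hm x).trans_eq (by ring))

lemma Op_dst (m : 𝓢(Rd d, ℂ)) {f : Rd d → ℂ} (hf : PG f) :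
    Op m (dst f) = dst (cv (𝓕 m : 𝓢(Rd d, ℂ)) f) :=
  (hf.isFun.isFun_Op m).dst_eq.symm

lemma LPCutoff.band_cv_ker (P : LPCutoff d) (q : ℕ) {f : Rd d → ℂ} (hf : PG f) :
    Band q (cv (P.ker q) f) := by
  rw [← hf.isFun.ev_eq]; exact P.band_ker q _

lemma LPCutoff.band_cv_lowKer (P : LPCutoff d) (q : ℕ) {f : Rd d → ℂ} (hf : PG f) :
    Band q (cv (P.lowKer q) f) := by
  rw [← hf.isFun.ev_eq]; exact P.band_lowKer q _

/-- Blocks of `η S_n(f ∘ χ)`. -/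
lemma exists_lpNorm_block_low_le (P : LPCutoff d) (hχ : LinGrowth χ) {η : Rd d → ℂ} (hη : Loc η R)
    (h : Pull kd χ (R + 1) R') (M : ℕ) :
    ∃ C : ℝ≥0, ∀ (n q : ℕ) (f : Rd d → ℂ), PG f →
      lpNorm kd.p (block P q (mulT η (Op (P.low n) (dst (f ∘ χ))))) ≤
        C * tw (min 0 (-((q - n) * M))) * nu kd M R' n (fun x ↦ ‖f x‖ₑ) := by
  obtain ⟨C₁, hC₁⟩ := hη.exists_lpNorm_block_le P kd M
  obtain ⟨C₂, hC₂⟩ := exists_nu_low_le P hχ h M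
  refine ⟨C₁ * C₂, fun n q f hf ↦ ?_⟩
  rw [Op_dst _ (hχ.pg hf)]
  refine (hC₁ n q _ (P.band_cv_lowKer n (hχ.pg hf))).trans ?_
  refine (mul_le_mul' le_rfl (hC₂ n f hf)).trans_eq ?_
  push_cast; ring

lemma exists_lpNorm_low_le (P : LPCutoff d) (hχ : LinGrowth χ) {η : Rd d → ℂ} (hη : Loc η R)
    (h : Pull kd χ (R + 1) R') (M : ℕ) :
    ∃ C : ℝ≥0, ∀ (n : ℕ) (f : Rd d → ℂ), PG f →
      lpNorm kd.p (mulT η (Op (P.low n) (dst (f ∘ χ)))) ≤ C * nu kd M R' n (fun x ↦ ‖f x‖ₑ) := by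
  obtain ⟨C₁, hC₁⟩ := hη.exists_lpNorm_le kd M
  obtain ⟨C₂, hC₂⟩ := exists_nu_low_le P hχ h M
  refine ⟨C₁ * C₂, fun n f hf ↦ ?_⟩
  rw [Op_dst _ (hχ.pg hf)]
  refine (hC₁ n _ (P.band_cv_lowKer n (hχ.pg hf)).pg).trans ?_
  refine (mul_le_mul' le_rfl (hC₂ n f hf)).trans_eq ?_
  push_cast; ring

/-- Blocks of `η φ_l(f ∘ χ)`, where the frequencies of `f` are small. -/
lemma exists_lpNorm_block_ker_le (P : LPCutoff d) (hχ : LinGrowth χ) {η : Rd d → ℂ} (hη : Loc η R)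
    (h : Pull kd χ (R + 1) ⊤) {ρ : ℝ}
    (hρ : 0 < ρ) {A : Rd d → Rd d →L[ℝ] Rd d} (hA : App ρ χ A) {B : ℝ} (hB : ∀ x, ‖A x‖ ≤ B) {N : ℕ}
    (hN : 2 * B < 2 ^ N) (hM : d ≤ M) :
    ∃ C : ℝ≥0, ∀ k l q : ℕ, k + N + 1 ≤ l → ∀ f : Rd d → ℂ, Band k f → (∃ H, ∀ x, ‖f x‖ ≤ H) →
      lpNorm kd.p (block P q (mulT η (Op (P.blk l) (dst (f ∘ χ))))) ≤
        C * (tw (min 0 (-((q - l) * M))) * tw ((k : ℝ) - l - l * ρ)) *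
          fn kd Set.univ (fun x ↦ ‖f x‖ₑ) := by
  obtain ⟨C₁, hC₁⟩ := hη.exists_lpNorm_block_le P kd M
  obtain ⟨C₂, hC₂⟩ := exists_nu_ker_le P hχ h hρ hA hB hN hM
  refine ⟨C₁ * C₂, fun k l q hkl f hf hfb ↦ ?_⟩
  rw [Op_dst _ (hχ.pg hf.pg)]
  refine (hC₁ l q _ (P.band_cv_ker l (hχ.pg hf.pg))).trans ?_
  refine (mul_le_mul' le_rfl (hC₂ k l l hkl (by omega) le_rfl f hf hfb)).trans_eq ?_
  push_cast; ring

end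

/-! ### Summation of blocks -/

/-- The norms of the spaces `C^r_*` and `H^r`. -/
def nrm (kd : Kind) (P : LPCutoff d) (r : ℝ) (u : 𝓢'(Rd d, ℂ)) : ℝ≥0∞ :=
  sq kd fun q ↦ tw (q * r) * lpNorm kd.p (block P q u)

lemma nrm_sob (P : LPCutoff d) (r : ℝ) : nrm .sob P r = sobNorm P r := by
  funext u
  simp only [nrm, sq, sobNorm, mul_pow]
  congr 2; funext q; congr 1
  rw [tw, ← ENNReal.rpow_natCast, ← ENNReal.rpow_mul]
  congr 1; push_cast; ring

lemma lpNorm_sum_le {p : ℝ≥0∞} [Fact (1 ≤ p)] {ι : Type*} (s : Finset ι) (X : ι → 𝓢'(Rd d, ℂ)) :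
    lpNorm p (∑ i ∈ s, X i) ≤ ∑ i ∈ s, lpNorm p (X i) := by
  have := lpNorm_le_tsum (p := p) (Finset.hasSum s X)
  exact this.trans_eq (Finset.tsum_subtype s fun i ↦ lpNorm p (X i))

lemma lpNorm_add_le {p : ℝ≥0∞} [Fact (1 ≤ p)] (S T : 𝓢'(Rd d, ℂ)) :
    lpNorm p (S + T) ≤ lpNorm p S + lpNorm p T := by
  simpa using lpNorm_sum_le (p := p) Finset.univ ![S, T]

lemma lpNorm_neg {p : ℝ≥0∞} [Fact (1 ≤ p)] (T : 𝓢'(Rd d, ℂ)) : lpNorm p (-T) = lpNorm p T := by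
  have h : ∀ T : 𝓢'(Rd d, ℂ), lpNorm p (-T) ≤ lpNorm p T := fun T ↦ by
    refine le_iInf₂ fun f hf ↦ (iInf₂_le (-f) ?_).trans_eq (enorm_neg f)
    rw [← hf]
    simpa using map_neg (Lp.toTemperedDistributionCLM ℂ (volume : Measure (Rd d)) p) f
  exact le_antisymm (h T) (by simpa using h (-T))

lemma lpNorm_sub_le {p : ℝ≥0∞} [Fact (1 ≤ p)] (S T : 𝓢'(Rd d, ℂ)) :
    lpNorm p (S - T) ≤ lpNorm p S + lpNorm p T := by
  rw [sub_eq_add_neg, ← lpNorm_neg T]; exact lpNorm_add_le S (-T)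

lemma nrm_add_le (kd : Kind) (P : LPCutoff d) (r : ℝ) (u v : 𝓢'(Rd d, ℂ)) :
    nrm kd P r (u + v) ≤ nrm kd P r u + nrm kd P r v := by
  refine (sq_mono fun q ↦ ?_).trans (sq_add kd _ _)
  rw [map_add, ← mul_add]
  exact mul_le_mul' le_rfl (lpNorm_add_le _ _)

lemma nrm_neg (kd : Kind) (P : LPCutoff d) (r : ℝ) (u : 𝓢'(Rd d, ℂ)) :
    nrm kd P r (-u) = nrm kd P r u := by
  simp only [nrm, map_neg, lpNorm_neg]

lemma nrm_sub_le (kd : Kind) (P : LPCutoff d) (r : ℝ) (u v : 𝓢'(Rd d, ℂ)) :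
    nrm kd P r (u - v) ≤ nrm kd P r u + nrm kd P r v := by
  rw [sub_eq_add_neg, ← nrm_neg kd P r v]; exact nrm_add_le kd P r u (-v)

lemma lpNorm_block_le_nrm (kd : Kind) (P : LPCutoff d) (r : ℝ) (u : 𝓢'(Rd d, ℂ)) (q : ℕ) :
    lpNorm kd.p (block P q u) ≤ tw (-(q * r)) * nrm kd P r u := by
  calc _ = tw (-(q * r)) * (tw (q * r) * lpNorm kd.p (block P q u)) := by
        rw [← mul_assoc, mul_comm (tw _), tw_mul_tw_neg, one_mul]
    _ ≤ _ := mul_le_mul' le_rfl (le_sq kd _ q)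

lemma tsum_lpNorm_block_ne_top {kd : Kind} {P : LPCutoff d} {r : ℝ} (hr : 0 < r) {u : 𝓢'(Rd d, ℂ)}
    (hu : nrm kd P r u < ⊤) : ∑' q, lpNorm kd.p (block P q u) ≠ ⊤ := by
  refine ne_top_of_le_ne_top ?_ (ENNReal.tsum_le_tsum fun q ↦ lpNorm_block_le_nrm kd P r u q)
  rw [ENNReal.tsum_mul_right]
  refine ENNReal.mul_ne_top ?_ hu.ne
  simpa [mul_comm] using tsum_tw_ne_top hr

lemma fn_ev_ker_le (kd : Kind) (P : LPCutoff d) (u : 𝓢'(Rd d, ℂ)) (q : ℕ) :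
    fn kd Set.univ (fun x ↦ ‖ev (P.ker q) u x‖ₑ) ≤ lpNorm kd.p (block P q u) :=
  fn_le_lpNorm kd (continuous_ev _ _) (isFun_block_ev P u q)

/-- Norm of a sum of almost orthogonal terms. -/
lemma exists_nrm_le (kd : Kind) (P : LPCutoff d) (t r : ℝ) {δ : ℝ} (hδ : 0 < δ) : ∃ C : ℝ≥0,
    ∀ (X : ℕ → 𝓢'(Rd d, ℂ)) (S : 𝓢'(Rd d, ℂ)) (a : ℕ → ℝ≥0∞) (c : ℝ≥0∞), HasSum X S →
      (∀ q j, lpNorm kd.p (block P q (X j)) ≤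
        c * tw (-(q * t) + j * r - δ * |(q : ℝ) - j|) * a j) →
      nrm kd P t S ≤ C * c * sq kd fun j ↦ tw (j * r) * a j := by
  obtain ⟨C, hC⟩ := exists_sq_exp_le kd hδ
  refine ⟨C, fun X S a c hS h ↦ ?_⟩
  have h1 : ∀ q : ℕ, tw (q * t) * lpNorm kd.p (block P q S) ≤
      c * ∑' j : ℕ, tw (-(δ * |(q : ℝ) - j|)) * (tw (j * r) * a j) := by
    intro q
    have h2 : HasSum (fun j ↦ block P q (X j)) (block P q S) := hS.mapL (block P q)
    refine (mul_le_mul' le_rfl (lpNorm_le_tsum h2)).trans ?_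
    rw [← ENNReal.tsum_mul_left, ← ENNReal.tsum_mul_left]
    refine ENNReal.tsum_le_tsum fun j ↦ (mul_le_mul' le_rfl (h q j)).trans_eq ?_
    rw [show -((q : ℝ) * t) + j * r - δ * |(q : ℝ) - j| =
      -(q * t) + (j * r + -(δ * |(q : ℝ) - j|)) by ring, tw_add, tw_add]
    calc _ = (tw (q * t) * tw (-(q * t))) * (c * (tw (j * r) * tw (-(δ * |(q : ℝ) - j|))) * a j) := by
          ring
      _ = _ := by rw [tw_mul_tw_neg]; ring
  refine (sq_mono h1).trans ?_
  rw [sq_const_mul, mul_comm (C : ℝ≥0∞), mul_assoc]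
  exact mul_le_mul' le_rfl (hC _)

/-- Boundedness of localized paracompositions. -/
theorem exists_nrm_paracomp_le (kd : Kind) (P : LPCutoff d) {χ : Rd d → Rd d} (hχ : LinGrowth χ)
    {η : Rd d → ℂ} {R : ℝ≥0∞} (hη : Loc η R) (h : Pull kd χ (R + 1) ⊤) {r : ℝ} (hr : 0 < r) (N : ℕ) :
    ∃ C : ℝ≥0, ∀ U, nrm kd P r U < ⊤ → ∃ S,
      HasSum (fun k ↦ mulT η (lowFreq P N k (dst (ev (P.ker k) U ∘ χ)))) S ∧
        nrm kd P r S ≤ C * nrm kd P r U := by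
  -- For q > k the decay 2^{-(q-k)M} has to supply r for the weight of the norm and another r for
  -- almost orthogonality; the condition d ≤ M is the one for Bernstein's inequality.
  obtain ⟨M, hM⟩ := exists_nat_ge (max (2 * r) d)
  have hMr : 2 * r ≤ M := (le_max_left _ _).trans hM
  have hMd : d ≤ M := by exact_mod_cast (le_max_right (2 * r) _).trans hM
  obtain ⟨C₁, hC₁⟩ := exists_lpNorm_block_low_le P hχ hη h M
  obtain ⟨C₂, hC₂⟩ := exists_lpNorm_low_le P hχ hη h M
  obtain ⟨C₃, hC₃⟩ := Band.exists_nu_le (d := d) kd hMd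
  obtain ⟨C₄, hC₄⟩ := exists_nrm_le kd P r r hr
  have hnu : ∀ U k, nu kd M ⊤ (k + N) (fun x ↦ ‖ev (P.ker k) U x‖ₑ) ≤
      C₃ * lpNorm kd.p (block P k U) := fun U k ↦
    (hC₃ k (k + N) _ (P.band_ker k U) (by omega) ⊤).trans
      (mul_le_mul' le_rfl (fn_ev_ker_le kd P U k))
  refine ⟨C₄ * (C₁ * (tw (N * M)).toNNReal * C₃), fun U hU ↦ ?_⟩
  simp_rw [P.lowFreq_eq]
  -- Positive smoothness makes the L^p norms of the terms summable, which gives convergence before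
  -- any orthogonality is used.
  have h1 : ∑' k, lpNorm kd.p (mulT η (Op (P.low (k + N)) (dst (ev (P.ker k) U ∘ χ)))) ≠ ⊤ := by
    refine ne_top_of_le_ne_top ?_ (ENNReal.tsum_le_tsum fun k ↦ (hC₂ (k + N) _ (PG_ev _ U)).trans
      (mul_le_mul' le_rfl (hnu U k)))
    rw [ENNReal.tsum_mul_left, ENNReal.tsum_mul_left]
    exact ENNReal.mul_ne_top ENNReal.coe_ne_top
      (ENNReal.mul_ne_top ENNReal.coe_ne_top (tsum_lpNorm_block_ne_top hr hU))
  obtain ⟨S, hS, -⟩ := exists_hasSum_of_lpNorm h1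
  refine ⟨S, hS, ?_⟩
  have h2 := hC₄ _ S (fun k ↦ lpNorm kd.p (block P k U)) (C₁ * tw (N * M) * C₃) hS fun q k ↦ by
    refine (hC₁ (k + N) q _ (PG_ev _ U)).trans ?_
    calc _ ≤ C₁ * (tw (N * M) * tw (-(q * r) + k * r - r * |(q : ℝ) - k|)) *
          (C₃ * lpNorm kd.p (block P k U)) := by
          refine mul_le_mul' (mul_le_mul' le_rfl ?_) (hnu U k)
          rw [← tw_add]
          apply tw_le
          push_cast
          have h3 : (0 : ℝ) ≤ N * M := by positivity
          -- For q ≤ k the weights cancel exactly, (k - q)r - r|q - k| = 0, so all decay in this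
          -- range comes from r > 0.
          rcases le_total (q : ℝ) k with h4 | h4
          · rw [abs_of_nonpos (by linarith)]
            exact (min_le_left _ _).trans (by nlinarith)
          · rw [abs_of_nonneg (by linarith)]
            exact (min_le_right _ _).trans (by nlinarith)
      _ = _ := by ring
  refine h2.trans_eq ?_
  push_cast
  rw [tw_coe]; rfl

/-! ### Low frequency approximation -/

lemma cv_lowKer_eq_sum (P : LPCutoff d) {f : Rd d → ℂ} (hf : PG f) (n : ℕ) (x : Rd d) :
    cv (P.lowKer n) f x = ∑ l ∈ Finset.range (n + 1), cv (P.ker l) f x := by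
  induction n with
  | zero => simp; rfl
  | succ n ih =>
    rw [Finset.sum_range_succ, ← ih, P.ker_succ, ← hf.isFun.ev_eq, ← hf.isFun.ev_eq,
      ← hf.isFun.ev_eq, ev, ev, ev, ← map_add]
    congr 1
    simp [tr]

lemma iSup_enorm_cv_ne_top (P : LPCutoff d) {f : Rd d → ℂ} (hb : ∃ H, ∀ x, ‖f x‖ ≤ H) (q : ℕ) :
    ⨆ x, ‖cv (P.ker q) f x‖ₑ ≠ ⊤ := by
  obtain ⟨C₁, hC₁, hK⟩ := P.exists_ker_le (d + 1)
  obtain ⟨C₂, hC₂⟩ := exists_J_le_iSup d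
  obtain ⟨H, hH⟩ := hb
  refine ne_top_of_le_ne_top (b := ENNReal.ofReal C₁ * (C₂ * ENNReal.ofReal H)) (by finiteness)
    (iSup_le fun x ↦ (enorm_cv_le (hK q) x).trans ?_)
  refine mul_le_mul' le_rfl ((hC₂ _ q le_rfl _ x).trans (mul_le_mul' le_rfl (iSup_le fun y ↦ ?_)))
  rw [← ofReal_norm]; exact ENNReal.ofReal_le_ofReal (hH y)

lemma enorm_sub_cv_lowKer_le (P : LPCutoff d) {f : Rd d → ℂ} (hf : Continuous f)
    (hb : ∃ H, ∀ x, ‖f x‖ ≤ H) (n : ℕ)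
    (h : ∑' l, ⨆ x, ‖cv (P.ker (l + (n + 1))) f x‖ₑ ≠ ⊤) (x : Rd d) :
    ‖f x - cv (P.lowKer n) f x‖ₑ ≤ ∑' l, ‖cv (P.ker (l + (n + 1))) f x‖ₑ := by
  have hpg : PG f := .of_bounded hf hb.choose_spec
  have h1 : ∑' l, ⨆ x, ‖cv (P.ker l) f x‖ₑ ≠ ⊤ := by
    rw [← ENNReal.summable.sum_add_tsum_nat_add' (k := n + 1)]
    exact ENNReal.add_ne_top.2 ⟨ENNReal.sum_ne_top.2 fun l _ ↦ iSup_enorm_cv_ne_top P hb l, h⟩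
  have h2 := P.hasSum_ev_ker hpg.isFun hf (ENNReal.summable_toReal h1) (fun q x ↦ by
    rw [hpg.isFun.ev_eq, ← toReal_enorm]
    exact ENNReal.toReal_mono (iSup_enorm_cv_ne_top P hb q)
      (le_iSup (fun x ↦ ‖cv (P.ker q) f x‖ₑ) x)) x
  have h3 := (hasSum_nat_add_iff' (n + 1)).2 h2
  simp only [hpg.isFun.ev_eq, ← cv_lowKer_eq_sum P hpg] at h3
  rw [← h3.tsum_eq]
  exact enorm_tsum_le_tsum_enorm

lemma nu_sub_cv_lowKer_le (P : LPCutoff d) (kd : Kind) (M : ℕ) (R : ℝ≥0∞) (n : ℕ) {f : Rd d → ℂ}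
    (hf : Continuous f) (hb : ∃ H, ∀ x, ‖f x‖ ≤ H) (n' : ℕ) :
    nu kd M R n (fun x ↦ ‖f x - cv (P.lowKer n') f x‖ₑ) ≤
      ∑' l, nu kd M R n (fun x ↦ ‖cv (P.ker (l + (n' + 1))) f x‖ₑ) := by
  have hpg : PG f := .of_bounded hf hb.choose_spec
  by_cases h : ∑' l, nu kd M R n (fun x ↦ ‖cv (P.ker (l + (n' + 1))) f x‖ₑ) = ⊤
  · rw [h]; exact le_top
  -- The supremum has a nonzero weight in `nu`, so finiteness of the sum of the `nu` already forces
  -- uniform summability of the blocks.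
  have h1 : ∑' l, ⨆ x, ‖cv (P.ker (l + (n' + 1))) f x‖ₑ ≠ ⊤ := by
    intro h2
    apply h
    rw [eq_top_iff]
    refine le_trans ?_ (ENNReal.tsum_le_tsum fun l ↦ le_add_self)
    rw [ENNReal.tsum_mul_left, h2, ENNReal.mul_top (tw_ne_zero _)]
  refine (nu_mono (enorm_sub_cv_lowKer_le P hf hb n' h1)).trans (nu_tsum fun l ↦ ?_)
  exact (hpg.isFun.continuous_cv _).measurable.enorm

/-! ### The main estimate for the remainder -/

/-- Maps which are approximated by polynomials to order `1 + ρ`, with `2^N` larger than twice the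
size of the derivative. -/
structure Tame (ρ : ℝ) (N : ℕ) (χ : Rd d → Rd d) : Prop where
  lin : LinGrowth χ
  pos : 0 < ρ
  app : ∃ (A : Rd d → Rd d →L[ℝ] Rd d) (B : ℝ), App ρ χ A ∧ (∀ x, ‖A x‖ ≤ B) ∧ 2 * B < 2 ^ N

section

variable {χ : Rd d → Rd d} {kd : Kind} {R R' : ℝ≥0∞} {M N : ℕ} {ρ m : ℝ}

lemma App.mono {ρ ρ' : ℝ} {A : Rd d → Rd d →L[ℝ] Rd d} (h : App ρ χ A) (hρ : ρ' ≤ ρ) :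
    App ρ' χ A := by
  obtain ⟨ε, C, L, hε, hC, H⟩ := h
  refine ⟨ε, C, L, hε, hC, fun l x ↦ ?_⟩
  obtain ⟨Q, h1, h2, h3⟩ := H l x
  refine ⟨Q, h1, h2, fun z ↦ (h3 z).trans ?_⟩
  refine mul_le_mul_of_nonneg_right (mul_le_mul_of_nonneg_left
    (Real.rpow_le_rpow_of_exponent_le (by norm_num) ?_) hC) (by positivity)
  nlinarith [(l.cast_nonneg : (0 : ℝ) ≤ l)]

lemma Tame.mono {ρ ρ' : ℝ} (h : Tame ρ N χ) (hρ : ρ' ≤ ρ) (h0 : 0 < ρ') : Tame ρ' N χ := by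
  obtain ⟨A, B, h1, h2, h3⟩ := h.app
  exact ⟨h.lin, h0, A, B, h1.mono hρ, h2, h3⟩

lemma tsum_tw_le {f : ℕ → ℝ≥0∞} {c : ℝ≥0∞} (h : ∀ l, f l ≤ c * tw (-l)) : ∑' l, f l ≤ c * 2 := by
  refine (ENNReal.tsum_le_tsum h).trans_eq ?_
  rw [ENNReal.tsum_mul_left]
  congr 1
  have : ∀ l : ℕ, tw (-(l : ℝ)) = 2⁻¹ ^ l := fun l ↦ by
    rw [tw, ENNReal.rpow_neg, ENNReal.rpow_natCast, ENNReal.inv_pow]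
  simp_rw [this]
  rw [ENNReal.tsum_geometric, ENNReal.one_sub_inv_two, inv_inv]

/-- High frequencies of a composition. -/
lemma exists_nu_comp_sub_low_le (P : LPCutoff d) (kd : Kind) (hχ : Tame m N χ)
    (h : Pull kd χ (R + 1) ⊤) (hM : d ≤ M) :
    ∃ C : ℝ≥0, ∀ (j : ℕ) (f : Rd d → ℂ), Band j f → (∃ H, ∀ x, ‖f x‖ ≤ H) →
      nu kd M R j (fun x ↦ ‖(f ∘ χ) x - cv (P.lowKer (j + N)) (f ∘ χ) x‖ₑ) ≤
        C * tw (-(j * m)) * fn kd Set.univ (fun x ↦ ‖f x‖ₑ) := by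
  obtain ⟨A, B, hA, hB, hN⟩ := hχ.app
  obtain ⟨C, hC⟩ := exists_nu_ker_le P hχ.lin h hχ.pos hA hB hN hM
  refine ⟨C * 2, fun j f hf hb ↦ ?_⟩
  obtain ⟨H, hH⟩ := hb
  refine (nu_sub_cv_lowKer_le P kd M R j (hf.pg.cont.comp hχ.lin.cont) ⟨H, fun x ↦ hH _⟩ _).trans ?_
  refine (tsum_tw_le (c := C * tw (-(j * m)) * fn kd Set.univ (fun x ↦ ‖f x‖ₑ)) fun l ↦ ?_).trans_eq
    (by push_cast; ring)
  refine (hC j j (l + (j + N + 1)) (by omega) le_rfl (by omega) f hf ⟨H, hH⟩).trans ?_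
  rw [show C * tw (-(j * m)) * fn kd Set.univ (fun x ↦ ‖f x‖ₑ) * tw (-l) =
    C * (tw (-(j * m)) * tw (-l)) * fn kd Set.univ (fun x ↦ ‖f x‖ₑ) by ring, ← tw_add]
  refine mul_le_mul' (mul_le_mul' le_rfl (tw_le ?_)) le_rfl
  push_cast
  have := hχ.pos
  nlinarith [mul_nonneg (l.cast_nonneg : (0 : ℝ) ≤ l) this.le,
    mul_nonneg (N.cast_nonneg : (0 : ℝ) ≤ N) this.le, (N.cast_nonneg : (0 : ℝ) ≤ N)]

lemma exists_iSup_cv_lowKer_le (P : LPCutoff d) : ∃ C : ℝ≥0, ∀ (n : ℕ) (f : Rd d → ℂ),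
    ⨆ x, ‖cv (P.lowKer n) f x‖ₑ ≤ C * ⨆ x, ‖f x‖ₑ := by
  obtain ⟨C₁, hC₁, hK⟩ := P.exists_lowKer_le (d + 1)
  obtain ⟨C₂, hC₂⟩ := exists_J_le_iSup d
  refine ⟨C₁.toNNReal * C₂, fun n f ↦ iSup_le fun x ↦ (enorm_cv_le (hK n) x).trans ?_⟩
  rw [ENNReal.coe_mul, mul_assoc]
  exact mul_le_mul' le_rfl (hC₂ _ n le_rfl _ x)

lemma iSup_enorm_le_of_bound {f : Rd d → ℂ} {H : ℝ} (h : ∀ x, ‖f x‖ ≤ H) :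
    ⨆ x, ‖f x‖ₑ ≤ ENNReal.ofReal H :=
  iSup_le fun x ↦ by rw [← ofReal_norm]; exact ENNReal.ofReal_le_ofReal (h x)

lemma exists_bound_of_iSup {f : Rd d → ℂ} (h : ⨆ x, ‖f x‖ₑ ≠ ⊤) : ∃ H, ∀ x, ‖f x‖ ≤ H :=
  ⟨(⨆ x, ‖f x‖ₑ).toReal, fun x ↦ by
    rw [← toReal_enorm]; exact ENNReal.toReal_mono h (le_iSup (fun x ↦ ‖f x‖ₑ) x)⟩

lemma exists_bound_cv_lowKer (P : LPCutoff d) {f : Rd d → ℂ} (hb : ∃ H, ∀ x, ‖f x‖ ≤ H) (n : ℕ) :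
    ∃ H, ∀ x, ‖cv (P.lowKer n) f x‖ ≤ H := by
  obtain ⟨C, hC⟩ := exists_iSup_cv_lowKer_le P
  obtain ⟨H, hH⟩ := hb
  refine exists_bound_of_iSup (ne_top_of_le_ne_top ?_ ((hC n f).trans (mul_le_mul' le_rfl
    (iSup_enorm_le_of_bound hH))))
  finiteness

/-- Blocks of the localized low frequency part of a composition. -/
lemma exists_fn_ker_mul_low_le (P : LPCutoff d) (kd : Kind) (hχ : LinGrowth χ) {η : Rd d → ℂ}
    (hη : Loc η R) (h : Pull kd χ (R + 1) ⊤) (N M : ℕ) : ∃ C : ℝ≥0, ∀ (j : ℕ) (f : Rd d → ℂ),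
      Band j f → ∀ k, fn kd Set.univ (fun x ↦ ‖cv (P.ker k)
          (fun y ↦ η y * cv (P.lowKer (j + N)) (f ∘ χ) y) x‖ₑ) ≤
            C * fn kd Set.univ (fun x ↦ ‖f x‖ₑ) ∧
        (j + N + 3 ≤ k → fn kd Set.univ (fun x ↦ ‖cv (P.ker k)
          (fun y ↦ η y * cv (P.lowKer (j + N)) (f ∘ χ) y) x‖ₑ) ≤
            C * tw (-(k * M)) * fn kd Set.univ (fun x ↦ ‖f x‖ₑ)) := by
  obtain ⟨C₁, hC₁⟩ := hη.exists_fn_cv_ker_le P kd d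
  obtain ⟨C₂, hC₂⟩ := exists_nu_low_le P hχ h d
  obtain ⟨C₃, hC₃⟩ := Band.exists_nu_le (d := d) (M := d) kd le_rfl
  obtain ⟨C₄, hC₄⟩ := hη.exists_fn_cv_ker_le_iSup P kd (M + d)
  obtain ⟨C₅, hC₅⟩ := Band.exists_iSup_le (d := d) kd
  obtain ⟨C₆, hC₆⟩ := exists_iSup_cv_lowKer_le P
  refine ⟨C₁ * (C₂ * C₃) + C₄ * (C₆ * C₅), fun j f hf k ↦ ⟨?_, fun hk ↦ ?_⟩⟩
  · refine (hC₁ (j + N) k _ (P.band_cv_lowKer _ (hχ.pg hf.pg))).trans ?_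
    calc _ ≤ C₁ * 1 * (C₂ * (C₃ * fn kd Set.univ (fun x ↦ ‖f x‖ₑ))) := by
          refine mul_le_mul' (mul_le_mul' le_rfl (tw_le_one (min_le_left _ _))) ?_
          refine (hC₂ _ f hf.pg).trans (mul_le_mul' le_rfl ?_)
          exact hC₃ j (j + N) f hf (by omega) ⊤
      _ = (C₁ * (C₂ * C₃) : ℝ≥0) * fn kd Set.univ (fun x ↦ ‖f x‖ₑ) := by push_cast; ring
      _ ≤ _ := mul_le_mul' (by simp) le_rfl
  · refine (hC₄ (j + N) k _ (P.band_cv_lowKer _ (hχ.pg hf.pg)) hk).trans ?_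
    have h1 : ⨆ x, ‖(f ∘ χ) x‖ₑ ≤ ⨆ x, ‖f x‖ₑ := iSup_le fun x ↦ le_iSup (fun x ↦ ‖f x‖ₑ) (χ x)
    calc _ ≤ C₄ * tw (-(k * (M + d : ℕ))) *
          (C₆ * (C₅ * tw (j * d) * fn kd Set.univ (fun x ↦ ‖f x‖ₑ))) := by
          refine mul_le_mul' le_rfl ((hC₆ _ _).trans (mul_le_mul' le_rfl (h1.trans (hC₅ j f hf))))
      _ = (tw (-(k * (M + d : ℕ))) * tw (j * d)) *
          ((C₄ * (C₆ * C₅) : ℝ≥0) * fn kd Set.univ (fun x ↦ ‖f x‖ₑ)) := by push_cast; ring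
      _ ≤ tw (-(k * M)) * (((C₁ * (C₂ * C₃) + C₄ * (C₆ * C₅) : ℝ≥0)) *
          fn kd Set.univ (fun x ↦ ‖f x‖ₑ)) := by
          rw [← tw_add]
          refine mul_le_mul' (tw_le ?_) (mul_le_mul' (by simp) le_rfl)
          have : (j : ℝ) * d ≤ k * d := by
            have : j ≤ k := by omega
            gcongr
          push_cast; linarith
      _ = _ := by ring

/-- Comparison of a composition with the low frequencies of its localized approximation. -/
lemma exists_nu_comp_sub_le (P : LPCutoff d) (kd : Kind) (hχ : Tame m N χ)
    (h : Pull kd χ (R' + 1) ⊤) {η : Rd d → ℂ} (hη : Loc η R) (hη1 : ∀ x ∈ bal d R', η x = 1)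
    (h' : Pull kd χ (R + 1) ⊤) (hM : d ≤ M) (hMm : d + m ≤ M) (K : ℕ) (hK : N + 2 ≤ K) :
    ∃ C : ℝ≥0, ∀ (j : ℕ) (f : Rd d → ℂ), Band j f → (∃ H, ∀ x, ‖f x‖ ≤ H) →
      nu kd M R' j (fun x ↦ ‖(f ∘ χ) x - cv (P.lowKer (j + K))
        (fun y ↦ η y * cv (P.lowKer (j + N)) (f ∘ χ) y) x‖ₑ) ≤
        C * tw (-(j * m)) * fn kd Set.univ (fun x ↦ ‖f x‖ₑ) := by
  -- The decay order n + d of the high blocks pays d for Bernstein's inequality, m for the factor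
  -- 2^{-jm} and 1 for a geometric series.
  obtain ⟨n, hn⟩ := exists_nat_ge (m + 1)
  obtain ⟨C₁, hC₁⟩ := exists_nu_comp_sub_low_le P kd hχ h hM
  obtain ⟨C₂, hC₂⟩ := exists_fn_ker_mul_low_le P kd hχ.lin hη h' N (n + d)
  obtain ⟨C₃, hC₃⟩ := Band.exists_iSup_le (d := d) kd
  obtain ⟨C₄, hC₄⟩ := exists_iSup_cv_lowKer_le P
  obtain ⟨B, hB⟩ := hη.exists_bound
  have hm := hχ.pos
  refine ⟨C₁ + (1 + B) * C₄ * C₃ + C₂ * (1 + C₃) * 2, fun j f hf hb ↦ ?_⟩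
  set F := fn kd Set.univ (fun x ↦ ‖f x‖ₑ) with hF
  have hbc : ∃ H, ∀ x, ‖(f ∘ χ) x‖ ≤ H := hb.imp fun H hH x ↦ hH _
  set g := cv (P.lowKer (j + N)) (f ∘ χ) with hg
  have hgb : Band (j + N) g := P.band_cv_lowKer _ (hχ.lin.pg hf.pg)
  set w : Rd d → ℂ := fun y ↦ η y * g y with hw
  have hwpg : PG w := hη.pg hgb.pg
  have hwb : ∃ H, ∀ x, ‖w x‖ ≤ H := by
    obtain ⟨H, hH⟩ := exists_bound_cv_lowKer P hbc (j + N)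
    refine ⟨B * H, fun x ↦ ?_⟩
    rw [hw, norm_mul]
    have : ‖η x‖ ≤ B := by have := hB x; rwa [← ofReal_norm, ENNReal.ofReal_le_coe] at this
    exact mul_le_mul this (hH x) (norm_nonneg _) B.2
  have hsup : ⨆ x, ‖g x‖ₑ ≤ C₄ * (C₃ * tw (j * d) * F) :=
    (hC₄ _ _).trans (mul_le_mul' le_rfl ((iSup_le fun x ↦ le_iSup (fun x ↦ ‖f x‖ₑ) (χ x)).trans
      (hC₃ j f hf)))
  -- Three errors are made. `p1` discards the high frequencies of the composition. `p2` inserts the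
  -- cutoff η, which changes nothing on the ball of radius R' and so costs only the weighted
  -- supremum, with d + m ≤ M. `p3` discards the high frequencies of the localized function, which
  -- decay rapidly because K ≥ N + 2 puts them beyond a spectral gap.
  have p1 := hC₁ j f hf hb
  have p2 : nu kd M R' j (fun x ↦ ‖(1 - η x) * g x‖ₑ) ≤
      ((1 + B) * C₄ * C₃ : ℝ≥0) * tw (-(j * m)) * F := by
    have e1 : fn kd (bal d R') (fun x ↦ ‖(1 - η x) * g x‖ₑ) = 0 := by
      refine le_antisymm ((fn_mono (g := fun _ ↦ 0) (fun x hx ↦ ?_) (measurableSet_bal _)).trans ?_)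
        zero_le
      · rw [hη1 x hx, sub_self, zero_mul, enorm_zero]
      · cases kd <;> simp [fn]
    rw [nu, e1, zero_add]
    calc _ ≤ tw (-(j * M)) * ((1 + B) * (C₄ * (C₃ * tw (j * d) * F))) := by
          refine mul_le_mul' le_rfl (iSup_le fun x ↦ ?_)
          rw [enorm_mul]
          refine mul_le_mul' ((enorm_sub_le).trans (add_le_add (by simp) (hB x)))
            ((le_iSup (fun x ↦ ‖g x‖ₑ) x).trans hsup)
      _ = ((1 + B) * C₄ * C₃ : ℝ≥0) * (tw (-(j * M)) * tw (j * d)) * F := by push_cast; ring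
      _ ≤ _ := by
          rw [← tw_add]
          refine mul_le_mul' (mul_le_mul' le_rfl (tw_le ?_)) le_rfl
          nlinarith [(j.cast_nonneg : (0 : ℝ) ≤ j)]
  have p3 : nu kd M R' j (fun x ↦ ‖w x - cv (P.lowKer (j + K)) w x‖ₑ) ≤
      (C₂ * (1 + C₃) * 2 : ℝ≥0) * tw (-(j * m)) * F := by
    refine (nu_sub_cv_lowKer_le P kd M R' j hwpg.cont hwb _).trans ?_
    refine (tsum_tw_le (c := (C₂ * (1 + C₃)) * tw (-(j * m)) * F) fun l ↦ ?_).trans_eq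
      (by push_cast; ring)
    set k := l + (j + K + 1) with hk
    have h1 := (hC₂ j f hf k).2 (by omega)
    have hbk : Band k (cv (P.ker k) w) := P.band_cv_ker k hwpg
    have h2 : nu kd M R' j (fun x ↦ ‖cv (P.ker k) w x‖ₑ) ≤
        (1 + C₃) * tw (k * d) * fn kd Set.univ (fun x ↦ ‖cv (P.ker k) w x‖ₑ) := by
      rw [nu, add_mul, add_mul]
      refine add_le_add ?_ ?_
      · rw [one_mul]
        exact (fn_mono_set (Set.subset_univ _)).trans
          (le_mul_of_one_le_left zero_le (one_le_tw (by positivity)))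
      · refine (mul_le_mul' (tw_le_one (by rw [neg_nonpos]; positivity)) (hC₃ k _ hbk)).trans_eq ?_
        rw [one_mul]
    calc _ ≤ (1 + C₃) * tw (k * d) * (C₂ * tw (-(k * (n + d : ℕ))) * F) :=
          h2.trans (mul_le_mul' le_rfl h1)
      _ = (C₂ * (1 + C₃)) * (tw (k * d) * tw (-(k * (n + d : ℕ)))) * F := by ring
      _ ≤ (C₂ * (1 + C₃)) * (tw (-(j * m)) * tw (-l)) * F := by
          rw [← tw_add, ← tw_add]
          refine mul_le_mul' (mul_le_mul' le_rfl (tw_le ?_)) le_rfl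
          have h3 : (k : ℝ) = l + (j + K + 1) := by rw [hk]; push_cast; ring
          push_cast
          rw [h3]
          have h4 : (0 : ℝ) ≤ l := l.cast_nonneg
          have h5 : (0 : ℝ) ≤ j := j.cast_nonneg
          have h6 : (0 : ℝ) ≤ K := K.cast_nonneg
          nlinarith [mul_nonneg h4 hm.le, mul_nonneg h6 hm.le, mul_nonneg h5 hm.le,
            mul_le_mul_of_nonneg_left hn (show (0 : ℝ) ≤ l + (j + K + 1) by positivity)]
      _ = _ := by ring
  have hmeas : ∀ {f : Rd d → ℂ}, Continuous f → Measurable fun x ↦ ‖f x‖ₑ := fun h ↦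
    h.measurable.enorm
  have hc1 : Continuous fun x ↦ (f ∘ χ) x - g x :=
    (hχ.lin.pg hf.pg).cont.sub hgb.pg.cont
  have hηc : Continuous fun x ↦ (1 - η x) * g x := by
    have : (fun x ↦ (1 - η x) * g x) = fun x ↦ g x - w x := by funext x; rw [hw]; ring
    rw [this]; exact hgb.pg.cont.sub hwpg.cont
  have hc3 : Continuous fun x ↦ w x - cv (P.lowKer (j + K)) w x :=
    hwpg.cont.sub (hwpg.isFun.continuous_cv _)
  calc _ ≤ nu kd M R' j (fun x ↦ ‖(f ∘ χ) x - g x‖ₑ + ‖(1 - η x) * g x‖ₑ +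
        ‖w x - cv (P.lowKer (j + K)) w x‖ₑ) := by
        refine nu_mono fun x ↦ ?_
        rw [show (f ∘ χ) x - cv (P.lowKer (j + K)) w x = ((f ∘ χ) x - g x) + (1 - η x) * g x +
          (w x - cv (P.lowKer (j + K)) w x) by rw [hw]; ring]
        exact (enorm_add_le _ _).trans (add_le_add (enorm_add_le _ _) le_rfl)
    _ ≤ _ := nu_add ((hmeas hc1).add (hmeas hηc)) (hmeas hc3)
    _ ≤ _ := add_le_add ((nu_add (hmeas hc1) (hmeas hηc)).trans (add_le_add p1 p2)) p3
    _ = _ := by push_cast; ring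

end

section

variable {χ χ' : Rd d → Rd d} {kd : Kind} {R R' R₁ : ℝ≥0∞} {M N N' N'' : ℕ} {ρ m r δ : ℝ}

/-- The weight of the block `q` of the term `j` of the remainder. -/
def wt (r m δ : ℝ) (q j : ℕ) : ℝ≥0∞ := tw (-(q * (r + m)) + j * r - δ * |(q : ℝ) - j|)

/-- A comparison of exponents, with two triangle-inequality losses of δ. For q > l the decay M ≥ r +
m + 3δ wins; for q < l the weight r + m ≥ 2δ does. Passing from l to j costs nothing for l ≤ j, as δ
≤ r, and at most 2rc in the range j < l ≤ j + c. In particular low blocks l far below j are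
acceptable although they carry only 2^{-lm}: the smoothness r supplies the missing decay. -/
lemma tw_mul_tw_le_wt (hδ : 0 ≤ δ) (hδr : δ ≤ r) (hδm : δ ≤ m) (hM : r + m + 3 * δ ≤ M)
    {j l c : ℕ} (q : ℕ) (hl : l ≤ j + c) :
    tw (min 0 (-((q - l) * M))) * tw (-(l * m)) ≤
      tw (2 * r * c) * (wt r m δ q j * tw (-(δ * |(q : ℝ) - l|))) := by
  rw [wt, ← tw_add, ← tw_add, ← tw_add]
  apply tw_le
  have h1 : (l : ℝ) - j ≤ c := by
    have : (l : ℝ) ≤ j + c := by exact_mod_cast hl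
    linarith
  have hc : (0 : ℝ) ≤ c := c.cast_nonneg
  have h2 : |(q : ℝ) - j| ≤ |(q : ℝ) - l| + |(l : ℝ) - j| := abs_sub_le _ _ _
  have h3 : δ * |(q : ℝ) - j| ≤ δ * |(q : ℝ) - l| + δ * |(l : ℝ) - j| := by
    rw [← mul_add]; exact mul_le_mul_of_nonneg_left h2 hδ
  have h4 : ((l : ℝ) - j) * r + δ * |(l : ℝ) - j| ≤ 2 * r * c := by
    rcases le_total 0 ((l : ℝ) - j) with h | h
    · rw [abs_of_nonneg h]; nlinarith
    · rw [abs_of_nonpos h]; nlinarith [mul_nonneg (hδ.trans hδr) hc]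
  have h5 : min 0 (-(((q : ℝ) - l) * M)) + (q - l) * (r + m) + 2 * (δ * |(q : ℝ) - l|) ≤ 0 := by
    rcases le_total 0 ((q : ℝ) - l) with h | h
    · rw [abs_of_nonneg h]
      have := min_le_right 0 (-(((q : ℝ) - l) * M))
      nlinarith
    · rw [abs_of_nonpos h]
      have := min_le_left 0 (-(((q : ℝ) - l) * M))
      nlinarith
  linarith

lemma tw_mul_tw_le_wt_of_ge (hδ : 0 ≤ δ) (hr : 0 ≤ r) (hm : 0 ≤ m) (hM : r + m + 3 * δ ≤ M)
    {j k : ℕ} (q : ℕ) (hk : j ≤ k) :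
    tw (min 0 (-((q - (k + N : ℕ)) * M))) * tw (-(k * (2 * M : ℕ))) ≤
      tw (N * M) * (wt r m δ q j * tw (-(δ * k))) := by
  rw [wt, ← tw_add, ← tw_add, ← tw_add]
  apply tw_le
  have h1 : (j : ℝ) ≤ k := by exact_mod_cast hk
  have h0 : (0 : ℝ) ≤ j := j.cast_nonneg
  have hq : (0 : ℝ) ≤ q := q.cast_nonneg
  have hN : (0 : ℝ) ≤ N := N.cast_nonneg
  have hM0 : (0 : ℝ) ≤ M := M.cast_nonneg
  have hNM := mul_nonneg hN hM0
  have hjr := mul_nonneg h0 hr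
  push_cast
  rcases le_total (q : ℝ) k with h | h
  · have h2 := min_le_left 0 (-(((q : ℝ) - (k + N)) * M))
    have h3 : δ * |(q : ℝ) - j| ≤ δ * k :=
      mul_le_mul_of_nonneg_left (abs_sub_le_iff.2 ⟨by linarith, by linarith⟩) hδ
    have h4 : q * (r + m) ≤ k * (r + m) := mul_le_mul_of_nonneg_right h (by linarith)
    have h5 : k * (r + m + 3 * δ) ≤ k * M := mul_le_mul_of_nonneg_left hM (by linarith)
    have h6 : 0 ≤ k * (M : ℝ) := by positivity
    have h7 : 0 ≤ δ * (k : ℝ) := by positivity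
    linarith
  · have h2 := min_le_right 0 (-(((q : ℝ) - (k + N)) * M))
    have h3 : δ * |(q : ℝ) - j| ≤ δ * q :=
      mul_le_mul_of_nonneg_left (abs_sub_le_iff.2 ⟨by linarith, by linarith⟩) hδ
    have h4 : δ * k ≤ δ * q := mul_le_mul_of_nonneg_left h hδ
    have h5 : q * (r + m + 3 * δ) ≤ q * M := mul_le_mul_of_nonneg_left hM hq
    have h6 : 0 ≤ k * (M : ℝ) := by positivity
    have h7 : 0 ≤ δ * (q : ℝ) := by positivity
    linarith

/-- The high frequencies of a composition up to `2^L`. -/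
lemma exists_sum_lpNorm_block_ker_le (P : LPCutoff d) (kd : Kind) (hχ : Tame m N χ) {η : Rd d → ℂ}
    (hη : Loc η R) (h : Pull kd χ (R + 1) ⊤) (hδ : 0 ≤ δ) (hδr : δ ≤ r) (hδm : δ ≤ m)
    (hM : r + m + 3 * δ ≤ M) (hMd : d ≤ M) (c : ℕ) : ∃ C : ℝ≥0, ∀ j k L q : ℕ, L ≤ j + c →
      ∀ f : Rd d → ℂ, Band k f → (∃ H, ∀ x, ‖f x‖ ≤ H) →
      ∑ l ∈ Finset.Ico (k + N + 1) (L + 1),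
        lpNorm kd.p (block P q (mulT η (Op (P.blk l) (dst (f ∘ χ))))) ≤
      C * wt r m δ q j * (∑' l : ℕ, tw (-(1 * |(l : ℝ) - k|)) * tw (-(δ * |(q : ℝ) - l|))) *
        fn kd Set.univ fun x ↦ ‖f x‖ₑ := by
  obtain ⟨A, B, hA, hB, hN⟩ := hχ.app
  obtain ⟨C, hC⟩ := exists_lpNorm_block_ker_le P hχ.lin hη h hχ.pos hA hB hN hMd
  refine ⟨C * (tw (2 * r * c)).toNNReal, fun j k L q hL f hf hb ↦ ?_⟩
  push_cast
  rw [tw_coe, mul_assoc, ← ENNReal.tsum_mul_right, ← ENNReal.tsum_mul_left]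
  refine le_trans (Finset.sum_le_sum fun l hl ↦ ?_) (ENNReal.sum_le_tsum (Finset.Ico (k + N + 1) (L + 1)))
  rw [Finset.mem_Ico] at hl
  refine (hC k l q hl.1 f hf hb).trans ?_
  have h1 : ((k : ℝ) - l - l * m) = -(1 * |(l : ℝ) - k|) + -(l * m) := by
    have : (k : ℝ) ≤ l := by exact_mod_cast (show k ≤ l by omega)
    rw [abs_of_nonneg (by linarith)]; ring
  rw [h1, tw_add]
  calc _ = C * (tw (-(1 * |(l : ℝ) - k|)) * (tw (min 0 (-((q - l) * M))) * tw (-(l * m)))) *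
        fn kd Set.univ (fun x ↦ ‖f x‖ₑ) := by ring
    _ ≤ C * (tw (-(1 * |(l : ℝ) - k|)) * (tw (2 * r * c) *
          (wt r m δ q j * tw (-(δ * |(q : ℝ) - l|))))) * fn kd Set.univ (fun x ↦ ‖f x‖ₑ) :=
        mul_le_mul' (mul_le_mul' le_rfl (mul_le_mul' le_rfl
          (tw_mul_tw_le_wt hδ hδr hδm hM q (by omega)))) le_rfl
    _ = _ := by ring

lemma sum_blk_eq (P : LPCutoff d) {n L : ℕ} (h : n ≤ L) (T : 𝓢'(Rd d, ℂ)) :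
    Op (P.low n) T = Op (P.low L) T - ∑ l ∈ Finset.Ico (n + 1) (L + 1), Op (P.blk l) T := by
  have h1 : ∀ n, ∑ l ∈ Finset.range (n + 1), Op (P.blk l) T = Op (P.low n) T := fun n ↦ by
    rw [← P.sum_block]; simp_rw [P.block_eq]
  rw [Finset.sum_Ico_eq_sub _ (by omega), h1, h1]; abel

lemma dst_sum {ι : Type*} (s : Finset ι) {f : ι → Rd d → ℂ} (h : ∀ i, PG (f i)) :
    dst (fun x ↦ ∑ i ∈ s, f i x) = ∑ i ∈ s, dst (f i) :=
  (IsFun.sum fun i _ ↦ (h i).isFun).dst_eq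

lemma dst_sub {f g : Rd d → ℂ} (hf : PG f) (hg : PG g) : dst (fun x ↦ f x - g x) = dst f - dst g :=
  (hf.isFun.sub hg.isFun).dst_eq

lemma PG.neg {f : Rd d → ℂ} (hf : PG f) : PG fun x ↦ -f x := by
  obtain ⟨C, n, hC, h⟩ := hf.growth
  exact ⟨hf.cont.neg, C, n, hC, fun x ↦ by rw [norm_neg]; exact h x⟩

lemma PG.add {f g : Rd d → ℂ} (hf : PG f) (hg : PG g) : PG fun x ↦ f x + g x := by
  obtain ⟨C, n, hC, h⟩ := hf.growth
  obtain ⟨C', n', hC', h'⟩ := hg.growth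
  refine ⟨hf.cont.add hg.cont, C + C', n + n', by positivity, fun x ↦ ?_⟩
  have h1 : 1 ≤ 1 + ‖x‖ := by linarith [norm_nonneg x]
  calc _ ≤ C * (1 + ‖x‖) ^ n + C' * (1 + ‖x‖) ^ n' := (norm_add_le _ _).trans (add_le_add (h x) (h' x))
    _ ≤ C * (1 + ‖x‖) ^ (n + n') + C' * (1 + ‖x‖) ^ (n + n') := by
      gcongr <;> first | exact h1 | omega
    _ = _ := by ring

lemma PG.sub {f g : Rd d → ℂ} (hf : PG f) (hg : PG g) : PG fun x ↦ f x - g x := by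
  simpa [sub_eq_add_neg] using hf.add hg.neg

lemma exists_bound_cv_ker (P : LPCutoff d) {f : Rd d → ℂ} (hb : ∃ H, ∀ x, ‖f x‖ ≤ H) (q : ℕ) :
    ∃ H, ∀ x, ‖cv (P.ker q) f x‖ ≤ H :=
  exists_bound_of_iSup (iSup_enorm_cv_ne_top P hb q)

lemma Loc.exists_bound_mul {η g : Rd d → ℂ} (hη : Loc η R) (hg : ∃ H, ∀ x, ‖g x‖ ≤ H) :
    ∃ H, ∀ x, ‖η x * g x‖ ≤ H := by
  obtain ⟨B, hB⟩ := hη.exists_bound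
  obtain ⟨H, hH⟩ := hg
  refine ⟨B * H, fun x ↦ ?_⟩
  rw [norm_mul]
  have : ‖η x‖ ≤ B := by have := hB x; rwa [← ofReal_norm, ENNReal.ofReal_le_coe] at this
  exact mul_le_mul this (hH x) (norm_nonneg _) B.2

/-- The main estimate for the remainder in the composition formula. -/
theorem exists_lpNorm_remainder_le (P : LPCutoff d) (kd : Kind) (hχ : Tame m N χ)
    (hχ' : Tame m N' χ') (hχ'' : Tame m N'' (χ' ∘ χ)) {η η₁ : Rd d → ℂ} (hη : Loc η R)
    (hη₁ : Loc η₁ R₁) (hη1 : ∀ x ∈ bal d R', η₁ x = 1) (h : Pull kd χ (R + 1) R')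
    (h_top : Pull kd χ (R + 1) ⊤) (h' : Pull kd χ' (R' + 1) ⊤) (h₁' : Pull kd χ' (R₁ + 1) ⊤)
    (h'' : Pull kd (χ' ∘ χ) (R + 1) ⊤) (hδ : 0 < δ) (hδr : δ ≤ r) (hδm : δ ≤ m) :
    ∃ C : ℝ≥0, ∀ (j q : ℕ) (f : Rd d → ℂ), Band j f → (∃ H, ∀ x, ‖f x‖ ≤ H) → ∀ E,
      HasSum (fun k ↦ mulT η (Op (P.low (k + N)) (dst (cv (P.ker k)
        (fun y ↦ η₁ y * cv (P.lowKer (j + N')) (f ∘ χ') y) ∘ χ)))) E →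
      lpNorm kd.p (block P q (E - mulT η (Op (P.low (j + N'')) (dst (f ∘ (χ' ∘ χ)))))) ≤
        C * wt r m δ q j * fn kd Set.univ fun x ↦ ‖f x‖ₑ := by
  have hm := hχ.pos
  obtain ⟨M, hM⟩ := exists_nat_ge (r + m + 3 * δ + d)
  have hMr : r + m + 3 * δ ≤ M := by linarith [(d.cast_nonneg : (0 : ℝ) ≤ d)]
  have hMd : d ≤ M := by exact_mod_cast (show (d : ℝ) ≤ M by linarith)
  have hMm : d + m ≤ M := by linarith
  -- With this K the blocks k > j + K satisfy k ≥ j + N' + 3, the gap beyond which blocks of w decay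
  -- rapidly.
  set K := N' + 2 with hK
  -- The level L = j + c is at least every cutoff level that occurs: k + N for k ≤ j + K, and j +
  -- N''.
  set c := K + N + N'' with hc
  obtain ⟨C₁, hC₁⟩ := exists_nu_comp_sub_le P kd hχ' h' hη₁ hη1 h₁' hMd hMm K le_rfl
  obtain ⟨C₂, hC₂⟩ := exists_fn_ker_mul_low_le P kd hχ'.lin hη₁ h₁' N' (2 * M)
  obtain ⟨C₃, hC₃⟩ := exists_lpNorm_block_low_le P hχ.lin hη h M
  obtain ⟨C₃', hC₃'⟩ := exists_lpNorm_block_low_le P hχ.lin hη h_top M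
  obtain ⟨C₄, hC₄⟩ := exists_sum_lpNorm_block_ker_le P kd hχ hη h_top hδ.le hδr hδm hMr hMd c
  obtain ⟨C₅, hC₅⟩ := exists_sum_lpNorm_block_ker_le P kd hχ'' hη h'' hδ.le hδr hδm hMr hMd c
  obtain ⟨C₆, hC₆⟩ := Band.exists_nu_le (d := d) kd hMd
  obtain ⟨C₇, hC₇⟩ := tsum_tw_abs hδ
  obtain ⟨C₈, hC₈⟩ := tsum_tw_abs one_pos
  have hgeo : ∑' k : ℕ, tw (-(δ * k)) = (∑' k : ℕ, tw (-(δ * k))).toNNReal :=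
    (ENNReal.coe_toNNReal (tsum_tw_ne_top hδ)).symm
  set C₉ := (∑' k : ℕ, tw (-(δ * k))).toNNReal
  refine ⟨C₃' * (tw (N * M)).toNNReal * C₆ * C₂ * C₉ +
    C₃ * (tw (c * m)).toNNReal * (tw (2 * r * c)).toNNReal * C₁ + C₄ * (C₇ * C₈) * C₂ + C₅ * C₇,
    fun j q f hf hb E hE ↦ ?_⟩
  set F := fn kd Set.univ (fun x ↦ ‖f x‖ₑ) with hF
  set w : Rd d → ℂ := fun y ↦ η₁ y * cv (P.lowKer (j + N')) (f ∘ χ') y with hw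
  have hbc : ∃ H, ∀ x, ‖(f ∘ χ') x‖ ≤ H := hb.imp fun H hH x ↦ hH _
  have hfc : PG (f ∘ χ') := hχ'.lin.pg hf.pg
  have hwpg : PG w := hη₁.pg (P.band_cv_lowKer _ hfc).pg
  have hwb : ∃ H, ∀ x, ‖w x‖ ≤ H := hη₁.exists_bound_mul (exists_bound_cv_lowKer P hbc _)
  have hvB : ∀ k, Band k (cv (P.ker k) w) := fun k ↦ P.band_cv_ker k hwpg
  have hvb : ∀ k, ∃ H, ∀ x, ‖cv (P.ker k) w x‖ ≤ H := fun k ↦ exists_bound_cv_ker P hwb k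
  set L := j + c with hL
  set W := cv (P.lowKer (j + K)) w with hW
  have hWpg : PG W := (P.band_cv_lowKer _ hwpg).pg
  set Y : ℕ → 𝓢'(Rd d, ℂ) := fun k ↦ mulT η (Op (P.low (k + N)) (dst (cv (P.ker k) w ∘ χ))) with hY
  have hT := (hasSum_nat_add_iff' (j + K + 1)).2 hE
  set T := E - ∑ k ∈ Finset.range (j + K + 1), Y k with hT_def
  -- Raise all the cutoffs S_{k+N} to S_L; the blocks w_k with k ≤ j + K then add up to W = S_{j+K}
  -- w inside a single cutoff.
  have e1 : ∑ k ∈ Finset.range (j + K + 1), Y k = mulT η (Op (P.low L) (dst (W ∘ χ))) -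
      ∑ k ∈ Finset.range (j + K + 1), ∑ l ∈ Finset.Ico (k + N + 1) (L + 1),
        mulT η (Op (P.blk l) (dst (cv (P.ker k) w ∘ χ))) := by
    have e2 : dst (W ∘ χ) = ∑ k ∈ Finset.range (j + K + 1), dst (cv (P.ker k) w ∘ χ) := by
      rw [← dst_sum _ fun k ↦ hχ.lin.pg (hvB k).pg]
      congr 1; funext x
      exact cv_lowKer_eq_sum P hwpg _ _
    rw [e2, map_sum, map_sum, ← Finset.sum_sub_distrib]
    refine Finset.sum_congr rfl fun k hk ↦ ?_
    have hk' := Finset.mem_range.1 hk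
    rw [hY, ← map_sum, ← map_sub]
    dsimp only
    rw [sum_blk_eq P (show k + N ≤ L by omega)]
  have e3 : mulT η (Op (P.low (j + N'')) (dst (f ∘ (χ' ∘ χ)))) =
      mulT η (Op (P.low L) (dst (f ∘ (χ' ∘ χ)))) - ∑ l ∈ Finset.Ico (j + N'' + 1) (L + 1),
        mulT η (Op (P.blk l) (dst (f ∘ (χ' ∘ χ)))) := by
    rw [← map_sum, ← map_sub, sum_blk_eq P (show j + N'' ≤ L by omega)]
  have e4 : mulT η (Op (P.low L) (dst ((fun x ↦ (f ∘ χ') x - W x) ∘ χ))) =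
      mulT η (Op (P.low L) (dst (f ∘ (χ' ∘ χ)))) - mulT η (Op (P.low L) (dst (W ∘ χ))) := by
    rw [← map_sub, ← map_sub, ← dst_sub (hχ''.lin.pg hf.pg) (hχ.lin.pg hWpg)]
    rfl
  -- The error is the tail k > j + K, the defect of W as an approximation of f ∘ χ', and the high
  -- blocks of w_k ∘ χ and of f ∘ χ' ∘ χ added when raising the cutoffs.
  have e5 : E - mulT η (Op (P.low (j + N'')) (dst (f ∘ (χ' ∘ χ)))) =
      T - mulT η (Op (P.low L) (dst ((fun x ↦ (f ∘ χ') x - W x) ∘ χ))) -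
      ∑ k ∈ Finset.range (j + K + 1), ∑ l ∈ Finset.Ico (k + N + 1) (L + 1),
        mulT η (Op (P.blk l) (dst (cv (P.ker k) w ∘ χ))) +
      ∑ l ∈ Finset.Ico (j + N'' + 1) (L + 1), mulT η (Op (P.blk l) (dst (f ∘ (χ' ∘ χ)))) := by
    rw [e3, e4, hT_def, e1]; abel
  have b1 : lpNorm kd.p (block P q T) ≤ (C₃' * (tw (N * M)).toNNReal * C₆ * C₂ * C₉ : ℝ≥0) *
      wt r m δ q j * F := by
    refine (lpNorm_le_tsum (hT.mapL (block P q))).trans ?_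
    have h1 : ∀ k : ℕ, lpNorm kd.p (block P q (Y (k + (j + K + 1)))) ≤
        C₃' * tw (N * M) * C₆ * C₂ * wt r m δ q j * F * tw (-(δ * k)) := by
      intro k
      set n := k + (j + K + 1) with hn
      refine (hC₃' (n + N) q _ (hvB n).pg).trans ?_
      calc _ ≤ C₃' * tw (min 0 (-((q - (n + N : ℕ)) * M))) *
            (C₆ * (C₂ * tw (-(n * (2 * M : ℕ))) * F)) :=
            mul_le_mul' le_rfl ((hC₆ n (n + N) _ (hvB n) (by omega) ⊤).trans
              (mul_le_mul' le_rfl ((hC₂ j f hf n).2 (by omega))))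
        _ = C₃' * C₆ * C₂ * F * (tw (min 0 (-((q - (n + N : ℕ)) * M))) * tw (-(n * (2 * M : ℕ)))) := by
            ring
        _ ≤ C₃' * C₆ * C₂ * F * (tw (N * M) * (wt r m δ q j * tw (-(δ * n)))) :=
            mul_le_mul' le_rfl (tw_mul_tw_le_wt_of_ge hδ.le (hδ.le.trans hδr) hm.le hMr q (by omega))
        _ ≤ C₃' * C₆ * C₂ * F * (tw (N * M) * (wt r m δ q j * tw (-(δ * k)))) := by
            refine mul_le_mul' le_rfl (mul_le_mul' le_rfl (mul_le_mul' le_rfl (tw_le ?_)))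
            have : (k : ℝ) ≤ n := by exact_mod_cast (show k ≤ n by omega)
            nlinarith
        _ = _ := by ring
    refine (ENNReal.tsum_le_tsum h1).trans_eq ?_
    rw [ENNReal.tsum_mul_left, hgeo]
    push_cast; rw [tw_coe]; ring
  -- The gain 2^{-jm} comes from the cancellation estimate for χ'. It was proved in `nu` at level j
  -- and may be used at level L, since `nu` decreases with the level.
  have b2 : lpNorm kd.p (block P q (mulT η (Op (P.low L) (dst ((fun x ↦ (f ∘ χ') x - W x) ∘ χ))))) ≤
      (C₃ * (tw (c * m)).toNNReal * (tw (2 * r * c)).toNNReal * C₁ : ℝ≥0) * wt r m δ q j * F := by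
    refine (hC₃ L q _ (hfc.sub hWpg)).trans ?_
    have h1 := (nu_anti (show j ≤ L by omega)).trans (hC₁ j f hf hb)
    calc _ ≤ C₃ * tw (min 0 (-((q - L) * M))) * (C₁ * tw (-(j * m)) * F) := mul_le_mul' le_rfl h1
      _ = C₃ * C₁ * tw (c * m) * F * (tw (min 0 (-((q - L) * M))) * tw (-(L * m))) := by
          rw [show -((j : ℝ) * m) = c * m + -(L * m) by rw [hL]; push_cast; ring, tw_add]; ring
      _ ≤ C₃ * C₁ * tw (c * m) * F * (tw (2 * r * c) * (wt r m δ q j * 1)) := by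
          refine mul_le_mul' le_rfl ((tw_mul_tw_le_wt hδ.le hδr hδm hMr q (le_refl L)).trans ?_)
          exact mul_le_mul' le_rfl (mul_le_mul' le_rfl (tw_le_one (by
            rw [neg_nonpos]; positivity)))
      _ = _ := by push_cast; rw [tw_coe, tw_coe]; ring
  have b3 : ∑ k ∈ Finset.range (j + K + 1), ∑ l ∈ Finset.Ico (k + N + 1) (L + 1),
        lpNorm kd.p (block P q (mulT η (Op (P.blk l) (dst (cv (P.ker k) w ∘ χ))))) ≤
      (C₄ * (C₇ * C₈) * C₂ : ℝ≥0) * wt r m δ q j * F := by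
    refine (Finset.sum_le_sum fun k _ ↦ (hC₄ j k L q le_rfl _ (hvB k) (hvb k)).trans
      (mul_le_mul' le_rfl (hC₂ j f hf k).1)).trans ?_
    rw [← Finset.sum_mul, ← Finset.mul_sum]
    -- Summing over k first uses the factor 2^{-|l-k|}; this is why the cancellation estimate keeps
    -- 2^{k-l} besides 2^{-lm}.
    have h1 : ∑ k ∈ Finset.range (j + K + 1), ∑' l : ℕ, tw (-(1 * |(l : ℝ) - k|)) *
        tw (-(δ * |(q : ℝ) - l|)) ≤ C₇ * C₈ := by
      refine (ENNReal.sum_le_tsum _).trans ?_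
      rw [ENNReal.tsum_comm]
      simp_rw [ENNReal.tsum_mul_right]
      calc _ ≤ ∑' l : ℕ, C₈ * tw (-(δ * |(q : ℝ) - l|)) :=
            ENNReal.tsum_le_tsum fun l ↦ mul_le_mul' (hC₈ l) le_rfl
        _ ≤ _ := by rw [ENNReal.tsum_mul_left, mul_comm]; exact mul_le_mul' (hC₇ q) le_rfl
    calc _ ≤ C₄ * wt r m δ q j * (C₇ * C₈) * (C₂ * F) :=
          mul_le_mul' (mul_le_mul' le_rfl h1) le_rfl
      _ = _ := by push_cast; ring
  have b4 : ∑ l ∈ Finset.Ico (j + N'' + 1) (L + 1),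
        lpNorm kd.p (block P q (mulT η (Op (P.blk l) (dst (f ∘ (χ' ∘ χ)))))) ≤
      (C₅ * C₇ : ℝ≥0) * wt r m δ q j * F := by
    refine (hC₅ j j L q le_rfl f hf hb).trans ?_
    calc _ ≤ C₅ * wt r m δ q j * C₇ * F := by
          refine mul_le_mul' (mul_le_mul' le_rfl (le_trans ?_ (hC₇ q))) le_rfl
          refine ENNReal.tsum_le_tsum fun l ↦ mul_le_of_le_one_left zero_le (tw_le_one ?_)
          rw [neg_nonpos]; positivity
      _ = _ := by push_cast; ring
  rw [e5]
  simp only [map_add, map_sub, map_sum]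
  calc _ ≤ _ := Paracomposition.lpNorm_add_le _ _
    _ ≤ _ := add_le_add ((Paracomposition.lpNorm_sub_le _ _).trans (add_le_add ((Paracomposition.lpNorm_sub_le _ _).trans
        (add_le_add b1 b2)) ((Paracomposition.lpNorm_sum_le _ _).trans ((Finset.sum_le_sum fun k _ ↦
          Paracomposition.lpNorm_sum_le _ _).trans b3)))) ((Paracomposition.lpNorm_sum_le _ _).trans b4)
    _ = _ := by push_cast; ring

end

/-! ### The remainder of the composition -/

lemma hasSum_dst {ι : Type*} [Countable ι] {f : ι → Rd d → ℂ} {F : Rd d → ℂ} {b : ι → ℝ}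
    (hf : ∀ i, Continuous (f i)) (hF : Continuous F) (hb : Summable b)
    (h : ∀ i x, ‖f i x‖ ≤ b i) (hs : ∀ x, HasSum (fun i ↦ f i x) (F x)) :
    HasSum (fun i ↦ dst (f i)) (dst F) := by
  have hpg : ∀ i, PG (f i) := fun i ↦ .of_bounded (hf i) (h i)
  have hFb : ∀ x, ‖F x‖ ≤ ∑' i, b i := fun x ↦
    (hs x).norm_le_of_bounded hb.hasSum (h · x)
  rw [hasSum_iff]
  intro g
  rw [((PG.of_bounded hF hFb).isFun g).2]
  simp_rw [fun i ↦ ((hpg i).isFun g).2]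
  refine hasSum_integral_of_dominated_convergence (fun i x ↦ ‖g x‖ * b i)
    (fun i ↦ (g.continuous.mul (hf i)).aestronglyMeasurable)
    (fun i ↦ .of_forall fun x ↦ ?_) (.of_forall fun x ↦ hb.mul_left _) ?_
    (.of_forall fun x ↦ (hs x).mul_left _)
  · rw [norm_mul]; exact mul_le_mul_of_nonneg_left (h i x) (norm_nonneg _)
  · simp_rw [tsum_mul_left]
    exact g.integrable.norm.mul_const _

section

variable {χ χ' : Rd d → Rd d} {kd : Kind} {R R' R₁ : ℝ≥0∞} {M N N' N'' : ℕ} {m r : ℝ}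

/-- Any order δ of decay in k can be had at the cost of the growth 2^{jδ}: for k beyond the spectrum
of S_{j+N'} the decay is rapid, and otherwise k ≤ j + N' + 3. With δ below the smoothness of u the
double series converges absolutely, so its order of summation is free. -/
lemma exists_lpNorm_double_le (P : LPCutoff d) (kd : Kind) (hχ : LinGrowth χ) (hχ' : LinGrowth χ')
    {η η₁ : Rd d → ℂ} (hη : Loc η R) (hη₁ : Loc η₁ R₁) (h : Pull kd χ (R + 1) ⊤)
    (h' : Pull kd χ' (R₁ + 1) ⊤) (N N' : ℕ) {δ : ℝ} (hδ : 0 ≤ δ) :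
    ∃ C : ℝ≥0, ∀ (k j : ℕ) (f : Rd d → ℂ), Band j f →
      lpNorm kd.p (mulT η (Op (P.low (k + N)) (dst (cv (P.ker k)
        (fun y ↦ η₁ y * cv (P.lowKer (j + N')) (f ∘ χ') y) ∘ χ)))) ≤
      C * (tw (-(δ * k)) * (tw (j * δ) * fn kd Set.univ fun x ↦ ‖f x‖ₑ)) := by
  obtain ⟨M, hM⟩ := exists_nat_ge (max δ d)
  have hMδ : δ ≤ M := (le_max_left _ _).trans hM
  have hMd : d ≤ M := by exact_mod_cast (le_max_right δ _).trans hM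
  obtain ⟨C₁, hC₁⟩ := exists_lpNorm_low_le P hχ hη h M
  obtain ⟨C₂, hC₂⟩ := Band.exists_nu_le (d := d) kd hMd
  obtain ⟨C₃, hC₃⟩ := exists_fn_ker_mul_low_le P kd hχ' hη₁ h' N' M
  refine ⟨C₁ * C₂ * C₃ * (tw ((N' + 3) * δ)).toNNReal, fun k j f hf ↦ ?_⟩
  have hv : PG (fun y ↦ η₁ y * cv (P.lowKer (j + N')) (f ∘ χ') y) :=
    hη₁.pg (P.band_cv_lowKer _ (hχ'.pg hf.pg)).pg
  have hvB := P.band_cv_ker k hv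
  set F := fn kd Set.univ fun x ↦ ‖f x‖ₑ
  have h1 : fn kd Set.univ (fun x ↦ ‖cv (P.ker k)
      (fun y ↦ η₁ y * cv (P.lowKer (j + N')) (f ∘ χ') y) x‖ₑ) ≤
        C₃ * (tw ((N' + 3) * δ) * (tw (-(δ * k)) * tw (j * δ))) * F := by
    simp_rw [← tw_add]
    by_cases hk : j + N' + 3 ≤ k
    · refine ((hC₃ j f hf k).2 hk).trans (mul_le_mul' (mul_le_mul' le_rfl (tw_le ?_)) le_rfl)
      have h0 : (0 : ℝ) ≤ k := k.cast_nonneg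
      have h2 : (0 : ℝ) ≤ (N' + 3) * δ + j * δ := by positivity
      nlinarith
    · refine ((hC₃ j f hf k).1).trans (mul_le_mul' ?_ le_rfl)
      refine le_mul_of_one_le_right zero_le (one_le_tw ?_)
      have h2 : (k : ℝ) ≤ j + N' + 3 := by exact_mod_cast (not_le.1 hk).le
      nlinarith
  calc _ ≤ C₁ * (C₂ * (C₃ * (tw ((N' + 3) * δ) * (tw (-(δ * k)) * tw (j * δ))) * F)) :=
        (hC₁ (k + N) _ hvB.pg).trans (mul_le_mul' le_rfl
          ((hC₂ k (k + N) _ hvB (by omega) ⊤).trans (mul_le_mul' le_rfl h1)))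
    _ = _ := by push_cast; rw [tw_coe]; ring

lemma tsum_tw_mul_lpNorm_block_ne_top {P : LPCutoff d} {δ : ℝ} (hδ : δ < r)
    {u : 𝓢'(Rd d, ℂ)} (hu : nrm kd P r u < ⊤) :
    ∑' j : ℕ, tw (j * δ) * lpNorm kd.p (block P j u) ≠ ⊤ := by
  refine ne_top_of_le_ne_top (b := (∑' j : ℕ, tw (-((r - δ) * j))) * nrm kd P r u)
    (ENNReal.mul_ne_top (tsum_tw_ne_top (sub_pos.2 hδ)) hu.ne) ?_
  rw [← ENNReal.tsum_mul_right]
  refine ENNReal.tsum_le_tsum fun j ↦ (mul_le_mul' le_rfl (lpNorm_block_le_nrm kd P r u j)).trans_eq ?_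
  rw [← mul_assoc, ← tw_add]
  congr 2; ring

lemma exists_bound_ev_ker (P : LPCutoff d) {u : 𝓢'(Rd d, ℂ)} {j : ℕ}
    (hu : lpNorm kd.p (block P j u) ≠ ⊤) : ∃ H, ∀ x, ‖ev (P.ker j) u x‖ ≤ H := by
  obtain ⟨C, hC⟩ := Band.exists_iSup_le (d := d) kd
  refine exists_bound_of_iSup (ne_top_of_le_ne_top ?_ (hC j _ (P.band_ker j u)))
  exact ENNReal.mul_ne_top (ENNReal.mul_ne_top ENNReal.coe_ne_top (tw_ne_top _))
    (ne_top_of_le_ne_top hu (fn_ev_ker_le kd P u j))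

-- Both paracompositions are brought to sums over the blocks j of U. The iterated one is a double
-- series in (k, j): summed over j first it is the paracomposition of W, summed over k first it
-- gives the E_j to which the single-block estimate applies. Summation over j is then almost
-- orthogonal with weight r + m.
set_option maxHeartbeats 800000 in
theorem exists_nrm_remainder_le (P : LPCutoff d) (kd : Kind) (hχ : Tame m N χ)
    (hχ' : Tame m N' χ') (hχ'' : Tame m N'' (χ' ∘ χ)) {η η₁ : Rd d → ℂ} (hη : Loc η R)
    (hη₁ : Loc η₁ R₁) (hη1 : ∀ x ∈ bal d R', η₁ x = 1) (h : Pull kd χ (R + 1) R')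
    (h_top : Pull kd χ (R + 1) ⊤) (h' : Pull kd χ' (R' + 1) ⊤) (h₁' : Pull kd χ' (R₁ + 1) ⊤)
    (h'' : Pull kd (χ' ∘ χ) (R + 1) ⊤) (hr : 0 < r) :
    ∃ C : ℝ≥0, ∀ U, nrm kd P r U < ⊤ → ∃ W V Z,
      HasSum (fun j ↦ mulT η₁ (lowFreq P N' j (dst (ev (P.ker j) U ∘ χ')))) W ∧
      HasSum (fun k ↦ mulT η (lowFreq P N k (dst (ev (P.ker k) W ∘ χ)))) V ∧
      HasSum (fun j ↦ mulT η (lowFreq P N'' j (dst (ev (P.ker j) U ∘ (χ' ∘ χ))))) Z ∧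
      nrm kd P r W ≤ C * nrm kd P r U ∧ nrm kd P (r + m) (V - Z) ≤ C * nrm kd P r U := by
  have hm := hχ.pos
  set δ := min r m
  have hδ : 0 < δ := lt_min hr hm
  obtain ⟨C₁, hC₁⟩ := exists_nrm_paracomp_le kd P hχ'.lin hη₁ h₁' hr N'
  obtain ⟨C₂, hC₂⟩ := exists_nrm_paracomp_le kd P hχ''.lin hη h'' hr N''
  obtain ⟨C₃, hC₃⟩ := exists_lpNorm_double_le P kd hχ.lin hχ'.lin hη hη₁ h_top h₁' N N' (half_pos hr).le
  obtain ⟨C₄, hC₄⟩ := exists_lpNorm_remainder_le P kd hχ hχ' hχ'' hη hη₁ hη1 h h_top h' h₁' h'' hδ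
    (min_le_left _ _) (min_le_right _ _)
  obtain ⟨C₅, hC₅⟩ := exists_nrm_le kd P (r + m) r hδ (d := d)
  obtain ⟨C₆, hC₆⟩ := Band.exists_iSup_le (d := d) kd
  obtain ⟨C₇, hC₇⟩ := exists_fn_ker_mul_low_le P kd hχ'.lin hη₁ h₁' N' 0
  refine ⟨max C₁ (C₅ * C₄), fun U hU ↦ ?_⟩
  obtain ⟨W, hW, hWn⟩ := hC₁ U hU
  obtain ⟨Z, hZ, -⟩ := hC₂ U hU
  set f : ℕ → Rd d → ℂ := fun j ↦ ev (P.ker j) U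
  set a : ℕ → ℝ≥0∞ := fun j ↦ lpNorm kd.p (block P j U)
  have hfa : ∀ j, fn kd Set.univ (fun x ↦ ‖f j x‖ₑ) ≤ a j := fn_ev_ker_le kd P U
  have hfB : ∀ j, Band j (f j) := fun j ↦ P.band_ker j U
  have ha : ∑' j, a j ≠ ⊤ := tsum_lpNorm_block_ne_top hr hU
  have hfb : ∀ j, ∃ H, ∀ x, ‖f j x‖ ≤ H := fun j ↦
    exists_bound_ev_ker (kd := kd) P (ne_top_of_le_ne_top ha (ENNReal.le_tsum j))
  set g : ℕ → Rd d → ℂ := fun j y ↦ η₁ y * cv (P.lowKer (j + N')) (f j ∘ χ') y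
  have hg : ∀ j, PG (g j) := fun j ↦ hη₁.pg (P.band_cv_lowKer _ (hχ'.lin.pg (hfB j).pg)).pg
  set v : ℕ → ℕ → Rd d → ℂ := fun k j ↦ cv (P.ker k) (g j)
  have hv : ∀ k j, Band k (v k j) := fun k j ↦ P.band_cv_ker k (hg j)
  have hgT : ∀ j, IsFun (g j) (mulT η₁ (lowFreq P N' j (dst (f j ∘ χ')))) := fun j ↦ by
    rw [P.lowFreq_eq]
    exact hη₁.isFun_mulT ((hχ'.lin.pg (hfB j).pg).isFun.isFun_Op _)
  -- The block k of W is the sum over j of the blocks of the terms g_j, uniformly by Bernstein's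
  -- inequality, so composition with χ may be performed term by term.
  have hWv : ∀ k, HasSum (fun j ↦ dst (v k j ∘ χ)) (dst (ev (P.ker k) W ∘ χ)) := fun k ↦ by
    have h1 : ∀ j x, ‖v k j x‖ₑ ≤ C₆ * tw (k * d) * (C₇ * a j) := fun j x ↦ by
      refine (le_iSup (fun x ↦ ‖v k j x‖ₑ) x).trans ((hC₆ k _ (hv k j)).trans ?_)
      exact mul_le_mul' le_rfl (((hC₇ j _ (hfB j) k).1).trans (mul_le_mul' le_rfl (hfa j)))
    have h2 : ∑' j, C₆ * tw (k * d) * (C₇ * a j) ≠ ⊤ := by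
      rw [ENNReal.tsum_mul_left, ENNReal.tsum_mul_left]
      exact ENNReal.mul_ne_top (ENNReal.mul_ne_top ENNReal.coe_ne_top (tw_ne_top _))
        (ENNReal.mul_ne_top ENNReal.coe_ne_top ha)
    refine hasSum_dst (fun j ↦ (hv k j).pg.cont.comp hχ.lin.cont)
      ((continuous_ev _ _).comp hχ.lin.cont) (ENNReal.summable_toReal h2) (fun j x ↦ ?_) fun x ↦ ?_
    · rw [← toReal_enorm]
      exact ENNReal.toReal_mono (ENNReal.ne_top_of_tsum_ne_top h2 j) (h1 j (χ x))
    · have h3 := (hasSum_iff.1 hW) (tr (χ x) (P.ker k))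
      refine h3.congr_fun fun j ↦ ?_
      exact (congrFun ((hgT j).ev_eq (P.ker k)) (χ x)).symm
  set X : ℕ × ℕ → 𝓢'(Rd d, ℂ) := fun p ↦ mulT η (Op (P.low (p.1 + N)) (dst (v p.1 p.2 ∘ χ)))
  have hX : ∑' p, lpNorm kd.p (X p) ≠ ⊤ := by
    refine ne_top_of_le_ne_top ?_ (ENNReal.tsum_le_tsum fun p ↦ (hC₃ p.1 p.2 _ (hfB p.2)).trans
      (mul_le_mul' le_rfl (mul_le_mul' le_rfl (mul_le_mul' le_rfl (hfa p.2)))))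
    rw [ENNReal.tsum_prod']
    simp_rw [ENNReal.tsum_mul_left, ENNReal.tsum_mul_right]
    exact ENNReal.mul_ne_top ENNReal.coe_ne_top (ENNReal.mul_ne_top (tsum_tw_ne_top (half_pos hr))
      (tsum_tw_mul_lpNorm_block_ne_top (half_lt_self hr) hU))
  obtain ⟨V, hV, -⟩ := exists_hasSum_of_lpNorm hX
  have hV1 : HasSum (fun k ↦ mulT η (lowFreq P N k (dst (ev (P.ker k) W ∘ χ)))) V := by
    rw [hasSum_iff] at hV ⊢
    intro φ
    refine (hV φ).prod_fiberwise fun k ↦ ?_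
    have h1 := ((hWv k).mapL (Op (P.low (k + N)))).mapL (mulT η)
    rw [P.lowFreq_eq]
    exact hasSum_iff.1 h1 φ
  have hE : ∀ j, ∃ E, HasSum (fun k ↦ X (k, j)) E := fun j ↦ by
    rw [ENNReal.tsum_prod', ENNReal.tsum_comm] at hX
    obtain ⟨E, hE, -⟩ := exists_hasSum_of_lpNorm (ENNReal.ne_top_of_tsum_ne_top hX j)
    exact ⟨E, hE⟩
  choose E hE using hE
  -- The same double sum taken in the other order.
  have hV2 : HasSum E V := by
    rw [hasSum_iff] at hV ⊢
    intro φ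
    refine HasSum.prod_fiberwise (f := fun p : ℕ × ℕ ↦ X p.swap φ) ?_ fun j ↦ hasSum_iff.1 (hE j) φ
    exact (Equiv.prodComm ℕ ℕ).hasSum_iff.2 (hV φ)
  refine ⟨W, V, Z, hW, hV1, hZ, hWn.trans (mul_le_mul' (by simp) le_rfl), ?_⟩
  refine (hC₅ _ _ a C₄ (hV2.sub hZ) fun q j ↦ ?_).trans ?_
  · rw [P.lowFreq_eq]
    refine (hC₄ j q (f j) (hfB j) (hfb j) (E j) (hE j)).trans (mul_le_mul' le_rfl (hfa j))
  · refine mul_le_mul' ?_ le_rfl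
    rw [← ENNReal.coe_mul]
    exact_mod_cast le_max_right _ _

end

/-! ### Kernels and bounded sets of Schwartz functions -/

/-- Leibniz' rule: only derivatives of f on the support of θ matter, with constants independent of
f. This allows separation of supports to be turned into smallness of all Schwartz seminorms. -/
lemma exists_seminorm_smulLeft_le {θ : Rd d → ℂ} (hθ : θ.HasTemperateGrowth)
    (s : Finset (ℕ × ℕ)) : ∃ (C : ℝ) (p n : ℕ), 0 ≤ C ∧ ∀ (f : 𝓢(Rd d, ℂ)) (H : ℝ), 0 ≤ H →
      (∀ z ∈ tsupport θ, ∀ i ≤ n, (1 + ‖z‖) ^ p * ‖iteratedFDeriv ℝ i f z‖ ≤ H) →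
      s.sup (schwartzSeminormFamily ℂ (Rd d) ℂ) (SchwartzMap.smulLeftCLM ℂ θ f) ≤ C * H := by
  choose l C hC hl using fun n ↦ hθ.norm_iteratedFDeriv_le_uniform n
  refine ⟨∑ i ∈ s, 2 ^ i.2 * C i.2, s.sup fun i ↦ i.1 + l i.2, s.sup Prod.snd,
    Finset.sum_nonneg fun i _ ↦ mul_nonneg (by positivity) (hC _), fun f H hH h ↦ ?_⟩
  refine Seminorm.finset_sup_apply_le (mul_nonneg (Finset.sum_nonneg fun i _ ↦
    mul_nonneg (by positivity) (hC _)) hH) fun i hi ↦ ?_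
  refine le_trans ?_ (mul_le_mul_of_nonneg_right (Finset.single_le_sum
    (f := fun i : ℕ × ℕ ↦ 2 ^ i.2 * C i.2) (fun i _ ↦ mul_nonneg (by positivity) (hC _)) hi) hH)
  refine SchwartzMap.seminorm_le_bound _ _ _ _ (by have := hC i.2; positivity) fun z ↦ ?_
  have hfun : (SchwartzMap.smulLeftCLM ℂ θ f : Rd d → ℂ) = fun z ↦ θ z * f z :=
    funext fun z ↦ SchwartzMap.smulLeftCLM_apply_apply hθ f z
  rw [hfun]
  by_cases hz : z ∈ tsupport θ
  · have h1 := norm_iteratedFDeriv_mul_le (n := i.2) hθ.1 (f.smooth ⊤) z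
      (by exact_mod_cast le_top)
    have hp : i.1 + l i.2 ≤ s.sup fun i ↦ i.1 + l i.2 :=
      Finset.le_sup (f := fun i : ℕ × ℕ ↦ i.1 + l i.2) hi
    calc _ ≤ (1 + ‖z‖) ^ i.1 * ∑ j ∈ Finset.range (i.2 + 1), (i.2.choose j : ℝ) *
          ‖iteratedFDeriv ℝ j θ z‖ * ‖iteratedFDeriv ℝ (i.2 - j) f z‖ := by
          gcongr; linarith
      _ ≤ ∑ j ∈ Finset.range (i.2 + 1), (i.2.choose j : ℝ) * (C i.2 * H) := by
          rw [Finset.mul_sum]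
          refine Finset.sum_le_sum fun j hj ↦ ?_
          have h2 := hl i.2 j (Finset.mem_range_succ_iff.1 hj) z
          have h3 := h z hz (i.2 - j) ((Nat.sub_le _ _).trans (Finset.le_sup (f := Prod.snd) hi))
          have h4 : (1 + ‖z‖) ^ (i.1 + l i.2) ≤ (1 + ‖z‖) ^ (s.sup fun i ↦ i.1 + l i.2) :=
            pow_le_pow_right₀ (by linarith [norm_nonneg z]) hp
          have h5 := hC i.2
          calc _ ≤ (1 + ‖z‖) ^ i.1 * ((i.2.choose j : ℝ) * (C i.2 * (1 + ‖z‖) ^ l i.2) *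
                ‖iteratedFDeriv ℝ (i.2 - j) f z‖) := by gcongr
            _ = (i.2.choose j : ℝ) * (C i.2 * ((1 + ‖z‖) ^ (i.1 + l i.2) *
                ‖iteratedFDeriv ℝ (i.2 - j) f z‖)) := by ring
            _ ≤ _ := by
              gcongr
              exact (mul_le_mul_of_nonneg_right h4 (norm_nonneg _)).trans h3
      _ = _ := by
          rw [← Finset.sum_mul, ← Nat.cast_sum, Nat.sum_range_choose]; push_cast; ring
  · have h1 : iteratedFDeriv ℝ i.2 (fun z ↦ θ z * f z) z = 0 := by
      by_contra h2
      exact hz (tsupport_mul_subset_left (support_iteratedFDeriv_subset i.2 h2))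
    rw [h1, norm_zero, mul_zero]
    have := hC i.2; positivity

lemma norm_iteratedFDeriv_ks_le (g : 𝓢(Rd d, ℂ)) (i k : ℕ) (w : Rd d) :
    ‖iteratedFDeriv ℝ i (ks k g) w‖ ≤
      2 ^ (k * (d + i)) * ‖iteratedFDeriv ℝ i g ((2 : ℝ) ^ k • w)‖ := by
  set L : Rd d →L[ℝ] Rd d := (2 : ℝ) ^ k • ContinuousLinearMap.id ℝ (Rd d)
  have hL : ‖L‖ ≤ 2 ^ k := by
    rw [norm_smul, norm_pow, Real.norm_two]
    exact mul_le_of_le_one_right (by positivity) (ContinuousLinearMap.norm_id_le (𝕜 := ℝ) (E := Rd d))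
  have h1 : ks k g = fun z ↦ ((2 : ℂ) ^ (k * d)) • (g ∘ L) z := by
    funext z; simp [ks, L]
  rw [h1, iteratedFDeriv_const_smul_apply' (((g.smooth ⊤).comp L.contDiff).contDiffAt.of_le
      (by exact_mod_cast le_top)),
    L.iteratedFDeriv_comp_right (g.smooth ⊤) w (by exact_mod_cast le_top), norm_smul, norm_pow,
    Complex.norm_two]
  have h2 := (iteratedFDeriv ℝ i g (L w)).norm_compContinuousLinearMap_le fun _ ↦ L
  rw [Finset.prod_const, Finset.card_univ, Fintype.card_fin] at h2
  calc _ ≤ (2 : ℝ) ^ (k * d) * (‖iteratedFDeriv ℝ i g (L w)‖ * (2 ^ k) ^ i) := by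
        gcongr; exact h2.trans (by gcongr)
    _ = _ := by simp only [L]; simp; ring

lemma exists_iteratedFDeriv_le (g : 𝓢(Rd d, ℂ)) (n A : ℕ) : ∃ C : ℝ, 0 ≤ C ∧ ∀ i ≤ n, ∀ w,
    ‖iteratedFDeriv ℝ i g w‖ ≤ C / (1 + ‖w‖) ^ A := by
  refine ⟨2 ^ A * ((Finset.Iic (A, n)).sup fun m ↦ SchwartzMap.seminorm ℂ m.1 m.2) g,
    by positivity, fun i hi w ↦ ?_⟩
  rw [le_div_iff₀ (by positivity), mul_comm]
  exact SchwartzMap.one_add_le_sup_seminorm_apply (𝕜 := ℂ) (m := (A, n)) (k := A) le_rfl hi g w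

lemma LPCutoff.exists_iteratedFDeriv_lowKer_le (P : LPCutoff d) (n A : ℕ) : ∃ C : ℝ, 0 ≤ C ∧
    ∀ i ≤ n, ∀ k w, ‖iteratedFDeriv ℝ i (P.lowKer k) w‖ ≤
      C * (2 ^ k) ^ (d + n) / (1 + 2 ^ k * ‖w‖) ^ A := by
  obtain ⟨C, hC, h⟩ := exists_iteratedFDeriv_le (𝓕 P.base : 𝓢(Rd d, ℂ)) n A
  refine ⟨C, hC, fun i hi k w ↦ ?_⟩
  rw [P.lowKer_eq]
  refine (norm_iteratedFDeriv_ks_le _ i k w).trans ?_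
  have h1 := h i hi ((2 : ℝ) ^ k • w)
  rw [norm_smul, norm_pow, Real.norm_two] at h1
  calc _ ≤ (2 ^ k) ^ (d + n) * (C / (1 + 2 ^ k * ‖w‖) ^ A) := by
        rw [pow_mul]
        gcongr
        exact one_le_pow₀ one_le_two
    _ = _ := by ring

lemma LPCutoff.exists_iteratedFDeriv_ker_le (P : LPCutoff d) (n A : ℕ) : ∃ C : ℝ, 0 ≤ C ∧
    ∀ i ≤ n, ∀ k w, ‖iteratedFDeriv ℝ i (P.ker k) w‖ ≤
      C * (2 ^ k) ^ (d + n) / (1 + 2 ^ k * ‖w‖) ^ A := by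
  obtain ⟨C, hC, h⟩ := P.exists_iteratedFDeriv_lowKer_le n A
  refine ⟨C * (1 + 2 ^ A), by positivity, fun i hi k w ↦ ?_⟩
  cases k with
  | zero =>
    refine (h i hi 0 w).trans ?_
    gcongr
    exact le_mul_of_one_le_right hC (by linarith [pow_pos (two_pos (α := ℝ)) A])
  | succ k =>
    have h1 : (P.ker (k + 1) : Rd d → ℂ) = (P.lowKer (k + 1) : Rd d → ℂ) - P.lowKer k := by
      rw [P.ker_succ]; rfl
    rw [h1, iteratedFDeriv_sub_apply (((P.lowKer (k + 1)).smooth i).contDiffAt)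
      (((P.lowKer k).smooth i).contDiffAt)]
    refine (norm_sub_le _ _).trans ((add_le_add (h i hi (k + 1) w) (h i hi k w)).trans ?_)
    have h2 : C * (2 ^ k) ^ (d + n) / (1 + 2 ^ k * ‖w‖) ^ A ≤
        2 ^ A * (C * (2 ^ (k + 1)) ^ (d + n) / (1 + 2 ^ (k + 1) * ‖w‖) ^ A) := by
      have h3 : 1 + 2 ^ (k + 1) * ‖w‖ ≤ 2 * (1 + 2 ^ k * ‖w‖) := by rw [pow_succ]; linarith
      rw [← mul_div_assoc, div_le_div_iff₀ (by positivity) (by positivity)]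
      calc _ ≤ C * (2 ^ (k + 1)) ^ (d + n) * (2 * (1 + 2 ^ k * ‖w‖)) ^ A := by
            gcongr <;> norm_num
        _ = _ := by rw [mul_pow]; ring
    calc _ ≤ _ := add_le_add le_rfl h2
      _ = _ := by ring

/-- The reflection of a Schwartz function. -/
def refl (K : 𝓢(Rd d, ℂ)) : 𝓢(Rd d, ℂ) :=
  compCLMOfContinuousLinearEquiv ℂ (ContinuousLinearEquiv.neg ℝ) K

lemma tr_refl_apply (K : 𝓢(Rd d, ℂ)) (y z : Rd d) : tr y (refl K) z = K (y - z) := by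
  simp [tr, refl]

lemma norm_iteratedFDeriv_tr_refl (K : 𝓢(Rd d, ℂ)) (i : ℕ) (y z : Rd d) :
    ‖iteratedFDeriv ℝ i (tr y (refl K)) z‖ = ‖iteratedFDeriv ℝ i K (y - z)‖ := by
  rw [iteratedFDeriv_tr]
  have := (LinearIsometryEquiv.neg ℝ (E := Rd d)).norm_iteratedFDeriv_comp_right (𝕜 := ℝ)
    (K : Rd d → ℂ) (z - y) i
  rw [show y - z = LinearIsometryEquiv.neg ℝ (z - y) by simp, ← this]
  rfl

/-- For ‖y‖ > R + 1 and ‖z‖ ≤ R one has ‖y - z‖ ≥ (1 + ‖y‖)/(2 + R), so the kernel at scale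
2^{-(k+N)} decays to any order in 2^k(1 + ‖y‖). For nearer y only polynomial growth in 2^k remains.
Its order n is independent of A, so A can be chosen later to beat other losses. -/
lemma exists_seminorm_mul_lowKer_le (P : LPCutoff d) {ψ : Rd d → ℂ} (hψ : ψ.HasTemperateGrowth)
    {R : ℝ} (hR : 0 ≤ R) (hψR : ∀ z ∈ tsupport ψ, ‖z‖ ≤ R) (N : ℕ) (s : Finset (ℕ × ℕ)) :
    ∃ n : ℕ, ∀ A : ℕ, ∃ C : ℝ, 0 ≤ C ∧ ∀ (k : ℕ) (y : Rd d),
      (s.sup (schwartzSeminormFamily ℂ (Rd d) ℂ)) (SchwartzMap.smulLeftCLM ℂ ψ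
          (tr y (refl (P.lowKer (k + N))))) ≤ C * (2 ^ k) ^ n ∧
      (R + 1 < ‖y‖ → (s.sup (schwartzSeminormFamily ℂ (Rd d) ℂ)) (SchwartzMap.smulLeftCLM ℂ ψ
          (tr y (refl (P.lowKer (k + N))))) * (2 ^ k * (1 + ‖y‖)) ^ A ≤ C) := by
  obtain ⟨C₁, p, n, hC₁, h₁⟩ := exists_seminorm_smulLeft_le hψ s
  refine ⟨d + n, fun A ↦ ?_⟩
  obtain ⟨C₂, hC₂, h₂⟩ := P.exists_iteratedFDeriv_lowKer_le n (A + (d + n))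
  set D : ℝ := C₁ * ((1 + R) ^ p * (C₂ * (2 ^ N) ^ (d + n)))
  have hD : 0 ≤ D := by positivity
  have hR2 : (1 : ℝ) ≤ (2 + R) ^ (A + (d + n)) := one_le_pow₀ (by linarith)
  refine ⟨D * (2 + R) ^ (A + (d + n)), by positivity, fun k y ↦ ⟨?_, fun hy ↦ ?_⟩⟩
  · refine (h₁ _ ((1 + R) ^ p * (C₂ * (2 ^ (k + N)) ^ (d + n))) (by positivity)
      fun z hz i hi ↦ ?_).trans ?_
    · rw [norm_iteratedFDeriv_tr_refl]
      have h3 := hψR z hz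
      gcongr
      refine (h₂ i hi (k + N) (y - z)).trans (div_le_self (by positivity) (one_le_pow₀ ?_))
      have : 0 ≤ 2 ^ (k + N) * ‖y - z‖ := by positivity
      linarith
    · calc _ = D * (2 ^ k) ^ (d + n) := by rw [pow_add 2 k N, mul_pow]; ring
        _ ≤ _ := by gcongr; exact le_mul_of_one_le_right hD hR2
  · have hv : (1 : ℝ) ≤ 1 + ‖y‖ := by linarith [norm_nonneg y]
    have ha : (1 : ℝ) ≤ 2 ^ k := one_le_pow₀ one_le_two
    have h0 := h₁ (tr y (refl (P.lowKer (k + N)))) ((1 + R) ^ p * (C₂ * (2 ^ (k + N)) ^ (d + n) /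
      (2 ^ k * (1 + ‖y‖) / (2 + R)) ^ (A + (d + n)))) (by positivity) fun z hz i hi ↦ by
        rw [norm_iteratedFDeriv_tr_refl]
        have h3 := hψR z hz
        have h4 : ‖y‖ ≤ ‖y - z‖ + ‖z‖ := by simpa using norm_add_le (y - z) z
        have h5 : (1 + ‖y‖) / (2 + R) ≤ ‖y - z‖ := by
          rw [div_le_iff₀ (by linarith)]; nlinarith
        gcongr
        refine (h₂ i hi (k + N) (y - z)).trans ?_
        gcongr
        calc 2 ^ k * (1 + ‖y‖) / (2 + R) = 2 ^ k * ((1 + ‖y‖) / (2 + R)) := by ring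
          _ ≤ 2 ^ (k + N) * ‖y - z‖ := by
              gcongr
              · norm_num
              · omega
          _ ≤ _ := by linarith
    refine (mul_le_mul_of_nonneg_right h0 (by positivity)).trans ?_
    rw [div_pow, div_div_eq_mul_div]
    have h6 : ((2 : ℝ) ^ k) ^ (d + n) * (2 ^ k * (1 + ‖y‖)) ^ A ≤
        (2 ^ k * (1 + ‖y‖)) ^ (A + (d + n)) := by
      rw [pow_add _ A, mul_comm]
      refine mul_le_mul_of_nonneg_left (pow_le_pow_left₀ (by positivity) ?_ _) (by positivity)
      exact le_mul_of_one_le_right (by positivity) hv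
    calc _ = D * (2 + R) ^ (A + (d + n)) * (((2 : ℝ) ^ k) ^ (d + n) * (2 ^ k * (1 + ‖y‖)) ^ A /
          (2 ^ k * (1 + ‖y‖)) ^ (A + (d + n))) := by rw [pow_add 2 k N, mul_pow]; ring
      _ ≤ _ := mul_le_of_le_one_right (by positivity) (div_le_one_of_le₀ h6 (by positivity))

/-- The counterpart for the factor θ, whose support keeps distance 1 from the ball of radius r: a
block kernel centred in that ball is smaller on the support than any power of 2^{-k}, while
elsewhere polynomial bounds suffice. Again the orders n and p precede the choice of A. -/
lemma exists_seminorm_mul_ker_le (P : LPCutoff d) {θ : Rd d → ℂ} (hθ : θ.HasTemperateGrowth)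
    {r : ℝ} (hr : 0 ≤ r) (hθr : ∀ z ∈ tsupport θ, r + 1 ≤ ‖z‖) (s : Finset (ℕ × ℕ)) :
    ∃ n p : ℕ, ∀ A : ℕ, ∃ C : ℝ, 0 ≤ C ∧ ∀ (k : ℕ) (w : Rd d),
      (s.sup (schwartzSeminormFamily ℂ (Rd d) ℂ)) (SchwartzMap.smulLeftCLM ℂ θ
          (tr w (P.ker k))) ≤ C * ((2 ^ k) ^ n * (1 + ‖w‖) ^ p) ∧
      (‖w‖ ≤ r → (s.sup (schwartzSeminormFamily ℂ (Rd d) ℂ)) (SchwartzMap.smulLeftCLM ℂ θ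
          (tr w (P.ker k))) * (2 ^ k) ^ A ≤ C) := by
  obtain ⟨C₁, p, n, hC₁, h₁⟩ := exists_seminorm_smulLeft_le hθ s
  refine ⟨d + n, p, fun A ↦ ?_⟩
  obtain ⟨C₂, hC₂, h₂⟩ := P.exists_iteratedFDeriv_ker_le n (p + (A + (d + n)))
  refine ⟨C₁ * C₂ * (1 + r) ^ p, by positivity, fun k w ↦ ?_⟩
  have ha : (1 : ℝ) ≤ 2 ^ k := one_le_pow₀ one_le_two
  have key : ∀ z, ∀ i ≤ n, (1 + ‖z‖) ^ p * ‖iteratedFDeriv ℝ i (tr w (P.ker k)) z‖ ≤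
      (1 + ‖w‖) ^ p * C₂ * (2 ^ k) ^ (d + n) / (1 + 2 ^ k * ‖z - w‖) ^ (A + (d + n)) := by
    intro z i hi
    rw [iteratedFDeriv_tr]
    have h3 : 1 + ‖z‖ ≤ (1 + ‖w‖) * (1 + 2 ^ k * ‖z - w‖) := by
      have h4 : ‖z‖ ≤ ‖z - w‖ + ‖w‖ := by simpa using norm_add_le (z - w) w
      have h5 : ‖z - w‖ ≤ 2 ^ k * ‖z - w‖ := le_mul_of_one_le_left (norm_nonneg _) ha
      have h6 : 0 ≤ ‖w‖ * (2 ^ k * ‖z - w‖) := by positivity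
      nlinarith
    calc _ ≤ ((1 + ‖w‖) * (1 + 2 ^ k * ‖z - w‖)) ^ p *
          (C₂ * (2 ^ k) ^ (d + n) / (1 + 2 ^ k * ‖z - w‖) ^ (p + (A + (d + n)))) := by
          gcongr; exact h₂ i hi k (z - w)
      _ = _ := by
          rw [mul_pow, pow_add _ p]
          have : (1 + 2 ^ k * ‖z - w‖) ≠ 0 := by positivity
          field_simp
  have hr1 : (1 : ℝ) ≤ (1 + r) ^ p := one_le_pow₀ (by linarith)
  refine ⟨?_, fun hw ↦ ?_⟩
  · refine (h₁ _ ((1 + ‖w‖) ^ p * C₂ * (2 ^ k) ^ (d + n)) (by positivity) fun z _ i hi ↦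
      (key z i hi).trans (div_le_self (by positivity) (one_le_pow₀ ?_))).trans ?_
    · have : 0 ≤ 2 ^ k * ‖z - w‖ := by positivity
      linarith
    · calc _ = C₁ * C₂ * ((2 ^ k) ^ (d + n) * (1 + ‖w‖) ^ p) := by ring
        _ ≤ _ := mul_le_mul_of_nonneg_right (le_mul_of_one_le_right (by positivity) hr1)
            (by positivity)
  · have h0 := h₁ (tr w (P.ker k)) ((1 + r) ^ p * C₂ * (2 ^ k) ^ (d + n) /
      (2 ^ k) ^ (A + (d + n))) (by positivity) fun z hz i hi ↦ by
        have h4 : ‖z‖ ≤ ‖z - w‖ + ‖w‖ := by simpa using norm_add_le (z - w) w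
        have h5 : 1 ≤ ‖z - w‖ := by linarith [hθr z hz]
        refine (key z i hi).trans ?_
        gcongr
        have : (2 : ℝ) ^ k * 1 ≤ 2 ^ k * ‖z - w‖ := by gcongr
        linarith
    refine (mul_le_mul_of_nonneg_right h0 (by positivity)).trans_eq ?_
    rw [pow_add _ A]
    field_simp

/-! ### The contribution of the part of `u` away from the range of a ball -/

/-- The symbol of the fat cutoff is 1 at the origin, so its kernel has integral 1. This lets the
estimate for products g F be used for a Schwartz function g alone. -/
lemma band_one : Band 0 fun _ : Rd d ↦ (1 : ℂ) where
  pg := .of_bounded continuous_const (C := 1) (by simp)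
  eq δ hδ x := by
    have hpg : PG fun _ : Rd d ↦ (1 : ℂ) := .of_bounded continuous_const (C := 1) (by simp)
    have h1 : (ks 0 (𝓕 (fat δ hδ) : 𝓢(Rd d, ℂ)) : Rd d → ℂ) = (𝓕 (fat δ hδ) : 𝓢(Rd d, ℂ)) := by
      funext z; simp [ks]
    rw [h1]
    refine ⟨hpg.isFun.integrable_tr _ x, ?_⟩
    simp_rw [mul_one]
    rw [integral_sub_right_eq_self (fun y ↦ (𝓕 (fat δ hδ) : 𝓢(Rd d, ℂ)) y) x]
    have h2 : (𝓕⁻ (𝓕 (fat δ hδ) : 𝓢(Rd d, ℂ)) : 𝓢(Rd d, ℂ)) 0 = fat (d := d) δ hδ 0 := by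
      rw [FourierTransform.fourierInv_fourier_eq]
    rw [SchwartzMap.fourierInv_coe, Real.fourierInv_eq] at h2
    simp only [inner_zero_right, AddChar.map_zero_eq_one, one_smul] at h2
    rw [h2, fat_eq_one hδ (by rw [norm_zero]; positivity)]

lemma exists_enorm_cv_schwartz_le (K : 𝓢(Rd d, ℂ)) : ∃ (C : ℝ≥0) (s : Finset (ℕ × ℕ)),
    ∀ (g : 𝓢(Rd d, ℂ)) (x : Rd d), ‖cv K g x‖ₑ ≤
      C * ENNReal.ofReal (s.sup (schwartzSeminormFamily ℂ (Rd d) ℂ) g) *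
        ENNReal.ofReal (jap (d + 1) 0 x) := by
  obtain ⟨C₁, hC₁, hK⟩ := exists_decay K ((d + 1) + (d + 1))
  obtain ⟨C₂, hC₂⟩ := exists_lintegral_jap d
  refine ⟨(C₁ * 2 ^ (d + 1)).toNNReal * C₂, Finset.Iic (d + 1, 0), fun g x ↦ ?_⟩
  set S := (Finset.Iic (d + 1, 0)).sup (schwartzSeminormFamily ℂ (Rd d) ℂ) g with hS
  have hS0 : 0 ≤ S := apply_nonneg _ _
  have hg : ∀ y, (1 + ‖y‖) ^ (d + 1) * ‖g y‖ ≤ 2 ^ (d + 1) * S := fun y ↦ by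
    have h := SchwartzMap.one_add_le_sup_seminorm_apply (𝕜 := ℂ) (m := (d + 1, 0))
      (k := d + 1) (n := 0) le_rfl le_rfl g y
    rw [norm_iteratedFDeriv_zero] at h
    exact h
  have hb : ∀ y, ‖K (y - x) * g y‖ₑ ≤ ENNReal.ofReal (C₁ * 2 ^ (d + 1)) * ENNReal.ofReal S *
      ENNReal.ofReal (jap (d + 1) 0 x) * ENNReal.ofReal (jap (d + 1) 0 (y - x)) := fun y ↦ by
    rw [← ENNReal.ofReal_mul (by positivity), ← ENNReal.ofReal_mul (by positivity),
      ← ENNReal.ofReal_mul (mul_nonneg (by positivity) (jap_nonneg _ _ _)), ← ofReal_norm, norm_mul]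
    apply ENNReal.ofReal_le_ofReal
    simp only [jap, zero_mul, pow_zero, one_mul]
    have h1 : 1 + ‖x‖ ≤ (1 + ‖y - x‖) * (1 + ‖y‖) := by
      have h2 : ‖x‖ ≤ ‖y - x‖ + ‖y‖ := by
        simpa [norm_sub_rev] using norm_add_le (x - y) y
      nlinarith [norm_nonneg (y - x), norm_nonneg y]
    have h3 : ‖g y‖ ≤ 2 ^ (d + 1) * S / (1 + ‖y‖) ^ (d + 1) := by
      rw [le_div_iff₀ (by positivity), mul_comm]; exact hg y
    calc _ ≤ C₁ / (1 + ‖y - x‖) ^ (d + 1 + (d + 1)) * (2 ^ (d + 1) * S / (1 + ‖y‖) ^ (d + 1)) :=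
          mul_le_mul (hK _) h3 (norm_nonneg _) (by positivity)
      _ = C₁ * 2 ^ (d + 1) * S * (1 / ((1 + ‖y - x‖) * (1 + ‖y‖)) ^ (d + 1)) *
          (1 / (1 + ‖y - x‖) ^ (d + 1)) := by rw [mul_pow, pow_add]; field_simp
      _ ≤ _ := by gcongr
  refine (enorm_integral_le_lintegral_enorm _).trans ((lintegral_mono hb).trans ?_)
  rw [lintegral_const_mul' _ _ (by finiteness)]
  refine (mul_le_mul' le_rfl (hC₂ (d + 1) 0 le_rfl x)).trans_eq ?_
  rw [ENNReal.ofReal]; push_cast; ring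

lemma exists_enorm_cv_ker_schwartz_le (P : LPCutoff d) (M : ℕ) :
    ∃ (C : ℝ≥0) (s : Finset (ℕ × ℕ)), ∀ (g : 𝓢(Rd d, ℂ)) (q : ℕ) (x : Rd d),
      ‖cv (P.ker q) g x‖ₑ ≤ C * ENNReal.ofReal (s.sup (schwartzSeminormFamily ℂ (Rd d) ℂ) g) *
        tw (-(q * M)) * ENNReal.ofReal (jap (d + 1) 0 x) := by
  obtain ⟨C₁, s₁, h₁⟩ := exists_cv_ker_mul_le P M
  choose C₂ s₂ h₂ using fun q ↦ exists_enorm_cv_schwartz_le (P.ker q)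
  set s := s₁ ∪ (Finset.range 3).biUnion s₂
  refine ⟨C₁ + ∑ q ∈ Finset.range 3, C₂ q * (tw (3 * M)).toNNReal, s, fun g q x ↦ ?_⟩
  have hmono : ∀ s' ⊆ s, ENNReal.ofReal (s'.sup (schwartzSeminormFamily ℂ (Rd d) ℂ) g) ≤
      ENNReal.ofReal (s.sup (schwartzSeminormFamily ℂ (Rd d) ℂ) g) := fun s' hs' ↦
    ENNReal.ofReal_le_ofReal (Seminorm.le_def.1 (Finset.sup_mono hs') g)
  -- The spectral gap relative to the level 0 of the constant function is 3; the remaining three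
  -- blocks are bounded individually.
  by_cases hq : 3 ≤ q
  · have h3 := h₁ g 0 q _ band_one (by omega) x
    simp only [mul_one] at h3
    refine h3.trans ?_
    simp only [enorm_one, ciSup_const, mul_one]
    refine mul_le_mul' (mul_le_mul' (mul_le_mul' ?_ (hmono _ Finset.subset_union_left)) le_rfl) le_rfl
    exact_mod_cast le_self_add
  · have hq' : q ∈ Finset.range 3 := by simpa using hq
    have h3 : s₂ q ⊆ s := (Finset.subset_biUnion_of_mem s₂ hq').trans Finset.subset_union_right
    have h4 : C₂ q * (tw (3 * M)).toNNReal ≤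
        C₁ + ∑ q ∈ Finset.range 3, C₂ q * (tw (3 * M)).toNNReal :=
      (Finset.single_le_sum (f := fun q ↦ C₂ q * (tw (3 * M)).toNNReal) (fun _ _ ↦ zero_le) hq').trans
        le_add_self
    have h5 : (1 : ℝ≥0∞) ≤ tw (3 * M) * tw (-(q * M)) := by
      rw [← tw_add]
      apply one_le_tw
      have : (q : ℝ) ≤ 3 := by exact_mod_cast (not_le.1 hq).le
      nlinarith [M.cast_nonneg (α := ℝ)]
    calc _ ≤ _ := h₂ q g x
      _ ≤ C₂ q * ENNReal.ofReal (s.sup (schwartzSeminormFamily ℂ (Rd d) ℂ) g) *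
          (tw (3 * M) * tw (-(q * M))) * ENNReal.ofReal (jap (d + 1) 0 x) :=
        mul_le_mul' ((mul_le_mul' le_rfl (hmono _ h3)).trans (le_mul_of_one_le_right zero_le h5)) le_rfl
      _ = ((C₂ q * (tw (3 * M)).toNNReal : ℝ≥0) : ℝ≥0∞) *
          ENNReal.ofReal (s.sup (schwartzSeminormFamily ℂ (Rd d) ℂ) g) *
          tw (-(q * M)) * ENNReal.ofReal (jap (d + 1) 0 x) := by push_cast; rw [tw_coe]; ring
      _ ≤ _ := by gcongr

lemma dualNorm_lt_top {B : Set 𝓢(Rd d, ℂ)} (hB : Bornology.IsVonNBounded ℂ B) (u : 𝓢'(Rd d, ℂ)) :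
    dualNorm B u < ⊤ := by
  obtain ⟨s, C, h⟩ := exists_seminorm_bound u
  obtain ⟨r, hr, hB⟩ := ((schwartz_withSeminorms ℂ (Rd d) ℂ).isVonNBounded_iff_finset_seminorm_bounded.1
    hB) s
  refine lt_of_le_of_lt (iSup₂_le fun f hf ↦ ?_) (ENNReal.ofReal_lt_top (r := C * r))
  rw [← ofReal_norm]
  exact ENNReal.ofReal_le_ofReal ((h f).trans (by gcongr; exact (hB f hf).le))

lemma enorm_le_dualNorm {B : Set 𝓢(Rd d, ℂ)} {f : 𝓢(Rd d, ℂ)} (hf : f ∈ B) (u : 𝓢'(Rd d, ℂ)) :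
    ‖u f‖ₑ ≤ dualNorm B u := le_iSup₂ (f := fun f (_ : f ∈ B) ↦ ‖u f‖ₑ) f hf

lemma dualNorm_mono {B B' : Set 𝓢(Rd d, ℂ)} (h : B ⊆ B') (u : 𝓢'(Rd d, ℂ)) :
    dualNorm B u ≤ dualNorm B' u := biSup_mono fun _ hf ↦ h hf

section

variable (P : LPCutoff d) {χ : Rd d → Rd d} (ψ θ : Rd d → ℂ) (N M : ℕ) (s : Finset (ℕ × ℕ))

/-- The size of the kernel `ψ(z) K(y - z)`, where `K` is the kernel of the low frequency cutoff. -/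
def kerSize (k : ℕ) (y : Rd d) : ℝ := s.sup (schwartzSeminormFamily ℂ (Rd d) ℂ)
  (SchwartzMap.smulLeftCLM ℂ ψ (tr y (refl (P.lowKer (k + N)))))

/-- The test functions that control the part `θ u` of `u`. -/
def farSet (χ : Rd d → Rd d) : Set 𝓢(Rd d, ℂ) := Set.range fun p : ℕ × Rd d ↦
  (((2 ^ p.1) ^ M * (1 + ‖p.2‖) ^ (d + 1) * kerSize P ψ N s p.1 p.2 : ℝ) : ℂ) •
    SchwartzMap.smulLeftCLM ℂ θ (tr (χ p.2) (P.ker p.1))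

variable {ψ θ}

/-- For ‖y‖ ≤ R + 1 the point χ(y) lies in the ball of radius L(2 + R) ≤ r, away from the support of
θ, and rapid decay of θ K_k(· - χ(y)) in 2^k beats the growth of `kerSize`. For larger y it is
`kerSize` that decays rapidly in 2^k(1 + ‖y‖) and beats the polynomial growth of the other factor.
-/
lemma isVonNBounded_farSet (hψ : ψ.HasTemperateGrowth) (hθ : θ.HasTemperateGrowth)
    {R r L : ℝ} (hR : 0 ≤ R) (hr : 0 ≤ r) (hψR : ∀ z ∈ tsupport ψ, ‖z‖ ≤ R)
    (hθr : ∀ z ∈ tsupport θ, r + 1 ≤ ‖z‖) (hL : 0 ≤ L) (hχ : ∀ x, ‖χ x‖ ≤ L * (1 + ‖x‖))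
    (hLr : L * (2 + R) ≤ r) : Bornology.IsVonNBounded ℂ (farSet P ψ θ N M s χ) := by
  rw [(schwartz_withSeminorms ℂ (Rd d) ℂ).isVonNBounded_iff_finset_seminorm_bounded]
  intro s'
  obtain ⟨n₁, h₁⟩ := exists_seminorm_mul_lowKer_le P hψ hR hψR N s
  obtain ⟨n₂, p, h₂⟩ := exists_seminorm_mul_ker_le P hθ hr hθr s'
  obtain ⟨C₁, hC₁, h₁⟩ := h₁ (M + n₂ + (d + 1 + p))
  obtain ⟨C₂, hC₂, h₂⟩ := h₂ (M + n₁)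
  refine ⟨(2 + R) ^ (d + 1) * C₁ * C₂ + C₁ * C₂ * (L + 1) ^ p + 1, by positivity, ?_⟩
  rintro _ ⟨⟨k, y⟩, rfl⟩
  have hS0 : 0 ≤ kerSize P ψ N s k y := apply_nonneg _ _
  have ha : (1 : ℝ) ≤ 2 ^ k := one_le_pow₀ one_le_two
  simp only
  rw [map_smul_eq_mul, Complex.norm_real, Real.norm_of_nonneg (by positivity)]
  set S := kerSize P ψ N s k y
  set T := (s'.sup (schwartzSeminormFamily ℂ (Rd d) ℂ)) (SchwartzMap.smulLeftCLM ℂ θ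
          (tr (χ y) (P.ker k)))
  have hT0 : 0 ≤ T := apply_nonneg _ _
  set a : ℝ := 2 ^ k
  rcases le_or_gt ‖y‖ (R + 1) with hy | hy
  · have hS : S ≤ C₁ * a ^ n₁ := (h₁ k y).1
    have hT : T * a ^ (M + n₁) ≤ C₂ := (h₂ k (χ y)).2 ((hχ y).trans (by nlinarith))
    have hv : 1 + ‖y‖ ≤ 2 + R := by linarith
    have h3 : a ^ M * (1 + ‖y‖) ^ (d + 1) * S * T ≤ (2 + R) ^ (d + 1) * C₁ * C₂ := by
      calc _ ≤ a ^ M * (2 + R) ^ (d + 1) * (C₁ * a ^ n₁) * T := by gcongr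
        _ = (2 + R) ^ (d + 1) * C₁ * (T * a ^ (M + n₁)) := by rw [pow_add]; ring
        _ ≤ _ := by gcongr
    have h4 : 0 ≤ C₁ * C₂ * (L + 1) ^ p := by positivity
    linarith
  · have hS : S * (a * (1 + ‖y‖)) ^ (M + n₂ + (d + 1 + p)) ≤ C₁ := (h₁ k y).2 hy
    have hT : T ≤ C₂ * (a ^ n₂ * (1 + ‖χ y‖) ^ p) := (h₂ k (χ y)).1
    have hv : (1 : ℝ) ≤ 1 + ‖y‖ := by linarith [norm_nonneg y]
    have hχy : 1 + ‖χ y‖ ≤ (L + 1) * (1 + ‖y‖) := by linarith [hχ y]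
    have h3 : a ^ M * (1 + ‖y‖) ^ (d + 1) * S * T ≤ C₁ * C₂ * (L + 1) ^ p := by
      calc _ ≤ a ^ M * (1 + ‖y‖) ^ (d + 1) * S *
            (C₂ * (a ^ n₂ * ((L + 1) * (1 + ‖y‖)) ^ p)) := by
            refine mul_le_mul_of_nonneg_left (hT.trans ?_) (by positivity)
            gcongr
        _ = S * (a ^ (M + n₂) * (1 + ‖y‖) ^ (d + 1 + p)) * (C₂ * (L + 1) ^ p) := by
            rw [mul_pow, pow_add, pow_add]; ring
        _ ≤ S * ((a * (1 + ‖y‖)) ^ (M + n₂ + (d + 1 + p))) * (C₂ * (L + 1) ^ p) := by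
            rw [pow_add (a * (1 + ‖y‖))]
            gcongr
            · exact le_mul_of_one_le_right (by positivity) hv
            · exact le_mul_of_one_le_left (by positivity) ha
        _ ≤ C₁ * (C₂ * (L + 1) ^ p) := by gcongr
        _ = _ := by ring
    have h4 : 0 ≤ (2 + R) ^ (d + 1) * C₁ * C₂ := by positivity
    linarith

end

/-- A block of the far part is an integral over y of φ_q(D) applied to the Schwartz function z ↦
ψ(z)K(y - z), times the value of θu on the kernel centred at χ(y). The weights built into `farSet`
make this integral converge and yield 2^{-kM}; regularity in q comes from the first, Schwartz,
factor. -/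
lemma exists_lpNorm_far_le (P : LPCutoff d) (kd : Kind) {χ : Rd d → Rd d} (hχ : LinGrowth χ) {ψ : 𝓢(Rd d, ℂ)} {θ : Rd d → ℂ}
    (hθ : θ.HasTemperateGrowth) (N M : ℕ) (hM : 0 < M) : ∃ (C : ℝ≥0) (s : Finset (ℕ × ℕ)), ∀ (u : 𝓢'(Rd d, ℂ)) (k : ℕ),
      (∀ q, lpNorm kd.p (block P q (mulT ψ (lowFreq P N k
        (dst (ev (P.ker k) (mulT θ u) ∘ χ))))) ≤
          C * tw (-(q * M)) * (tw (-(k * M)) * dualNorm (farSet P ψ θ N M s χ) u)) ∧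
      (dualNorm (farSet P ψ θ N M s χ) u ≠ ⊤ → lpNorm kd.p (mulT ψ (lowFreq P N k
        (dst (ev (P.ker k) (mulT θ u) ∘ χ)))) ≤
          C * (tw (-(k * M)) * dualNorm (farSet P ψ θ N M s χ) u)) := by
  obtain ⟨C₁, s, h₁⟩ := exists_enorm_cv_ker_schwartz_le P M (d := d)
  obtain ⟨C₂, hC₂⟩ := exists_lintegral_jap d
  obtain ⟨C₃, hC₃⟩ := exists_fn_weight_le (d := d) kd
  have hM' : (0 : ℝ) < M := by exact_mod_cast hM
  set G : ℝ≥0 := (∑' q : ℕ, tw (-(M * q))).toNNReal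
  have hG : (G : ℝ≥0∞) = ∑' q : ℕ, tw (-(M * q)) := ENNReal.coe_toNNReal (tsum_tw_ne_top hM')
  refine ⟨C₁ * C₂ * C₃ * (1 + G), s, fun u k ↦ ?_⟩
  set D := dualNorm (farSet P ψ θ N M s χ) u
  set b : Rd d → ℂ := ev (P.ker k) (mulT θ u)
  have hb : PG (b ∘ χ) := hχ.pg (PG_ev _ _)
  have hbu : ∀ y, b y = u (SchwartzMap.smulLeftCLM ℂ θ (tr y (P.ker k))) := fun y ↦
    TemperedDistribution.smulLeftCLM_apply_apply ..
  rw [P.lowFreq_eq]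
  set T := mulT ψ (Op (P.low (k + N)) (dst (b ∘ χ)))
  have hT : IsFun (fun x ↦ ψ x * cv (P.lowKer (k + N)) (b ∘ χ) x) T :=
    (hb.isFun.isFun_Op _).smulLeft ψ.hasTemperateGrowth
  have hev : ∀ q x, ‖ev (P.ker q) T x‖ₑ ≤
      C₁ * C₂ * tw (-(q * M)) * (tw (-(k * M)) * D) * ENNReal.ofReal (jap (d + 1) 0 x) := by
    intro q x
    set g : Rd d → 𝓢(Rd d, ℂ) := fun y ↦
      SchwartzMap.smulLeftCLM ℂ ψ (tr y (refl (P.lowKer (k + N))))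
    have hg : ∀ y z, g y z = ψ z * P.lowKer (k + N) (y - z) := fun y z ↦ by
      rw [SchwartzMap.smulLeftCLM_apply_apply ψ.hasTemperateGrowth, tr_refl_apply]; rfl
    -- The factor ψ and the cutoff S_{k+N} are transposed onto the kernel of φ_q(D), so that u
    -- enters only through the function b ∘ χ.
    have e1 : ev (P.ker q) T x = ∫ y, cv (P.ker q) (g y) x * (b ∘ χ) y := by
      have : ev (P.ker q) T x = dst (b ∘ χ) (Cop (P.low (k + N))
          (SchwartzMap.smulLeftCLM ℂ ψ (tr x (P.ker q)))) := by
        rw [ev, TemperedDistribution.smulLeftCLM_apply_apply, Op_apply]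
      rw [this, (hb.isFun _).2]
      congr 1; funext y; congr 1
      rw [Cop_apply, cv]
      congr 1; funext z
      rw [SchwartzMap.smulLeftCLM_apply_apply ψ.hasTemperateGrowth, hg, smul_eq_mul]
      simp only [tr, compSubConstCLM_apply]
      rw [LPCutoff.lowKer]; ring
    have e2 : ∀ y, ENNReal.ofReal (kerSize P ψ N s k y) * ‖b (χ y)‖ₑ ≤
        tw (-(k * M)) * D * ENNReal.ofReal (jap (d + 1) 0 (y - 0)) := fun y ↦ by
      have hS0 : 0 ≤ kerSize P ψ N s k y := apply_nonneg _ _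
      have h2 := enorm_le_dualNorm (B := farSet P ψ θ N M s χ) ⟨(k, y), rfl⟩ u
      rw [map_smul, smul_eq_mul, enorm_mul, ← hbu (χ y), ← ofReal_norm (Complex.ofReal _),
        Complex.norm_real, Real.norm_of_nonneg (by positivity), ENNReal.ofReal_mul (by positivity),
        ENNReal.ofReal_mul (by positivity), sub_zero] at *
      have h3 : tw (-(k * M)) * ENNReal.ofReal ((2 ^ k) ^ M) = 1 := by
        rw [tw_eq_ofReal, ← ENNReal.ofReal_mul (by positivity), ← pow_mul, ← Real.rpow_natCast 2 (k * M),
          ← Real.rpow_add two_pos]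
        push_cast; simp
      have h4 : ENNReal.ofReal (jap (d + 1) 0 y) * ENNReal.ofReal ((1 + ‖y‖) ^ (d + 1)) = 1 := by
        rw [← ENNReal.ofReal_mul (jap_nonneg _ _ _)]
        simp only [jap, zero_mul, pow_zero, one_mul]
        rw [one_div_mul_cancel (by positivity), ENNReal.ofReal_one]
      calc _ = tw (-(k * M)) * ENNReal.ofReal (jap (d + 1) 0 y) * (ENNReal.ofReal ((2 ^ k) ^ M) *
            ENNReal.ofReal ((1 + ‖y‖) ^ (d + 1)) * ENNReal.ofReal (kerSize P ψ N s k y) *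
              ‖b (χ y)‖ₑ) := by
            have h5 : ∀ a b c d e f : ℝ≥0∞, a * b * (c * d * e * f) = (a * c) * (b * d) * (e * f) :=
              fun a b c d e f ↦ by ring
            rw [h5, h3, h4, one_mul, one_mul]
        _ ≤ tw (-(k * M)) * ENNReal.ofReal (jap (d + 1) 0 y) * D := mul_le_mul' le_rfl h2
        _ = _ := by ring
    rw [e1]
    refine (enorm_integral_le_lintegral_enorm _).trans ?_
    calc _ ≤ ∫⁻ y, (C₁ * tw (-(q * M)) * ENNReal.ofReal (jap (d + 1) 0 x)) *
          (tw (-(k * M)) * D) * ENNReal.ofReal (jap (d + 1) 0 (y - 0)) := by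
          refine lintegral_mono fun y ↦ ?_
          rw [enorm_mul]
          calc _ ≤ C₁ * ENNReal.ofReal (kerSize P ψ N s k y) * tw (-(q * M)) *
                ENNReal.ofReal (jap (d + 1) 0 x) * ‖b (χ y)‖ₑ := mul_le_mul' (h₁ (g y) q x) le_rfl
            _ = (C₁ * tw (-(q * M)) * ENNReal.ofReal (jap (d + 1) 0 x)) *
                (ENNReal.ofReal (kerSize P ψ N s k y) * ‖b (χ y)‖ₑ) := by ring
            _ ≤ _ := (mul_le_mul' le_rfl (e2 y)).trans_eq (by ring)
      _ ≤ (C₁ * tw (-(q * M)) * ENNReal.ofReal (jap (d + 1) 0 x)) * (tw (-(k * M)) * D) * C₂ := by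
          rw [lintegral_const_mul _ (measurable_jap _ _ _)]
          exact mul_le_mul' le_rfl (hC₂ _ 0 le_rfl 0)
      _ = _ := by ring
  have hw : Measurable fun x : Rd d ↦ ENNReal.ofReal (jap (d + 1) 0 x) :=
    (continuous_jap _ _).measurable.ennreal_ofReal
  refine ⟨fun q ↦ ?_, fun hD ↦ ?_⟩
  · refine (lpNorm_le_fn kd (continuous_ev _ _) (isFun_block_ev P T q)).trans ?_
    refine (fn_mono' (hev q)).trans ?_
    rw [fn_const_mul _ hw]
    calc _ ≤ C₁ * C₂ * tw (-(q * M)) * (tw (-(k * M)) * D) * C₃ := mul_le_mul' le_rfl hC₃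
      _ = ((C₁ * C₂ * C₃ * 1 : ℝ≥0) : ℝ≥0∞) * tw (-(q * M)) * (tw (-(k * M)) * D) := by
          push_cast; ring
      _ ≤ _ := by gcongr; exact le_self_add
  · have hTc : Continuous fun x ↦ ψ x * cv (P.lowKer (k + N)) (b ∘ χ) x :=
      ψ.continuous.mul (hb.isFun.continuous_cv _)
    have hle : ∀ x : Rd d, ENNReal.ofReal (jap (d + 1) 0 x) ≤ 1 := fun x ↦ by
      rw [← ENNReal.ofReal_one]
      exact ENNReal.ofReal_le_ofReal ((jap_le _ _ _).trans_eq (by simp))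
    have hK : C₁ * C₂ * (tw (-(k * M)) * D) ≠ ⊤ := by
      have := tw_ne_top (-(k * M : ℝ)); finiteness
    have hsum : ∑' q : ℕ, C₁ * C₂ * tw (-(q * M)) * (tw (-(k * M)) * D) =
        C₁ * C₂ * (tw (-(k * M)) * D) * G := by
      rw [hG, ← ENNReal.tsum_mul_left]
      congr 1; funext q; rw [mul_comm (q : ℝ)]; ring
    have hsum' : ∑' q : ℕ, C₁ * C₂ * tw (-(q * M)) * (tw (-(k * M)) * D) ≠ ⊤ := by
      rw [hsum]; exact ENNReal.mul_ne_top hK ENNReal.coe_ne_top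
    -- The term itself is recovered by summing its blocks, which converge uniformly because M > 0.
    have hpt : ∀ x, ‖ψ x * cv (P.lowKer (k + N)) (b ∘ χ) x‖ₑ ≤
        C₁ * C₂ * (tw (-(k * M)) * D) * G * ENNReal.ofReal (jap (d + 1) 0 x) := fun x ↦ by
      have h3 := P.hasSum_ev_ker hT hTc (ENNReal.summable_toReal hsum') (fun q x ↦ by
        rw [← toReal_enorm]
        refine ENNReal.toReal_mono (ENNReal.ne_top_of_tsum_ne_top hsum' q) ((hev q x).trans ?_)
        exact mul_le_of_le_one_right zero_le (hle x)) x
      rw [← h3.tsum_eq]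
      refine enorm_tsum_le_tsum_enorm.trans ((ENNReal.tsum_le_tsum fun q ↦ hev q x).trans_eq ?_)
      rw [ENNReal.tsum_mul_right, hsum]
    refine (lpNorm_le_fn kd hTc hT).trans ((fn_mono' hpt).trans ?_)
    rw [fn_const_mul _ hw]
    calc _ ≤ C₁ * C₂ * (tw (-(k * M)) * D) * G * C₃ := mul_le_mul' le_rfl hC₃
      _ = ((C₁ * C₂ * C₃ * G : ℝ≥0) : ℝ≥0∞) * (tw (-(k * M)) * D) := by
          push_cast; ring
      _ ≤ _ := by gcongr; exact le_add_self

lemma exists_sq_tw_le (kd : Kind) : ∃ C : ℝ≥0, sq kd (fun j ↦ tw (-j)) ≤ C := by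
  cases kd with
  | zyg => exact ⟨1, iSup_le fun j ↦ by simpa using tw_le_one (by simp)⟩
  | sob =>
    have h1 : ∑' j : ℕ, tw (-(2 * j)) ≠ ⊤ := tsum_tw_ne_top two_pos
    have h2 : sq .sob (fun j ↦ tw (-j)) ≠ ⊤ := by
      refine ENNReal.rpow_ne_top_of_nonneg (by norm_num) (ne_top_of_le_ne_top h1 ?_)
      refine ENNReal.tsum_le_tsum fun j ↦ ?_
      rw [pow_two, ← tw_add]; exact tw_le (by linarith)
    exact ⟨_, (ENNReal.coe_toNNReal h2).ge⟩

/-- The far part gains arbitrary smoothness t. The radius depends only on R and the growth of χ: it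
is chosen so that χ maps the ball of radius R + 1 into a ball at distance at least 1 from the
support of θ. -/
theorem exists_nrm_far_le (P : LPCutoff d) (kd : Kind) {χ : Rd d → Rd d} (hχ : LinGrowth χ) {ψ : 𝓢(Rd d, ℂ)} {R : ℝ}
    (hψ : ∀ z ∈ tsupport ψ, ‖z‖ ≤ R) (N : ℕ) (t : ℝ) : ∃ r : ℝ, ∀ θ : Rd d → ℂ,
      θ.HasTemperateGrowth → (∀ z ∈ tsupport θ, r ≤ ‖z‖) → ∃ (B : Set 𝓢(Rd d, ℂ)) (C : ℝ≥0),
        Bornology.IsVonNBounded ℂ B ∧ ∀ u, ∃ S,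
          HasSum (fun k ↦ mulT ψ (lowFreq P N k (dst (ev (P.ker k) (mulT θ u) ∘ χ)))) S ∧
          nrm kd P t S ≤ C * dualNorm B u := by
  obtain ⟨L, hL⟩ := hχ.growth
  set R' := max R 0
  set r := max L 0 * (2 + R')
  have hr : 0 ≤ r := by positivity
  refine ⟨r + 1, fun θ hθ hθr ↦ ?_⟩
  obtain ⟨M, hM⟩ := exists_nat_ge (max (t + 1) 2)
  have hMt : t + 1 ≤ M := (le_max_left _ _).trans hM
  have hM2 : (2 : ℝ) ≤ M := (le_max_right _ _).trans hM
  have hM0 : 0 < M := by exact_mod_cast two_pos.trans_le hM2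
  obtain ⟨C₁, s, h₁⟩ := exists_lpNorm_far_le P kd hχ (ψ := ψ) hθ N M hM0
  obtain ⟨C₂, h₂⟩ := exists_nrm_le kd P t 1 one_pos (d := d)
  obtain ⟨C₃, h₃⟩ := exists_sq_tw_le kd
  have hB : Bornology.IsVonNBounded ℂ (farSet P ψ θ N M s χ) :=
    isVonNBounded_farSet P N M s ψ.hasTemperateGrowth hθ (le_max_right R 0) hr
      (fun z hz ↦ (hψ z hz).trans (le_max_left _ _)) hθr (le_max_right L 0)
      (fun x ↦ (hL x).trans (by gcongr; exact le_max_left _ _)) le_rfl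
  refine ⟨_, C₂ * C₁ * C₃, hB, fun u ↦ ?_⟩
  set D := dualNorm (farSet P ψ θ N M s χ) u
  have hD : D ≠ ⊤ := (dualNorm_lt_top hB u).ne
  have hsum : ∑' k, lpNorm kd.p (mulT ψ (lowFreq P N k
      (dst (ev (P.ker k) (mulT θ u) ∘ χ)))) ≠ ⊤ := by
    refine ne_top_of_le_ne_top ?_ (ENNReal.tsum_le_tsum fun k ↦ (h₁ u k).2 hD)
    rw [ENNReal.tsum_mul_left, ENNReal.tsum_mul_right]
    refine ENNReal.mul_ne_top ENNReal.coe_ne_top (ENNReal.mul_ne_top ?_ hD)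
    simp_rw [mul_comm _ (M : ℝ)]
    exact tsum_tw_ne_top (two_pos.trans_le hM2)
  obtain ⟨S, hS, -⟩ := exists_hasSum_of_lpNorm hsum
  refine ⟨S, hS, (h₂ _ S (fun j ↦ tw (-(2 * j))) (C₁ * D) hS fun q j ↦ ?_).trans ?_⟩
  · refine ((h₁ u j).1 q).trans ?_
    calc _ = C₁ * D * (tw (-(q * M)) * tw (-(j * M))) := by ring
      _ ≤ C₁ * D * (tw (-(q * t) + j * 1 - 1 * |(q : ℝ) - j|) * tw (-(2 * j))) := by
          refine mul_le_mul' le_rfl ?_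
          rw [← tw_add, ← tw_add]
          apply tw_le
          have h3 : |(q : ℝ) - j| ≤ q + j := by
            rw [abs_le]; constructor <;> linarith [q.cast_nonneg (α := ℝ), j.cast_nonneg (α := ℝ)]
          nlinarith [q.cast_nonneg (α := ℝ), j.cast_nonneg (α := ℝ)]
      _ = _ := by ring
  · have e : (fun j : ℕ ↦ tw (j * 1) * tw (-(2 * j))) = fun j : ℕ ↦ tw (-j) := by
      funext j; rw [← tw_add]; congr 1; ring
    rw [e]
    refine (mul_le_mul' le_rfl h₃).trans_eq ?_
    push_cast; ring

/-! ### Composition with the maps `χ` -/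

lemma Pull.mono {kd : Kind} {χ : Rd d → Rd d} {R R' R'' : ℝ≥0∞} (h : Pull kd χ R R')
    (hR : R' ≤ R'') : Pull kd χ R R'' := by
  obtain ⟨C, hC⟩ := h
  exact ⟨C, fun f hf ↦ (hC f hf).trans (mul_le_mul' le_rfl (fn_mono_set (bal_mono hR)))⟩

lemma pull_zyg {χ : Rd d → Rd d} {R R' : ℝ≥0∞} (h : Set.MapsTo χ (bal d R) (bal d R')) :
    Pull .zyg χ R R' :=
  ⟨1, fun f _ ↦ iSup₂_le fun x hx ↦ by
    rw [ENNReal.coe_one, one_mul]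
    exact le_iSup₂ (f := fun y (_ : y ∈ bal d R') ↦ f y) (χ x) (h hx)⟩

lemma exists_abs_det_le (M : ℝ) : ∃ C : ℝ≥0, ∀ A : Rd d →L[ℝ] Rd d, ‖A‖ ≤ M →
    ENNReal.ofReal |A.det| ≤ C := by
  have : ProperSpace (Rd d →L[ℝ] Rd d) := FiniteDimensional.proper ℝ _
  obtain ⟨C, hC⟩ := (isCompact_closedBall (0 : Rd d →L[ℝ] Rd d) M).exists_bound_of_continuousOn
    ContinuousLinearMap.continuous_det.continuousOn
  exact ⟨C.toNNReal, fun A hA ↦ ENNReal.ofReal_le_ofReal (hC A (by simpa using hA))⟩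

/-- Change of variables by the inverse κ, whose Jacobian is bounded on the part of the range that is
used. -/
lemma pull_sob {χ κ : Rd d → Rd d} (hd : IsDiffeo χ κ) {R R' : ℝ≥0∞}
    (h : Set.MapsTo χ (bal d R) (bal d R')) {M : ℝ} (hM : ∀ x ∈ bal d R, ‖fderiv ℝ κ (χ x)‖ ≤ M) :
    Pull .sob χ R R' := by
  obtain ⟨C, hC⟩ := exists_abs_det_le (d := d) M
  set s := κ ⁻¹' bal d R
  have hs : MeasurableSet s := hd.contDiff_inv.continuous.measurable (measurableSet_bal R)
  have hsR : κ '' s = bal d R := Set.image_preimage_eq _ hd.left_inv.surjective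
  have hsR' : s ⊆ bal d R' := fun y hy ↦ by
    have := h (show κ y ∈ bal d R from hy)
    rwa [hd.right_inv y] at this
  have key : ∀ f : Rd d → ℝ≥0∞, ∫⁻ x in bal d R, f (χ x) ^ 2 ≤ C * ∫⁻ y in bal d R', f y ^ 2 := by
    intro f
    rw [← hsR, lintegral_image_eq_lintegral_abs_det_fderiv_mul volume hs
      (fun y _ ↦ ((hd.contDiff_inv.differentiable (by norm_num)) y).hasFDerivAt.hasFDerivWithinAt)
      hd.right_inv.injective.injOn, ← lintegral_const_mul' _ _ ENNReal.coe_ne_top]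
    refine (setLIntegral_mono' hs fun y hy ↦ ?_).trans (lintegral_mono_set hsR')
    rw [hd.right_inv y]
    refine mul_le_mul' (hC _ ?_) le_rfl
    have := hM (κ y) hy
    rwa [hd.right_inv y] at this
  refine ⟨((C : ℝ≥0∞) ^ (1 / 2 : ℝ)).toNNReal, fun f _ ↦ ?_⟩
  rw [ENNReal.coe_toNNReal (ENNReal.rpow_ne_top_of_nonneg (by norm_num) ENNReal.coe_ne_top)]
  simp only [fn]
  rw [← ENNReal.mul_rpow_of_nonneg _ _ (by norm_num)]
  exact ENNReal.rpow_le_rpow (key f) (by norm_num)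

lemma isCompact_bal {R : ℝ≥0∞} (hR : R ≠ ⊤) : IsCompact (bal d R) := by
  lift R to ℝ≥0 using hR
  have h : bal d R = Metric.closedBall 0 R := by
    ext x
    simp [bal, enorm_le_coe, ← NNReal.coe_le_coe]
  rw [h]
  exact isCompact_closedBall _ _

lemma exists_mapsTo_bal {χ : Rd d → Rd d} (hχ : Continuous χ) {R : ℝ≥0∞} (hR : R ≠ ⊤) :
    ∃ R' : ℝ≥0∞, R' ≠ ⊤ ∧ Set.MapsTo χ (bal d R) (bal d R') := by
  obtain ⟨C, hC⟩ := (isCompact_bal hR).exists_bound_of_continuousOn hχ.continuousOn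
  refine ⟨ENNReal.ofReal C, ENNReal.ofReal_ne_top, fun x hx ↦ ?_⟩
  change ‖χ x‖ₑ ≤ _
  rw [← ofReal_norm]
  exact ENNReal.ofReal_le_ofReal (hC x hx)

/-- The map is a diffeomorphism in the case of Sobolev spaces. -/
def Diffeo (kd : Kind) (χ : Rd d → Rd d) : Prop := kd = .sob → ∃ κ, IsDiffeo χ κ

/-- The map is a diffeomorphism with bounded derivative of the inverse in the case of Sobolev
spaces. -/
def BddDiffeo (kd : Kind) (χ : Rd d → Rd d) : Prop :=
  kd = .sob → ∃ κ, IsDiffeo χ κ ∧ BoundedDeriv κ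

lemma IsDiffeo.comp {χ χ' κ κ' : Rd d → Rd d} (h' : IsDiffeo χ' κ') (h : IsDiffeo χ κ) :
    IsDiffeo (χ' ∘ χ) (κ ∘ κ') where
  contDiff := h'.contDiff.comp h.contDiff
  contDiff_inv := h.contDiff_inv.comp h'.contDiff_inv
  left_inv := h'.left_inv.comp h.left_inv
  right_inv := h'.right_inv.comp h.right_inv

lemma Diffeo.comp {kd : Kind} {χ χ' : Rd d → Rd d} (h' : Diffeo kd χ') (h : Diffeo kd χ) :
    Diffeo kd (χ' ∘ χ) := fun hk ↦
  let ⟨_, hκ⟩ := h hk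
  let ⟨_, hκ'⟩ := h' hk
  ⟨_, hκ'.comp hκ⟩

lemma norm_fderiv_comp_le {f g : Rd d → Rd d} (hf : ContDiff ℝ 1 f) (hg : ContDiff ℝ 1 g)
    {A B : ℝ} (hA : ∀ x, ‖fderiv ℝ f x‖ ≤ A) (hB : ∀ x, ‖fderiv ℝ g x‖ ≤ B) (x : Rd d) :
    ‖fderiv ℝ (f ∘ g) x‖ ≤ A * B := by
  rw [fderiv_comp x (hf.differentiable (by norm_num) _) (hg.differentiable (by norm_num) _)]
  exact (ContinuousLinearMap.opNorm_comp_le _ _).trans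
    (mul_le_mul (hA _) (hB _) (norm_nonneg _) ((norm_nonneg _).trans (hA 0)))

lemma BddDiffeo.comp {kd : Kind} {χ χ' : Rd d → Rd d} (h' : BddDiffeo kd χ')
    (h : BddDiffeo kd χ) : BddDiffeo kd (χ' ∘ χ) := fun hk ↦
  let ⟨_, hκ, _, hM⟩ := h hk
  let ⟨_, hκ', _, hM'⟩ := h' hk
  ⟨_, hκ'.comp hκ, _, norm_fderiv_comp_le hκ.contDiff_inv hκ'.contDiff_inv hM hM'⟩

/-- On a bounded ball compactness bounds the derivative of the inverse, so no global bound is needed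
for the local statements. -/
lemma Diffeo.exists_pull {kd : Kind} {χ : Rd d → Rd d} (h : Diffeo kd χ) (hχ : Continuous χ)
    {R : ℝ≥0∞} (hR : R ≠ ⊤) : ∃ R' : ℝ≥0∞, R' ≠ ⊤ ∧ Pull kd χ R R' := by
  obtain ⟨R', hR', hm⟩ := exists_mapsTo_bal hχ hR
  refine ⟨R', hR', ?_⟩
  cases kd with
  | zyg => exact pull_zyg hm
  | sob =>
    obtain ⟨κ, hκ⟩ := h rfl
    obtain ⟨M, hM⟩ := (isCompact_bal hR).exists_bound_of_continuousOn (f := fun x ↦ fderiv ℝ κ (χ x))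
      ((hκ.contDiff_inv.continuous_fderiv (by norm_num)).comp hχ).continuousOn
    exact pull_sob hκ hm hM

lemma Diffeo.pull {kd : Kind} {χ : Rd d → Rd d} (h : Diffeo kd χ) (hχ : Continuous χ)
    {R : ℝ≥0∞} (hR : R ≠ ⊤) : Pull kd χ R ⊤ :=
  let ⟨_, _, h⟩ := h.exists_pull hχ hR
  h.mono le_top

lemma BddDiffeo.pull {kd : Kind} {χ : Rd d → Rd d} (h : BddDiffeo kd χ) : Pull kd χ ⊤ ⊤ := by
  have hm : Set.MapsTo χ (bal d ⊤) (bal d ⊤) := by simp [bal_top, Set.mapsTo_univ]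
  cases kd with
  | zyg => exact pull_zyg hm
  | sob =>
    obtain ⟨κ, hκ, M, hM⟩ := h rfl
    exact pull_sob hκ hm fun x _ ↦ hM (χ x)

section

variable {P : LPCutoff d} {ρ ρ' : ℝ} {χ χ' : Rd d → Rd d}

lemma IsZygmundMap.linGrowth (h : IsZygmundMap P ρ χ) (hρ : 0 < ρ) : LinGrowth χ := by
  obtain ⟨B, hB⟩ := h.exists_fderiv_le hρ
  have hB0 : 0 ≤ B := (norm_nonneg _).trans (hB 0)
  refine ⟨h.contDiff.continuous, B + ‖χ 0‖, fun x ↦ ?_⟩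
  have h1 := norm_sub_le_of_fderiv_le h.contDiff hB x 0
  rw [sub_zero] at h1
  have h2 : ‖χ x‖ ≤ ‖χ x - χ 0‖ + ‖χ 0‖ := by simpa using norm_add_le (χ x - χ 0) (χ 0)
  nlinarith [norm_nonneg x, norm_nonneg (χ 0)]

lemma IsZygmundMap.tame (h : IsZygmundMap P ρ χ) (hρ : 0 < ρ) {N : ℕ} (hN : LargeFor χ N) :
    Tame ρ N χ :=
  let ⟨M, hM, hMN⟩ := hN
  ⟨h.linGrowth hρ, hρ, _, M, h.app hρ, hM, hMN⟩

lemma IsZygmundMap.tame_comp (h : IsZygmundMap P ρ χ) (hρ : 0 < ρ) (h' : IsZygmundMap P ρ' χ')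
    (hρ' : 0 < ρ') {N : ℕ} (hN : LargeFor (χ' ∘ χ) N) : Tame (min ρ ρ') N (χ' ∘ χ) := by
  obtain ⟨M, hM, hMN⟩ := hN
  obtain ⟨B, hB⟩ := h.exists_fderiv_le hρ
  obtain ⟨B', hB'⟩ := h'.exists_fderiv_le hρ'
  have h1 := (h.app hρ).comp (h'.app hρ') hB hB' (norm_sub_le_of_fderiv_le h'.contDiff hB')
  refine ⟨(h'.linGrowth hρ').comp (h.linGrowth hρ), lt_min hρ hρ', _, M, h1, fun x ↦ ?_, hMN⟩
  have := hM x
  rwa [fderiv_comp x (h'.contDiff.differentiable (by norm_num) _)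
    (h.contDiff.differentiable (by norm_num) _)] at this

end

/-! ### Test functions and distributions -/

lemma Test.toSchwartz_apply (φ : Test d) (x : Rd d) : φ.toSchwartz x = (φ x : ℂ) := rfl

lemma cut_eq_mulT (ψ : Test d) (u : 𝓢'(Rd d, ℂ)) : cut ψ u = mulT ψ.toSchwartz u := rfl

lemma cut_apply (ψ : Test d) (u : 𝓢'(Rd d, ℂ)) (φ : 𝓢(Rd d, ℂ)) :
    cut ψ u φ = u (SchwartzMap.smulLeftCLM ℂ ψ.toSchwartz φ) :=
  TemperedDistribution.smulLeftCLM_apply_apply ..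

lemma smulLeft_toSchwartz (ψ φ : Test d) :
    SchwartzMap.smulLeftCLM ℂ ψ.toSchwartz φ.toSchwartz = (Test.mul ψ φ).toSchwartz := by
  ext x
  rw [SchwartzMap.smulLeftCLM_apply_apply ψ.toSchwartz.hasTemperateGrowth]
  simp only [Test.toSchwartz_apply, smul_eq_mul]
  exact (Complex.ofReal_mul _ _).symm

lemma exists_test_eq_one (r : ℝ) : ∃ ψ : Test d, ∀ x, ‖x‖ ≤ r → ψ x = 1 := by
  set f : ContDiffBump (0 : Rd d) := ⟨max r 0 + 1, max r 0 + 2, by positivity, by linarith⟩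
  refine ⟨⟨f, f.contDiff, f.hasCompactSupport, fun _ _ ↦ trivial⟩, fun x hx ↦ ?_⟩
  refine f.one_of_mem_closedBall ?_
  rw [mem_closedBall_zero_iff]
  exact (hx.trans (le_max_left r 0)).trans (by simp [f])

lemma Test.exists_norm_le (ψ : Test d) : ∃ R : ℝ, ∀ z ∈ tsupport ψ.toSchwartz, ‖z‖ ≤ R := by
  have h : HasCompactSupport (ψ.toSchwartz : Rd d → ℂ) :=
    ψ.hasCompactSupport.comp_left (g := fun t : ℝ ↦ (t : ℂ)) Complex.ofReal_zero
  obtain ⟨R, hR⟩ := h.isCompact.isBounded.exists_norm_le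
  exact ⟨R, hR⟩

lemma Test.exists_loc (ψ : Test d) : ∃ R : ℝ≥0∞, R ≠ ⊤ ∧ Loc ψ.toSchwartz R := by
  obtain ⟨R, hR⟩ := ψ.exists_norm_le
  refine ⟨ENNReal.ofReal R, ENNReal.ofReal_ne_top, .inr ⟨ENNReal.ofReal_ne_top, ⟨_, rfl⟩, fun x hx ↦ ?_⟩⟩
  by_contra h
  refine hx ?_
  change ‖x‖ₑ ≤ _
  rw [← ofReal_norm]
  exact ENNReal.ofReal_le_ofReal (hR x (subset_tsupport _ h))

/-- The complement `1 - ψ` of a cutoff function. -/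
def Test.compl (ψ : Test d) (x : Rd d) : ℂ := 1 - ψ.toSchwartz x

lemma Test.hasTemperateGrowth_compl (ψ : Test d) : ψ.compl.HasTemperateGrowth :=
  (Function.HasTemperateGrowth.const 1).sub ψ.toSchwartz.hasTemperateGrowth

lemma mulT_compl (ψ : Test d) (u : 𝓢'(Rd d, ℂ)) : mulT ψ.compl u = u - cut ψ u := by
  ext φ
  have h : SchwartzMap.smulLeftCLM ℂ ψ.compl φ = φ - SchwartzMap.smulLeftCLM ℂ ψ.toSchwartz φ := by
    ext x
    rw [SchwartzMap.smulLeftCLM_apply_apply ψ.hasTemperateGrowth_compl, sub_apply,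
      SchwartzMap.smulLeftCLM_apply_apply ψ.toSchwartz.hasTemperateGrowth, Test.compl, sub_smul,
      one_smul]
  change mulT ψ.compl u φ = u φ - cut ψ u φ
  rw [cut_apply, TemperedDistribution.smulLeftCLM_apply_apply, h, map_sub]

lemma le_norm_of_mem_tsupport_compl {ψ : Test d} {r : ℝ} (h : ∀ x, ‖x‖ ≤ r → ψ x = 1) :
    ∀ z ∈ tsupport ψ.compl, r ≤ ‖z‖ := by
  refine closure_minimal (fun z hz ↦ ?_) (isClosed_le continuous_const continuous_norm)
  by_contra hr
  refine hz ?_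
  simp [Test.compl, Test.toSchwartz_apply, h z (not_le.1 hr).le]

/-- Test functions are real and Schwartz functions complex; splitting ψφ into real and imaginary
parts lets information on test functions determine a localized tempered distribution. -/
lemma exists_eq_toSchwartz_add (ψ : Test d) (φ : 𝓢(Rd d, ℂ)) : ∃ a b : Test d,
    SchwartzMap.smulLeftCLM ℂ ψ.toSchwartz φ = a.toSchwartz + Complex.I • b.toSchwartz := by
  have hφ := φ.smooth ⊤
  refine ⟨⟨fun x ↦ ψ x * (φ x).re, ψ.contDiff.mul (Complex.reCLM.contDiff.comp hφ),
    ψ.hasCompactSupport.mul_right, fun _ _ ↦ trivial⟩,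
    ⟨fun x ↦ ψ x * (φ x).im, ψ.contDiff.mul (Complex.imCLM.contDiff.comp hφ),
    ψ.hasCompactSupport.mul_right, fun _ _ ↦ trivial⟩, ?_⟩
  ext x
  rw [SchwartzMap.smulLeftCLM_apply_apply ψ.toSchwartz.hasTemperateGrowth]
  change (ψ x : ℂ) • φ x = ((ψ x * (φ x).re : ℝ) : ℂ) + Complex.I • ((ψ x * (φ x).im : ℝ) : ℂ)
  conv_lhs => rw [← Complex.re_add_im (φ x)]
  simp only [smul_eq_mul]; push_cast; ring

lemma hasSum_cut {T : ℕ → 𝓢'(Rd d, ℂ)} {w : 𝓢'(Rd d, ℂ)}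
    (h : ∀ φ : Test d, HasSum (fun k ↦ T k φ.toSchwartz) (w φ.toSchwartz)) (ψ : Test d) :
    HasSum (fun k ↦ cut ψ (T k)) (cut ψ w) := by
  rw [hasSum_iff]
  intro φ
  obtain ⟨a, b, hab⟩ := exists_eq_toSchwartz_add ψ φ
  simp only [cut_apply, hab, map_add, map_smul]
  exact (h a).add ((h b).const_smul _)

lemma isCut_of_hasSum {T : ℕ → 𝓢'(Rd d, ℂ)} {v : Distr d}
    (hv : ∀ φ : Test d, HasSum (fun k ↦ T k φ.toSchwartz) (v φ)) {ψ : Test d} {S : 𝓢'(Rd d, ℂ)}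
    (hS : HasSum (fun k ↦ cut ψ (T k)) S) : IsCut ψ v S := by
  intro φ
  have h1 := hasSum_iff.1 hS φ.toSchwartz
  simp only [cut_apply, smulLeft_toSchwartz] at h1
  exact h1.unique (hv _)

lemma exists_finset_toSchwartz_le (K : TopologicalSpace.Compacts (Rd d))
    (hK : (K : Set (Rd d)) ⊆ (⊤ : TopologicalSpace.Opens (Rd d))) (s : Finset (ℕ × ℕ)) :
    ∃ (s' : Finset ℕ) (C : ℝ), 0 ≤ C ∧ ∀ f : ContDiffMapSupportedIn (Rd d) ℝ ⊤ K,
      s.sup (schwartzSeminormFamily ℂ (Rd d) ℂ) (Test.toSchwartz (TestFunction.ofSupportedIn hK f)) ≤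
        C * (s'.sup fun i ↦ ContDiffMapSupportedIn.seminorm ℝ (Rd d) ℝ ⊤ K i) f := by
  obtain ⟨R, hR⟩ := K.isCompact.isBounded.exists_norm_le
  refine ⟨s.image Prod.snd, ∑ i ∈ s, (max R 0) ^ i.1, by positivity, fun f ↦ ?_⟩
  set p := ((s.image Prod.snd).sup fun i ↦ ContDiffMapSupportedIn.seminorm ℝ (Rd d) ℝ ⊤ K i) with hp
  have hp0 : 0 ≤ p f := apply_nonneg _ _
  refine Seminorm.finset_sup_apply_le (by positivity) fun i hi ↦ ?_
  refine le_trans ?_ (mul_le_mul_of_nonneg_right (Finset.single_le_sum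
    (f := fun i : ℕ × ℕ ↦ (max R 0) ^ i.1) (fun _ _ ↦ by positivity) hi) hp0)
  refine SchwartzMap.seminorm_le_bound _ _ _ _ (by positivity) fun x ↦ ?_
  have h1 : ‖iteratedFDeriv ℝ i.2 (Test.toSchwartz (TestFunction.ofSupportedIn hK f)) x‖ =
      ‖iteratedFDeriv ℝ i.2 f x‖ :=
    Complex.ofRealLI.norm_iteratedFDeriv_comp_left (f.contDiff.contDiffAt) (by exact_mod_cast le_top)
  rw [h1]
  by_cases hx : x ∈ K
  · have h2 : ‖iteratedFDeriv ℝ i.2 f x‖ ≤ p f :=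
      (ContDiffMapSupportedIn.norm_iteratedFDeriv_apply_le_seminorm_top ℝ).trans
        (Seminorm.le_def.1 (Finset.le_sup (f := fun i ↦ ContDiffMapSupportedIn.seminorm ℝ (Rd d) ℝ ⊤ K i)
          (Finset.mem_image_of_mem _ hi)) f)
    exact mul_le_mul (pow_le_pow_left₀ (norm_nonneg _) ((hR x hx).trans (le_max_left _ _)) _) h2
      (norm_nonneg _) (by positivity)
  · rw [f.iteratedFDeriv_zero_on_compl hx]
    simp only [Pi.zero_apply, norm_zero, mul_zero]
    positivity

/-- Localized sums glue. On functions supported in a compact set K the series is given by the sum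
belonging to a cutoff equal to 1 on K, which is tempered and hence continuous there; continuity on
every such space is continuity on the inductive limit. -/
theorem exists_distr {T : ℕ → 𝓢'(Rd d, ℂ)}
    (h : ∀ ψ : Test d, ∃ S, HasSum (fun k ↦ cut ψ (T k)) S) :
    ∃ v : Distr d, ∀ φ : Test d, HasSum (fun k ↦ T k φ.toSchwartz) (v φ) := by
  choose S hS using h
  have hone : ∀ K : TopologicalSpace.Compacts (Rd d), ∃ ψ : Test d, ∀ x ∈ K, ψ x = 1 := fun K ↦ by
    obtain ⟨R, hR⟩ := K.isCompact.isBounded.exists_norm_le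
    obtain ⟨ψ, hψ⟩ := exists_test_eq_one (d := d) R
    exact ⟨ψ, fun x hx ↦ hψ x (hR x hx)⟩
  choose ψ hψ using hone
  have key : ∀ (K : TopologicalSpace.Compacts (Rd d)) (φ : Test d), (∀ x ∉ K, φ x = 0) →
      HasSum (fun k ↦ T k φ.toSchwartz) (S (ψ K) φ.toSchwartz) := fun K φ hφ ↦ by
    have h1 := hasSum_iff.1 (hS (ψ K)) φ.toSchwartz
    have h2 : (Test.mul (ψ K) φ).toSchwartz = φ.toSchwartz := by
      ext x
      change (((ψ K x * φ x : ℝ)) : ℂ) = (φ x : ℂ)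
      by_cases hx : x ∈ K
      · rw [hψ K x hx, one_mul]
      · rw [hφ x hx, mul_zero]
    simpa only [cut_apply, smulLeft_toSchwartz, h2] using h1
  have hadd : ∀ f g : Test d, (f + g).toSchwartz = f.toSchwartz + g.toSchwartz := fun f g ↦ by
    ext x; exact Complex.ofReal_add _ _
  have hsmul : ∀ (c : ℝ) (f : Test d), (c • f).toSchwartz = (c : ℂ) • f.toSchwartz := fun c f ↦ by
    ext x; exact Complex.ofReal_mul _ _
  have hT : ∀ (K : TopologicalSpace.Compacts (Rd d))
      (hK : (K : Set (Rd d)) ⊆ (⊤ : TopologicalSpace.Opens (Rd d))),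
      ∃ A : ContDiffMapSupportedIn (Rd d) ℝ ⊤ K →L[ℝ] ℂ, ∀ f,
        A f = S (ψ K) (Test.toSchwartz (TestFunction.ofSupportedIn hK f)) := fun K hK ↦ by
    refine ⟨ContDiffMapSupportedIn.mkCLMtoNormedSpace ℝ
      (fun f ↦ S (ψ K) (Test.toSchwartz (TestFunction.ofSupportedIn hK f))) (fun f g ↦ ?_)
      (fun c f ↦ ?_) ?_, fun f ↦ rfl⟩
    · rw [← map_add, ← hadd]; rfl
    · exact (congrArg (S (ψ K)) (hsmul c (TestFunction.ofSupportedIn hK f))).trans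
        ((map_smul (S (ψ K)) (c : ℂ) _).trans (Complex.coe_smul c _))
    · obtain ⟨s, C, hC⟩ := exists_seminorm_bound (S (ψ K))
      obtain ⟨s', C', hC', h'⟩ := exists_finset_toSchwartz_le K hK s
      refine ⟨s', C * C', by positivity, fun f ↦ (hC _).trans ?_⟩
      rw [mul_assoc]
      exact mul_le_mul_of_nonneg_left (h' f) C.2
  choose A hA using hT
  have hsum : ∀ φ : Test d, Summable fun k ↦ T k φ.toSchwartz := fun φ ↦
    (key ⟨tsupport φ, φ.hasCompactSupport⟩ φ fun x hx ↦ image_eq_zero_of_notMem_tsupport hx).summable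
  exact ⟨TestFunction.limitCLM ℝ (fun φ : Test d ↦ ∑' k, T k φ.toSchwartz) A
    (fun K hK f ↦ by
      rw [hA]
      exact (key K _ fun x hx ↦ f.zero_on_compl hx).tsum_eq), fun φ ↦ (hsum φ).hasSum⟩

/-! ### Continuity of paracomposition -/

/-- The terms of the series that defines `χ^⋆ u`. -/
def pc (P : LPCutoff d) (N : ℕ) (χ : Rd d → Rd d) (u : 𝓢'(Rd d, ℂ)) (k : ℕ) : 𝓢'(Rd d, ℂ) :=
  lowFreq P N k (dst (ev (P.ker k) u ∘ χ))

section

variable {P : LPCutoff d} {N N' N'' : ℕ} {χ χ' : Rd d → Rd d} {kd : Kind} {r m : ℝ}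

lemma pc_add (hχ : LinGrowth χ) (u v : 𝓢'(Rd d, ℂ)) (k : ℕ) :
    pc P N χ (u + v) k = pc P N χ u k + pc P N χ v k := by
  have h : dst (ev (P.ker k) (u + v) ∘ χ) = dst (ev (P.ker k) u ∘ χ) + dst (ev (P.ker k) v ∘ χ) :=
    ((hχ.pg (PG_ev _ u)).isFun.add (hχ.pg (PG_ev _ v)).isFun).dst_eq
  simp only [pc, P.lowFreq_eq, h, map_add]

lemma isBlockComp_dst (hχ : LinGrowth χ) (u : 𝓢'(Rd d, ℂ)) :
    IsBlockComp P χ u fun k ↦ dst (ev (P.ker k) u ∘ χ) := fun k ↦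
  ⟨_, continuous_ev _ _, isFun_block_ev P u k, (hχ.pg (PG_ev _ u)).isFun⟩

lemma IsBlockComp.eq_dst {u : 𝓢'(Rd d, ℂ)} {g : ℕ → 𝓢'(Rd d, ℂ)} (h : IsBlockComp P χ u g) (k : ℕ) :
    g k = dst (ev (P.ker k) u ∘ χ) := by
  obtain ⟨f, hf, h1, h2⟩ := h k
  rw [h1.unique (isFun_block_ev P u k) hf (continuous_ev _ _)] at h2
  exact h2.dst_eq.symm

lemma isParacomp_of_hasSum (hχ : LinGrowth χ) {u v : 𝓢'(Rd d, ℂ)} (h : HasSum (pc P N χ u) v) :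
    IsParacomp P N χ u v := ⟨_, isBlockComp_dst hχ u, h⟩

lemma isParacompDistr_iff (hχ : LinGrowth χ) {u : 𝓢'(Rd d, ℂ)} {v : Distr d} :
    IsParacompDistr P N χ u v ↔ ∀ φ : Test d, HasSum (fun k ↦ pc P N χ u k φ.toSchwartz) (v φ) := by
  refine ⟨?_, fun h ↦ ⟨_, isBlockComp_dst hχ u, h⟩⟩
  rintro ⟨g, hg, h⟩ φ
  simp only [hg.eq_dst] at h
  exact h φ

lemma loc_one : Loc (fun _ : Rd d ↦ (1 : ℂ)) ⊤ := .inl ⟨rfl, rfl⟩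

lemma mulT_one (u : 𝓢'(Rd d, ℂ)) : mulT (fun _ ↦ 1) u = u := by
  ext φ
  rw [TemperedDistribution.smulLeftCLM_apply_apply]
  congr 1
  ext x
  rw [SchwartzMap.smulLeftCLM_apply_apply (.const 1), one_smul]

theorem continuousOnSpace (hχ : LinGrowth χ) (h : Pull kd χ ⊤ ⊤) (hr : 0 < r) :
    ContinuousOnSpace P N χ (nrm kd P r) := by
  obtain ⟨C, hC⟩ := exists_nrm_paracomp_le kd P hχ loc_one (by simpa using h) hr N
  refine ⟨C, fun u hu ↦ ?_⟩
  obtain ⟨S, hS, hSn⟩ := hC u hu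
  simp only [mulT_one] at hS
  exact ⟨S, isParacomp_of_hasSum hχ hS, hSn⟩

theorem remainderOnSpace (hχ : Tame m N χ) (hχ' : Tame m N' χ') (hχ'' : Tame m N'' (χ' ∘ χ))
    (h : Pull kd χ ⊤ ⊤) (h' : Pull kd χ' ⊤ ⊤) (h'' : Pull kd (χ' ∘ χ) ⊤ ⊤) (hr : 0 < r) :
    RemainderOnSpace P N N' N'' χ χ' (nrm kd P r) (nrm kd P (r + m)) := by
  obtain ⟨C, hC⟩ := exists_nrm_remainder_le P kd hχ hχ' hχ'' loc_one loc_one (R' := ⊤)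
    (fun _ _ ↦ rfl) (by simpa using h) (by simpa using h) (by simpa using h') (by simpa using h')
    (by simpa using h'') hr
  refine ⟨C, fun u hu ↦ ?_⟩
  obtain ⟨W, V, Z, hW, hV, hZ, -, hn⟩ := hC u hu
  simp only [mulT_one] at hW hV hZ
  exact ⟨W, V, Z, isParacomp_of_hasSum hχ'.lin hW, isParacomp_of_hasSum hχ.lin hV,
    isParacomp_of_hasSum hχ''.lin hZ, hn⟩

lemma pc_eq_cut_add (hχ : LinGrowth χ) (ψ : Test d) (u : 𝓢'(Rd d, ℂ)) (k : ℕ) :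
    pc P N χ u k = pc P N χ (cut ψ u) k + pc P N χ (mulT ψ.compl u) k := by
  rw [← pc_add hχ, mulT_compl, add_sub_cancel]

/-- Split u by a cutoff ψ' equal to 1 on a ball so large that the complementary part falls under the
far estimate; the part ψ'u falls under the global bound with output localized by ψ. -/
theorem exists_nrm_local_le (kd : Kind) (P : LPCutoff d) (hχ : LinGrowth χ)
    (h : ∀ R : ℝ≥0∞, R ≠ ⊤ → Pull kd χ R ⊤) (hr : 0 < r) (N : ℕ) (ψ : Test d) :
    ∃ (ψ' : Test d) (B : Set 𝓢(Rd d, ℂ)) (C : ℝ≥0), Bornology.IsVonNBounded ℂ B ∧ ∀ u,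
      nrm kd P r (cut ψ' u) < ⊤ → ∃ S, HasSum (fun k ↦ cut ψ (pc P N χ u k)) S ∧
        nrm kd P r S ≤ C * (nrm kd P r (cut ψ' u) + dualNorm B u) := by
  obtain ⟨R, hR, hψ⟩ := ψ.exists_loc
  obtain ⟨R₀, hR₀⟩ := ψ.exists_norm_le
  obtain ⟨C₁, h₁⟩ := exists_nrm_paracomp_le kd P hχ hψ (h _ (by finiteness)) hr N
  obtain ⟨r₁, hr₁⟩ := exists_nrm_far_le P kd hχ hR₀ N r
  obtain ⟨ψ', hψ'⟩ := exists_test_eq_one (d := d) r₁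
  obtain ⟨B, C₂, hB, h₂⟩ := hr₁ ψ'.compl ψ'.hasTemperateGrowth_compl
    (le_norm_of_mem_tsupport_compl hψ')
  refine ⟨ψ', B, C₁ + C₂, hB, fun u hu ↦ ?_⟩
  obtain ⟨S₁, hS₁, hn₁⟩ := h₁ _ hu
  obtain ⟨S₂, hS₂, hn₂⟩ := h₂ u
  refine ⟨S₁ + S₂, ?_, (nrm_add_le kd P r S₁ S₂).trans ((add_le_add hn₁ hn₂).trans ?_)⟩
  · simp only [pc_eq_cut_add hχ ψ' u, cut_eq_mulT ψ, map_add]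
    exact hS₁.add hS₂
  · push_cast
    rw [mul_add, add_mul, add_mul]
    exact add_le_add le_self_add le_add_self

lemma cutNorm_le {p : 𝓢'(Rd d, ℂ) → ℝ≥0∞} {ψ : Test d} {v : Distr d} {S : 𝓢'(Rd d, ℂ)}
    (h : IsCut ψ v S) : cutNorm p ψ v ≤ p S := iInf₂_le S h

theorem continuousOnLocalSpace (hχ : LinGrowth χ) (h : ∀ R : ℝ≥0∞, R ≠ ⊤ → Pull kd χ R ⊤)
    (hr : 0 < r) : ContinuousOnLocalSpace P N χ (nrm kd P r) := by
  have key := exists_nrm_local_le kd P hχ h hr N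
  refine ⟨fun u hu ↦ ?_, fun ψ ↦ ?_⟩
  · choose ψ' B C hB hS using key
    choose S hS hn using fun ψ ↦ hS ψ u (hu _)
    obtain ⟨v, hv⟩ := exists_distr fun ψ ↦ ⟨_, hS ψ⟩
    refine ⟨v, (isParacompDistr_iff hχ).2 hv, fun ψ ↦ ?_⟩
    refine (cutNorm_le (isCut_of_hasSum hv (hS ψ))).trans_lt ((hn ψ).trans_lt ?_)
    exact ENNReal.mul_lt_top ENNReal.coe_lt_top
      (ENNReal.add_lt_top.2 ⟨hu _, dualNorm_lt_top (hB ψ) u⟩)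
  · obtain ⟨ψ', B, C, hB, hS⟩ := key ψ
    refine ⟨ψ', B, C, hB, fun u v hu hv ↦ ?_⟩
    obtain ⟨S, hS, hn⟩ := hS u (hu _)
    exact (cutNorm_le (isCut_of_hasSum ((isParacompDistr_iff hχ).1 hv) hS)).trans hn

/-- The cutoffs are chosen from the output inwards: ψ₁ for the intermediate distribution w = χ'^⋆u
depends on ψ, and ψ' for u depends on both. Every passage to a complement produces a far term with t
= r + m, so only the localized composition formula has to gain m derivatives. -/
theorem exists_nrm_local_remainder_le (P : LPCutoff d) (hχ : Tame m N χ) (hχ' : Tame m N' χ')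
    (hχ'' : Tame m N'' (χ' ∘ χ)) (h : Diffeo kd χ) (h' : Diffeo kd χ') (hr : 0 < r) (ψ : Test d) :
    ∃ (ψ' ψ₁ : Test d) (B : Set 𝓢(Rd d, ℂ)) (C : ℝ≥0), Bornology.IsVonNBounded ℂ B ∧ ∀ u w,
      nrm kd P r (cut ψ' u) < ⊤ → HasSum (fun j ↦ cut ψ₁ (pc P N' χ' u j)) (cut ψ₁ w) →
      ∃ V Z, HasSum (fun k ↦ cut ψ (pc P N χ w k)) V ∧
        HasSum (fun k ↦ cut ψ (pc P N'' (χ' ∘ χ) u k)) Z ∧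
        nrm kd P (r + m) (V - Z) ≤ C * (nrm kd P r (cut ψ' u) + dualNorm B u + dualNorm B w) := by
  have hrm : 0 < r + m := add_pos hr hχ.pos
  have hc := hχ.lin.cont
  have hc' := hχ'.lin.cont
  obtain ⟨R, hR, hψ⟩ := ψ.exists_loc
  obtain ⟨R₀, hR₀⟩ := ψ.exists_norm_le
  obtain ⟨R', hR', hp⟩ := h.exists_pull hc (show R + 1 ≠ ⊤ by finiteness)
  obtain ⟨r₁, hr₁⟩ := exists_nrm_far_le P kd hχ.lin hR₀ N (r + m)
  -- The radius r₁ makes (1 - ψ₁)w a far contribution; the radius R' makes ψ₁ equal to 1 on the ball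
  -- from which composition with χ draws its values.
  obtain ⟨ψ₁, hψ₁⟩ := exists_test_eq_one (d := d) (max r₁ R'.toReal)
  obtain ⟨B₁, C₁, hB₁, h₁⟩ := hr₁ ψ₁.compl ψ₁.hasTemperateGrowth_compl
    (le_norm_of_mem_tsupport_compl fun x hx ↦ hψ₁ x (hx.trans (le_max_left _ _)))
  have hη1 : ∀ x ∈ bal d R', ψ₁.toSchwartz x = 1 := fun x hx ↦ by
    rw [Test.toSchwartz_apply, hψ₁ x, Complex.ofReal_one]
    refine le_trans ?_ (le_max_right _ _)
    rw [← toReal_enorm]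
    exact ENNReal.toReal_mono hR' hx
  obtain ⟨R₁, hR₁, hψ₁'⟩ := ψ₁.exists_loc
  obtain ⟨R₁₀, hR₁₀⟩ := ψ₁.exists_norm_le
  obtain ⟨r₂, hr₂⟩ := exists_nrm_far_le P kd hχ'.lin hR₁₀ N' (r + m)
  obtain ⟨r₃, hr₃⟩ := exists_nrm_far_le P kd hχ''.lin hR₀ N'' (r + m)
  -- One cutoff must serve two far estimates: r₂ for χ' followed by localization by ψ₁, and r₃ for
  -- χ' ∘ χ followed by localization by ψ.
  obtain ⟨ψ', hψ'⟩ := exists_test_eq_one (d := d) (max r₂ r₃)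
  obtain ⟨B₂, C₂, hB₂, h₂⟩ := hr₂ ψ'.compl ψ'.hasTemperateGrowth_compl
    (le_norm_of_mem_tsupport_compl fun x hx ↦ hψ' x (hx.trans (le_max_left _ _)))
  obtain ⟨B₃, C₃, hB₃, h₃⟩ := hr₃ ψ'.compl ψ'.hasTemperateGrowth_compl
    (le_norm_of_mem_tsupport_compl fun x hx ↦ hψ' x (hx.trans (le_max_right _ _)))
  obtain ⟨C₄, h₄⟩ := exists_nrm_remainder_le P kd hχ hχ' hχ'' hψ hψ₁' hη1 hp
    (h.pull hc (by finiteness)) (h'.pull hc' (by finiteness)) (h'.pull hc' (by finiteness))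
    ((h'.comp h).pull (hc'.comp hc) (by finiteness)) hr
  obtain ⟨C₅, h₅⟩ := exists_nrm_paracomp_le kd P hχ.lin hψ (h.pull hc (by finiteness)) hrm N
  refine ⟨ψ', ψ₁, B₁ ∪ B₂ ∪ B₃, C₄ + C₅ * C₂ + C₁ + C₃, (hB₁.union hB₂).union hB₃,
    fun u w hu hw ↦ ?_⟩
  obtain ⟨W, V, Z, hW, hV, hZ, -, hn⟩ := h₄ _ hu
  obtain ⟨W₂, hW₂, hn₂⟩ := h₂ u
  obtain ⟨V₂, hV₂, hnV₂⟩ := h₅ W₂ (hn₂.trans_lt (ENNReal.mul_lt_top ENNReal.coe_lt_top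
    (dualNorm_lt_top hB₂ u)))
  obtain ⟨S₁, hS₁, hn₁⟩ := h₁ w
  obtain ⟨S₃, hS₃, hn₃⟩ := h₃ u
  -- The localized intermediate distribution is the near part W, covered by the composition
  -- estimate, plus the far part W₂. The latter already has smoothness r + m, which χ^⋆ preserves.
  have hwW : cut ψ₁ w = W + W₂ := by
    refine hw.unique ?_
    simp only [pc_eq_cut_add hχ'.lin ψ' u, cut_eq_mulT ψ₁, map_add]
    exact hW.add hW₂
  refine ⟨V + V₂ + S₁, Z + S₃, ?_, ?_, ?_⟩
  · simp only [pc_eq_cut_add hχ.lin ψ₁ w, hwW, pc_add hχ.lin W W₂, cut_eq_mulT ψ, map_add]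
    exact (hV.add hV₂).add hS₁
  · simp only [pc_eq_cut_add hχ''.lin ψ' u, cut_eq_mulT ψ, map_add]
    exact hZ.add hS₃
  · set B := B₁ ∪ B₂ ∪ B₃
    set D := nrm kd P r (cut ψ' u) + dualNorm B u + dualNorm B w
    have e : V + V₂ + S₁ - (Z + S₃) = V - Z + (V₂ + (S₁ - S₃)) := by abel
    have d₁ : dualNorm B₁ w ≤ D := (dualNorm_mono
      (Set.subset_union_left.trans Set.subset_union_left) w).trans le_add_self
    have d₂ : dualNorm B₂ u ≤ D := (dualNorm_mono
      (Set.subset_union_right.trans Set.subset_union_left) u).trans (le_add_self.trans le_self_add)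
    have d₃ : dualNorm B₃ u ≤ D :=
      (dualNorm_mono Set.subset_union_right u).trans (le_add_self.trans le_self_add)
    have d₄ : nrm kd P r (cut ψ' u) ≤ D := le_self_add.trans le_self_add
    rw [e]
    calc _ ≤ C₄ * D + (C₅ * (C₂ * D) + (C₁ * D + C₃ * D)) := by
          refine (nrm_add_le ..).trans (add_le_add (hn.trans (by gcongr)) ?_)
          refine (nrm_add_le ..).trans (add_le_add (hnV₂.trans ?_) ?_)
          · exact mul_le_mul' le_rfl (hn₂.trans (by gcongr))
          · exact (nrm_sub_le ..).trans (add_le_add (hn₁.trans (by gcongr)) (hn₃.trans (by gcongr)))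
      _ = _ := by push_cast; ring

theorem remainderOnLocalSpace (hχ : Tame m N χ) (hχ' : Tame m N' χ')
    (hχ'' : Tame m N'' (χ' ∘ χ)) (h : Diffeo kd χ) (h' : Diffeo kd χ') (hr : 0 < r) :
    RemainderOnLocalSpace P N N' N'' χ χ' (nrm kd P r) (nrm kd P (r + m)) := by
  have key := exists_nrm_local_remainder_le P hχ hχ' hχ'' h h' hr
  have hcut : ∀ {u w : 𝓢'(Rd d, ℂ)} {w₀ : Distr d}, IsParacompDistr P N' χ' u w₀ →
      IsRestriction w w₀ → ∀ ψ₁, HasSum (fun j ↦ cut ψ₁ (pc P N' χ' u j)) (cut ψ₁ w) := by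
    intro u w w₀ hw₀ hw
    refine hasSum_cut fun φ ↦ ?_
    rw [← hw φ]
    exact (isParacompDistr_iff hχ'.lin).1 hw₀ φ
  have hsub : ∀ {ψ : Test d} {v z : Distr d} {V Z : 𝓢'(Rd d, ℂ)}, IsCut ψ v V → IsCut ψ z Z →
      IsCut ψ (v - z) (V - Z) := fun {ψ v z V Z} hv hz φ ↦ by
    change V φ.toSchwartz - Z φ.toSchwartz = v (ψ.mul φ) - z (ψ.mul φ)
    rw [← hv φ, ← hz φ]
  refine ⟨fun u w w₀ hu hw₀ hw ↦ ?_, fun ψ ↦ ?_⟩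
  · choose ψ' ψ₁ B C hB hS using key
    choose V Z hV hZ hn using fun ψ ↦ hS ψ u w (hu _) (hcut hw₀ hw _)
    obtain ⟨v, hv⟩ := exists_distr fun ψ ↦ ⟨_, hV ψ⟩
    obtain ⟨z, hz⟩ := exists_distr fun ψ ↦ ⟨_, hZ ψ⟩
    refine ⟨v, z, (isParacompDistr_iff hχ.lin).2 hv, (isParacompDistr_iff hχ''.lin).2 hz, fun ψ ↦ ?_⟩
    refine (cutNorm_le (hsub (isCut_of_hasSum hv (hV ψ)) (isCut_of_hasSum hz (hZ ψ)))).trans_lt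
      ((hn ψ).trans_lt ?_)
    exact ENNReal.mul_lt_top ENNReal.coe_lt_top (ENNReal.add_lt_top.2
      ⟨ENNReal.add_lt_top.2 ⟨hu _, dualNorm_lt_top (hB ψ) u⟩, dualNorm_lt_top (hB ψ) w⟩)
  · obtain ⟨ψ', ψ₁, B, C, hB, hS⟩ := key ψ
    refine ⟨ψ', B, C, hB, fun u w w₀ v z hu hw₀ hw hv hz ↦ ?_⟩
    obtain ⟨V, Z, hV, hZ, hn⟩ := hS u w (hu _) (hcut hw₀ hw _)
    exact (cutNorm_le (hsub (isCut_of_hasSum ((isParacompDistr_iff hχ.lin).1 hv) hV)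
      (isCut_of_hasSum ((isParacompDistr_iff hχ''.lin).1 hz) hZ))).trans hn

end

end Paracomposition

end

/-! ### The theorem -/

open Paracomposition in
theorem theorem4p1 (d : ℕ) (P : LPCutoff d) (ρ : ℝ) (hρ : 0 < ρ) (χ : Rd d → Rd d)
    (hχ : IsZygmundMap P ρ χ) :
    -- continuity on the Zygmund spaces
    (∀ (N : ℕ) (σ : ℝ), 0 < σ →
      ContinuousOnSpace P N χ (zygNorm P σ) ∧ ContinuousOnLocalSpace P N χ (zygNorm P σ)) ∧
    -- continuity on the Sobolev spaces
    (∀ κ : Rd d → Rd d, IsDiffeo χ κ → ∀ (N : ℕ) (s : ℝ), 0 < s →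
      (BoundedDeriv κ → ContinuousOnSpace P N χ (sobNorm P s)) ∧
        ContinuousOnLocalSpace P N χ (sobNorm P s)) ∧
    -- functoriality
    (∀ (ρ' : ℝ) (χ' : Rd d → Rd d), 0 < ρ' → IsZygmundMap P ρ' χ' →
      ∀ N N' N'' : ℕ, LargeFor χ N → LargeFor χ' N' → LargeFor (χ' ∘ χ) N'' →
        (∀ σ : ℝ, 0 < σ →
          RemainderOnSpace P N N' N'' χ χ' (zygNorm P σ) (zygNorm P (σ + min ρ ρ')) ∧
          RemainderOnLocalSpace P N N' N'' χ χ' (zygNorm P σ) (zygNorm P (σ + min ρ ρ'))) ∧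
        (∀ κ κ' : Rd d → Rd d, IsDiffeo χ κ → IsDiffeo χ' κ' → ∀ s : ℝ, 0 < s →
          (BoundedDeriv κ → BoundedDeriv κ' →
            RemainderOnSpace P N N' N'' χ χ' (sobNorm P s) (sobNorm P (s + min ρ ρ'))) ∧
          RemainderOnLocalSpace P N N' N'' χ χ' (sobNorm P s) (sobNorm P (s + min ρ ρ')))) := by
  -- For the Zygmund scale the diffeomorphism hypotheses are void, since suprema need no change of
  -- variables.
  have hz : ∀ χ : Rd d → Rd d, BddDiffeo .zyg χ := fun _ h ↦ by cases h
  have hz' : ∀ χ : Rd d → Rd d, Diffeo .zyg χ := fun _ h ↦ by cases h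
  have hl := hχ.linGrowth hρ
  refine ⟨fun N σ hσ ↦ ⟨continuousOnSpace hl (hz χ).pull hσ,
    continuousOnLocalSpace hl (fun R hR ↦ (hz' χ).pull hl.cont hR) hσ⟩, fun κ hκ N s hs ↦ ?_, ?_⟩
  · simp only [← nrm_sob]
    exact ⟨fun hb ↦ continuousOnSpace hl (BddDiffeo.pull fun _ ↦ ⟨κ, hκ, hb⟩) hs,
      continuousOnLocalSpace hl (fun R hR ↦ Diffeo.pull (fun _ ↦ ⟨κ, hκ⟩) hl.cont hR) hs⟩
  · intro ρ' χ' hρ' hχ' N N' N'' hN hN' hN''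
    have hm : 0 < min ρ ρ' := lt_min hρ hρ'
    -- Both maps are weakened to the common order min(ρ, ρ'), which is also the order available for
    -- the composition.
    have t := (hχ.tame hρ hN).mono (min_le_left ρ ρ') hm
    have t' := (hχ'.tame hρ' hN').mono (min_le_right ρ ρ') hm
    have t'' := hχ.tame_comp hρ hχ' hρ' hN''
    refine ⟨fun σ hσ ↦ ⟨remainderOnSpace t t' t'' (hz χ).pull (hz χ').pull (hz _).pull hσ,
      remainderOnLocalSpace t t' t'' (hz' χ) (hz' χ') hσ⟩, fun κ κ' hκ hκ' s hs ↦ ?_⟩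
    simp only [← nrm_sob]
    refine ⟨fun hb hb' ↦ ?_, remainderOnLocalSpace t t' t'' (fun _ ↦ ⟨κ, hκ⟩) (fun _ ↦ ⟨κ', hκ'⟩) hs⟩
    have h : BddDiffeo .sob χ := fun _ ↦ ⟨κ, hκ, hb⟩
    have h' : BddDiffeo .sob χ' := fun _ ↦ ⟨κ', hκ', hb'⟩
    exact remainderOnSpace t t' t'' h.pull h'.pull (h'.comp h).pull hs
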